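/- **Setting.** Let $d\ge 1$ and let $\mathcal A$ be a finite alphabet, $\mathcal A=\{0,\dots,q-1\}$ with $q\ge 2$. Two sites of $\mathbb Z^d$ are adjacent if their $L^1$ distance is $1$; for $V\subset\mathbb Z^d$, $\partial V$ is the set of sites outside $V$ adjacent to a site of $V$. Let $B_n=[-n,n]^d\cap\mathbb Z^d$. For a configuration $w$ on a finite set $S$, write $\mu(w)$ for the measure of the cylinder set $\{x: x|_S=w\}$. *Specification.* Let $\gamma:\mathcal A\to(0,\infty)$ and $\beta_i:\mathcal A\times\mathcal A\to[0,\infty)$, $1\le i\le d$. For $w\in\mathcal A^W$, $W$ finite, put $$I(w)=\prod_{v\in W}\gamma(w_v)\ \prod_{i=1}^d\ \prod_{v\in W,\ v+e_i\in W}\beta_i(w_v,w_{v+e_i}).$$ For finite $V$, $\delta\in\mathcal A^{\partial V}$ is $V$-admissible if $I(w\delta)>0$ for some $w\in\mathcal A^V$; then $\Lambda^\delta(w)=I(w\delta)/\sum_{x\in\mathcal A^V}I(x\delta)$ for $w\in\mathcal A^V$, and $\Lambda^\delta$ is also regarded as a probability measure on the configurations on $V\cup\partial V$ that agree with $\delta$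 on $\partial V$. *SSM.* The specification satisfies strong spatial mixing (SSM) if there are $C,\alpha>0$ such that for all finite $V$, $u\in V$, $\partial V\subseteq T\subseteq V\cup\partial V$, $x\in\mathcal A^{\{u\}}$ and $y,z\in\mathcal A^T$ such that $\delta=y|_{\partial V}$ and $\eta=z|_{\partial V}$ are $V$-admissible and $\Lambda^\delta(y),\Lambda^\eta(z)>0$, $$|\Lambda^\delta(x\mid y)-\Lambda^\eta(x\mid z)|\le Ce^{-\alpha\, d(u,D(y,z))},$$ where $D(y,z)$ is the set of sites where $y$ and $z$ differ and $d(\cdot,\cdot)$ is the $L^1$ distance (so for $y=z$ nothing is required). *Gibbs measure.* A stationary Gibbs measure for $(\gamma,\beta_i)$ is a shift-invariant Borel probability measure $\mu$ on $\mathcal A^{\mathbb Z^d}$ that is a Markov random field (for finite $S$, finite $T$ with $\partial S\subseteq T\subseteq\mathbb Z^d\setminus S$, $\eta\in\mathcal A^S$ and $\delta\in\mathcal A^T$ with $\mu(\delta)>0$: $\mu(\eta\mid\delta|_{\partial S})=\mu(\eta\mid\delta)$) and such that for all finite $V$ and $\delta\in\mathcal A^{\partial V}$ with $\mu(\delta)>0$,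 $\delta$ is $V$-admissible and $\mu(x\mid\delta)=\Lambda^\delta(x)$ for all $x\in\mathcal A^V$. *Entropy.* For finite $S,T\subset\mathbb Z^d$, $H_\mu(S\mid T)=\sum_{w\in\mathcal A^{S\cup T},\,\mu(w)>0}-\mu(w)\log\frac{\mu(w)}{\mu(w|_T)}$; we write $H_\mu(0\mid T)$ for $H_\mu(\{0\}\mid T)$ (which is $0$ if $0\in T$). *Algorithms.* An algorithm is a program of a random access machine with integer registers, integer-addressed memory, the operations $+,-,\cdot$ and integer division, conditionals and while loops, and oracle queries. Its running time is the logarithmic cost: every operation is charged at least the bit lengths of its operands (multiplication and division: the product of these), and a query the bit lengths of its arguments and of its answer. Oracles give access to the interactions and to a finite set $K\subset\mathbb Z^d$: on request of a precision $k\in\mathbb N$ they return an integer $m$ with $|m2^{-k}-\gamma(a)|\le2^{-k}$, respectively $|m2^{-k}-\beta_i(a,b)|\le 2^{-k}$, where in the second case $m=0$ if and only if $\beta_i(a,b)=0$; and they decide whether a given site is in $K$. The answers are otherwise arbitrary. **Theorem.** For all $d$ and $q$ there is one such algorithm with the following property. Let $(\gamma,\beta_i)$ be any interactions as above whose specification satisfies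 SSM, let $\mu$ be a stationary Gibbs measure for them, and let $(K_n)_{n\in\mathbb N}$ be finite sets with $K_n\subset B_n$ and $|K_n|=O(n^{d-1})$. Then, on every input $n$ and with any oracles for $(\gamma,\beta_i)$ and $K_n$, the algorithm halts with two rational numbers $h_n^-\le H_\mu(0\mid K_n)\le h_n^+$ with $h_n^+-h_n^-\le e^{-n^{d-1}}$, and its running time is $e^{O(n^{(d-1)^2})}$: there are $c$ and $N$, which do not depend on the choice of the oracles, such that it is at most $e^{c\,n^{(d-1)^2}}$ for all $n\ge N$. In particular the algorithm is not given the constants $C,\alpha$ of SSM. -/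

import Mathlib

open MeasureTheory ProbabilityTheory Filter Asymptotics

noncomputable section

namespace GibbsEntropy

/-! ## The lattice and configurations -/

/-- The sites of the `d`-dimensional cubic lattice. -/
abbrev Site (d : ℕ) : Type := Fin d → ℤ

/-- The `i`-th standard basis vector. -/
def e {d : ℕ} (i : Fin d) : Site d := Pi.single i 1

/-- The `L¹` distance on the lattice. -/
def l1 {d : ℕ} (u v : Site d) : ℕ := ∑ i, (u i - v i).natAbs

/-- The cube of side length `2n+1` centred at the origin. -/
def box (d n : ℕ) : Finset (Site d) :=
  Fintype.piFinset fun _ => Finset.Icc (-(n : ℤ)) (n : ℤ)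

/-- The boundary of a finite set `V`: the sites outside `V` with a nearest neighbour in `V`. -/
def bdry {d : ℕ} (V : Finset (Site d)) : Finset (Site d) :=
  (V.biUnion fun v => Finset.univ.biUnion fun i : Fin d => {v + e i, v - e i}) \ V

/-- Configurations on a finite set `S` over the alphabet `{0, …, q-1}`. -/
abbrev Config (d q : ℕ) (S : Finset (Site d)) : Type := (↥S) → Fin q

/-- The restriction `w|_T` of a configuration `w` on `S` to a subset `T` of `S`. -/
def res {d q : ℕ} {T S : Finset (Site d)} (h : T ⊆ S) (w : Config d q S) : Config d q T :=
  fun v => w ⟨v.1, h v.2⟩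

/-- The concatenation of a configuration on `S` and one on `T`
(only used for disjoint `S` and `T`). -/
def concat {d q : ℕ} {S T : Finset (Site d)} (w : Config d q S) (δ : Config d q T) :
    Config d q (S ∪ T) :=
  fun v => if h : v.1 ∈ S then w ⟨v.1, h⟩
    else δ ⟨v.1, (Finset.mem_union.mp v.2).resolve_left h⟩

/-- The cylinder set of a configuration with finite shape. -/
def cyl {d q : ℕ} {S : Finset (Site d)} (w : Config d q S) : Set (Site d → Fin q) :=
  {x | ∀ v : S, x v.1 = w v}

/-! ## Measures, Markov random fields, entropy -/

/-- The shift `(σ_v x)_u = x_{u+v}`. -/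
def shift {d q : ℕ} (v : Site d) (x : Site d → Fin q) : Site d → Fin q := fun u => x (u + v)

/-- Translation invariance. -/
def Stationary {d q : ℕ} (μ : Measure (Site d → Fin q)) : Prop :=
  ∀ v : Site d, μ.map (shift v) = μ

/-- The (nearest-neighbour) Markov random field property. -/
def IsMRF {d q : ℕ} (μ : Measure (Site d → Fin q)) : Prop :=
  ∀ (S : Finset (Site d)) (η : Config d q S) (T : Finset (Site d)) (hT : bdry S ⊆ T),
    Disjoint T S → ∀ δ : Config d q T, 0 < μ.real (cyl δ) →
      (μ[|cyl (res hT δ)]).real (cyl η) = (μ[|cyl δ]).real (cyl η)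

/-- The conditional entropy `H_μ(S | T)`, as a sum over the configurations on `S ∪ T`.
The terms with `μ(w) = 0` vanish, and `μ(w) > 0` forces `μ(w|_T) > 0`. -/
def condEntropy {d q : ℕ} (μ : Measure (Site d → Fin q)) (S T : Finset (Site d)) : ℝ :=
  ∑ w : Config d q (S ∪ T),
    -(μ.real (cyl w) * Real.log (μ.real (cyl w) /
      μ.real (cyl (res (T := T) Finset.subset_union_right w))))

/-! ## Gibbs specifications -/

/-- Local interactions `γ : A → (0,∞)` and `β_i : A × A → [0,∞)`. -/
structure Interaction (d q : ℕ) where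
  γ : Fin q → ℝ
  β : Fin d → Fin q → Fin q → ℝ
  γ_pos : ∀ a, 0 < γ a
  β_nonneg : ∀ i a b, 0 ≤ β i a b

namespace Interaction

variable {d q : ℕ} (Φ : Interaction d q)

/-- The weight `I(w)` of a configuration `w` on `W`: the product of the vertex weights and of
the weights of all edges inside `W`. -/
def weight {W : Finset (Site d)} (w : Config d q W) : ℝ :=
  (∏ v : W, Φ.γ (w v)) *
    ∏ i : Fin d, ∏ v : W, if h : v.1 + e i ∈ W then Φ.β i (w v) (w ⟨v.1 + e i, h⟩) else 1

/-- A boundary configuration is `V`-admissible if it extends to `V` with positive weight. -/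
def Admissible (V : Finset (Site d)) (δ : Config d q (bdry V)) : Prop :=
  ∃ w : Config d q V, 0 < Φ.weight (concat w δ)

/-- The specification `Λ^δ(w)`, for `w` on `V` (meaningful for `V`-admissible `δ`). -/
def spec (V : Finset (Site d)) (δ : Config d q (bdry V)) (w : Config d q V) : ℝ :=
  Φ.weight (concat w δ) / ∑ x : Config d q V, Φ.weight (concat x δ)

open Classical in
/-- `Λ^δ` as a measure on the configurations on `V ∪ ∂V` that agree with `δ` on `∂V`. -/
def specProb (V : Finset (Site d)) (δ : Config d q (bdry V))
    (E : Set (Config d q (V ∪ bdry V))) : ℝ :=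
  ∑ w : Config d q V, if concat w δ ∈ E then Φ.spec V δ w else 0

end Interaction

/-- The configurations on `W` that extend a configuration `y` on a subset `T`. -/
def cylIn {d q : ℕ} {T W : Finset (Site d)} (hT : T ⊆ W) (y : Config d q T) :
    Set (Config d q W) :=
  {z | res hT z = y}

/-- The set of sites at which two configurations on `T` differ. -/
def diffSet {d q : ℕ} {T : Finset (Site d)} (y z : Config d q T) : Set (Site d) :=
  {v | ∃ h : v ∈ T, y ⟨v, h⟩ ≠ z ⟨v, h⟩}

/-- The `L¹` distance from a site to a set (only relevant for a non-empty set). -/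
def distTo {d : ℕ} (u : Site d) (D : Set (Site d)) : ℕ := sInf (l1 u '' D)

/-- Strong spatial mixing (at exponential rate) of the specification.
For `y = z` the left-hand side is `0`, whatever the distance to the empty set is taken to be. -/
def Interaction.SSM {d q : ℕ} (Φ : Interaction d q) : Prop :=
  ∃ C α : ℝ, 0 < C ∧ 0 < α ∧
    ∀ (V : Finset (Site d)) (u : Site d) (hu : u ∈ V) (T : Finset (Site d))
      (h₁ : bdry V ⊆ T) (h₂ : T ⊆ V ∪ bdry V) (x : Fin q) (y z : Config d q T),
      Φ.Admissible V (res h₁ y) → Φ.Admissible V (res h₁ z) →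
      0 < Φ.specProb V (res h₁ y) (cylIn h₂ y) →
      0 < Φ.specProb V (res h₁ z) (cylIn h₂ z) →
      |Φ.specProb V (res h₁ y)
            ({c | c ⟨u, Finset.mem_union_left _ hu⟩ = x} ∩ cylIn h₂ y) /
          Φ.specProb V (res h₁ y) (cylIn h₂ y) -
        Φ.specProb V (res h₁ z)
            ({c | c ⟨u, Finset.mem_union_left _ hu⟩ = x} ∩ cylIn h₂ z) /
          Φ.specProb V (res h₁ z) (cylIn h₂ z)| ≤
        C * Real.exp (-α * (distTo u (diffSet y z) : ℝ))

/-- Stationary Gibbs measures for the specification of `Φ`. -/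
structure IsGibbs {d q : ℕ} (Φ : Interaction d q) (μ : Measure (Site d → Fin q)) : Prop where
  isProbabilityMeasure : IsProbabilityMeasure μ
  stationary : Stationary μ
  isMRF : IsMRF μ
  gibbs : ∀ (V : Finset (Site d)) (δ : Config d q (bdry V)), 0 < μ.real (cyl δ) →
    Φ.Admissible V δ ∧ ∀ x : Config d q V, (μ[|cyl δ]).real (cyl x) = Φ.spec V δ x

/-! ## The machine model

A random access machine with oracles and logarithmic cost: it has integer registers, an
integer-addressed memory of integers, and programs with structured control flow. Every operation
is charged at least the number of bits of its operands; multiplication and division are charged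
the product of the bit lengths. -/

/-- The state of the machine. -/
structure State where
  reg : ℕ → ℤ
  mem : ℤ → ℤ

/-- A family of oracles: `O k args` is the answer of oracle number `k` to the query `args`. -/
abbrev Oracle : Type := ℕ → List ℤ → ℤ

/-- The bit length of an integer (with sign). -/
def len (z : ℤ) : ℕ := Nat.size z.natAbs + 1

/-- Expressions. Division is `Int` division (rounding down for a positive divisor). -/
inductive Expr : Type
  | const (c : ℤ)
  | reg (i : ℕ)
  | mem (a : Expr)
  | add (a b : Expr)
  | sub (a b : Expr)
  | mul (a b : Expr)
  | div (a b : Expr)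

/-- The value of an expression. -/
def Expr.eval (s : State) : Expr → ℤ
  | .const c => c
  | .reg i => s.reg i
  | .mem a => s.mem (a.eval s)
  | .add a b => a.eval s + b.eval s
  | .sub a b => a.eval s - b.eval s
  | .mul a b => a.eval s * b.eval s
  | .div a b => a.eval s / b.eval s

/-- The time needed to evaluate an expression. -/
def Expr.cost (s : State) : Expr → ℕ
  | .const c => len c
  | .reg i => len (s.reg i)
  | .mem a => a.cost s + len (a.eval s) + len (s.mem (a.eval s))
  | .add a b => a.cost s + b.cost s + len (a.eval s) + len (b.eval s)
  | .sub a b => a.cost s + b.cost s + len (a.eval s) + len (b.eval s)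
  | .mul a b => a.cost s + b.cost s + len (a.eval s) * len (b.eval s)
  | .div a b => a.cost s + b.cost s + len (a.eval s) * len (b.eval s)

/-- Programs. -/
inductive Prog : Type
  | skip
  /-- `r_i := x` -/
  | assign (i : ℕ) (x : Expr)
  /-- `mem[a] := x` -/
  | store (a x : Expr)
  /-- `r_i := ` the answer of oracle `k` to the query `args` -/
  | query (i k : ℕ) (args : List Expr)
  | seq (p₁ p₂ : Prog)
  /-- if `x > 0` then `p₁` else `p₂` -/
  | ite (x : Expr) (p₁ p₂ : Prog)
  /-- while `x > 0` do `p` -/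
  | loop (x : Expr) (p : Prog)

/-- `Exec O p s t s'`: with oracles `O`, the program `p` started in the state `s` halts after
time `t` in the state `s'`. -/
inductive Exec (O : Oracle) : Prog → State → ℕ → State → Prop
  | skip (s : State) : Exec O .skip s 1 s
  | assign (i : ℕ) (x : Expr) (s : State) :
      Exec O (.assign i x) s (x.cost s + 1)
        { s with reg := Function.update s.reg i (x.eval s) }
  | store (a x : Expr) (s : State) :
      Exec O (.store a x) s (a.cost s + x.cost s + 1)
        { s with mem := Function.update s.mem (a.eval s) (x.eval s) }
  | query (i k : ℕ) (args : List Expr) (s : State) :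
      Exec O (.query i k args) s
        ((args.map (Expr.cost s)).sum + len (O k (args.map (Expr.eval s))) + 1)
        { s with reg := Function.update s.reg i (O k (args.map (Expr.eval s))) }
  | seq {p₁ p₂ : Prog} {s s' s'' : State} {t₁ t₂ : ℕ} :
      Exec O p₁ s t₁ s' → Exec O p₂ s' t₂ s'' → Exec O (.seq p₁ p₂) s (t₁ + t₂) s''
  | ite_pos {x : Expr} {p₁ p₂ : Prog} {s s' : State} {t : ℕ} :
      0 < x.eval s → Exec O p₁ s t s' → Exec O (.ite x p₁ p₂) s (x.cost s + 1 + t) s'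
  | ite_neg {x : Expr} {p₁ p₂ : Prog} {s s' : State} {t : ℕ} :
      ¬ 0 < x.eval s → Exec O p₂ s t s' → Exec O (.ite x p₁ p₂) s (x.cost s + 1 + t) s'
  | loop_done {x : Expr} {p : Prog} {s : State} :
      ¬ 0 < x.eval s → Exec O (.loop x p) s (x.cost s + 1) s
  | loop_step {x : Expr} {p : Prog} {s s' s'' : State} {t₁ t₂ : ℕ} :
      0 < x.eval s → Exec O p s t₁ s' → Exec O (.loop x p) s' t₂ s'' →
        Exec O (.loop x p) s (x.cost s + 1 + t₁ + t₂) s''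

/-- The initial state on input `n`: register `0` holds `n`, everything else is `0`. -/
def initState (n : ℕ) : State where
  reg := Function.update (fun _ => 0) 0 (n : ℤ)
  mem := fun _ => 0

/-- On input `n`, with oracles `O`, the program `p` halts after time `t` and outputs the rational
numbers `lo` and `hi`, in the form `lo = r₀ / r₂`, `hi = r₁ / r₂` with `r₂ > 0`. -/
def Outputs (p : Prog) (O : Oracle) (n : ℕ) (lo hi : ℚ) (t : ℕ) : Prop :=
  ∃ s : State, Exec O p (initState n) t s ∧ 0 < s.reg 2 ∧
    lo = (s.reg 0 : ℚ) / (s.reg 2 : ℚ) ∧ hi = (s.reg 1 : ℚ) / (s.reg 2 : ℚ)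

/-- The oracles give access to the interactions `Φ` and to the finite set `K`.
Oracle `0` and oracle `1` return, for a requested precision `k`, an integer `m` such that
`m / 2^k` is within `2^(-k)` of `γ(a)`, respectively of `β_i(a, b)`, where an approximation of
`β_i(a, b)` is `0` exactly if `β_i(a, b)` is `0`. Oracle `2` decides membership in `K`. -/
structure Represents {d q : ℕ} (Φ : Interaction d q) (K : Finset (Site d)) (O : Oracle) :
    Prop where
  gamma : ∀ (a : Fin q) (k : ℕ),
    |((O 0 [((a : ℕ) : ℤ), (k : ℤ)] : ℤ) : ℝ) / 2 ^ k - Φ.γ a| ≤ 1 / 2 ^ k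
  beta : ∀ (i : Fin d) (a b : Fin q) (k : ℕ),
    |((O 1 [((i : ℕ) : ℤ), ((a : ℕ) : ℤ), ((b : ℕ) : ℤ), (k : ℤ)] : ℤ) : ℝ) / 2 ^ k
      - Φ.β i a b| ≤ 1 / 2 ^ k
  beta_zero : ∀ (i : Fin d) (a b : Fin q) (k : ℕ),
    O 1 [((i : ℕ) : ℤ), ((a : ℕ) : ℤ), ((b : ℕ) : ℤ), (k : ℤ)] = 0 ↔ Φ.β i a b = 0
  mem : ∀ v : Site d, O 2 (List.ofFn v) = if v ∈ K then 1 else 0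

end GibbsEntropy

end

open GibbsEntropy

noncomputable section

namespace GibbsEntropy


/-! ## Bit lengths -/

/-! The algorithm works on cubes of growing radius r. It runs through all configurations ξ on the
outer layer of the cube and all configurations y on the part of `K` inside, and computes by a
transfer matrix the partition functions of the cube with ξ, y and the symbol at the origin
prescribed. For every ξ these give the conditional probabilities of the symbols at the origin given
y, and the entropy of the origin given `K` under the boundary condition ξ. Since the constants of
SSM are unknown, r cannot be fixed in advance. Instead the algorithm tests at every radius whether
these numbers are nearly independent of ξ, and stops at the first radius that passes.

Correctness at that radius (`Rounded.sound`) uses no mixing. The measure is a mixture, over the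
configurations ζ outside the inner cube, of finite-volume measures that depend on ζ only through its
boundary code (`IsGibbs.real_eq_sum`), and `IsGibbs.condEntropy_formula` writes the entropy in terms
of this mixture. As `K` may stick out of the cube, conditioning on `K` also conditions on a part of
ζ. But the resulting probability of a symbol at the origin is a weighted mean of finite-volume
conditional probabilities with the same y, and the second test confines these to a few steps of a
grid of mesh 1/M. So the terms -p log p may be replaced by those of any one boundary condition. The
entropy is then nearly a mean of the entropies of the boundary conditions, which the third test
forces to be close to their average `meanH`. With M = D², an error 1/M in p costs about 1/D in -p
log p; D = 50 q 3^x with x = n^(d-1) makes the output interval 3^(-x) long.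

Termination (`viol_nonpos`) is where SSM enters, with the sites of `K` inside the cube among the
conditioned sites. If two configurations agree on the core, the part of `K` within radius r/2, the
conditional probabilities at the origin differ by at most C e^(-α⌊r/2⌋). This settles the second
test. For the third, the entropy under ξ is an average of a function that nearly depends on the core
only. Revealing the core site by site (`Mixing.chain`) bounds the influence of ξ on the probability
of each core configuration by |K| C e^(-α⌊r/2⌋), and there are at most q^|K| of them. Since |K| is
O(x + 1) and M is exponential in x, a radius c (x + 1) suffices, uniformly in the oracles
(`exists_radius`). The first test, on the precision of the interactions, passes there too because
the precision is 2^(-r).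

Running time: the outer layer and the window of the transfer matrix have O(r^(d-1)) sites, so the
table has e^(O(r^(d-1) + |K|)) entries, which is e^(O(n^((d-1)²))) for r of order n^(d-1).
Everything else is polynomial in the table. This is proved generically: the program is compiled from
a small language of terms with bounded sums and products, and if all data are bounded by R, then
each term runs in time R^e with e depending only on the term (`Tm.runs`). It remains to exhibit such
an R (`exists_bounds`). -/

lemma len_le_iff {z : ℤ} {b : ℕ} : len z ≤ b + 1 ↔ z.natAbs < 2 ^ b := by
  unfold len
  rw [Nat.add_le_add_iff_right, Nat.size_le]

lemma one_le_len (z : ℤ) : 1 ≤ len z := by simp [len]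

lemma len_le_natAbs (z : ℤ) : len z ≤ z.natAbs + 1 :=
  len_le_iff.2 Nat.lt_two_pow_self

lemma len_neg (z : ℤ) : len (-z) = len z := by simp [len]

lemma len_add_le (x y : ℤ) : len (x + y) ≤ len x + len y := by
  obtain ⟨a, ha⟩ := Nat.exists_eq_add_of_le' (one_le_len x)
  obtain ⟨b, hb⟩ := Nat.exists_eq_add_of_le' (one_le_len y)
  have h1 := len_le_iff.1 ha.le
  have h2 := len_le_iff.1 hb.le
  rw [ha, hb, show a + 1 + (b + 1) = (a + b + 1) + 1 by ring]
  refine len_le_iff.2 ((Int.natAbs_add_le x y).trans_lt ?_)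
  have h3 : 2 ^ a ≤ 2 ^ (a + b) := Nat.pow_le_pow_right (by norm_num) (by omega)
  have h4 : 2 ^ b ≤ 2 ^ (a + b) := Nat.pow_le_pow_right (by norm_num) (by omega)
  rw [pow_succ]
  omega

lemma len_sub_le (x y : ℤ) : len (x - y) ≤ len x + len y := by
  simpa [sub_eq_add_neg, len_neg] using len_add_le x (-y)

lemma len_mul_le (x y : ℤ) : len (x * y) ≤ len x + len y := by
  obtain ⟨a, ha⟩ := Nat.exists_eq_add_of_le' (one_le_len x)
  obtain ⟨b, hb⟩ := Nat.exists_eq_add_of_le' (one_le_len y)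
  have h1 := len_le_iff.1 ha.le
  have h2 := len_le_iff.1 hb.le
  have : len (x * y) ≤ a + b + 1 := by
    refine len_le_iff.2 ?_
    rw [Int.natAbs_mul, pow_add]
    exact Nat.mul_lt_mul'' h1 h2
  omega

lemma len_mono {x y : ℤ} (h : x.natAbs ≤ y.natAbs) : len x ≤ len y := by
  unfold len
  have := Nat.size_le_size h
  omega

lemma len_div_le (x y : ℤ) : len (x / y) ≤ len x :=
  len_mono (Int.natAbs_ediv_le_natAbs x y)

/-! ## The size of expressions -/

/-- A measure of the size of an expression. -/
def Expr.sz : Expr → ℕ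
  | .const c => len c
  | .reg _ => 1
  | .mem a => a.sz + 1
  | .add a b => a.sz + b.sz + 1
  | .sub a b => a.sz + b.sz + 1
  | .mul a b => a.sz + b.sz + 1
  | .div a b => a.sz + b.sz + 1

/-- All the cells that are read have at most `β` bits. -/
def Expr.ReadsBelow (β : ℕ) (s : State) : Expr → Prop
  | .const _ => True
  | .reg i => len (s.reg i) ≤ β
  | .mem a => a.ReadsBelow β s ∧ len (s.mem (a.eval s)) ≤ β
  | .add a b => a.ReadsBelow β s ∧ b.ReadsBelow β s
  | .sub a b => a.ReadsBelow β s ∧ b.ReadsBelow β s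
  | .mul a b => a.ReadsBelow β s ∧ b.ReadsBelow β s
  | .div a b => a.ReadsBelow β s ∧ b.ReadsBelow β s

/-- Every operation, multiplication included, at most adds the bit lengths of its operands, so
lengths stay linear in the size of the expression. The charge for products and quotients is a
product of lengths, hence the square. -/
lemma Expr.bound {β : ℕ} (hβ : 1 ≤ β) (s : State) (E : Expr) (h : E.ReadsBelow β s) :
    len (E.eval s) ≤ E.sz * β ∧ E.cost s ≤ 2 * (E.sz * β) ^ 2 := by
  induction E with
  | const c =>
    have := one_le_len c
    simp only [Expr.eval, Expr.sz, Expr.cost]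
    constructor
    · nlinarith
    · have h1 : 1 ≤ len c * β := Nat.mul_pos this hβ
      nlinarith
  | reg i =>
    simp only [Expr.ReadsBelow] at h
    simp only [Expr.eval, Expr.sz, Expr.cost]
    constructor
    · omega
    · nlinarith
  | mem a iha =>
    obtain ⟨h1, h2⟩ := h
    obtain ⟨i1, i2⟩ := iha h1
    simp only [Expr.eval, Expr.sz, Expr.cost]
    generalize ha : a.sz = A at *
    have : (A + 1) * β = A * β + β := by ring
    rw [this]
    generalize A * β = X at *
    constructor
    · omega
    · nlinarith
  | add a b iha ihb =>
    obtain ⟨i1, i2⟩ := iha h.1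
    obtain ⟨j1, j2⟩ := ihb h.2
    have := len_add_le (a.eval s) (b.eval s)
    simp only [Expr.eval, Expr.sz, Expr.cost]
    have e1 : (a.sz + b.sz + 1) * β = a.sz * β + b.sz * β + β := by ring
    rw [e1]
    generalize a.sz * β = X at *
    generalize b.sz * β = Y at *
    constructor
    · omega
    · nlinarith
  | sub a b iha ihb =>
    obtain ⟨i1, i2⟩ := iha h.1
    obtain ⟨j1, j2⟩ := ihb h.2
    have := len_sub_le (a.eval s) (b.eval s)
    simp only [Expr.eval, Expr.sz, Expr.cost]
    have e1 : (a.sz + b.sz + 1) * β = a.sz * β + b.sz * β + β := by ring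
    rw [e1]
    generalize a.sz * β = X at *
    generalize b.sz * β = Y at *
    constructor
    · omega
    · nlinarith
  | mul a b iha ihb =>
    obtain ⟨i1, i2⟩ := iha h.1
    obtain ⟨j1, j2⟩ := ihb h.2
    have := len_mul_le (a.eval s) (b.eval s)
    simp only [Expr.eval, Expr.sz, Expr.cost]
    have e1 : (a.sz + b.sz + 1) * β = a.sz * β + b.sz * β + β := by ring
    rw [e1]
    generalize a.sz * β = X at *
    generalize b.sz * β = Y at *
    have := Nat.mul_le_mul i1 j1
    constructor
    · omega
    · nlinarith
  | div a b iha ihb =>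
    obtain ⟨i1, i2⟩ := iha h.1
    obtain ⟨j1, j2⟩ := ihb h.2
    have := len_div_le (a.eval s) (b.eval s)
    simp only [Expr.eval, Expr.sz, Expr.cost]
    have e1 : (a.sz + b.sz + 1) * β = a.sz * β + b.sz * β + β := by ring
    rw [e1]
    generalize a.sz * β = X at *
    generalize b.sz * β = Y at *
    have := Nat.mul_le_mul i1 j1
    constructor
    · omega
    · nlinarith

/-! ## A language of terms with bounded sums and products -/

/-- Binary arithmetic operations. -/
inductive BinOp : Type
  | add | sub | mul | div

/-- The machine expression of an operation. -/
def BinOp.expr : BinOp → Expr → Expr → Expr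
  | .add => .add
  | .sub => .sub
  | .mul => .mul
  | .div => .div

/-- The meaning of an operation. -/
def BinOp.ap : BinOp → ℤ → ℤ → ℤ
  | .add => (· + ·)
  | .sub => (· - ·)
  | .mul => (· * ·)
  | .div => (· / ·)

/-- Terms: straight-line arithmetic, memory access, oracle queries and sums and products whose
range is given by a register. The registers `2` and `3` hold the radius (which is also the
precision of the queries) and the side length of the cube. -/
inductive Tm (d : ℕ) : Type
  | const (c : ℤ)
  | var (i : ℕ)
  | mem (a : Tm d)
  | op (o : BinOp) (a b : Tm d)
  | ite (c a b : Tm d)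
  | gam (a : Tm d)
  | bet (i : Fin d) (a b : Tm d)
  | inK (t : Tm d)
  | agg (p : Bool) (n : ℕ) (b : Tm d)

/-- The remainder modulo the constant `q`. -/
def modExpr (q : ℕ) (e : Expr) : Expr := .sub e (.mul (.const q) (.div e (.const q)))

/-- Powers of an expression. -/
def powExpr (e : Expr) : ℕ → Expr
  | 0 => .const 1
  | k + 1 => .mul (powExpr e k) e

/-- The coordinates of the site with index stored in register `k`. -/
def siteExpr (k i : ℕ) : Expr :=
  .sub (.sub (.div (.reg k) (powExpr (.reg 3) i))
    (.mul (.reg 3) (.div (.div (.reg k) (powExpr (.reg 3) i)) (.reg 3)))) (.add (.reg 2) (.const 1))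

/-- The site with index `t` in the cube of side length `L` and radius `r + 1`. -/
def siteZ (d : ℕ) (r L t : ℤ) : Fin d → ℤ := fun i => t / L ^ (i : ℕ) % L - (r + 1)

/-- The combination of the partial result of a sum or a product with the next term. -/
def aggOp (p : Bool) : BinOp := if p then .mul else .add

/-- The empty sum or product. -/
def aggInit (p : Bool) : ℤ := if p then 1 else 0

/-- The sum or product of the first `n` values of `f`. -/
def aggVal (p : Bool) (f : ℕ → ℤ) : ℕ → ℤ
  | 0 => aggInit p
  | n + 1 => (aggOp p).ap (aggVal p f n) (f n)

lemma aggVal_false (f : ℕ → ℤ) (n : ℕ) : aggVal false f n = ∑ i ∈ Finset.range n, f i := by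
  induction n with
  | zero => rfl
  | succ n ih => rw [Finset.sum_range_succ, ← ih]; rfl

lemma aggVal_true (f : ℕ → ℤ) (n : ℕ) : aggVal true f n = ∏ i ∈ Finset.range n, f i := by
  induction n with
  | zero => rfl
  | succ n ih => rw [Finset.prod_range_succ, ← ih]; rfl

/-- The compiler: the value of the term is computed in register `k`, with the registers from `k`
on as working space. -/
def Tm.compile {d : ℕ} (q : ℕ) : ℕ → Tm d → Prog
  | k, .const c => .assign k (.const c)
  | k, .var i => .assign k (.reg i)
  | k, .mem a => .seq (a.compile q k) (.assign k (.mem (.reg k)))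
  -- The second operand is compiled one level higher, so that the first one survives in register
  -- `k`.
  | k, .op o a b => .seq (a.compile q k) (.seq (b.compile q (k + 1))
      (.assign k (o.expr (.reg k) (.reg (k + 1)))))
  | k, .ite c a b => .seq (c.compile q k) (.ite (.reg k) (a.compile q k) (b.compile q k))
  | k, .gam a => .seq (a.compile q k) (.query k 0 [modExpr q (.reg k), .reg 2])
  | k, .bet i a b => .seq (a.compile q k) (.seq (b.compile q (k + 1))
      (.query k 1 [.const (i : ℕ), modExpr q (.reg k), modExpr q (.reg (k + 1)), .reg 2]))
  | k, .inK t => .seq (t.compile q k) (.query k 2 (List.ofFn fun i : Fin d => siteExpr k i))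
  -- Register `k` accumulates, `k + 1` counts and `k + 2` keeps a copy of the bound; the body may
  -- use the registers from `k + 3` on.
  | k, .agg p n b => .seq (.assign k (.const (aggInit p))) (.seq (.assign (k + 1) (.const 0))
      (.seq (.assign (k + 2) (.reg n))
        (.loop (.sub (.reg (k + 2)) (.reg (k + 1))) (.seq (b.compile q (k + 3))
          (.seq (.assign k ((aggOp p).expr (.reg k) (.reg (k + 3))))
            (.assign (k + 1) (.add (.reg (k + 1)) (.const 1))))))))

/-- The value of a term. -/
def Tm.eval {d : ℕ} (q : ℕ) (O : Oracle) (m : ℤ → ℤ) : ℕ → (ℕ → ℤ) → Tm d → ℤ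
  | _, _, .const c => c
  | _, ρ, .var i => ρ i
  | k, ρ, .mem a => m (a.eval q O m k ρ)
  | k, ρ, .op o a b => o.ap (a.eval q O m k ρ) (b.eval q O m (k + 1) ρ)
  | k, ρ, .ite c a b => if 0 < c.eval q O m k ρ then a.eval q O m k ρ else b.eval q O m k ρ
  | k, ρ, .gam a => O 0 [a.eval q O m k ρ % q, ρ 2]
  | k, ρ, .bet i a b => O 1 [(i : ℕ), a.eval q O m k ρ % q, b.eval q O m (k + 1) ρ % q, ρ 2]
  | k, ρ, .inK t => O 2 (List.ofFn (siteZ d (ρ 2) (ρ 3) (t.eval q O m k ρ)))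
  | k, ρ, .agg p n b =>
      aggVal p (fun i => b.eval q O m (k + 3) (Function.update ρ (k + 1) i)) (ρ n).toNat

/-- The registers read by a term, compiled at level `k`, lie in `S` (or are bound). -/
def Tm.Scoped {d : ℕ} : Set ℕ → ℕ → Tm d → Prop
  | _, _, .const _ => True
  | S, _, .var i => i ∈ S
  | S, k, .mem a => a.Scoped S k
  | S, k, .op _ a b => a.Scoped S k ∧ b.Scoped S (k + 1)
  | S, k, .ite c a b => c.Scoped S k ∧ a.Scoped S k ∧ b.Scoped S k
  | S, k, .gam a => a.Scoped S k
  | S, k, .bet _ a b => a.Scoped S k ∧ b.Scoped S (k + 1)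
  | S, k, .inK t => t.Scoped S k
  | S, k, .agg _ n b => n ∈ S ∧ b.Scoped (insert (k + 1) S) (k + 3)

lemma Tm.Scoped.mono {d : ℕ} {S S' : Set ℕ} (h : S ⊆ S') {k : ℕ} {t : Tm d}
    (ht : t.Scoped S k) : t.Scoped S' k := by
  induction t generalizing S S' k with
  | const c => trivial
  | var i => exact h ht
  | mem a ih => exact ih h ht
  | op o a b iha ihb => exact ⟨iha h ht.1, ihb h ht.2⟩
  | ite c a b ihc iha ihb => exact ⟨ihc h ht.1, iha h ht.2.1, ihb h ht.2.2⟩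
  | gam a ih => exact ih h ht
  | bet i a b iha ihb => exact ⟨iha h ht.1, ihb h ht.2⟩
  | inK t ih => exact ih h ht
  | agg p n b ih => exact ⟨h ht.1, ih (Set.insert_subset_insert h) ht.2⟩

/-- The exponent in the bound for the running time of a term. -/
def Tm.expo {d : ℕ} (q : ℕ) : Tm d → ℕ
  | .const c => 2 * len c + 10
  | .var _ => 10
  | .mem a => 2 * a.expo q + 20
  | .op _ a b => 2 * (a.expo q + b.expo q) + 20
  | .ite c a b => 2 * c.expo q + a.expo q + b.expo q + 20
  | .gam a => 2 * a.expo q + 4 * len q + 40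
  | .bet i a b => 2 * (a.expo q + b.expo q) + 2 * len (i : ℕ) + 8 * len q + 80
  | .inK t => 2 * t.expo q +
      2 * ((List.ofFn fun i : Fin d => siteExpr 0 i).map Expr.sz).sum + 2 * d + 40
  | .agg _ _ b => 2 * b.expo q + 40

/-- The bounds on the memory and the answers of the oracles that are used in the time bound. -/
structure DataBound (d q : ℕ) (O : Oracle) (m : ℤ → ℤ) (z : ℤ) (R : ℕ) : Prop where
  two_le : 2 ≤ R
  mem : ∀ a, len (m a) ≤ R
  -- The symbols in a query are reduced modulo `q`, so only answers to legitimate queries have to be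
  -- bounded, whatever integer the term produces.
  gam : ∀ a : ℤ, len (O 0 [a % q, z]) ≤ R
  bet : ∀ (i : Fin d) (a b : ℤ), len (O 1 [(i : ℕ), a % q, b % q, z]) ≤ R
  inK : ∀ v : Fin d → ℤ, len (O 2 (List.ofFn v)) ≤ R


lemma le_pow_of_le {R a m m' : ℕ} (hR : 2 ≤ R) (h : a ≤ R ^ m) (hm : m ≤ m') : a ≤ R ^ m' :=
  h.trans (Nat.pow_le_pow_right (by omega) hm)

/-- As R ≥ 2, a sum costs one more power of R, and constants are absorbed in the same way. This
keeps all time bounds in the form R^m. -/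
lemma add_le_pow {R a b m : ℕ} (hR : 2 ≤ R) (ha : a ≤ R ^ m) (hb : b ≤ R ^ m) :
    a + b ≤ R ^ (m + 1) := by
  rw [pow_succ]
  nlinarith [Nat.zero_le (R ^ m)]

lemma self_le_pow {R : ℕ} (hR : 2 ≤ R) (a : ℕ) : a ≤ R ^ a :=
  (Nat.lt_two_pow_self).le.trans (Nat.pow_le_pow_left hR a)

lemma one_le_pow' {R : ℕ} (hR : 2 ≤ R) (m : ℕ) : 1 ≤ R ^ m := Nat.one_le_pow _ _ (by omega)

lemma Expr.cost_le_pow {R m : ℕ} (hR : 2 ≤ R) {s : State} {E : Expr}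
    (h : E.ReadsBelow (R ^ m) s) :
    E.cost s + 1 ≤ R ^ (2 * (E.sz + m) + 2) ∧ len (E.eval s) ≤ R ^ (E.sz + m) := by
  obtain ⟨h1, h2⟩ := E.bound (one_le_pow' hR m) s h
  have h3 : E.sz * R ^ m ≤ R ^ (E.sz + m) := by
    rw [pow_add]; exact Nat.mul_le_mul_right _ (self_le_pow hR _)
  refine ⟨?_, h1.trans h3⟩
  refine add_le_pow hR (h2.trans ?_) (one_le_pow' hR _)
  have h4 := Nat.pow_le_pow_left h3 2
  rw [← pow_mul] at h4
  rw [pow_succ, mul_comm 2 (E.sz + m)]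
  calc 2 * (E.sz * R ^ m) ^ 2 ≤ R * R ^ ((E.sz + m) * 2) := Nat.mul_le_mul hR h4
    _ = _ := mul_comm _ _

lemma modExpr_eval (q : ℕ) (e : Expr) (s : State) :
    (modExpr q e).eval s = e.eval s % q := by
  simp [modExpr, Expr.eval, Int.emod_def]

lemma powExpr_eval (e : Expr) (k : ℕ) (s : State) : (powExpr e k).eval s = e.eval s ^ k := by
  induction k with
  | zero => simp [powExpr, Expr.eval]
  | succ k ih => simp [powExpr, Expr.eval, ih, pow_succ]

lemma powExpr_readsBelow {e : Expr} {β : ℕ} {s : State} (h : e.ReadsBelow β s) (k : ℕ) :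
    (powExpr e k).ReadsBelow β s := by
  induction k with
  | zero => trivial
  | succ k ih => exact ⟨ih, h⟩

lemma siteExpr_eval (k i : ℕ) (s : State) :
    (siteExpr k i).eval s = s.reg k / s.reg 3 ^ i % s.reg 3 - (s.reg 2 + 1) := by
  simp [siteExpr, Expr.eval, powExpr_eval, Int.emod_def]

lemma siteExpr_readsBelow {k i β : ℕ} {s : State} (hk : len (s.reg k) ≤ β)
    (h2 : len (s.reg 2) ≤ β) (h3 : len (s.reg 3) ≤ β) : (siteExpr k i).ReadsBelow β s := by
  have := powExpr_readsBelow (e := .reg 3) (s := s) (β := β) h3 i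
  simp [siteExpr, Expr.ReadsBelow, *]

lemma siteExpr_sz (k i : ℕ) : (siteExpr k i).sz = (siteExpr 0 i).sz := rfl

/-- A rule for loops with a given number of iterations. -/
lemma exec_loop {O : Oracle} {x : Expr} {p : Prog} {N Tb : ℕ} (P : ℕ → State → Prop)
    (hstep : ∀ i < N, ∀ s, P i s → 0 < x.eval s ∧
      ∃ t s', Exec O p s t s' ∧ x.cost s + 1 + t ≤ Tb ∧ P (i + 1) s')
    (hend : ∀ s, P N s → ¬ 0 < x.eval s ∧ x.cost s + 1 ≤ Tb)
    (s : State) (hs : P 0 s) :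
    ∃ t s', Exec O (.loop x p) s t s' ∧ t ≤ (N + 1) * Tb ∧ P N s' := by
  have key : ∀ j i, i + j = N → ∀ s, P i s →
      ∃ t s', Exec O (.loop x p) s t s' ∧ t ≤ (j + 1) * Tb ∧ P N s' := by
    intro j
    induction j with
    | zero =>
      intro i hi s hs
      obtain rfl : i = N := by omega
      obtain ⟨h1, h2⟩ := hend s hs
      exact ⟨_, s, Exec.loop_done h1, by omega, hs⟩
    | succ j ih =>
      intro i hi s hs
      obtain ⟨h1, t, s', h2, h3, h4⟩ := hstep i (by omega) s hs
      obtain ⟨t', s'', h5, h6, h7⟩ := ih (i + 1) (by omega) s' h4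
      refine ⟨_, s'', Exec.loop_step h1 h2 h5, ?_, h7⟩
      calc x.cost s + 1 + t + t' ≤ Tb + (j + 1) * Tb := by omega
        _ = (j + 1 + 1) * Tb := by ring
  exact key N 0 (by omega) s hs

/-- The specification of a compiled term. -/
def Tm.Runs {d : ℕ} (q : ℕ) (O : Oracle) (R k : ℕ) (t : Tm d) (v : ℤ) (s : State) : Prop :=
  ∃ T s', Exec O (t.compile q k) s T s' ∧ T ≤ R ^ t.expo q ∧ len v ≤ R ^ t.expo q ∧
    s'.reg k = v ∧ (∀ i < k, s'.reg i = s.reg i) ∧ s'.mem = s.mem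

/-- The generic time bound, by induction on the term: the exponent does not depend on the data.
Registers are bounded in absolute value and not only in length because they serve as ranges of
loops; a loop has fewer than R rounds, so nesting only raises the exponent. -/
lemma Tm.runs {d q : ℕ} {O : Oracle} {m : ℤ → ℤ} {z : ℤ} {R : ℕ}
    (hD : DataBound d q O m z R) (t : Tm d) :
    ∀ (S : Set ℕ) (k : ℕ) (ρ : ℕ → ℤ) (s : State), t.Scoped S k → (∀ i ∈ S, i < k) →
      2 ∈ S → 3 ∈ S → ρ 2 = z → (∀ i ∈ S, (ρ i).natAbs + 1 ≤ R) →
      (∀ i ∈ S, s.reg i = ρ i) → s.mem = m → t.Runs q O R k (t.eval q O m k ρ) s := by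
  have hR := hD.two_le
  induction t with
  | const c =>
    intro S k ρ s ht hS h2 h3 hz hb hs hm
    obtain ⟨h4, h5⟩ := Expr.cost_le_pow (m := 0) (E := .const c) (s := s) hR trivial
    refine ⟨_, _, Exec.assign _ _ _, ?_, ?_, ?_, ?_, ?_⟩
    · exact le_pow_of_le hR h4 (by simp [Expr.sz, Tm.expo])
    · exact le_pow_of_le hR h5 (by simp only [Expr.sz, Tm.expo]; omega)
    · simp [Expr.eval, Tm.eval]
    · intro i hi; simp [Function.update_of_ne hi.ne]
    · rfl
  | var i =>
    intro S k ρ s ht hS h2 h3 hz hb hs hm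
    have hr : len (s.reg i) ≤ R ^ 1 := by
      rw [hs i ht, pow_one]; exact (len_le_natAbs _).trans (hb i ht)
    obtain ⟨h4, h5⟩ := Expr.cost_le_pow (m := 1) (E := .reg i) (s := s) hR hr
    refine ⟨_, _, Exec.assign _ _ _, ?_, ?_, ?_, ?_, ?_⟩
    · exact le_pow_of_le hR h4 (by simp [Expr.sz, Tm.expo])
    · simp only [Tm.eval, ← hs i ht]
      exact le_pow_of_le hR hr (by simp [Tm.expo])
    · simp [Expr.eval, Tm.eval, hs i ht]
    · intro i hi; simp [Function.update_of_ne hi.ne]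
    · rfl
  | mem a ih =>
    intro S k ρ s ht hS h2 h3 hz hb hs hm
    obtain ⟨T, s', e1, t1, l1, v1, f1, m1⟩ := ih S k ρ s ht hS h2 h3 hz hb hs hm
    have hr : (Expr.mem (.reg k)).ReadsBelow (R ^ (a.expo q + 1)) s' := by
      refine ⟨?_, ?_⟩
      · simp only [Expr.ReadsBelow, v1]
        exact le_pow_of_le hR l1 (by omega)
      · rw [m1, hm]
        refine (hD.mem _).trans ?_
        rw [pow_succ]
        nlinarith [one_le_pow' hR (a.expo q)]
    obtain ⟨h4, h5⟩ := Expr.cost_le_pow hR hr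
    refine ⟨_, _, Exec.seq e1 (Exec.assign _ _ _), ?_, ?_, ?_, ?_, ?_⟩
    · refine le_pow_of_le hR (add_le_pow hR (le_pow_of_le hR t1 ?_) h4) ?_ <;>
        simp [Expr.sz, Tm.expo] <;> omega
    · refine le_pow_of_le (m := 1) hR ?_ (by simp only [Tm.expo]; omega)
      simpa [Tm.eval] using hD.mem _
    · simp [Expr.eval, Tm.eval, v1, m1, hm]
    · intro i hi; simp [Function.update_of_ne hi.ne, f1 i hi]
    · simp [m1]
  | op o a b iha ihb =>
    intro S k ρ s ht hS h2 h3 hz hb hs hm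
    obtain ⟨T, s', e1, t1, l1, v1, f1, m1⟩ := iha S k ρ s ht.1 hS h2 h3 hz hb hs hm
    obtain ⟨T', s'', e2, t2, l2, v2, f2, m2⟩ := ihb S (k + 1) ρ s' ht.2
      (fun i hi => (hS i hi).trans (Nat.lt_succ_self k)) h2 h3 hz hb
      (fun i hi => (f1 i (hS i hi)).trans (hs i hi)) (m1.trans hm)
    have hk : s''.reg k = a.eval q O m k ρ := (f2 k (Nat.lt_succ_self k)).trans v1
    have hsz : (o.expr (.reg k) (.reg (k + 1))).sz = 3 := by cases o <;> rfl
    have hev : (o.expr (.reg k) (.reg (k + 1))).eval s'' =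
        o.ap (a.eval q O m k ρ) (b.eval q O m (k + 1) ρ) := by
      cases o <;> simp [BinOp.expr, BinOp.ap, Expr.eval, hk, v2]
    have hr : (o.expr (.reg k) (.reg (k + 1))).ReadsBelow (R ^ (a.expo q + b.expo q)) s'' := by
      have h4 : len (s''.reg k) ≤ R ^ (a.expo q + b.expo q) := by
        rw [hk]; exact le_pow_of_le hR l1 (by omega)
      have h5 : len (s''.reg (k + 1)) ≤ R ^ (a.expo q + b.expo q) := by
        rw [v2]; exact le_pow_of_le hR l2 (by omega)
      cases o <;> exact ⟨h4, h5⟩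
    obtain ⟨h4, h5⟩ := Expr.cost_le_pow hR hr
    rw [hsz] at h4 h5
    refine ⟨_, _, Exec.seq e1 (Exec.seq e2 (Exec.assign _ _ _)), ?_, ?_, ?_, ?_, ?_⟩
    · refine le_pow_of_le hR (add_le_pow hR (le_pow_of_le hR t1 ?_)
        (add_le_pow hR (le_pow_of_le hR t2 ?_) h4)) ?_ <;> (try simp only [Tm.expo]) <;> omega
    · rw [hev] at h5
      exact le_pow_of_le hR h5 (by simp only [Tm.expo]; omega)
    · simp [hev, Tm.eval]
    · intro i hi
      simp [Function.update_of_ne hi.ne, f2 i (by omega), f1 i hi]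
    · simp [m1, m2]
  | ite c a b ihc iha ihb =>
    intro S k ρ s ht hS h2 h3 hz hb hs hm
    obtain ⟨T, s', e1, t1, l1, v1, f1, m1⟩ := ihc S k ρ s ht.1 hS h2 h3 hz hb hs hm
    have hs' : ∀ i ∈ S, s'.reg i = ρ i := fun i hi => (f1 i (hS i hi)).trans (hs i hi)
    have hr : (Expr.reg k).ReadsBelow (R ^ c.expo q) s' := by
      simpa only [Expr.ReadsBelow, v1] using l1
    obtain ⟨h4, h5⟩ := Expr.cost_le_pow hR hr
    by_cases hc : 0 < c.eval q O m k ρ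
    · obtain ⟨T', s'', e2, t2, l2, v2, f2, m2⟩ := iha S k ρ s' ht.2.1 hS h2 h3 hz hb hs'
        (m1.trans hm)
      refine ⟨_, _, Exec.seq e1 (Exec.ite_pos (by simpa [Expr.eval, v1] using hc) e2),
        ?_, ?_, ?_, ?_, ?_⟩
      · refine le_pow_of_le (m := 2 * c.expo q + a.expo q + b.expo q + 10 + 1 + 1) hR
          (add_le_pow hR (le_pow_of_le hR t1 ?_)
          (add_le_pow hR (le_pow_of_le hR h4 ?_) (le_pow_of_le hR t2 ?_))) ?_ <;>
          (try simp only [Tm.expo, Expr.sz]) <;> omega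
      · simp only [Tm.eval, if_pos hc]
        exact le_pow_of_le hR l2 (by simp only [Tm.expo]; omega)
      · simp [Tm.eval, hc, v2]
      · intro i hi; rw [f2 i hi, f1 i hi]
      · rw [m2, m1]
    · obtain ⟨T', s'', e2, t2, l2, v2, f2, m2⟩ := ihb S k ρ s' ht.2.2 hS h2 h3 hz hb hs'
        (m1.trans hm)
      refine ⟨_, _, Exec.seq e1 (Exec.ite_neg (by simpa [Expr.eval, v1] using hc) e2),
        ?_, ?_, ?_, ?_, ?_⟩
      · refine le_pow_of_le (m := 2 * c.expo q + a.expo q + b.expo q + 10 + 1 + 1) hR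
          (add_le_pow hR (le_pow_of_le hR t1 ?_)
          (add_le_pow hR (le_pow_of_le hR h4 ?_) (le_pow_of_le hR t2 ?_))) ?_ <;>
          (try simp only [Tm.expo, Expr.sz]) <;> omega
      · simp only [Tm.eval, if_neg hc]
        exact le_pow_of_le hR l2 (by simp only [Tm.expo]; omega)
      · simp [Tm.eval, hc, v2]
      · intro i hi; rw [f2 i hi, f1 i hi]
      · rw [m2, m1]
  | gam a ih =>
    intro S k ρ s ht hS h2 h3 hz hb hs hm
    obtain ⟨T, s', e1, t1, l1, v1, f1, m1⟩ := ih S k ρ s ht hS h2 h3 hz hb hs hm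
    have hs2 : s'.reg 2 = ρ 2 := (f1 2 (hS 2 h2)).trans (hs 2 h2)
    have hr : (modExpr q (.reg k)).ReadsBelow (R ^ a.expo q) s' := by
      have : len (s'.reg k) ≤ R ^ a.expo q := by rw [v1]; exact l1
      exact ⟨this, trivial, this, trivial⟩
    have hr2 : (Expr.reg 2).ReadsBelow (R ^ 1) s' := by
      simp only [Expr.ReadsBelow, hs2, pow_one]
      exact (len_le_natAbs _).trans (hb 2 h2)
    obtain ⟨h4, -⟩ := Expr.cost_le_pow hR hr
    obtain ⟨h5, -⟩ := Expr.cost_le_pow hR hr2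
    have hans := hD.gam (a.eval q O m k ρ)
    have hval : O 0 (List.map (Expr.eval s') [modExpr q (.reg k), .reg 2]) =
        O 0 [a.eval q O m k ρ % q, z] := by
      simp [modExpr_eval, Expr.eval, v1, hs2, hz]
    refine ⟨_, _, Exec.seq e1 (Exec.query _ _ _ _), ?_, ?_, ?_, ?_, ?_⟩
    · rw [hval]
      simp only [List.map_cons, List.map_nil, List.sum_cons, List.sum_nil]
      have hsz : (modExpr q (.reg k)).sz = 2 * len q + 5 := by
        simp [modExpr, Expr.sz]; ring
      rw [hsz] at h4
      have b1 : (modExpr q (.reg k)).cost s' + 1 ≤ R ^ (2 * a.expo q + 4 * len q + 12) :=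
        le_pow_of_le hR h4 (by omega)
      have b2 : (Expr.reg 2).cost s' + 1 ≤ R ^ (2 * a.expo q + 4 * len q + 12) :=
        le_pow_of_le hR h5 (by simp only [Expr.sz]; omega)
      have b3 : T ≤ R ^ (2 * a.expo q + 4 * len q + 12) := le_pow_of_le hR t1 (by omega)
      have b4 : len (O 0 [a.eval q O m k ρ % q, z]) ≤ R ^ (2 * a.expo q + 4 * len q + 12) :=
        le_pow_of_le (m := 1) hR (by simpa using hans) (by omega)
      have := add_le_pow hR (add_le_pow hR b1 b2) (add_le_pow hR b3 b4)
      refine le_trans ?_ (le_pow_of_le hR this (by simp only [Tm.expo]; omega))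
      omega
    · simp only [Tm.eval, hz]
      exact le_pow_of_le (m := 1) hR (by simpa using hans) (by simp only [Tm.expo]; omega)
    · simp only [Function.update_self, Tm.eval, hval, hz]
    · intro i hi; simp [Function.update_of_ne hi.ne, f1 i hi]
    · simp [m1]
  | bet j a b iha ihb =>
    intro S k ρ s ht hS h2 h3 hz hb hs hm
    obtain ⟨T, s', e1, t1, l1, v1, f1, m1⟩ := iha S k ρ s ht.1 hS h2 h3 hz hb hs hm
    obtain ⟨T', s'', e2, t2, l2, v2, f2, m2⟩ := ihb S (k + 1) ρ s' ht.2
      (fun i hi => (hS i hi).trans (Nat.lt_succ_self k)) h2 h3 hz hb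
      (fun i hi => (f1 i (hS i hi)).trans (hs i hi)) (m1.trans hm)
    have hk : s''.reg k = a.eval q O m k ρ := (f2 k (Nat.lt_succ_self k)).trans v1
    have hs2 : s''.reg 2 = ρ 2 := (f2 2 (by have := hS 2 h2; omega)).trans
      ((f1 2 (hS 2 h2)).trans (hs 2 h2))
    have hra : (modExpr q (.reg k)).ReadsBelow (R ^ a.expo q) s'' := by
      have : len (s''.reg k) ≤ R ^ a.expo q := by rw [hk]; exact l1
      exact ⟨this, trivial, this, trivial⟩
    have hrb : (modExpr q (.reg (k + 1))).ReadsBelow (R ^ b.expo q) s'' := by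
      have : len (s''.reg (k + 1)) ≤ R ^ b.expo q := by rw [v2]; exact l2
      exact ⟨this, trivial, this, trivial⟩
    have hr2 : (Expr.reg 2).ReadsBelow (R ^ 1) s'' := by
      simp only [Expr.ReadsBelow, hs2, pow_one]
      exact (len_le_natAbs _).trans (hb 2 h2)
    obtain ⟨h4, -⟩ := Expr.cost_le_pow hR hra
    obtain ⟨h5, -⟩ := Expr.cost_le_pow hR hrb
    obtain ⟨h6, -⟩ := Expr.cost_le_pow hR hr2
    have hans := hD.bet j (a.eval q O m k ρ) (b.eval q O m (k + 1) ρ)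
    have hval : O 1 (List.map (Expr.eval s'')
        [.const (j : ℕ), modExpr q (.reg k), modExpr q (.reg (k + 1)), .reg 2]) =
        O 1 [(j : ℕ), a.eval q O m k ρ % q, b.eval q O m (k + 1) ρ % q, z] := by
      simp [modExpr_eval, Expr.eval, v2, hk, hs2, hz]
    refine ⟨_, _, Exec.seq e1 (Exec.seq e2 (Exec.query _ _ _ _)), ?_, ?_, ?_, ?_, ?_⟩
    · rw [hval]
      simp only [List.map_cons, List.map_nil, List.sum_cons, List.sum_nil]
      have hsza : (modExpr q (.reg k)).sz = 2 * len q + 5 := by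
        simp [modExpr, Expr.sz]; ring
      have hszb : (modExpr q (.reg (k + 1))).sz = 2 * len q + 5 := by
        simp [modExpr, Expr.sz]; ring
      rw [hsza] at h4
      rw [hszb] at h5
      set X := 2 * (a.expo q + b.expo q) + 2 * len (j : ℕ) + 4 * len q + 12 with hX
      have b0 : (Expr.const (j : ℕ)).cost s'' ≤ R ^ X :=
        le_pow_of_le hR (self_le_pow hR _) (by simp only [Expr.cost, hX]; omega)
      have b1 : (modExpr q (.reg k)).cost s'' + 1 ≤ R ^ X := le_pow_of_le hR h4 (by omega)
      have b1' : (modExpr q (.reg (k + 1))).cost s'' + 1 ≤ R ^ X :=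
        le_pow_of_le hR h5 (by omega)
      have b2 : (Expr.reg 2).cost s'' + 1 ≤ R ^ X :=
        le_pow_of_le hR h6 (by simp only [Expr.sz]; omega)
      have b3 : T ≤ R ^ X := le_pow_of_le hR t1 (by omega)
      have b3' : T' ≤ R ^ X := le_pow_of_le hR t2 (by omega)
      have b4 : len (O 1 [(j : ℕ), a.eval q O m k ρ % q, b.eval q O m (k + 1) ρ % q, z]) ≤
          R ^ X := le_pow_of_le (m := 1) hR (by simpa using hans) (by omega)
      have := add_le_pow hR (add_le_pow hR (add_le_pow hR b1 b2) (add_le_pow hR b3 b4))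
        (add_le_pow hR (add_le_pow hR b0 b1') (add_le_pow hR b3' b3'))
      refine le_trans ?_ (le_pow_of_le hR this (by simp only [Tm.expo, hX]; omega))
      omega
    · simp only [Tm.eval, hz]
      exact le_pow_of_le (m := 1) hR (by simpa using hans) (by simp only [Tm.expo]; omega)
    · simp only [Function.update_self, Tm.eval, hval, hz]
    · intro i hi
      simp [Function.update_of_ne hi.ne, f2 i (by omega), f1 i hi]
    · simp [m1, m2]
  | inK t ih =>
    intro S k ρ s ht hS h2 h3 hz hb hs hm
    obtain ⟨T, s', e1, t1, l1, v1, f1, m1⟩ := ih S k ρ s ht hS h2 h3 hz hb hs hm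
    have hs2 : s'.reg 2 = ρ 2 := (f1 2 (hS 2 h2)).trans (hs 2 h2)
    have hs3 : s'.reg 3 = ρ 3 := (f1 3 (hS 3 h3)).trans (hs 3 h3)
    have hRe : R ≤ R ^ (t.expo q + 1) := by
      rw [pow_succ]; nlinarith [one_le_pow' hR (t.expo q)]
    have hr : ∀ i : ℕ, (siteExpr k i).ReadsBelow (R ^ (t.expo q + 1)) s' := fun i =>
      siteExpr_readsBelow (by rw [v1]; exact le_pow_of_le hR l1 (by omega))
        (by rw [hs2]; exact ((len_le_natAbs _).trans (hb 2 h2)).trans hRe)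
        (by rw [hs3]; exact ((len_le_natAbs _).trans (hb 3 h3)).trans hRe)
    have hans := hD.inK (siteZ d (ρ 2) (ρ 3) (t.eval q O m k ρ))
    have hval : O 2 (List.map (Expr.eval s') (List.ofFn fun i : Fin d => siteExpr k i)) =
        O 2 (List.ofFn (siteZ d (ρ 2) (ρ 3) (t.eval q O m k ρ))) := by
      rw [List.map_ofFn]
      congr 2
      funext i
      simp [siteExpr_eval, v1, hs2, hs3, siteZ]
    refine ⟨_, _, Exec.seq e1 (Exec.query _ _ _ _), ?_, ?_, ?_, ?_, ?_⟩
    · rw [hval]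
      set Z := ((List.ofFn fun i : Fin d => siteExpr 0 i).map Expr.sz).sum with hZ
      set X := 2 * t.expo q + 2 * Z + 2 * d + 20 with hX
      have c1 : ((List.ofFn fun i : Fin d => siteExpr k i).map (Expr.cost s')).sum ≤ R ^ X := by
        have hle : ∀ c ∈ (List.ofFn fun i : Fin d => siteExpr k i).map (Expr.cost s'),
            c ≤ R ^ (2 * (Z + (t.expo q + 1)) + 2) := by
          intro c hc
          obtain ⟨E, hE, rfl⟩ := List.mem_map.1 hc
          obtain ⟨i, rfl⟩ := (List.mem_ofFn' _ _).1 hE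
          have h4 := (Expr.cost_le_pow hR (hr i)).1
          refine le_trans (Nat.le_succ _) (le_pow_of_le hR h4 ?_)
          have : (siteExpr k i).sz ≤ Z := by
            rw [siteExpr_sz, hZ]
            refine List.single_le_sum (by simp) _ ?_
            exact List.mem_map.2 ⟨_, (List.mem_ofFn' _ _).2 ⟨i, rfl⟩, rfl⟩
          omega
        refine (List.sum_le_card_nsmul _ _ hle).trans ?_
        simp only [List.length_map, List.length_ofFn, smul_eq_mul]
        calc d * R ^ (2 * (Z + (t.expo q + 1)) + 2)
            ≤ R ^ d * R ^ (2 * (Z + (t.expo q + 1)) + 2) :=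
              Nat.mul_le_mul_right _ (self_le_pow hR d)
          _ = R ^ (d + (2 * (Z + (t.expo q + 1)) + 2)) := (pow_add _ _ _).symm
          _ ≤ R ^ X := Nat.pow_le_pow_right (by omega) (by omega)
      have b3 : T ≤ R ^ X := le_pow_of_le hR t1 (by omega)
      have b4 : len (O 2 (List.ofFn (siteZ d (ρ 2) (ρ 3) (t.eval q O m k ρ)))) ≤ R ^ X :=
        le_pow_of_le (m := 1) hR (by simpa using hans) (by omega)
      have := add_le_pow hR (add_le_pow hR c1 b3) (add_le_pow hR b4 (one_le_pow' hR X))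
      refine le_trans ?_ (le_pow_of_le hR this (by simp only [Tm.expo, hX, hZ]; omega))
      omega
    · simp only [Tm.eval]
      exact le_pow_of_le (m := 1) hR (by simpa using hans) (by simp only [Tm.expo]; omega)
    · simp only [Function.update_self, Tm.eval, hval]
    · intro i hi; simp [Function.update_of_ne hi.ne, f1 i hi]
    · simp [m1]
  | agg p n b ih =>
    intro S k ρ s ht hS h2 h3 hz hb hs hm
    obtain ⟨hn, hbS⟩ := ht
    have hnk := hS n hn
    set N := (ρ n).toNat with hN
    have hNR : N + 1 ≤ R := by have := hb n hn; omega
    set f : ℕ → ℤ := fun i => b.eval q O m (k + 3) (Function.update ρ (k + 1) i) with hf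
    set e := b.expo q with he
    have hlenN : ∀ i : ℕ, i ≤ N → len (i : ℤ) ≤ R ^ 1 := fun i hi => by
      rw [pow_one]; exact (len_le_natAbs _).trans (by simp; omega)
    -- Bit lengths add up for sums and for products alike, so the accumulator grows by at most R^e
    -- bits per round. The 2 is the length of the initial value 1.
    let P : ℕ → State → Prop := fun i s' => s'.reg k = aggVal p f i ∧ s'.reg (k + 1) = i ∧
      s'.reg (k + 2) = ρ n ∧ (∀ j < k, s'.reg j = s.reg j) ∧ s'.mem = s.mem ∧
      len (aggVal p f i) ≤ 2 + i * R ^ e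
    have hacc : ∀ i ≤ N, 2 + i * R ^ e ≤ R ^ (e + 2) := by
      intro i hi
      have h4 : 1 ≤ R ^ e := one_le_pow' hR e
      have h5 : i + 1 ≤ R := by omega
      have h6 : (i + 1) * R ^ e ≤ R * R ^ e := Nat.mul_le_mul_right _ h5
      have h7 : R ^ (e + 2) = R * (R * R ^ e) := by ring
      have h8 : 2 * (R * R ^ e) ≤ R * (R * R ^ e) := Nat.mul_le_mul_right _ hR
      have h9 : 2 * 1 ≤ R * R ^ e := Nat.mul_le_mul hR h4
      rw [h7]
      rw [add_mul] at h6
      omega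
    have hguard : ∀ i ≤ N, ∀ s', P i s' →
        (Expr.sub (.reg (k + 2)) (.reg (k + 1))).ReadsBelow (R ^ 1) s' := by
      intro i hi s' ⟨_, h5, h6, _⟩
      refine ⟨?_, ?_⟩
      · simp only [Expr.ReadsBelow, h6, pow_one]
        exact (len_le_natAbs _).trans (hb n hn)
      · simp only [Expr.ReadsBelow, h5]
        exact hlenN i hi
    have hstep : ∀ i < N, ∀ s', P i s' →
        0 < (Expr.sub (.reg (k + 2)) (.reg (k + 1))).eval s' ∧
        ∃ t s'', Exec O (.seq (b.compile q (k + 3))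
          (.seq (.assign k ((aggOp p).expr (.reg k) (.reg (k + 3))))
            (.assign (k + 1) (.add (.reg (k + 1)) (.const 1))))) s' t s'' ∧
          (Expr.sub (.reg (k + 2)) (.reg (k + 1))).cost s' + 1 + t ≤ R ^ (2 * e + 16) ∧
          P (i + 1) s'' := by
      intro i hi s' hP
      have hg := (Expr.cost_le_pow hR (hguard i hi.le s' hP)).1
      obtain ⟨p1, p2, p3, p4, p5, p6⟩ := hP
      refine ⟨by simp only [Expr.eval, p2, p3]; omega, ?_⟩
      obtain ⟨T, s1, e1, t1, l1, v1, f1, m1⟩ := ih (insert (k + 1) S) (k + 3)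
        (Function.update ρ (k + 1) i) s' hbS
        (by rintro j (rfl | hj); · omega
            · have := hS j hj; omega) (Or.inr h2) (Or.inr h3)
        (by rw [Function.update_of_ne (by have := hS 2 h2; omega)]; exact hz)
        (by
          rintro j (rfl | hj)
          · simp; omega
          · rw [Function.update_of_ne (by have := hS j hj; omega)]; exact hb j hj)
        (by
          rintro j (rfl | hj)
          · simp [p2]
          · rw [Function.update_of_ne (by have := hS j hj; omega), p4 j (hS j hj)]
            exact hs j hj) (p5.trans hm)
      change s1.reg (k + 3) = f i at v1
      change len (f i) ≤ R ^ e at l1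
      have hk : s1.reg k = aggVal p f i := (f1 k (by omega)).trans p1
      have hk1 : s1.reg (k + 1) = i := (f1 (k + 1) (by omega)).trans p2
      have hk2 : s1.reg (k + 2) = ρ n := (f1 (k + 2) (by omega)).trans p3
      have hev : ((aggOp p).expr (.reg k) (.reg (k + 3))).eval s1 = aggVal p f (i + 1) := by
        cases p <;> simp [aggOp, BinOp.expr, BinOp.ap, Expr.eval, aggVal, hk, v1]
      have hsz : ((aggOp p).expr (.reg k) (.reg (k + 3))).sz = 3 := by cases p <;> rfl
      have hr : ((aggOp p).expr (.reg k) (.reg (k + 3))).ReadsBelow (R ^ (e + 2)) s1 := by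
        have h4 : len (s1.reg k) ≤ R ^ (e + 2) := by
          rw [hk]; exact p6.trans (hacc i hi.le)
        have h5 : len (s1.reg (k + 3)) ≤ R ^ (e + 2) := by
          rw [v1]; exact le_pow_of_le hR l1 (by omega)
        cases p <;> exact ⟨h4, h5⟩
      obtain ⟨c1, -⟩ := Expr.cost_le_pow hR hr
      rw [hsz] at c1
      set s2 : State := ⟨Function.update s1.reg k (aggVal p f (i + 1)), s1.mem⟩ with hs2
      have hr2 : (Expr.add (.reg (k + 1)) (.const 1)).ReadsBelow (R ^ 1) s2 := by
        refine ⟨?_, trivial⟩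
        simp only [Expr.ReadsBelow, hs2]
        rw [Function.update_of_ne (by omega), hk1]
        exact hlenN i hi.le
      obtain ⟨c2, -⟩ := Expr.cost_le_pow hR hr2
      have hlen1 : len 1 = 2 := by simp [len, Nat.size_one]
      simp only [Expr.sz, hlen1] at c2 hg
      have e2 := Exec.assign (O := O) k ((aggOp p).expr (.reg k) (.reg (k + 3))) s1
      rw [hev, ← hs2] at e2
      refine ⟨_, _, Exec.seq e1 (Exec.seq e2 (Exec.assign _ _ _)), ?_, ?_⟩
      · have b1 : T ≤ R ^ (2 * e + 14) := le_pow_of_le hR t1 (by omega)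
        have b2 : _ ≤ R ^ (2 * e + 14) := le_pow_of_le hR c1 (by omega)
        have b3 : _ ≤ R ^ (2 * e + 14) := le_pow_of_le hR c2 (by omega)
        have b4 : _ ≤ R ^ (2 * e + 14) := le_pow_of_le hR hg (by omega)
        have := add_le_pow hR (add_le_pow hR b1 b2) (add_le_pow hR b3 b4)
        refine le_trans ?_ this
        omega
      · refine ⟨?_, ?_, ?_, ?_, ?_, ?_⟩
        · simp [hs2]
        · simp [hs2, Expr.eval, hk1]
        · simp [hs2, hk2]
        · intro j hj
          simp only [hs2, Function.update_of_ne (show j ≠ k + 1 by omega),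
            Function.update_of_ne (show j ≠ k by omega)]
          rw [f1 j (by omega), p4 j hj]
        · simp [hs2, m1, p5]
        · have : len (aggVal p f (i + 1)) ≤ len (aggVal p f i) + len (f i) := by
            cases p
            · exact len_add_le _ _
            · exact len_mul_le _ _
          refine this.trans ?_
          have h8 : (i + 1) * R ^ e = i * R ^ e + R ^ e := by ring
          rw [h8]
          omega
    have hend : ∀ s', P N s' →
        ¬ 0 < (Expr.sub (.reg (k + 2)) (.reg (k + 1))).eval s' ∧
        (Expr.sub (.reg (k + 2)) (.reg (k + 1))).cost s' + 1 ≤ R ^ (2 * e + 16) := by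
      intro s' hP
      have hg := (Expr.cost_le_pow hR (hguard N le_rfl s' hP)).1
      obtain ⟨p1, p2, p3, p4, p5, p6⟩ := hP
      refine ⟨by simp only [Expr.eval, p2, p3]; omega, ?_⟩
      exact le_pow_of_le hR hg (by simp only [Expr.sz]; omega)
    obtain ⟨T, s', e1, t1, hP⟩ := exec_loop P hstep hend
      { s with reg := Function.update (Function.update (Function.update s.reg k (aggInit p))
          (k + 1) 0) (k + 2) (s.reg n) } (by
        refine ⟨?_, ?_, ?_, ?_, rfl, ?_⟩
        · simp [aggVal]
        · simp
        · simp [hs n hn]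
        · intro j hj
          simp only [Function.update_of_ne (show j ≠ k + 1 by omega),
            Function.update_of_ne (show j ≠ k by omega),
            Function.update_of_ne (show j ≠ k + 2 by omega)]
        · cases p <;> simp [aggVal, aggInit, len, Nat.size_one])
    obtain ⟨p1, p2, p3, p4, p5, p6⟩ := hP
    have e2 : Exec O ((Tm.agg p n b).compile q k) s
        ((Expr.const (aggInit p)).cost s + 1 + ((Expr.const 0).cost s + 1 +
          ((Expr.reg n).cost s + 1 + T))) s' := by
      refine Exec.seq (Exec.assign _ _ _) (Exec.seq (Exec.assign _ _ _) (Exec.seq ?_ e1))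
      have := Exec.assign (O := O) (k + 2) (.reg n)
        { s with reg := Function.update (Function.update s.reg k (aggInit p)) (k + 1) 0 }
      simpa [Expr.eval, Expr.cost, Function.update_of_ne (show n ≠ k + 1 by omega),
        Function.update_of_ne (show n ≠ k by omega)] using this
    refine ⟨_, _, e2, ?_, ?_, p1, p4, p5⟩
    · have b1 : (Expr.const (aggInit p)).cost s + 1 ≤ R ^ (2 * e + 17) := by
        have : (Expr.const (aggInit p)).cost s + 1 ≤ 3 := by
          cases p <;> simp [Expr.cost, aggInit, len, Nat.size_one]
        exact le_pow_of_le hR (this.trans (self_le_pow hR 3)) (by omega)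
      have b2 : (Expr.const 0).cost s + 1 ≤ R ^ (2 * e + 17) := by
        have : (Expr.const 0).cost s + 1 ≤ 3 := by simp [Expr.cost, len]
        exact le_pow_of_le hR (this.trans (self_le_pow hR 3)) (by omega)
      have b3 : (Expr.reg n).cost s + 1 ≤ R ^ (2 * e + 17) := by
        have hrr : (Expr.reg n).ReadsBelow (R ^ 1) s := by
          simp only [Expr.ReadsBelow, hs n hn, pow_one]
          exact (len_le_natAbs _).trans (hb n hn)
        exact le_pow_of_le hR (Expr.cost_le_pow hR hrr).1 (by simp only [Expr.sz]; omega)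
      have b4 : T ≤ R ^ (2 * e + 17) := by
        refine t1.trans ?_
        rw [show 2 * e + 17 = (2 * e + 16) + 1 by ring, pow_succ, mul_comm]
        exact Nat.mul_le_mul_left _ hNR
      have := add_le_pow hR (add_le_pow hR b1 b2) (add_le_pow hR b3 b4)
      refine le_trans ?_ (le_pow_of_le hR this (by simp only [Tm.expo, ← he]; omega))
      omega
    · exact le_pow_of_le hR (p6.trans (hacc N le_rfl)) (by simp only [Tm.expo, ← he]; omega)


/-! ## Codes: terms that can be placed at any level -/

/-- A term for every level of the compiler. -/
abbrev Code (d : ℕ) : Type := ℕ → Tm d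

section Codes

variable {d : ℕ}

/-- A constant. -/
def constC (c : ℤ) : Code d := fun _ => .const c
/-- A register. -/
def varC (i : ℕ) : Code d := fun _ => .var i
/-- Reading the memory. -/
def memC (a : Code d) : Code d := fun k => .mem (a k)
/-- Binary operations. -/
def opC (o : BinOp) (a b : Code d) : Code d := fun k => .op o (a k) (b (k + 1))
/-- Addition. -/
def addC (a b : Code d) : Code d := opC .add a b
/-- Subtraction. -/
def subC (a b : Code d) : Code d := opC .sub a b
/-- Multiplication. -/
def mulC (a b : Code d) : Code d := opC .mul a b
/-- Division. -/
def divC (a b : Code d) : Code d := opC .div a b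
/-- The remainder of a division. -/
def modC (a b : Code d) : Code d := subC a (mulC b (divC a b))
/-- Conditionals. -/
def iteC (c a b : Code d) : Code d := fun k => .ite (c k) (a k) (b k)
/-- The vertex weights. -/
def gamC (a : Code d) : Code d := fun k => .gam (a k)
/-- The edge weights. -/
def betC (i : Fin d) (a b : Code d) : Code d := fun k => .bet i (a k) (b (k + 1))
/-- Membership in the finite set given by the oracle. -/
def inKC (t : Code d) : Code d := fun k => .inK (t k)
/-- Sums over the numbers below the value of a register. -/
def sumC (n : ℕ) (f : Code d → Code d) : Code d := fun k => .agg false n (f (varC (k + 1)) (k + 3))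
/-- Products over the numbers below the value of a register. -/
def prodC (n : ℕ) (f : Code d → Code d) : Code d := fun k => .agg true n (f (varC (k + 1)) (k + 3))
/-- Products over the coordinates. -/
def finProdC (f : Fin d → Code d) : Code d := ((List.finRange d).map f).foldr mulC (constC 1)
/-- Sums over the coordinates. -/
def finSumC (f : Fin d → Code d) : Code d := ((List.finRange d).map f).foldr addC (constC 0)
/-- Powers with constant exponent. -/
def powC (c : Code d) : ℕ → Code d
  | 0 => constC 1
  | k + 1 => mulC (powC c k) c

end Codes

/-- A partial assignment of values to the registers below some level. -/
structure World where
  /-- the registers with a known value -/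
  S : Set ℕ
  /-- the level -/
  K : ℕ
  /-- the values -/
  ρ : ℕ → ℤ
  lt : ∀ i ∈ S, i < K
  two : 2 ∈ S
  three : 3 ∈ S

/-- Extension of partial assignments. -/
instance : LE World where
  le w w' := w.S ⊆ w'.S ∧ w.K ≤ w'.K ∧ ∀ i ∈ w.S, w'.ρ i = w.ρ i

lemma World.le_trans {w w' w'' : World} (h : w ≤ w') (h' : w' ≤ w'') : w ≤ w'' :=
  ⟨h.1.trans h'.1, h.2.1.trans h'.2.1, fun i hi => (h'.2.2 i (h.1 hi)).trans (h.2.2 i hi)⟩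

/-- The register `i` is known to have the value `v`. -/
def World.Has (w : World) (i : ℕ) (v : ℤ) : Prop := i ∈ w.S ∧ w.ρ i = v

lemma World.Has.mono {w w' : World} (h : w ≤ w') {i : ℕ} {v : ℤ} (hv : w.Has i v) : w'.Has i v :=
  ⟨h.1 hv.1, (h.2.2 i hv.1).trans hv.2⟩

/-- The code is well scoped and has the value `v`. -/
def Is {d : ℕ} (q : ℕ) (O : Oracle) (m : ℤ → ℤ) (w : World) (c : Code d) (v : ℤ) : Prop :=
  ∀ k ≥ w.K, (c k).Scoped w.S k ∧
    ∀ ρ' : ℕ → ℤ, (∀ i ∈ w.S, ρ' i = w.ρ i) → (c k).eval q O m k ρ' = v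

namespace Is

variable {d q : ℕ} {O : Oracle} {m : ℤ → ℤ} {w : World} {a b c : Code d} {x y z : ℤ}

lemma mono {w' : World} (h : w ≤ w') (ha : Is q O m w a x) : Is q O m w' a x := by
  intro k hk
  obtain ⟨h1, h2⟩ := ha k (h.2.1.trans hk)
  refine ⟨h1.mono h.1, fun ρ' hρ => h2 ρ' fun i hi => ?_⟩
  rw [hρ i (h.1 hi), h.2.2 i hi]

lemma congr (ha : Is q O m w a x) (h : x = y) : Is q O m w a y := h ▸ ha

lemma const (n : ℤ) : Is q O m w (constC n : Code d) n := fun _ _ => ⟨trivial, fun _ _ => rfl⟩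

lemma var {i : ℕ} (h : w.Has i x) : Is q O m w (varC i : Code d) x := fun _ _ =>
  ⟨h.1, fun _ hρ => (hρ i h.1).trans h.2⟩

lemma mem (ha : Is q O m w a x) : Is q O m w (memC a) (m x) := fun k hk =>
  ⟨(ha k hk).1, fun ρ' hρ => congrArg m ((ha k hk).2 ρ' hρ)⟩

lemma op (o : BinOp) (ha : Is q O m w a x) (hb : Is q O m w b y) :
    Is q O m w (opC o a b) (o.ap x y) := fun k hk =>
  ⟨⟨(ha k hk).1, (hb (k + 1) (by omega)).1⟩, fun ρ' hρ => by
    simp [opC, Tm.eval, (ha k hk).2 ρ' hρ, (hb (k + 1) (by omega)).2 ρ' hρ]⟩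

lemma add (ha : Is q O m w a x) (hb : Is q O m w b y) : Is q O m w (addC a b) (x + y) :=
  ha.op .add hb

lemma sub (ha : Is q O m w a x) (hb : Is q O m w b y) : Is q O m w (subC a b) (x - y) :=
  ha.op .sub hb

lemma mul (ha : Is q O m w a x) (hb : Is q O m w b y) : Is q O m w (mulC a b) (x * y) :=
  ha.op .mul hb

lemma div (ha : Is q O m w a x) (hb : Is q O m w b y) : Is q O m w (divC a b) (x / y) :=
  ha.op .div hb

lemma mod (ha : Is q O m w a x) (hb : Is q O m w b y) : Is q O m w (modC a b) (x % y) :=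
  (ha.sub (hb.mul (ha.div hb))).congr (Int.emod_def x y).symm

lemma ite (hc : Is q O m w c z) (ha : Is q O m w a x) (hb : Is q O m w b y) :
    Is q O m w (iteC c a b) (if 0 < z then x else y) := fun k hk =>
  ⟨⟨(hc k hk).1, (ha k hk).1, (hb k hk).1⟩, fun ρ' hρ => by
    simp [iteC, Tm.eval, (hc k hk).2 ρ' hρ, (ha k hk).2 ρ' hρ, (hb k hk).2 ρ' hρ]⟩

lemma gam (h2 : w.Has 2 z) (ha : Is q O m w a x) : Is q O m w (gamC a) (O 0 [x % q, z]) :=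
  fun k hk => ⟨(ha k hk).1, fun ρ' hρ => by
    simp [gamC, Tm.eval, (ha k hk).2 ρ' hρ, (hρ 2 h2.1).trans h2.2]⟩

lemma bet (h2 : w.Has 2 z) (i : Fin d) (ha : Is q O m w a x) (hb : Is q O m w b y) :
    Is q O m w (betC i a b) (O 1 [(i : ℕ), x % q, y % q, z]) :=
  fun k hk => ⟨⟨(ha k hk).1, (hb (k + 1) (by omega)).1⟩, fun ρ' hρ => by
    simp [betC, Tm.eval, (ha k hk).2 ρ' hρ, (hb (k + 1) (by omega)).2 ρ' hρ,
      (hρ 2 h2.1).trans h2.2]⟩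

lemma inK {r L : ℤ} (h2 : w.Has 2 r) (h3 : w.Has 3 L) (ha : Is q O m w a x) :
    Is q O m w (inKC a) (O 2 (List.ofFn (siteZ d r L x))) :=
  fun k hk => ⟨(ha k hk).1, fun ρ' hρ => by
    simp [inKC, Tm.eval, (ha k hk).2 ρ' hρ, (hρ 2 h2.1).trans h2.2, (hρ 3 h3.1).trans h3.2]⟩

/-- The bound variable is abstract: the body has to be correct in every extension of the world in
which the code `ci` has the value `i`. It is used in the extension where the counter `k + 1` holds
`i`; quantifying over all extensions is what allows sums to be nested. -/
lemma agg {n : ℕ} {N : ℕ} (p : Bool) (hn : w.Has n N) (f : Code d → Code d) (g : ℕ → ℤ)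
    (hf : ∀ w', w ≤ w' → ∀ (ci : Code d) (i : ℕ), Is q O m w' ci i → Is q O m w' (f ci) (g i)) :
    Is q O m w (fun k => .agg p n (f (varC (k + 1)) (k + 3))) (aggVal p g N) := by
  intro k hk
  have key : ∀ (ρ' : ℕ → ℤ) (i : ℕ), (∀ i ∈ w.S, ρ' i = w.ρ i) →
      (f (varC (k + 1)) (k + 3)).Scoped (insert (k + 1) w.S) (k + 3) ∧
      (f (varC (k + 1)) (k + 3)).eval q O m (k + 3) (Function.update ρ' (k + 1) i) = g i := by
    intro ρ' i hρ
    have hne : ∀ j ∈ w.S, j ≠ k + 1 := fun j hj => by have := w.lt j hj; omega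
    let w' : World := ⟨insert (k + 1) w.S, k + 3, Function.update ρ' (k + 1) i, by
      rintro j (rfl | hj)
      · omega
      · have := w.lt j hj; omega, Or.inr w.two, Or.inr w.three⟩
    have hw : w ≤ w' := ⟨Set.subset_insert _ _, by change w.K ≤ k + 3; omega, fun j hj => by
      change Function.update ρ' (k + 1) (i : ℤ) j = _
      rw [Function.update_of_ne (hne j hj), hρ j hj]⟩
    have := hf w' hw (varC (k + 1)) i (Is.var ⟨Set.mem_insert _ _, by simp [w']⟩) (k + 3) _root_.le_rfl
    exact ⟨this.1, this.2 _ fun _ _ => rfl⟩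
  refine ⟨⟨hn.1, (key w.ρ 0 fun _ _ => rfl).1⟩, fun ρ' hρ => ?_⟩
  simp only [Tm.eval, hρ n hn.1, hn.2, Int.toNat_natCast]
  congr 1
  funext i
  exact (key ρ' i hρ).2

lemma sum {n N : ℕ} (hn : w.Has n N) (f : Code d → Code d) (g : ℕ → ℤ)
    (hf : ∀ w', w ≤ w' → ∀ (ci : Code d) (i : ℕ), Is q O m w' ci i → Is q O m w' (f ci) (g i)) :
    Is q O m w (sumC n f) (∑ i ∈ Finset.range N, g i) :=
  (agg false hn f g hf).congr (aggVal_false g N)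

lemma prod {n N : ℕ} (hn : w.Has n N) (f : Code d → Code d) (g : ℕ → ℤ)
    (hf : ∀ w', w ≤ w' → ∀ (ci : Code d) (i : ℕ), Is q O m w' ci i → Is q O m w' (f ci) (g i)) :
    Is q O m w (prodC n f) (∏ i ∈ Finset.range N, g i) :=
  (agg true hn f g hf).congr (aggVal_true g N)

lemma finProd {f : Fin d → Code d} {g : Fin d → ℤ} (h : ∀ i, Is q O m w (f i) (g i)) :
    Is q O m w (finProdC f) (∏ i, g i) := by
  rw [Fin.prod_univ_def, finProdC]
  induction List.finRange d with
  | nil => exact const 1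
  | cons i l ih => simpa using (h i).mul ih

lemma finSum {f : Fin d → Code d} {g : Fin d → ℤ} (h : ∀ i, Is q O m w (f i) (g i)) :
    Is q O m w (finSumC f) (∑ i, g i) := by
  rw [Fin.sum_univ_def, finSumC]
  induction List.finRange d with
  | nil => exact const 0
  | cons i l ih => simpa using (h i).add ih

lemma pow (h : Is q O m w a x) (k : ℕ) : Is q O m w (powC a k) (x ^ k) := by
  induction k with
  | zero => exact (const (d := d) 1).congr (pow_zero x).symm
  | succ k ih => exact (ih.mul h).congr (pow_succ x k).symm

variable {s t u : ℕ}

lemma addN (ha : Is q O m w a s) (hb : Is q O m w b t) :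
    Is q O m w (addC a b) ((s + t : ℕ) : ℤ) := (ha.add hb).congr (by push_cast; rfl)

lemma mulN (ha : Is q O m w a s) (hb : Is q O m w b t) :
    Is q O m w (mulC a b) ((s * t : ℕ) : ℤ) := (ha.mul hb).congr (by push_cast; rfl)

lemma divN (ha : Is q O m w a s) (hb : Is q O m w b t) :
    Is q O m w (divC a b) ((s / t : ℕ) : ℤ) := (ha.div hb).congr (by push_cast; rfl)

lemma modN (ha : Is q O m w a s) (hb : Is q O m w b t) :
    Is q O m w (modC a b) ((s % t : ℕ) : ℤ) := (ha.mod hb).congr (by push_cast; rfl)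

lemma powN (h : Is q O m w a s) (k : ℕ) : Is q O m w (powC a k) ((s ^ k : ℕ) : ℤ) :=
  (h.pow k).congr (by push_cast; rfl)

lemma ltN {p r : Code d} (ha : Is q O m w a s) (hb : Is q O m w b t) (hp : Is q O m w p x)
    (hr : Is q O m w r y) :
    Is q O m w (iteC (subC b a) p r) (if s < t then x else y) :=
  ((hb.sub ha).ite hp hr).congr (by simp only [sub_pos, Nat.cast_lt])

lemma constN (n : ℕ) : Is q O m w (constC n : Code d) n := const n

end Is


/-! ## The functions computed by the algorithm -/

/-- The side length of the cube of radius `r + 1`. -/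
def sideL (r : ℕ) : ℕ := 2 * r + 3
/-- The number of sites of the cube of radius `r + 1`. -/
def nSites (d r : ℕ) : ℕ := sideL r ^ d
/-- The number of sites of a face of the cube of radius `r + 1`. -/
def winLen (d r : ℕ) : ℕ := sideL r ^ (d - 1)
/-- The number of configurations on a face. -/
def winQ (d q r : ℕ) : ℕ := q ^ winLen d r
/-- The coordinates, shifted to be non-negative, of the site with index `t`. -/
def coord (r t i : ℕ) : ℕ := t / sideL r ^ i % sideL r

/-- The site with index `t` is in the interior of the cube. -/
def Inner (d r t : ℕ) : Prop := ∀ i : Fin d, 0 < coord r t i ∧ coord r t i + 1 < sideL r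

instance (d r : ℕ) : DecidablePred (Inner d r) := fun t =>
  inferInstanceAs (Decidable (∀ i : Fin d, 0 < coord r t i ∧ coord r t i + 1 < sideL r))

/-- The site with index `t` is in the interior of the cube, and in the set given by the oracle. -/
def Key (d r : ℕ) (O : Oracle) (t : ℕ) : Prop :=
  Inner d r t ∧ 0 < O 2 (List.ofFn (siteZ d r (sideL r) t))

instance (d r : ℕ) (O : Oracle) : DecidablePred (Key d r O) := fun t =>
  inferInstanceAs (Decidable (Inner d r t ∧ 0 < O 2 (List.ofFn (siteZ d r (sideL r) t))))

/-- The site with index `t` is in the boundary of the cube. -/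
def Outer (d r t : ℕ) : Prop := ¬ Inner d r t

instance (d r : ℕ) : DecidablePred (Outer d r) := fun t =>
  inferInstanceAs (Decidable (¬ Inner d r t))

/-- The number of configurations on the boundary of the cube. -/
def ringQ (d q r : ℕ) : ℕ := q ^ Nat.count (Outer d r) (nSites d r)

/-- The number of configurations on the part of the given set inside the cube. -/
def keyQ (d q r : ℕ) (O : Oracle) : ℕ := q ^ Nat.count (Key d r O) (nSites d r)

/-- The `k`-th digit of `c` in base `q` (for `k ≤ N`). -/
def digit (q N c k : ℕ) : ℕ := c / q ^ min k N % q

/-- The symbol prescribed at the site with index `t`, or `a` if none is prescribed. -/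
def forced (d q r : ℕ) (O : Oracle) (ξ y x t a : ℕ) : ℕ :=
  if Inner d r t then
    if t = (nSites d r - 1) / 2 then x
    else if Key d r O t then digit q (nSites d r) y (Nat.count (Key d r O) (min t (nSites d r)))
    else a
  else digit q (nSites d r) ξ (Nat.count (Outer d r) (min t (nSites d r)))

/-- The transfer matrix recursion. -/
def row (d q r : ℕ) (O : Oracle) (ξ y x : ℕ) : ℕ → ℕ → ℤ
  | 0, _ => 1
  -- The base-q digits of `c` are the symbols at the sites t + 1, t + 2, …. The site t, with symbol
  -- `a`, is charged with the edges to its forward neighbours t + L^i, which are the digits L^i - 1.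
  -- Then `a` is pushed in front of the window and the last symbol dropped.
  | t + 1, c => ∑ a ∈ Finset.range q, (if forced d q r O ξ y x t a = a then 1 else 0) *
      O 0 [(a : ℤ), (r : ℤ)] *
      (∏ i : Fin d, if coord r t i + 1 < sideL r then
        O 1 [((i : ℕ) : ℤ), (a : ℤ), (digit q (nSites d r) c (sideL r ^ (i : ℕ) - 1) : ℤ), (r : ℤ)]
        else 1) * row d q r O ξ y x t ((a + q * c) % winQ d q r)

/-- The entries of the table that the algorithm writes into the memory. -/
def tab (d q r : ℕ) (O : Oracle) (u : ℕ) : ℤ :=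
  -- The address is a number in mixed radix; from the top its digits are ξ, y, x, the height t and
  -- the window. An entry therefore refers only to smaller addresses.
  row d q r O (u / winQ d q r / (nSites d r + 1) / q / keyQ d q r O)
    (u / winQ d q r / (nSites d r + 1) / q % keyQ d q r O)
    (u / winQ d q r / (nSites d r + 1) % q)
    (u / winQ d q r % (nSites d r + 1)) (u % winQ d q r)

/-- The size of the table. -/
def tabSize (d q r : ℕ) (O : Oracle) : ℕ :=
  ringQ d q r * keyQ d q r O * q * (nSites d r + 1) * winQ d q r

/-- The index of the table entry that holds a partition function. -/
def addrA (d q r : ℕ) (O : Oracle) (ξ y x : ℕ) : ℕ :=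
  (((ξ * keyQ d q r O + y) * q + x) * (nSites d r + 1) + nSites d r) * winQ d q r

/-- The integer partition function of the cube with prescribed values at the boundary, on the given
set, and at the origin. -/
def partA (d q r : ℕ) (O : Oracle) (ξ y x : ℕ) : ℤ := row d q r O ξ y x (nSites d r) 0

/-- The inverse of the precision of the output, up to constants. -/
def gridD (q x : ℕ) : ℕ := 50 * q * 3 ^ x
/-- The number of points of the grid in the unit interval. -/
def gridM (q x : ℕ) : ℕ := gridD q x ^ 2

section Flags

variable (A : ℕ → ℕ → ℕ → ℤ) (q Qy Qx M : ℕ)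

/-- The partition function without a prescribed value at the origin. -/
def sumX (ξ y : ℕ) : ℤ := ∑ x ∈ Finset.range q, A ξ y x
/-- The partition function with a prescribed value at the boundary only. -/
def sumYX (ξ : ℕ) : ℤ := ∑ y ∈ Finset.range Qy, sumX A q ξ y
/-- The conditional probabilities, rounded down to the grid. -/
def condJ (ξ y x : ℕ) : ℤ := (M : ℤ) * A ξ y x / sumX A q ξ y
/-- The approximation of `-p log p` for `p = j/M`. -/
def phi (j : ℤ) : ℤ := (∑ i ∈ Finset.range M, if 0 < ((i + 1 : ℕ) : ℤ) - j then
  j * M / ((i + 1 : ℕ) : ℤ) else 0) / M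
/-- The approximate entropy for a given boundary configuration. -/
def entH (ξ : ℕ) : ℤ := (∑ y ∈ Finset.range Qy, sumX A q ξ y *
  ∑ x ∈ Finset.range q, phi M (condJ A q M ξ y x)) / sumYX A q Qy ξ
/-- The number of violations of the approximate independence of the boundary of the conditional
probabilities. -/
def viol₂ : ℤ := ∑ ξ ∈ Finset.range Qx, ∑ η ∈ Finset.range Qx, ∑ y ∈ Finset.range Qy,
  ∑ x ∈ Finset.range q, if 0 < sumX A q ξ y then if 0 < sumX A q η y then
    if 0 < condJ A q M ξ y x - condJ A q M η y x - 1 then 1 else 0 else 0 else 0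
/-- The number of violations of the approximate independence of the boundary of the entropies. -/
def viol₃ (e : ℕ) : ℤ := ∑ ξ ∈ Finset.range Qx, ∑ η ∈ Finset.range Qx,
  if 0 < sumYX A q Qy ξ then if 0 < sumYX A q Qy η then
    if 0 < entH A q Qy M ξ - entH A q Qy M η - e then 1 else 0 else 0 else 0
/-- The average of the approximate entropies. -/
def meanH : ℤ := (∑ ξ ∈ Finset.range Qx, if 0 < sumYX A q Qy ξ then entH A q Qy M ξ else 0) /
  ∑ ξ ∈ Finset.range Qx, if 0 < sumYX A q Qy ξ then 1 else 0

end Flags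

/-- The threshold for the integers that represent the interactions. -/
def thresh (d r M : ℕ) : ℕ := 16 * (d + 1) * nSites d r * M + 1

/-- The number of violations of the precision of the interactions. -/
def viol₁ (d q r : ℕ) (O : Oracle) (M : ℕ) : ℤ :=
  (∑ a ∈ Finset.range q, if 0 < (thresh d r M : ℤ) - O 0 [(a : ℤ), (r : ℤ)] then 1 else 0) +
  ∑ i : Fin d, ∑ a ∈ Finset.range q, ∑ b ∈ Finset.range q,
    if 0 < (thresh d r M : ℤ) - O 1 [((i : ℕ) : ℤ), (a : ℤ), (b : ℤ), (r : ℤ)] then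
      -- The square tests whether the answer is non-zero. Zeros are exempt from the threshold: they
      -- represent the interaction exactly.
      if 0 < O 1 [((i : ℕ) : ℤ), (a : ℤ), (b : ℤ), (r : ℤ)] *
        O 1 [((i : ℕ) : ℤ), (a : ℤ), (b : ℤ), (r : ℤ)] then 1 else 0 else 0

/-- The number of violations of the stopping condition. -/
def viol (d q r x : ℕ) (O : Oracle) : ℤ :=
  viol₁ d q r O (gridM q x) +
  viol₂ (partA d q r O) q (keyQ d q r O) (ringQ d q r) (gridM q x) +
  viol₃ (partA d q r O) q (keyQ d q r O) (ringQ d q r) (gridM q x) (20 * q * gridD q x)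

/-! ## Codes for these functions -/

/-- The registers that describe the cube. -/
structure Ctx₁ (d q r : ℕ) (w : World) : Prop where
  h2 : w.Has 2 (r : ℕ)
  h3 : w.Has 3 (sideL r : ℕ)
  h4 : w.Has 4 (nSites d r : ℕ)
  h16 : w.Has 16 (q : ℕ)

/-- The registers that are used in the main computation. -/
structure Ctx₂ (d q r x : ℕ) (O : Oracle) (w : World) : Prop extends Ctx₁ d q r w where
  h6 : w.Has 6 (winQ d q r : ℕ)
  h7 : w.Has 7 (gridD q x : ℕ)
  h8 : w.Has 8 (gridM q x : ℕ)
  h10 : w.Has 10 (ringQ d q r : ℕ)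
  h12 : w.Has 12 (keyQ d q r O : ℕ)

lemma Ctx₁.mono {d q r : ℕ} {w w' : World} (h : w ≤ w') (hw : Ctx₁ d q r w) : Ctx₁ d q r w' :=
  ⟨hw.h2.mono h, hw.h3.mono h, hw.h4.mono h, hw.h16.mono h⟩

lemma Ctx₂.mono {d q r x : ℕ} {O : Oracle} {w w' : World} (h : w ≤ w') (hw : Ctx₂ d q r x O w) :
    Ctx₂ d q r x O w' :=
  ⟨hw.toCtx₁.mono h, hw.h6.mono h, hw.h7.mono h, hw.h8.mono h, hw.h10.mono h, hw.h12.mono h⟩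

section

variable {d : ℕ}

/-- Comparison. -/
def ltC (a b p r : Code d) : Code d := iteC (subC b a) p r
/-- Test of equality. -/
def eqC (a b p r : Code d) : Code d := iteC (subC b a) r (iteC (subC a b) r p)
/-- The predecessor of a natural number. -/
def predC (a : Code d) : Code d := iteC a (subC a (constC 1)) (constC 0)
/-- `coord` -/
def coordC (t : Code d) (i : ℕ) : Code d := modC (divC t (powC (varC 3) i)) (varC 3)
/-- `Inner` -/
def innerC (t : Code d) : Code d := finProdC fun i =>
  ltC (constC 0) (coordC t i) (ltC (addC (coordC t i) (constC 1)) (varC 3) (constC 1) (constC 0))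
    (constC 0)
/-- `Key` -/
def keyC (t : Code d) : Code d :=
  iteC (innerC t) (iteC (inKC t) (constC 1) (constC 0)) (constC 0)
/-- `Outer` -/
def outerC (t : Code d) : Code d := iteC (innerC t) (constC 0) (constC 1)
/-- counting -/
def rankC (P : Code d → Code d) (t : Code d) : Code d :=
  sumC 4 fun s => ltC s t (P s) (constC 0)
/-- powers of `q` -/
def qpowC (e : Code d) : Code d := prodC 4 fun s => ltC s e (varC 16) (constC 1)
/-- `digit` -/
def digitC (c e : Code d) : Code d := modC (divC c (qpowC e)) (varC 16)
/-- `forced` -/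
def forcedC (ξ y x t a : Code d) : Code d :=
  iteC (innerC t)
    (eqC t (divC (predC (varC 4)) (constC 2)) x
      (iteC (keyC t) (digitC y (rankC keyC t)) a))
    (digitC ξ (rankC outerC t))
/-- One step of the transfer matrix recursion. -/
def rowStepC (ξ y x t c base : Code d) : Code d :=
  sumC 16 fun a =>
    mulC (mulC (mulC (eqC (forcedC ξ y x t a) a (constC 1) (constC 0)) (gamC a))
      (finProdC fun i => ltC (addC (coordC t i) (constC 1)) (varC 3)
        (betC i a (digitC c (predC (powC (varC 3) i)))) (constC 1)))
      (memC (addC base (modC (addC a (mulC (varC 16) c)) (varC 6))))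
/-- `tab` -/
def tabC : Code d :=
  let c : Code d := modC (varC 15) (varC 6)
  let t : Code d := modC (divC (varC 15) (varC 6)) (addC (varC 4) (constC 1))
  let e : Code d := divC (divC (varC 15) (varC 6)) (addC (varC 4) (constC 1))
  iteC t (rowStepC (divC (divC e (varC 16)) (varC 12)) (modC (divC e (varC 16)) (varC 12))
    (modC e (varC 16)) (predC t) c (subC (subC (varC 15) (varC 6)) c)) (constC 1)

end

namespace Is

variable {d q r : ℕ} {O : Oracle} {m : ℤ → ℤ} {w : World} {a b c p p' : Code d} {x y z : ℤ}
  {s t : ℕ}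

lemma lt (ha : Is q O m w a s) (hb : Is q O m w b t) (hp : Is q O m w p x)
    (hr : Is q O m w p' y) : Is q O m w (ltC a b p p') (if s < t then x else y) :=
  ha.ltN hb hp hr

lemma eq (ha : Is q O m w a s) (hb : Is q O m w b t) (hp : Is q O m w p x)
    (hr : Is q O m w p' y) : Is q O m w (eqC a b p p') (if s = t then x else y) :=
  ((hb.sub ha).ite hr ((ha.sub hb).ite hr hp)).congr (by
    rcases lt_trichotomy s t with h | h | h
    · rw [if_pos (by omega), if_neg (by omega)]
    · subst h; simp
    · rw [if_neg (by omega), if_pos (by omega), if_neg (by omega)])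

lemma pred (ha : Is q O m w a s) : Is q O m w (predC a) ((s - 1 : ℕ) : ℤ) :=
  (ha.ite (ha.sub (const 1)) (const 0)).congr (by
    rcases s with _ | s <;> simp)

lemma coord (h : Ctx₁ d q r w) (ha : Is q O m w a t) (i : ℕ) :
    Is q O m w (coordC a i) (coord r t i : ℕ) :=
  (ha.divN ((var h.h3).powN i)).modN (var h.h3)

lemma inner (h : Ctx₁ d q r w) (ha : Is q O m w a t) :
    Is q O m w (innerC a) (if Inner d r t then 1 else 0) := by
  refine (finProd (g := fun i => if 0 < GibbsEntropy.coord r t i ∧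
    GibbsEntropy.coord r t i + 1 < sideL r then 1 else 0) fun i => ?_).congr ?_
  · refine ((constN 0).lt (ha.coord h i) (((ha.coord h i).addN (constN 1)).lt (var h.h3)
      (const 1) (const 0)) (const 0)).congr ?_
    rw [← ite_and]
  · rw [Finset.prod_ite_zero]
    simp only [Inner, Finset.mem_univ, true_implies, Finset.prod_const_one]
    congr

lemma key (h : Ctx₁ d q r w) (ha : Is q O m w a t) :
    Is q O m w (keyC a) (if Key d r O t then 1 else 0) := by
  refine ((ha.inner h).ite ((inK h.h2 h.h3 ha).ite (const 1) (const 0)) (const 0)).congr ?_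
  unfold Key
  split_ifs <;> simp_all

lemma outer (h : Ctx₁ d q r w) (ha : Is q O m w a t) :
    Is q O m w (outerC a) (if Outer d r t then 1 else 0) := by
  refine ((ha.inner h).ite (const 0) (const 1)).congr ?_
  unfold Outer
  split_ifs <;> simp_all

lemma rank {P : ℕ → Prop} [DecidablePred P] {f : Code d → Code d} (h : Ctx₁ d q r w)
    (hP : ∀ w', w ≤ w' → ∀ (ci : Code d) (i : ℕ), Is q O m w' ci i →
      Is q O m w' (f ci) (if P i then 1 else 0)) (ha : Is q O m w a t) :
    Is q O m w (rankC f a) (Nat.count P (min t (nSites d r)) : ℕ) := by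
  refine (sum h.h4 _ (fun s => if s < t then (if P s then 1 else 0) else 0) ?_).congr ?_
  · intro w' hw ci i hi
    exact hi.lt (ha.mono hw) (hP w' hw ci i hi) (const 0)
  · induction nSites d r with
    | zero => simp
    | succ N ih =>
      rw [Finset.sum_range_succ, ih]
      by_cases hN : N < t
      · rw [min_eq_right hN.le, min_eq_right hN, Nat.count_succ]
        split_ifs <;> simp
      · rw [min_eq_left (by omega), min_eq_left (by omega)]
        simp [hN]

/-- The power is computed as a product over the range in register 4, which truncates the exponent at
the number of sites; hence the `min` in `digit`. -/
lemma qpow (h : Ctx₁ d q r w) (ha : Is q O m w a t) :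
    Is q O m w (qpowC a) ((q ^ min t (nSites d r) : ℕ) : ℤ) := by
  refine (prod h.h4 _ (fun s => if s < t then (q : ℤ) else 1) ?_).congr ?_
  · intro w' hw ci i hi
    exact hi.lt (ha.mono hw) (var (h.h16.mono hw)) (const 1)
  · induction nSites d r with
    | zero => simp
    | succ N ih =>
      rw [Finset.prod_range_succ, ih]
      by_cases hN : N < t
      · rw [min_eq_right hN.le, min_eq_right hN]
        simp [hN, pow_succ]
      · rw [min_eq_left (by omega), min_eq_left (by omega)]
        simp [hN]

lemma digit (h : Ctx₁ d q r w) (ha : Is q O m w a s) (hb : Is q O m w b t) :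
    Is q O m w (digitC a b) (digit q (nSites d r) s t : ℕ) :=
  (ha.divN (hb.qpow h)).modN (var h.h16)

variable {ξ' y' x' a' : ℕ} {ξc yc xc tc : Code d}

lemma forced (h : Ctx₁ d q r w) (hξ : Is q O m w ξc ξ') (hy : Is q O m w yc y')
    (hx : Is q O m w xc x') (ht : Is q O m w tc t) (ha : Is q O m w a a') :
    Is q O m w (forcedC ξc yc xc tc a) (forced d q r O ξ' y' x' t a' : ℕ) := by
  refine ((ht.inner h).ite (ht.eq ((var h.h4).pred.divN (constN 2)) hx ((ht.key h).ite
    (hy.digit h (ht.rank (P := Key d r O) h fun w' hw ci i hi => hi.key (h.mono hw))) ha))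
    (hξ.digit h (ht.rank (P := Outer d r) h fun w' hw ci i hi => hi.outer (h.mono hw)))).congr ?_
  unfold GibbsEntropy.forced
  have e : ∀ (p : Prop) [Decidable p], (0 < (if p then (1 : ℤ) else 0)) ↔ p := by
    intro p _
    split_ifs <;> simp_all
  simp only [e]
  split_ifs <;> rfl

end Is


/-! ### The layout of the table in the memory -/

section Table

lemma table_index {Q n cc t w : ℕ} (hw : w < Q) (ht : t < n + 1) :
    ((cc * (n + 1) + t) * Q + w) % Q = w ∧
    ((cc * (n + 1) + t) * Q + w) / Q % (n + 1) = t ∧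
    ((cc * (n + 1) + t) * Q + w) / Q / (n + 1) = cc := by
  have h1 : ((cc * (n + 1) + t) * Q + w) / Q = cc * (n + 1) + t := by
    rw [add_comm, Nat.add_mul_div_right _ _ (by omega), Nat.div_eq_of_lt hw, zero_add]
  refine ⟨?_, ?_, ?_⟩
  · rw [add_comm, Nat.add_mul_mod_self_right, Nat.mod_eq_of_lt hw]
  · rw [h1, add_comm, Nat.add_mul_mod_self_right, Nat.mod_eq_of_lt ht]
  · rw [h1, add_comm, Nat.add_mul_div_right _ _ (by omega), Nat.div_eq_of_lt ht, zero_add]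

variable {d q r : ℕ} {O : Oracle}

lemma tab_index {cc t w : ℕ} (hw : w < winQ d q r) (ht : t < nSites d r + 1) :
    tab d q r O ((cc * (nSites d r + 1) + t) * winQ d q r + w) =
      row d q r O (cc / q / keyQ d q r O) (cc / q % keyQ d q r O) (cc % q) t w := by
  obtain ⟨h1, h2, h3⟩ := table_index (cc := cc) hw ht
  rw [tab, h1, h2, h3]

lemma tab_addrA (hq : 0 < q) {ξ y x : ℕ} (hx : x < q) (hy : y < keyQ d q r O) :
    tab d q r O (addrA d q r O ξ y x) = partA d q r O ξ y x := by
  have h := tab_index (d := d) (r := r) (O := O) (q := q) (cc := (ξ * keyQ d q r O + y) * q + x)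
    (t := nSites d r) (w := 0) (Nat.pow_pos hq) (Nat.lt_succ_self _)
  rw [add_zero] at h
  have e1 : ((ξ * keyQ d q r O + y) * q + x) / q = ξ * keyQ d q r O + y := by
    rw [add_comm, Nat.add_mul_div_right _ _ hq, Nat.div_eq_of_lt hx, zero_add]
  have e2 : ((ξ * keyQ d q r O + y) * q + x) % q = x := by
    rw [add_comm, Nat.add_mul_mod_self_right, Nat.mod_eq_of_lt hx]
  have e3 : (ξ * keyQ d q r O + y) / keyQ d q r O = ξ := by
    rw [add_comm, Nat.add_mul_div_right _ _ (by omega), Nat.div_eq_of_lt hy, zero_add]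
  have e4 : (ξ * keyQ d q r O + y) % keyQ d q r O = y := by
    rw [add_comm, Nat.add_mul_mod_self_right, Nat.mod_eq_of_lt hy]
  rw [addrA, h, e1, e2, e3, e4, partA]

lemma addrA_lt (hq : 0 < q) {ξ y x : ℕ} (hξ : ξ < ringQ d q r) (hy : y < keyQ d q r O)
    (hx : x < q) : addrA d q r O ξ y x < tabSize d q r O := by
  have hQ : 0 < winQ d q r := Nat.pow_pos hq
  have h1 : ξ * keyQ d q r O + y + 1 ≤ ringQ d q r * keyQ d q r O := by nlinarith
  have h2 : (ξ * keyQ d q r O + y) * q + x + 1 ≤ ringQ d q r * keyQ d q r O * q := by nlinarith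
  have h3 : ((ξ * keyQ d q r O + y) * q + x) * (nSites d r + 1) + nSites d r + 1 ≤
    ringQ d q r * keyQ d q r O * q * (nSites d r + 1) := by nlinarith
  exact Nat.mul_lt_mul_of_pos_right h3 hQ

end Table

namespace Is

variable {d q r x : ℕ} {O : Oracle} {m : ℤ → ℤ} {w : World}

lemma rowStep (h : Ctx₂ d q r x O w) {ξc yc xc tc cc bc : Code d} {ξ y x' t c : ℕ} {b : ℤ}
    (hξ : Is q O m w ξc ξ) (hy : Is q O m w yc y) (hx : Is q O m w xc x') (ht : Is q O m w tc t)
    (hc : Is q O m w cc c) (hb : Is q O m w bc b)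
    (hm : ∀ v < winQ d q r, m (b + (v : ℕ)) = row d q r O ξ y x' t v) (hq : 0 < q) :
    Is q O m w (rowStepC ξc yc xc tc cc bc) (row d q r O ξ y x' (t + 1) c) := by
  have hQ : 0 < winQ d q r := Nat.pow_pos hq
  refine (sum h.h16 _ (fun a => (if GibbsEntropy.forced d q r O ξ y x' t a = a then 1 else 0) *
      O 0 [(a : ℤ) % q, (r : ℤ)] *
      (∏ i : Fin d, if GibbsEntropy.coord r t i + 1 < sideL r then
        O 1 [((i : ℕ) : ℤ), (a : ℤ) % q,
          (GibbsEntropy.digit q (nSites d r) c (sideL r ^ (i : ℕ) - 1) : ℤ) % q, (r : ℤ)]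
        else 1) * m (b + ((a + q * c) % winQ d q r : ℕ))) ?_).congr ?_
  · intro w' hw ci i hi
    have h' := h.mono hw
    refine ((((((hξ.mono hw).forced h'.toCtx₁ (hy.mono hw) (hx.mono hw) (ht.mono hw) hi).eq hi
      (const 1) (const 0)).mul (hi.gam h'.h2)).mul (finProd fun j => ?_)).mul
      (((hb.mono hw).add ((hi.addN ((var h'.h16).mulN (hc.mono hw))).modN (var h'.h6))).mem))
    exact (((ht.mono hw).coord h'.toCtx₁ j).addN (constN 1)).lt (var h'.h3)
      (hi.bet h'.h2 j ((hc.mono hw).digit h'.toCtx₁ ((var h'.h3).powN j).pred)) (const 1)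
  · rw [row]
    refine Finset.sum_congr rfl fun a ha => ?_
    have e1 : (a : ℤ) % q = a := by
      rw [Finset.mem_range] at ha
      exact_mod_cast Nat.mod_eq_of_lt ha
    have e2 : ∀ k : ℕ, (GibbsEntropy.digit q (nSites d r) c k : ℤ) % q =
        GibbsEntropy.digit q (nSites d r) c k := fun k => by
      unfold GibbsEntropy.digit
      exact_mod_cast Nat.mod_mod _ _
    rw [hm _ (Nat.mod_lt _ hQ)]
    simp only [e1, e2]

lemma tab (h : Ctx₂ d q r x O w) {u : ℕ} (hu : w.Has 15 u) (hq : 0 < q)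
    (hm : ∀ v < u, m (v : ℕ) = tab d q r O v) : Is q O m w (tabC : Code d) (tab d q r O u) := by
  have hQ : 0 < winQ d q r := Nat.pow_pos hq
  set c := u % winQ d q r with hc
  set t := u / winQ d q r % (nSites d r + 1) with ht
  set e := u / winQ d q r / (nSites d r + 1) with he
  have hu' : u = (e * (nSites d r + 1) + t) * winQ d q r + c := by
    have h1 := Nat.div_add_mod u (winQ d q r)
    have h2 := Nat.div_add_mod (u / winQ d q r) (nSites d r + 1)
    rw [← he, ← ht] at h2
    rw [← hc, ← h2] at h1
    rw [← h1]; ring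
  have htlt : t < nSites d r + 1 := Nat.mod_lt _ (Nat.succ_pos _)
  have hclt : c < winQ d q r := Nat.mod_lt _ hQ
  have vu : Is q O m w (varC 15 : Code d) u := var hu
  have hcI : Is q O m w (modC (varC 15) (varC 6) : Code d) c := vu.modN (var h.h6)
  have htI : Is q O m w (modC (divC (varC 15) (varC 6)) (addC (varC 4) (constC 1)) : Code d) t :=
    (vu.divN (var h.h6)).modN ((var h.h4).addN (constN 1))
  have heI : Is q O m w (divC (divC (varC 15) (varC 6)) (addC (varC 4) (constC 1)) : Code d) e :=
    (vu.divN (var h.h6)).divN ((var h.h4).addN (constN 1))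
  have hbI := (vu.sub (var h.h6)).sub hcI
  -- The row for the same ξ, y, x at the preceding height occupies the `winQ` addresses just before
  -- the current row, which starts at u - c.
  have key : ∀ T, t = T + 1 → ∀ v < winQ d q r, m ((u : ℤ) - winQ d q r - c + (v : ℕ)) =
      row d q r O (e / q / keyQ d q r O) (e / q % keyQ d q r O) (e % q) (t - 1) v := by
    intro T hT v hv
    have e1 : (u : ℤ) - winQ d q r - c + (v : ℕ) =
        (((e * (nSites d r + 1) + T) * winQ d q r + v : ℕ) : ℤ) := by
      have : (u : ℤ) = (e * (nSites d r + 1) + t) * winQ d q r + c := by exact_mod_cast hu'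
      rw [this, hT]; push_cast; ring
    rw [e1, hm, tab_index hv (by omega), hT]
    · rfl
    · rw [hu', hT]
      nlinarith
  rcases Nat.eq_zero_or_pos t with h0 | hpos
  · -- the value does not matter here, only the scoping
    let m' : ℤ → ℤ := fun z => row d q r O (e / q / keyQ d q r O) (e / q % keyQ d q r O) (e % q)
      (t - 1) (z - ((u : ℤ) - winQ d q r - c)).toNat
    have hs : Is q O m' w (rowStepC (divC (divC (divC (divC (varC 15) (varC 6))
        (addC (varC 4) (constC 1))) (varC 16)) (varC 12))
        (modC (divC (divC (divC (varC 15) (varC 6)) (addC (varC 4) (constC 1))) (varC 16))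
          (varC 12)) (modC (divC (divC (varC 15) (varC 6)) (addC (varC 4) (constC 1))) (varC 16))
        (predC (modC (divC (varC 15) (varC 6)) (addC (varC 4) (constC 1))))
        (modC (varC 15) (varC 6)) (subC (subC (varC 15) (varC 6)) (modC (varC 15) (varC 6))) :
          Code d)
        (row d q r O (e / q / keyQ d q r O) (e / q % keyQ d q r O) (e % q) (t - 1 + 1) c) := by
      have vu : Is q O m' w (varC 15 : Code d) u := var hu
      have hcI : Is q O m' w (modC (varC 15) (varC 6) : Code d) c := vu.modN (var h.h6)
      have htI : Is q O m' w
          (modC (divC (varC 15) (varC 6)) (addC (varC 4) (constC 1)) : Code d) t :=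
        (vu.divN (var h.h6)).modN ((var h.h4).addN (constN 1))
      have heI : Is q O m' w
          (divC (divC (varC 15) (varC 6)) (addC (varC 4) (constC 1)) : Code d) e :=
        (vu.divN (var h.h6)).divN ((var h.h4).addN (constN 1))
      exact rowStep h ((heI.divN (var h.h16)).divN (var h.h12))
        ((heI.divN (var h.h16)).modN (var h.h12)) (heI.modN (var h.h16)) htI.pred hcI
        ((vu.sub (var h.h6)).sub hcI) (fun v _ => by simp [m']) hq
    intro k hk
    refine ⟨⟨(htI k hk).1, (hs k hk).1, trivial⟩, fun ρ' hρ => ?_⟩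
    have e1 := (htI k hk).2 ρ' hρ
    have e2 : GibbsEntropy.tab d q r O u = 1 := by
      rw [hu', tab_index hclt htlt, h0, row]
    rw [e2]
    simp only [tabC, iteC, Tm.eval, e1, h0]
    simp [constC, Tm.eval]
  · obtain ⟨T, hT⟩ := Nat.exists_eq_add_of_le' hpos
    refine (htI.ite (rowStep h ((heI.divN (var h.h16)).divN (var h.h12))
        ((heI.divN (var h.h16)).modN (var h.h12)) (heI.modN (var h.h16)) htI.pred hcI
        hbI (key T hT) hq) (const 1)).congr ?_
    rw [if_pos (by exact_mod_cast hpos)]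
    conv_rhs => rw [hu', tab_index hclt htlt]
    rw [hT]
    rfl

end Is

/-! ### Codes for the tests and the output -/

section FlagCodes

variable {d : ℕ}

/-- Reading a partition function from the memory. -/
def readC (ξ y x : Code d) : Code d :=
  memC (mulC (addC (mulC (addC (mulC (addC (mulC ξ (varC 12)) y) (varC 16)) x)
    (addC (varC 4) (constC 1))) (varC 4)) (varC 6))
/-- `sumX` -/
def sumXC (ξ y : Code d) : Code d := sumC 16 fun x => readC ξ y x
/-- `sumYX` -/
def sumYXC (ξ : Code d) : Code d := sumC 12 fun y => sumXC ξ y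
/-- `condJ` -/
def condJC (ξ y x : Code d) : Code d := divC (mulC (varC 8) (readC ξ y x)) (sumXC ξ y)
/-- `phi` -/
def phiC (j : Code d) : Code d := divC (sumC 8 fun i => iteC (subC (addC i (constC 1)) j)
  (divC (mulC j (varC 8)) (addC i (constC 1))) (constC 0)) (varC 8)
/-- `entH` -/
def entHC (ξ : Code d) : Code d :=
  divC (sumC 12 fun y => mulC (sumXC ξ y) (sumC 16 fun x => phiC (condJC ξ y x))) (sumYXC ξ)
/-- `viol₂` -/
def viol₂C : Code d := sumC 10 fun ξ => sumC 10 fun η => sumC 12 fun y => sumC 16 fun x =>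
  iteC (sumXC ξ y) (iteC (sumXC η y) (iteC (subC (subC (condJC ξ y x) (condJC η y x)) (constC 1))
    (constC 1) (constC 0)) (constC 0)) (constC 0)
/-- `viol₃` -/
def viol₃C : Code d := sumC 10 fun ξ => sumC 10 fun η =>
  iteC (sumYXC ξ) (iteC (sumYXC η) (iteC (subC (subC (entHC ξ) (entHC η))
    (mulC (mulC (constC 20) (varC 16)) (varC 7))) (constC 1) (constC 0)) (constC 0)) (constC 0)
/-- `meanH` -/
def meanHC : Code d := divC (sumC 10 fun ξ => iteC (sumYXC ξ) (entHC ξ) (constC 0))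
  (sumC 10 fun ξ => iteC (sumYXC ξ) (constC 1) (constC 0))
/-- `thresh` -/
def threshC : Code d := addC (mulC (mulC (constC (16 * (d + 1) : ℕ)) (varC 4)) (varC 8)) (constC 1)
/-- `viol₁` -/
def viol₁C : Code d := addC
  (sumC 16 fun a => iteC (subC threshC (gamC a)) (constC 1) (constC 0))
  (finSumC fun i => sumC 16 fun a => sumC 16 fun b => iteC (subC threshC (betC i a b))
    (iteC (mulC (betC i a b) (betC i a b)) (constC 1) (constC 0)) (constC 0))
/-- The continuation of the search. -/
def violC : Code d := iteC (addC (addC viol₁C viol₂C) viol₃C) (constC 1) (constC 0)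

end FlagCodes

namespace Is

variable {d q r x : ℕ} {O : Oracle} {m : ℤ → ℤ} {w : World}

/-- The partition functions, as read from the memory. -/
def memA (d q r : ℕ) (O : Oracle) (m : ℤ → ℤ) (ξ y x : ℕ) : ℤ := m (addrA d q r O ξ y x : ℕ)

variable {ξ y a : ℕ} {ξc yc ac : Code d}

lemma read (h : Ctx₂ d q r x O w) (hξ : Is q O m w ξc ξ) (hy : Is q O m w yc y)
    (ha : Is q O m w ac a) : Is q O m w (readC ξc yc ac) (memA d q r O m ξ y a) :=
  (((((((hξ.mulN (var h.h12)).addN hy).mulN (var h.h16)).addN ha).mulN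
    ((var h.h4).addN (constN 1))).addN (var h.h4)).mulN (var h.h6)).mem

lemma sumX (h : Ctx₂ d q r x O w) (hξ : Is q O m w ξc ξ) (hy : Is q O m w yc y) :
    Is q O m w (sumXC ξc yc) (sumX (memA d q r O m) q ξ y) :=
  sum h.h16 _ _ fun _ hw _ _ hi => read (h.mono hw) (hξ.mono hw) (hy.mono hw) hi

lemma sumYX (h : Ctx₂ d q r x O w) (hξ : Is q O m w ξc ξ) :
    Is q O m w (sumYXC ξc) (sumYX (memA d q r O m) q (keyQ d q r O) ξ) :=
  sum h.h12 _ _ fun _ hw _ _ hi => sumX (h.mono hw) (hξ.mono hw) hi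

lemma condJ (h : Ctx₂ d q r x O w) (hξ : Is q O m w ξc ξ) (hy : Is q O m w yc y)
    (ha : Is q O m w ac a) :
    Is q O m w (condJC ξc yc ac) (condJ (memA d q r O m) q (gridM q x) ξ y a) :=
  ((var h.h8).mul (read h hξ hy ha)).div (sumX h hξ hy)

lemma phi (h : Ctx₂ d q r x O w) {j : ℤ} (hj : Is q O m w ξc j) :
    Is q O m w (phiC ξc) (phi (gridM q x) j) :=
  (sum h.h8 _ _ fun _ hw _ _ hi => ((hi.addN (constN 1)).sub (hj.mono hw)).ite
    (((hj.mono hw).mul (var (h.h8.mono hw))).div (hi.addN (constN 1))) (const 0)).div (var h.h8)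

lemma entH (h : Ctx₂ d q r x O w) (hξ : Is q O m w ξc ξ) :
    Is q O m w (entHC ξc) (entH (memA d q r O m) q (keyQ d q r O) (gridM q x) ξ) :=
  (sum h.h12 _ _ fun _ hw _ _ hi => (sumX (h.mono hw) (hξ.mono hw) hi).mul
    (sum (h.mono hw).h16 _ _ fun _ hw' _ _ hj => phi ((h.mono hw).mono hw')
      (condJ ((h.mono hw).mono hw') ((hξ.mono hw).mono hw') (hi.mono hw') hj))).div (sumYX h hξ)

lemma viol₂ (h : Ctx₂ d q r x O w) : Is q O m w (viol₂C : Code d)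
    (viol₂ (memA d q r O m) q (keyQ d q r O) (ringQ d q r) (gridM q x)) := by
  refine sum h.h10 _ _ fun w₁ hw₁ _ _ h₁ => ?_
  refine sum (h.mono hw₁).h10 _ _ fun w₂ hw₂ _ _ h₂ => ?_
  have hw₁₂ := hw₂
  have hw₂ := World.le_trans hw₁ hw₂
  refine sum (h.mono hw₂).h12 _ _ fun w₃ hw₃ _ _ h₃ => ?_
  have hw₂₃ := hw₃
  have hw₃ := World.le_trans hw₂ hw₃
  refine sum (h.mono hw₃).h16 _ _ fun w₄ hw₄ _ _ h₄ => ?_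
  have h₁ := ((h₁.mono hw₁₂).mono hw₂₃).mono hw₄
  have h₂ := (h₂.mono hw₂₃).mono hw₄
  have h₃ := h₃.mono hw₄
  have h := h.mono (World.le_trans hw₃ hw₄)
  exact (sumX h h₁ h₃).ite ((sumX h h₂ h₃).ite ((((condJ h h₁ h₃ h₄).sub (condJ h h₂ h₃ h₄)).sub
    (const 1)).ite (const 1) (const 0)) (const 0)) (const 0)

lemma viol₃ (h : Ctx₂ d q r x O w) : Is q O m w (viol₃C : Code d)
    (viol₃ (memA d q r O m) q (keyQ d q r O) (ringQ d q r) (gridM q x) (20 * q * gridD q x)) := by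
  refine sum h.h10 _ _ fun w₁ hw₁ _ _ h₁ => ?_
  refine sum (h.mono hw₁).h10 _ _ fun w₂ hw₂ _ _ h₂ => ?_
  have h₁ := h₁.mono hw₂
  have h := h.mono (World.le_trans hw₁ hw₂)
  exact (sumYX h h₁).ite ((sumYX h h₂).ite ((((entH h h₁).sub (entH h h₂)).sub
    (((constN 20).mulN (var h.h16)).mulN (var h.h7))).ite (const 1) (const 0)) (const 0)) (const 0)

lemma meanH (h : Ctx₂ d q r x O w) : Is q O m w (meanHC : Code d)
    (meanH (memA d q r O m) q (keyQ d q r O) (ringQ d q r) (gridM q x)) :=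
  (sum h.h10 _ _ fun _ hw _ _ hi => (sumYX (h.mono hw) hi).ite (entH (h.mono hw) hi)
    (const 0)).div (sum h.h10 _ _ fun _ hw _ _ hi => (sumYX (h.mono hw) hi).ite (const 1) (const 0))

lemma viol₁ (h : Ctx₂ d q r x O w) : Is q O m w (viol₁C : Code d) (viol₁ d q r O (gridM q x)) := by
  have hth : ∀ w', w ≤ w' → Is q O m w' (threshC : Code d) (thresh d r (gridM q x) : ℕ) :=
    fun w' hw => (((constN _).mulN (var (h.h4.mono hw))).mulN (var (h.h8.mono hw))).addN (constN 1)
  have hmod : ∀ a ∈ Finset.range q, (a : ℤ) % q = a := fun a ha => by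
    rw [Finset.mem_range] at ha
    exact_mod_cast Nat.mod_eq_of_lt ha
  refine (add (sum h.h16 _ _ fun w' hw _ _ hi => ((hth w' hw).sub (hi.gam (h.mono hw).h2)).ite
    (const 1) (const 0)) (finSum fun i => sum h.h16 _ _ fun w' hw _ _ hi =>
      sum (h.mono hw).h16 _ _ fun w'' hw' _ _ hj =>
        ((hth w'' (World.le_trans hw hw')).sub
          ((hi.mono hw').bet ((h.mono hw).mono hw').h2 i hj)).ite
        ((((hi.mono hw').bet ((h.mono hw).mono hw').h2 i hj).mul
          ((hi.mono hw').bet ((h.mono hw).mono hw').h2 i hj)).ite (const 1) (const 0))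
          (const 0))).congr ?_
  unfold GibbsEntropy.viol₁
  congr 1
  · exact Finset.sum_congr rfl fun a ha => by rw [hmod a ha]
  · exact Finset.sum_congr rfl fun i _ => Finset.sum_congr rfl fun a ha =>
      Finset.sum_congr rfl fun b hb => by rw [hmod a ha, hmod b hb]

end Is

/-! ### The tests depend only on table entries with codes in range -/

section Congr

variable {A B : ℕ → ℕ → ℕ → ℤ} {q Qy Qx M : ℕ}

lemma sumX_congr (h : ∀ ξ < Qx, ∀ y < Qy, ∀ x < q, A ξ y x = B ξ y x) {ξ y : ℕ} (hξ : ξ < Qx)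
    (hy : y < Qy) : sumX A q ξ y = sumX B q ξ y :=
  Finset.sum_congr rfl fun x hx => h ξ hξ y hy x (Finset.mem_range.1 hx)

lemma sumYX_congr (h : ∀ ξ < Qx, ∀ y < Qy, ∀ x < q, A ξ y x = B ξ y x) {ξ : ℕ} (hξ : ξ < Qx) :
    sumYX A q Qy ξ = sumYX B q Qy ξ :=
  Finset.sum_congr rfl fun _ hy => sumX_congr h hξ (Finset.mem_range.1 hy)

lemma condJ_congr (h : ∀ ξ < Qx, ∀ y < Qy, ∀ x < q, A ξ y x = B ξ y x) {ξ y x : ℕ} (hξ : ξ < Qx)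
    (hy : y < Qy) (hx : x < q) : condJ A q M ξ y x = condJ B q M ξ y x := by
  rw [condJ, condJ, h ξ hξ y hy x hx, sumX_congr h hξ hy]

lemma entH_congr (h : ∀ ξ < Qx, ∀ y < Qy, ∀ x < q, A ξ y x = B ξ y x) {ξ : ℕ} (hξ : ξ < Qx) :
    entH A q Qy M ξ = entH B q Qy M ξ := by
  rw [entH, entH, sumYX_congr h hξ]
  congr 1
  refine Finset.sum_congr rfl fun y hy => ?_
  rw [sumX_congr h hξ (Finset.mem_range.1 hy)]
  congr 1
  exact Finset.sum_congr rfl fun x hx => by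
    rw [condJ_congr h hξ (Finset.mem_range.1 hy) (Finset.mem_range.1 hx)]

lemma viol₂_congr (h : ∀ ξ < Qx, ∀ y < Qy, ∀ x < q, A ξ y x = B ξ y x) :
    viol₂ A q Qy Qx M = viol₂ B q Qy Qx M := by
  refine Finset.sum_congr rfl fun ξ hξ => Finset.sum_congr rfl fun η hη =>
    Finset.sum_congr rfl fun y hy => Finset.sum_congr rfl fun x hx => ?_
  rw [Finset.mem_range] at hξ hη hy hx
  rw [sumX_congr h hξ hy, sumX_congr h hη hy, condJ_congr h hξ hy hx, condJ_congr h hη hy hx]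

lemma viol₃_congr (h : ∀ ξ < Qx, ∀ y < Qy, ∀ x < q, A ξ y x = B ξ y x) (e : ℕ) :
    viol₃ A q Qy Qx M e = viol₃ B q Qy Qx M e := by
  refine Finset.sum_congr rfl fun ξ hξ => Finset.sum_congr rfl fun η hη => ?_
  rw [Finset.mem_range] at hξ hη
  rw [sumYX_congr h hξ, sumYX_congr h hη, entH_congr h hξ, entH_congr h hη]

lemma meanH_congr (h : ∀ ξ < Qx, ∀ y < Qy, ∀ x < q, A ξ y x = B ξ y x) :
    meanH A q Qy Qx M = meanH B q Qy Qx M := by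
  unfold meanH
  congr 1
  · exact Finset.sum_congr rfl fun ξ hξ => by
      rw [sumYX_congr h (Finset.mem_range.1 hξ), entH_congr h (Finset.mem_range.1 hξ)]
  · exact Finset.sum_congr rfl fun ξ hξ => by rw [sumYX_congr h (Finset.mem_range.1 hξ)]

end Congr


/-! ## The program -/

section Program

variable {d : ℕ} (q : ℕ)

/-- Assign the value of a code to a register. -/
def setP (j : ℕ) (c : Code d) : Prog := .seq ((c 20).compile q 20) (.assign j (.reg 20))

/-- A sequence of assignments. -/
def blockP (l : List (ℕ × Code d)) : Prog := l.foldr (fun p P => .seq (setP q p.1 p.2) P) .skip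

/-- The exponent of the running time of a sequence of assignments. -/
def blockE (l : List (ℕ × Code d)) : ℕ := l.foldr (fun p e => (p.2 20).expo q + e + 3) 1

/-- The registers that describe the cube of the next larger radius. -/
def cubeBlock (d : ℕ) : List (ℕ × Code d) :=
  [(2, addC (varC 2) (constC 1)), (3, addC (mulC (constC 2) (varC 2)) (constC 3)),
   (4, powC (varC 3) d), (5, powC (varC 3) (d - 1)), (6, prodC 5 fun _ => varC 16),
   (9, sumC 4 outerC), (10, prodC 9 fun _ => varC 16),
   (11, sumC 4 keyC), (12, prodC 11 fun _ => varC 16),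
   (13, mulC (mulC (mulC (mulC (varC 10) (varC 12)) (varC 16)) (addC (varC 4) (constC 1)))
     (varC 6)), (15, constC 0)]

/-- The constants of the computation. -/
def initBlock (d : ℕ) : List (ℕ × Code d) :=
  [(16, constC q), (7, mulC (mulC (constC 50) (varC 16)) (prodC 1 fun _ => constC 3)),
   (8, powC (varC 7) 2), (14, constC 1)]

/-- The loop that fills the table. -/
def tableP (d : ℕ) : Prog := .loop (.sub (.reg 13) (.reg 15))
  (.seq ((tabC (d := d) 20).compile q 20)
    (.seq (.store (.reg 15) (.reg 20)) (.assign 15 (.add (.reg 15) (.const 1)))))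

/-- The upper bound for the entropy. -/
def hiC : Code d := addC meanHC (mulC (mulC (constC 25) (varC 16)) (varC 7))
/-- The lower bound for the entropy. -/
def loC : Code d := subC meanHC (mulC (mulC (constC 25) (varC 16)) (varC 7))

/-- One round of the main loop. -/
def roundP (d : ℕ) : Prog := .seq (blockP q (cubeBlock d)) (.seq (tableP q d)
  (blockP q [(14, (violC : Code d))]))

/-- The output. -/
def outP (d : ℕ) : Prog := .seq (setP q 17 (hiC (d := d))) (.seq (setP q 18 (loC (d := d)))
  (.seq (.assign 2 (.reg 8)) (.seq (.assign 0 (.reg 18)) (.assign 1 (.reg 17)))))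

/-- The algorithm. -/
def mainP (d : ℕ) : Prog := .seq (.query 17 2 (List.replicate d (.const 0)))
  (.ite (.reg 17) (.seq (.assign 0 (.const 0)) (.seq (.assign 1 (.const 0)) (.assign 2 (.const 1))))
    (.seq (.assign 1 (powExpr (.reg 0) (d - 1))) (.seq (blockP q (initBlock q d))
      (.seq (.loop (.reg 14) (roundP q d)) (outP q d)))))

end Program

/-- The assignment of values to all the registers from `1` to `16`. -/
def worldOf (g : ℕ → ℤ) : World where
  -- Register 0 is left out: it holds the input, which for d = 1 is not bounded by R.
  S := {i | 1 ≤ i ∧ i ≤ 16}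
  K := 20
  ρ := g
  lt := fun i hi => by have := hi.2; omega
  two := ⟨by norm_num, by norm_num⟩
  three := ⟨by norm_num, by norm_num⟩

lemma worldOf_has {g : ℕ → ℤ} {i : ℕ} {v : ℤ} (h1 : 1 ≤ i) (h2 : i ≤ 16) (hv : g i = v) :
    (worldOf g).Has i v := ⟨⟨h1, h2⟩, hv⟩

/-- The table and the flag are not part of the context. -/
lemma Ctx₂.of_eq {d q r x : ℕ} {O : Oracle} {g g' : ℕ → ℤ} (h : Ctx₂ d q r x O (worldOf g))
    (he : ∀ i, i ≠ 14 → i ≠ 15 → g' i = g i) : Ctx₂ d q r x O (worldOf g') :=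
  { h2 := ⟨h.h2.1, (he _ (by norm_num) (by norm_num)).trans h.h2.2⟩
    h3 := ⟨h.h3.1, (he _ (by norm_num) (by norm_num)).trans h.h3.2⟩
    h4 := ⟨h.h4.1, (he _ (by norm_num) (by norm_num)).trans h.h4.2⟩
    h16 := ⟨h.h16.1, (he _ (by norm_num) (by norm_num)).trans h.h16.2⟩
    h6 := ⟨h.h6.1, (he _ (by norm_num) (by norm_num)).trans h.h6.2⟩
    h7 := ⟨h.h7.1, (he _ (by norm_num) (by norm_num)).trans h.h7.2⟩
    h8 := ⟨h.h8.1, (he _ (by norm_num) (by norm_num)).trans h.h8.2⟩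
    h10 := ⟨h.h10.1, (he _ (by norm_num) (by norm_num)).trans h.h10.2⟩
    h12 := ⟨h.h12.1, (he _ (by norm_num) (by norm_num)).trans h.h12.2⟩ }

/-- The state has the given registers and memory. -/
def Agree (g : ℕ → ℤ) (m : ℤ → ℤ) (s : State) : Prop :=
  (∀ i, 1 ≤ i → i ≤ 16 → s.reg i = g i) ∧ s.mem = m

/-- The registers are bounded. -/
def RegBound (R : ℕ) (g : ℕ → ℤ) : Prop := ∀ i, 1 ≤ i → i ≤ 16 → (g i).natAbs + 1 ≤ R

lemma RegBound.update {R : ℕ} {g : ℕ → ℤ} (h : RegBound R g) (j : ℕ) {v : ℤ}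
    (hv : v.natAbs + 1 ≤ R) : RegBound R (Function.update g j v) := by
  intro i h1 h2
  by_cases hij : i = j
  · subst hij; simpa using hv
  · rw [Function.update_of_ne hij]; exact h i h1 h2

/-! ### Execution of assignments and of the loop that fills the table -/

section Exec

variable {d q : ℕ} {O : Oracle} {m : ℤ → ℤ} {R : ℕ} {g : ℕ → ℤ}

lemma exec_code {c : Code d} {v : ℤ} (hD : DataBound d q O m (g 2) R) (hg : RegBound R g)
    (hc : Is q O m (worldOf g) c v) {s : State} (hs : Agree g m s) :
    ∃ T s', Exec O ((c 20).compile q 20) s T s' ∧ T ≤ R ^ (c 20).expo q ∧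
      len v ≤ R ^ (c 20).expo q ∧ s'.reg 20 = v ∧ (∀ i < 20, s'.reg i = s.reg i) ∧
      s'.mem = s.mem := by
  obtain ⟨h1, h2⟩ := hc 20 le_rfl
  have := Tm.runs hD (c 20) (worldOf g).S 20 g s h1 (worldOf g).lt (worldOf g).two
    (worldOf g).three rfl (fun i hi => hg i hi.1 hi.2) (fun i hi => hs.1 i hi.1 hi.2) hs.2
  rwa [h2 g fun _ _ => rfl] at this

lemma exec_set {c : Code d} {v : ℤ} (hD : DataBound d q O m (g 2) R) (hg : RegBound R g)
    (hc : Is q O m (worldOf g) c v) {s : State} (hs : Agree g m s) {j : ℕ} :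
    ∃ T s', Exec O (setP q j c) s T s' ∧ T ≤ R ^ ((c 20).expo q + 2) ∧
      len v ≤ R ^ (c 20).expo q ∧ s'.reg j = v ∧ (∀ i < 20, i ≠ j → s'.reg i = s.reg i) ∧
      s'.mem = s.mem := by
  obtain ⟨T, s', e1, t1, l1, v1, f1, m1⟩ := exec_code hD hg hc hs
  refine ⟨_, _, Exec.seq e1 (Exec.assign _ _ _), ?_, l1, ?_, ?_, m1⟩
  · have hR := hD.two_le
    have := add_le_pow hR (le_pow_of_le hR t1 (Nat.le_succ _))
      (add_le_pow hR l1 (one_le_pow' hR _))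
    simpa [Expr.cost, v1, add_assoc] using this
  · simp [Expr.eval, v1]
  · intro i hi hij
    simp [Function.update_of_ne hij, f1 i hi]

/-- The effect of a sequence of assignments on the registers. -/
inductive Steps (d q : ℕ) (O : Oracle) (m : ℤ → ℤ) (R : ℕ) :
    (ℕ → ℤ) → List (ℕ × Code d) → (ℕ → ℤ) → Prop
  | nil (g : ℕ → ℤ) : Steps d q O m R g [] g
  | cons {g g' : ℕ → ℤ} {j : ℕ} {c : Code d} {v : ℤ} {l : List (ℕ × Code d)}
      (_ : 1 ≤ j ∧ j ≤ 16) (hD : DataBound d q O m (g 2) R) (hc : Is q O m (worldOf g) c v)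
      (hv : v.natAbs + 1 ≤ R) (h : Steps d q O m R (Function.update g j v) l g') :
      Steps d q O m R g ((j, c) :: l) g'

lemma exec_block (hR : 2 ≤ R) {l : List (ℕ × Code d)} {g' : ℕ → ℤ} (h : Steps d q O m R g l g')
    (hg : RegBound R g) {s : State} (hs : Agree g m s) :
    ∃ T s', Exec O (blockP q l) s T s' ∧ T ≤ R ^ blockE q l ∧ Agree g' m s' ∧ RegBound R g' := by
  induction h generalizing s with
  | nil g => exact ⟨1, s, Exec.skip s, one_le_pow' hR _, hs, hg⟩
  | @cons g g' j c v l hj hD hc hv h ih =>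
    obtain ⟨T, s', e1, t1, l1, v1, f1, m1⟩ := exec_set hD hg hc hs (j := j)
    obtain ⟨T', s'', e2, t2, a2, b2⟩ := ih (hg.update j hv) (s := s') ⟨fun i h1 h2 => by
      by_cases hij : i = j
      · subst hij; simpa using v1
      · rw [Function.update_of_ne hij, f1 i (by omega) hij, hs.1 i h1 h2], m1.trans hs.2⟩
    refine ⟨_, s'', Exec.seq e1 e2, ?_, a2, b2⟩
    refine le_pow_of_le hR (add_le_pow (m := (c 20).expo q + blockE q l + 2) hR
      (le_pow_of_le hR t1 (by omega)) (le_pow_of_le hR t2 (by omega))) ?_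
    simp [blockE]

/-- Entries are written in the order of their addresses and refer only to earlier ones, so it is
enough to carry along that the first u entries are correct. -/
lemma exec_table {r x : ℕ} (hq : 0 < q) (hR : 2 ≤ R)
    (hD : ∀ m : ℤ → ℤ, (∀ a, len (m a) ≤ R) → DataBound d q O m (r : ℕ) R)
    (hg : RegBound R g) (hctx : Ctx₂ d q r x O (worldOf g)) (h13 : g 13 = tabSize d q r O)
    (h15 : g 15 = 0) (htab : ∀ u < tabSize d q r O, len (tab d q r O u) ≤ R)
    (hm : ∀ a, len (m a) ≤ R) {s : State} (hs : Agree g m s) :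
    ∃ T s' g' m', Exec O (tableP q d) s T s' ∧ T ≤ R ^ ((tabC (d := d) 20).expo q + 20) ∧
      Agree g' m' s' ∧ RegBound R g' ∧ (∀ i, i ≠ 15 → g' i = g i) ∧ (∀ a, len (m' a) ≤ R) ∧
      ∀ u < tabSize d q r O, m' (u : ℕ) = tab d q r O u := by
  set U := tabSize d q r O with hU
  set e := (tabC (d := d) 20).expo q with he
  have hUR : U + 1 ≤ R := by
    have := hg 13 (by norm_num) (by norm_num)
    rw [h13] at this
    simpa using this
  let P : ℕ → State → Prop := fun u s => ∃ m', Agree (Function.update g 15 (u : ℕ)) m' s ∧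
    (∀ a, len (m' a) ≤ R) ∧ ∀ v < u, m' (v : ℕ) = tab d q r O v
  have hguard : ∀ u ≤ U, ∀ s, P u s →
      (Expr.sub (.reg 13) (.reg 15)).ReadsBelow (R ^ 1) s ∧
      (Expr.sub (.reg 13) (.reg 15)).eval s = U - u := by
    rintro u hu s ⟨m', h1, -, -⟩
    have e13 : s.reg 13 = U := by rw [h1.1 13 (by norm_num) (by norm_num)]; simpa using h13
    have e15 : s.reg 15 = u := by rw [h1.1 15 (by norm_num) (by norm_num)]; simp
    refine ⟨⟨?_, ?_⟩, by simp [Expr.eval, e13, e15]⟩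
    · simp only [Expr.ReadsBelow, e13, pow_one]
      exact (len_le_natAbs _).trans (by simpa using hUR)
    · simp only [Expr.ReadsBelow, e15, pow_one]
      exact (len_le_natAbs _).trans (by simp; omega)
  have hstep : ∀ u < U, ∀ s, P u s → 0 < (Expr.sub (.reg 13) (.reg 15)).eval s ∧
      ∃ t s', Exec O (.seq ((tabC (d := d) 20).compile q 20)
        (.seq (.store (.reg 15) (.reg 20)) (.assign 15 (.add (.reg 15) (.const 1))))) s t s' ∧
        (Expr.sub (.reg 13) (.reg 15)).cost s + 1 + t ≤ R ^ (e + 16) ∧ P (u + 1) s' := by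
    intro u hu s hP
    obtain ⟨g1, g2⟩ := hguard u hu.le s hP
    refine ⟨by rw [g2]; omega, ?_⟩
    have g3 := (Expr.cost_le_pow hR g1).1
    obtain ⟨m', a1, b1, c1⟩ := hP
    have hne : ∀ i, i ≠ 15 → Function.update g 15 (u : ℤ) i = g i :=
      fun i hi => Function.update_of_ne hi _ _
    have hctx' : Ctx₂ d q r x O (worldOf (Function.update g 15 (u : ℕ))) :=
      hctx.of_eq fun i _ hi => hne i (by omega)
    have h2 : (Function.update g 15 (u : ℤ)) 2 = (r : ℕ) := hctx'.h2.2
    obtain ⟨T, s1, e1, t1, l1, v1, f1, m1⟩ := exec_code (m := m')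
      (h2 ▸ hD m' b1) (hg.update 15 (v := (u : ℕ)) (by simp; omega))
      (Is.tab hctx' (worldOf_has (by norm_num) (by norm_num) (by simp)) hq c1) a1
    have e15 : s1.reg 15 = u := by
      rw [f1 15 (by norm_num), a1.1 15 (by norm_num) (by norm_num)]; simp
    have hlu : len (u : ℤ) ≤ R := (len_le_natAbs _).trans (by simp; omega)
    refine ⟨_, _, Exec.seq e1 (Exec.seq (Exec.store _ _ _) (Exec.assign _ _ _)), ?_, ?_⟩
    · simp only [Expr.cost, e15, v1, Expr.eval] at g3 ⊢
      have hRe : R ≤ R ^ (e + 12) := by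
        simpa using Nat.pow_le_pow_right (n := R) (by omega) (show 1 ≤ e + 12 by omega)
      have k1 : T ≤ R ^ (e + 12) := le_pow_of_le hR t1 (by omega)
      have k2 : len (tab d q r O u) ≤ R ^ (e + 12) := (htab u hu).trans hRe
      have k3 : len (u : ℤ) ≤ R ^ (e + 12) := hlu.trans hRe
      have k4 : len 1 + 1 ≤ R ^ (e + 12) := by
        have : len 1 = 2 := by simp [len, Nat.size_one]
        rw [this]
        exact le_pow_of_le hR (self_le_pow hR 3) (by omega)
      have k5 := le_pow_of_le (m' := e + 12) hR g3 (by simp [Expr.sz])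
      have := add_le_pow hR (add_le_pow hR (add_le_pow hR k1 k2) (add_le_pow hR k3 k4))
        (add_le_pow hR (add_le_pow hR k5 k3) (add_le_pow hR k3 k4))
      refine le_trans ?_ (le_pow_of_le hR this (m' := e + 16) (by omega))
      omega
    · refine ⟨Function.update m' (u : ℤ) (tab d q r O u), ⟨?_, ?_⟩, ?_, ?_⟩
      · intro i h1 h2
        by_cases hi : i = 15
        · subst hi; simp [Expr.eval, e15]
        · simp only [Function.update_of_ne hi]
          rw [f1 i (by omega), a1.1 i h1 h2, Function.update_of_ne hi]
      · simp [Expr.eval, e15, v1, m1, a1.2]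
      · intro a
        by_cases ha : a = u
        · subst ha; simpa using htab u hu
        · rw [Function.update_of_ne ha]; exact b1 a
      · intro v hv
        by_cases hvu : v = u
        · subst hvu; simp
        · rw [Function.update_of_ne (by exact_mod_cast hvu)]
          exact c1 v (by omega)
  have hend : ∀ s, P U s → ¬ 0 < (Expr.sub (.reg 13) (.reg 15)).eval s ∧
      (Expr.sub (.reg 13) (.reg 15)).cost s + 1 ≤ R ^ (e + 16) := by
    intro s hP
    obtain ⟨g1, g2⟩ := hguard U le_rfl s hP
    refine ⟨by rw [g2]; omega, ?_⟩
    exact le_pow_of_le hR (Expr.cost_le_pow hR g1).1 (by simp [Expr.sz])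
  obtain ⟨T, s', e1, t1, m', a1, b1, c1⟩ := exec_loop (O := O) (x := .sub (.reg 13) (.reg 15))
    (p := .seq ((tabC (d := d) 20).compile q 20)
      (.seq (.store (.reg 15) (.reg 20)) (.assign 15 (.add (.reg 15) (.const 1)))))
    (N := U) (Tb := R ^ (e + 16)) P hstep hend s ⟨m, ⟨fun i h1 h2 => by
      rw [hs.1 i h1 h2]
      by_cases hi : i = 15
      · subst hi; simpa using h15
      · rw [Function.update_of_ne hi], hs.2⟩, hm, by simp⟩
  · refine ⟨T, s', _, m', e1, ?_, a1, hg.update 15 (by simpa using hUR),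
      fun i hi => Function.update_of_ne hi _ _, b1, c1⟩
    refine t1.trans ((Nat.mul_le_mul_right _ hUR).trans ?_)
    calc R * R ^ (e + 16) = R ^ (e + 17) := by ring
      _ ≤ R ^ (e + 20) := Nat.pow_le_pow_right (by omega) (by omega)

end Exec


/-! ### The main loop and its running time in terms of a common bound -/

/-- The bounds that are used for the running time. -/
structure Bounds (d q n r x : ℕ) (O : Oracle) (R : ℕ) : Prop where
  two_le : 2 ≤ R
  -- For d = 1 the bound R will not depend on n; the power n^(d-1) is then computed without reading
  -- n.
  hn : 2 ≤ d → n + 1 ≤ R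
  hx : x + 1 ≤ R
  hq : q + 1 ≤ R
  hr : r + 2 ≤ R
  hD : gridD q x + 1 ≤ R
  hM : gridM q x + 1 ≤ R
  hL : ∀ i ≤ r, sideL i + 1 ≤ R
  hN : ∀ i ≤ r, nSites d i + 1 ≤ R
  hW : ∀ i ≤ r, winLen d i + 1 ≤ R
  hQ : ∀ i ≤ r, winQ d q i + 1 ≤ R
  hring : ∀ i ≤ r, ringQ d q i + 1 ≤ R
  hkey : ∀ i ≤ r, keyQ d q i O + 1 ≤ R
  hU : ∀ i ≤ r, tabSize d q i O + 1 ≤ R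
  htab : ∀ i ≤ r, ∀ u < tabSize d q i O, len (tab d q i O u) ≤ R
  gam : ∀ i : ℕ, i ≤ r → ∀ a : ℤ, len (O 0 [a % q, (i : ℕ)]) ≤ R
  bet : ∀ i : ℕ, i ≤ r → ∀ (j : Fin d) (a b : ℤ), len (O 1 [(j : ℕ), a % q, b % q, (i : ℕ)]) ≤ R
  inK : ∀ v : Fin d → ℤ, len (O 2 (List.ofFn v)) ≤ R

section

variable {d q n r x : ℕ} {O : Oracle} {R : ℕ}

lemma Bounds.data (hB : Bounds d q n r x O R) {i : ℕ} (hi : i ≤ r) {m : ℤ → ℤ}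
    (hm : ∀ a, len (m a) ≤ R) : DataBound d q O m (i : ℕ) R :=
  ⟨hB.two_le, hm, hB.gam i hi, hB.bet i hi, hB.inK⟩

/-- The registers between two rounds. -/
structure GoodRegs (q x i : ℕ) (g : ℕ → ℤ) : Prop where
  h1 : g 1 = x
  h2 : g 2 = i
  h7 : g 7 = gridD q x
  h8 : g 8 = gridM q x
  h16 : g 16 = q

lemma steps_cube (hB : Bounds d q n r x O R) {i : ℕ} (hi : i + 1 ≤ r) {m : ℤ → ℤ}
    (hm : ∀ a, len (m a) ≤ R) {g : ℕ → ℤ} (hg : GoodRegs q x i g) :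
    ∃ g', Steps d q O m R g (cubeBlock d) g' ∧ GoodRegs q x (i + 1) g' ∧
      Ctx₂ d q (i + 1) x O (worldOf g') ∧ g' 13 = tabSize d q (i + 1) O ∧ g' 15 = 0 ∧
      g' 14 = g 14 := by
  -- During the first assignment register 2, which is also the precision of the queries, still holds
  -- the previous radius.
  have hold := hB.data (show i ≤ r by omega) hm
  have hnew := hB.data hi hm
  have hcl : ∀ (p : ℕ → Prop) [DecidablePred p], Nat.count p (nSites d (i + 1)) + 1 ≤ R :=
    fun p _ => (Nat.add_le_add_right (Nat.count_le p) 1).trans (hB.hN _ hi)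
  have cast : ∀ v : ℕ, v + 1 ≤ R → ((v : ℕ) : ℤ).natAbs + 1 ≤ R := fun v hv => by simpa using hv
  refine ⟨_, Steps.cons (v := ((i + 1 : ℕ) : ℤ)) (by norm_num) (by rw [hg.h2]; exact hold)
    ?_ (cast _ (by have := hB.hr; omega)) <|
    Steps.cons (v := (sideL (i + 1) : ℕ)) (by norm_num) (by simpa using hnew) ?_
      (cast _ (hB.hL _ hi)) <|
    Steps.cons (v := (nSites d (i + 1) : ℕ)) (by norm_num) (by simpa using hnew) ?_
      (cast _ (hB.hN _ hi)) <|
    Steps.cons (v := (winLen d (i + 1) : ℕ)) (by norm_num) (by simpa using hnew) ?_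
      (cast _ (hB.hW _ hi)) <|
    Steps.cons (v := (winQ d q (i + 1) : ℕ)) (by norm_num) (by simpa using hnew) ?_
      (cast _ (hB.hQ _ hi)) <|
    Steps.cons (v := (Nat.count (Outer d (i + 1)) (nSites d (i + 1)) : ℕ)) (by norm_num)
      (by simpa using hnew) ?_ (cast _ (hcl _)) <|
    Steps.cons (v := (ringQ d q (i + 1) : ℕ)) (by norm_num) (by simpa using hnew) ?_
      (cast _ (hB.hring _ hi)) <|
    Steps.cons (v := (Nat.count (Key d (i + 1) O) (nSites d (i + 1)) : ℕ)) (by norm_num)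
      (by simpa using hnew) ?_ (cast _ (hcl _)) <|
    Steps.cons (v := (keyQ d q (i + 1) O : ℕ)) (by norm_num) (by simpa using hnew) ?_
      (cast _ (hB.hkey _ hi)) <|
    Steps.cons (v := (tabSize d q (i + 1) O : ℕ)) (by norm_num) (by simpa using hnew) ?_
      (cast _ (hB.hU _ hi)) <|
    Steps.cons (v := 0) (by norm_num) (by simpa using hnew) (Is.const 0)
      (by have := hB.two_le; simp; omega) <|
    Steps.nil _, ?_, ?_, ?_, ?_, ?_⟩
  · exact (Is.var (worldOf_has (by norm_num) (by norm_num) hg.h2)).addN (Is.constN 1)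
  · refine ((Is.constN 2).mulN (Is.var (worldOf_has (v := ((i + 1 : ℕ) : ℤ)) (by norm_num)
      (by norm_num) ?_))).addN (Is.constN 3)
    simp
  · refine (Is.var (worldOf_has (v := (sideL (i + 1) : ℕ)) (by norm_num) (by norm_num) ?_)).powN _
    simp
  · refine (Is.var (worldOf_has (v := (sideL (i + 1) : ℕ)) (by norm_num) (by norm_num) ?_)).powN _
    simp
  · refine (Is.prod (N := winLen d (i + 1)) (worldOf_has (by norm_num) (by norm_num) ?_) _
      (fun _ => (q : ℤ)) fun w hw _ _ _ => Is.var (World.Has.mono hw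
        (worldOf_has (by norm_num) (by norm_num) ?_))).congr ?_
    · simp
    · simp [hg.h16]
    · simp [winQ]
  · refine (Is.sum (N := nSites d (i + 1)) (worldOf_has (by norm_num) (by norm_num) ?_) _
      (fun t => if Outer d (i + 1) t then (1 : ℤ) else 0) fun w hw _ _ ht =>
        ht.outer (q := q) (Ctx₁.mono hw ?_)).congr ?_
    · simp
    · refine ⟨worldOf_has (by norm_num) (by norm_num) ?_, worldOf_has (by norm_num) (by norm_num) ?_,
        worldOf_has (by norm_num) (by norm_num) ?_, worldOf_has (by norm_num) (by norm_num) ?_⟩ <;>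
      simp [hg.h16]
    · rw [Nat.count_eq_card_filter_range, Finset.card_filter]
      push_cast
      rfl
  · refine (Is.prod (N := Nat.count (Outer d (i + 1)) (nSites d (i + 1)))
      (worldOf_has (by norm_num) (by norm_num) ?_) _
      (fun _ => (q : ℤ)) fun w hw _ _ _ => Is.var (World.Has.mono hw
        (worldOf_has (by norm_num) (by norm_num) ?_))).congr ?_
    · simp
    · simp [hg.h16]
    · simp [ringQ]
  · refine (Is.sum (N := nSites d (i + 1)) (worldOf_has (by norm_num) (by norm_num) ?_) _
      (fun t => if Key d (i + 1) O t then (1 : ℤ) else 0) fun w hw _ _ ht =>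
        ht.key (q := q) (Ctx₁.mono hw ?_)).congr ?_
    · simp
    · refine ⟨worldOf_has (by norm_num) (by norm_num) ?_, worldOf_has (by norm_num) (by norm_num) ?_,
        worldOf_has (by norm_num) (by norm_num) ?_, worldOf_has (by norm_num) (by norm_num) ?_⟩ <;>
      simp [hg.h16]
    · rw [Nat.count_eq_card_filter_range, Finset.card_filter]
      push_cast
      rfl
  · refine (Is.prod (N := Nat.count (Key d (i + 1) O) (nSites d (i + 1)))
      (worldOf_has (by norm_num) (by norm_num) ?_) _
      (fun _ => (q : ℤ)) fun w hw _ _ _ => Is.var (World.Has.mono hw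
        (worldOf_has (by norm_num) (by norm_num) ?_))).congr ?_
    · simp
    · simp [hg.h16]
    · simp [keyQ]
  · refine (((((Is.var (worldOf_has (v := (ringQ d q (i + 1) : ℕ)) (by norm_num) (by norm_num)
      ?_)).mulN (Is.var (worldOf_has (v := (keyQ d q (i + 1) O : ℕ)) (by norm_num) (by norm_num)
      ?_))).mulN (Is.var (worldOf_has (v := (q : ℕ)) (by norm_num) (by norm_num) ?_))).mulN
      ((Is.var (worldOf_has (v := (nSites d (i + 1) : ℕ)) (by norm_num) (by norm_num)
      ?_)).addN (Is.constN 1))).mulN (Is.var (worldOf_has (v := (winQ d q (i + 1) : ℕ))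
      (by norm_num) (by norm_num) ?_)))
    all_goals simp [hg.h16]
  · exact ⟨by simp [hg.h1], by simp, by simp [hg.h7], by simp [hg.h8], by simp [hg.h16]⟩
  · exact
      { h2 := worldOf_has (by norm_num) (by norm_num) (by simp)
        h3 := worldOf_has (by norm_num) (by norm_num) (by simp)
        h4 := worldOf_has (by norm_num) (by norm_num) (by simp)
        h16 := worldOf_has (by norm_num) (by norm_num) (by simp [hg.h16])
        h6 := worldOf_has (by norm_num) (by norm_num) (by simp)
        h7 := worldOf_has (by norm_num) (by norm_num) (by simp [hg.h7])
        h8 := worldOf_has (by norm_num) (by norm_num) (by simp [hg.h8])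
        h10 := worldOf_has (by norm_num) (by norm_num) (by simp)
        h12 := worldOf_has (by norm_num) (by norm_num) (by simp) }
  · simp
  · simp
  · simp

lemma steps_init (hB : Bounds d q n r x O R) {m : ℤ → ℤ}
    (hm : ∀ a, len (m a) ≤ R) {g : ℕ → ℤ} (h1 : g 1 = x) (h2 : g 2 = 0) :
    ∃ g', Steps d q O m R g (initBlock q d) g' ∧ GoodRegs q x 0 g' ∧ g' 14 = 1 := by
  have hold := hB.data (show 0 ≤ r by omega) hm
  have cast : ∀ v : ℕ, v + 1 ≤ R → ((v : ℕ) : ℤ).natAbs + 1 ≤ R := fun v hv => by simpa using hv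
  refine ⟨_, Steps.cons (v := (q : ℕ)) (by norm_num) (by rw [h2]; exact hold)
    (Is.const _) (cast _ hB.hq) <|
    Steps.cons (v := (gridD q x : ℕ)) (by norm_num) (by simpa [h2] using hold) ?_
      (cast _ hB.hD) <|
    Steps.cons (v := (gridM q x : ℕ)) (by norm_num) (by simpa [h2] using hold) ?_
      (cast _ hB.hM) <|
    Steps.cons (v := 1) (by norm_num) (by simpa [h2] using hold) (Is.const 1)
      (by have := hB.two_le; simp; omega) <|
    Steps.nil _, ⟨by simp [h1], by simp [h2], by simp, by simp, by simp⟩, by simp⟩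
  · refine ((Is.mulN (s := 50) (t := q) (Is.constN 50) (Is.var (worldOf_has (by norm_num)
      (by norm_num) ?_))).mul (Is.prod (N := x) (worldOf_has (by norm_num) (by norm_num) ?_) _
      (fun _ => 3) fun _ _ _ _ _ => Is.const 3)).congr ?_
    · simp
    · simp [h1]
    · simp [gridD]
  · refine (Is.var (worldOf_has (v := (gridD q x : ℕ)) (by norm_num) (by norm_num) ?_)).powN 2
    simp

end


section

variable {d q n r x : ℕ} {O : Oracle} {R : ℕ}

/-- The exponent of the running time of one round. -/
def roundE (d q : ℕ) : ℕ := blockE q (cubeBlock d) + ((tabC (d := d) 20).expo q + 20) +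
  blockE q [(14, (violC : Code d))] + 2

/-- The lower end of the output, up to the denominator. -/
def outLo (d q r x : ℕ) (O : Oracle) : ℤ :=
  meanH (partA d q r O) q (keyQ d q r O) (ringQ d q r) (gridM q x) - 25 * q * gridD q x

/-- The upper end of the output, up to the denominator. -/
def outHi (d q r x : ℕ) (O : Oracle) : ℤ :=
  meanH (partA d q r O) q (keyQ d q r O) (ringQ d q r) (gridM q x) + 25 * q * gridD q x

lemma memA_eq (hq : 0 < q) {m : ℤ → ℤ}
    (hm : ∀ u < tabSize d q r O, m (u : ℕ) = tab d q r O u) :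
    ∀ ξ < ringQ d q r, ∀ y < keyQ d q r O, ∀ a < q,
      Is.memA d q r O m ξ y a = partA d q r O ξ y a := by
  intro ξ hξ y hy a ha
  rw [Is.memA, hm _ (addrA_lt hq hξ hy ha), tab_addrA hq ha hy]

lemma is_viol (hq : 0 < q) {m : ℤ → ℤ} {w : World} (h : Ctx₂ d q r x O w)
    (hm : ∀ u < tabSize d q r O, m (u : ℕ) = tab d q r O u) :
    Is q O m w (violC : Code d) (if 0 < viol d q r x O then 1 else 0) := by
  refine ((((Is.viol₁ h).add (Is.viol₂ h)).add (Is.viol₃ h)).ite (Is.const 1)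
    (Is.const 0)).congr ?_
  rw [viol₂_congr (memA_eq hq hm), viol₃_congr (memA_eq hq hm)]
  rfl

lemma is_mean (hq : 0 < q) {m : ℤ → ℤ} {w : World} (h : Ctx₂ d q r x O w)
    (hm : ∀ u < tabSize d q r O, m (u : ℕ) = tab d q r O u) :
    Is q O m w (meanHC : Code d)
      (meanH (partA d q r O) q (keyQ d q r O) (ringQ d q r) (gridM q x)) :=
  (Is.meanH h).congr (meanH_congr (memA_eq hq hm))

/-- The invariant of the main loop. -/
def RoundInv (d q x : ℕ) (O : Oracle) (R i : ℕ) (s : State) : Prop :=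
  ∃ g m, Agree g m s ∧ RegBound R g ∧ (∀ a, len (m a) ≤ R) ∧ GoodRegs q x i g ∧
    -- Register 14 is the flag that keeps the loop running. It starts as 1, so the radius 0 is never
    -- tested.
    g 14 = (if i = 0 ∨ 0 < viol d q i x O then 1 else 0) ∧
    (1 ≤ i → Ctx₂ d q i x O (worldOf g) ∧ ∀ u < tabSize d q i O, m (u : ℕ) = tab d q i O u)

lemma exec_round (hq : 0 < q) (hB : Bounds d q n r x O R) {i : ℕ} (hi : i < r) {s : State}
    (hs : RoundInv d q x O R i s) :
    ∃ T s', Exec O (roundP q d) s T s' ∧ T ≤ R ^ roundE d q ∧ RoundInv d q x O R (i + 1) s' := by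
  have hR := hB.two_le
  obtain ⟨g, m, ha, hb, hm, hg, -, -⟩ := hs
  obtain ⟨g₁, st, hg₁, hctx, h13, h15, -⟩ := steps_cube hB hi hm hg
  obtain ⟨T₁, s₁, e₁, t₁, a₁, b₁⟩ := exec_block hR st hb ha
  obtain ⟨T₂, s₂, g₂, m₂, e₂, t₂, a₂, b₂, c₂, d₂, f₂⟩ := exec_table hq hR
    (fun m hm => hB.data (i := i + 1) hi hm) b₁ hctx h13 h15 (hB.htab (i + 1) hi) hm a₁
  have hctx₂ : Ctx₂ d q (i + 1) x O (worldOf g₂) := hctx.of_eq fun i _ hi => c₂ i hi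
  have h2 : g₂ 2 = ((i + 1 : ℕ) : ℤ) := hctx₂.h2.2
  have st₃ : Steps d q O m₂ R g₂ [(14, violC)] _ := Steps.cons (by norm_num)
    (h2 ▸ hB.data (i := i + 1) hi d₂) (is_viol hq hctx₂ f₂)
    (by split_ifs <;> simp <;> omega) (Steps.nil _)
  obtain ⟨T₃, s₃, e₃, t₃, a₃, b₃⟩ := exec_block hR st₃ b₂ a₂
  refine ⟨_, s₃, Exec.seq e₁ (Exec.seq e₂ e₃), ?_, _, m₂, a₃, b₃, d₂, ?_, ?_, fun _ => ⟨?_, f₂⟩⟩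
  · refine le_pow_of_le hR (add_le_pow hR (le_pow_of_le hR t₁ ?_)
      (add_le_pow (m := blockE q (cubeBlock d) + ((tabC (d := d) 20).expo q + 20) +
        blockE q [(14, (violC : Code d))]) hR (le_pow_of_le hR t₂ ?_)
      (le_pow_of_le hR t₃ ?_))) ?_
    · omega
    · omega
    · omega
    · simp only [roundE]; omega
  · exact ⟨by simpa using (c₂ 1 (by norm_num)).trans hg₁.h1, by simpa using h2,
      by simpa using (c₂ 7 (by norm_num)).trans hg₁.h7,
      by simpa using (c₂ 8 (by norm_num)).trans hg₁.h8,
      by simpa using (c₂ 16 (by norm_num)).trans hg₁.h16⟩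
  · simp
  · exact hctx₂.of_eq fun i hi _ => Function.update_of_ne hi _ _

/-- The flag stays 1 until the first radius without violations, so there are exactly r rounds, for
the radii 1 to r. As r < R, the number of rounds costs one more power of R. -/
lemma exec_rounds (hq : 0 < q) (hB : Bounds d q n r x O R) (hr : 1 ≤ r)
    (hfin : viol d q r x O ≤ 0) (hgo : ∀ i, 1 ≤ i → i < r → 0 < viol d q i x O) {s : State}
    (hs : RoundInv d q x O R 0 s) :
    ∃ T s', Exec O (.loop (.reg 14) (roundP q d)) s T s' ∧ T ≤ R ^ (roundE d q + 12) ∧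
      RoundInv d q x O R r s' := by
  have hR := hB.two_le
  have hround : ∃ E, E = roundE d q ∧ ∀ i < r, ∀ s, RoundInv d q x O R i s →
      ∃ T s', Exec O (roundP q d) s T s' ∧ T ≤ R ^ E ∧ RoundInv d q x O R (i + 1) s' :=
    ⟨_, rfl, fun i hi s hs => exec_round hq hB hi hs⟩
  obtain ⟨E, hE, hround⟩ := hround
  rw [← hE]
  clear hE
  revert hround
  generalize roundP q d = p
  intro hround
  have h14 : ∀ i ≤ r, ∀ s, RoundInv d q x O R i s →
      s.reg 14 = (if i = 0 ∨ 0 < viol d q i x O then 1 else 0) ∧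
      (Expr.reg 14).cost s + 1 ≤ R ^ 10 := by
    rintro i - s ⟨g, m, a, b, -, -, e, -⟩
    have h := a.1 14 (by norm_num) (by norm_num)
    refine ⟨h.trans e, ?_⟩
    have hr : (Expr.reg 14).ReadsBelow (R ^ 1) s := by
      simp only [Expr.ReadsBelow, h, pow_one]
      exact (len_le_natAbs _).trans (b 14 (by norm_num) (by norm_num))
    exact le_pow_of_le hR (Expr.cost_le_pow hR hr).1 (by simp [Expr.sz])
  obtain ⟨T, s', e, t, hP⟩ := exec_loop (O := O) (x := .reg 14) (p := p) (N := r)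
    (Tb := R ^ (E + 11)) (RoundInv d q x O R) (by
      intro i hi s hs
      obtain ⟨e1, e2⟩ := h14 i hi.le s hs
      refine ⟨?_, ?_⟩
      · change 0 < s.reg 14
        rw [e1, if_pos]
        · norm_num
        · rcases Nat.eq_zero_or_pos i with h | h
          · exact Or.inl h
          · exact Or.inr (hgo i h hi)
      · obtain ⟨T, s', e, t, hP⟩ := hround i hi s hs
        exact ⟨T, s', e, add_le_pow hR (le_pow_of_le hR e2 (by omega))
          (le_pow_of_le hR t (by omega)), hP⟩) (by
      intro s hs
      obtain ⟨e1, e2⟩ := h14 r le_rfl s hs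
      refine ⟨?_, le_pow_of_le hR e2 (by omega)⟩
      change ¬ 0 < s.reg 14
      rw [e1, if_neg]
      · norm_num
      · rintro (h | h) <;> omega) s hs
  refine ⟨T, s', e, t.trans ?_, hP⟩
  rw [show E + 12 = (E + 11) + 1 by ring, pow_succ, mul_comm]
  exact Nat.mul_le_mul_left _ (by have := hB.hr; omega)

/-- The exponent of the running time of the output. -/
def outE (d q : ℕ) : ℕ := (hiC (d := d) 20).expo q + (loC (d := d) 20).expo q + 10

lemma exec_out (hq : 0 < q) (hB : Bounds d q n r x O R) (hr : 1 ≤ r) {s : State}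
    (hs : RoundInv d q x O R r s) :
    ∃ T s', Exec O (outP q d) s T s' ∧ T ≤ R ^ outE d q ∧ s'.reg 0 = outLo d q r x O ∧
      s'.reg 1 = outHi d q r x O ∧ s'.reg 2 = gridM q x := by
  have hR := hB.two_le
  obtain ⟨g, m, a, b, hm, hg, -, hex⟩ := hs
  obtain ⟨hctx, htab⟩ := hex hr
  have hD : DataBound d q O m (g 2) R := by rw [hg.h2]; exact hB.data le_rfl hm
  have hqD : Is q O m (worldOf g) (mulC (mulC (constC 25) (varC 16)) (varC 7) : Code d)
      (25 * q * gridD q x) :=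
    ((Is.const 25).mul (Is.var hctx.h16)).mul (Is.var hctx.h7)
  have hhi : Is q O m (worldOf g) (hiC : Code d) (outHi d q r x O) :=
    (is_mean hq hctx htab).add hqD
  have hlo : Is q O m (worldOf g) (loC : Code d) (outLo d q r x O) :=
    (is_mean hq hctx htab).sub hqD
  obtain ⟨T₁, s₁, e₁, t₁, l₁, v₁, f₁, m₁⟩ := exec_set hD b hhi a (j := 17)
  have a₁ : Agree g m s₁ :=
    ⟨fun i h1 h2 => (f₁ i (by omega) (by omega)).trans (a.1 i h1 h2), m₁.trans a.2⟩
  obtain ⟨T₂, s₂, e₂, t₂, l₂, v₂, f₂, m₂⟩ := exec_set hD b hlo a₁ (j := 18)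
  have h8 : s₂.reg 8 = gridM q x := by
    rw [f₂ 8 (by norm_num) (by norm_num), a₁.1 8 (by norm_num) (by norm_num), hg.h8]
  have h17 : s₂.reg 17 = outHi d q r x O := by
    rw [f₂ 17 (by norm_num) (by norm_num), v₁]
  refine ⟨_, _, Exec.seq e₁ (Exec.seq e₂ (Exec.seq (Exec.assign _ _ _)
    (Exec.seq (Exec.assign _ _ _) (Exec.assign _ _ _)))), ?_, ?_, ?_, ?_⟩
  · set X := (hiC (d := d) 20).expo q + (loC (d := d) 20).expo q + 2 with hX
    have k1 : T₁ ≤ R ^ X := le_pow_of_le hR t₁ (by omega)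
    have k2 : T₂ ≤ R ^ X := le_pow_of_le hR t₂ (by omega)
    have k3 : len (outHi d q r x O) ≤ R ^ X := le_pow_of_le hR l₁ (by omega)
    have k4 : len (outLo d q r x O) ≤ R ^ X := le_pow_of_le hR l₂ (by omega)
    have k5 : len (gridM q x : ℕ) ≤ R ^ X := by
      refine le_pow_of_le (m := 1) hR ?_ (by omega)
      rw [pow_one]
      exact (len_le_natAbs _).trans (by simpa using hB.hM)
    have k6 : 3 ≤ R ^ (X + 1) := le_pow_of_le hR (show 3 ≤ R ^ 2 by nlinarith) (by omega)
    have := add_le_pow hR (add_le_pow hR (add_le_pow hR k1 k2) (add_le_pow hR k3 k4))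
      (add_le_pow hR (le_pow_of_le hR k5 (show X ≤ X + 1 by omega)) k6)
    refine le_trans ?_ (le_pow_of_le hR this (m' := outE d q) (by simp only [outE]; omega))
    simp [Expr.cost, h8, h17, v₂]
    omega
  · simp [Expr.eval, v₂]
  · simp [Expr.eval, h17]
  · simp [Expr.eval, h8]

/-- The exponent of the running time of the algorithm. -/
def mainE (d q : ℕ) : ℕ :=
  blockE q (initBlock q d) + roundE d q + outE d q + 2 * (powExpr (.reg 0) (d - 1)).sz + d + 40

lemma powExpr_readsBelow' {e : Expr} {β : ℕ} {s : State} {k : ℕ} (h : 1 ≤ k → e.ReadsBelow β s) :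
    (powExpr e k).ReadsBelow β s := by
  rcases Nat.eq_zero_or_pos k with rfl | hk
  · trivial
  · exact powExpr_readsBelow (h hk) k

/-- The algorithm halts at the first radius at which there are no violations. -/
theorem mainP_outputs (hd : 1 ≤ d) (hq : 0 < q) (hxn : x = n ^ (d - 1))
    (hB : Bounds d q n r x O R) (hr : 1 ≤ r) (hK : ¬ 0 < O 2 (List.ofFn fun _ : Fin d => 0))
    (hfin : viol d q r x O ≤ 0) (hgo : ∀ i, 1 ≤ i → i < r → 0 < viol d q i x O) :
    ∃ t, Outputs (mainP q d) O n (outLo d q r x O / gridM q x) (outHi d q r x O / gridM q x) t ∧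
      t ≤ R ^ mainE d q := by
  have hR := hB.two_le
  set s₀ := initState n with hs₀
  set s₁ : State := ⟨Function.update s₀.reg 17 (O 2 (List.ofFn fun _ : Fin d => 0)), s₀.mem⟩ with hs₁
  set s₂ : State := ⟨Function.update s₁.reg 1 x, s₁.mem⟩ with hs₂
  have e₁ : Exec O (.query 17 2 (List.replicate d (.const 0))) s₀
      (d + len (O 2 (List.ofFn fun _ : Fin d => 0)) + 1) s₁ := by
    have := Exec.query (O := O) 17 2 (List.replicate d (.const 0)) s₀
    simpa [Expr.cost, Expr.eval, len, hs₁, List.ofFn_const] using this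
  have e₂ : Exec O (.assign 1 (powExpr (.reg 0) (d - 1))) s₁
      ((powExpr (.reg 0) (d - 1)).cost s₁ + 1) s₂ := by
    have := Exec.assign (O := O) 1 (powExpr (.reg 0) (d - 1)) s₁
    have h : (powExpr (.reg 0) (d - 1)).eval s₁ = x := by
      rw [powExpr_eval, hxn]
      simp [Expr.eval, hs₁, hs₀, initState]
    rwa [h] at this
  have hc := (Expr.cost_le_pow (m := 1) (E := powExpr (.reg 0) (d - 1)) (s := s₁) hR
    (powExpr_readsBelow' fun h => by
      have : s₁.reg 0 = n := by simp [hs₁, hs₀, initState]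
      simp only [Expr.ReadsBelow, this, pow_one]
      exact (len_le_natAbs _).trans (by simpa using hB.hn (by omega)))).1
  have hm : ∀ a, len (s₂.mem a) ≤ R := fun a => by
    have : len (s₂.mem a) = 1 := by simp [hs₂, hs₁, hs₀, initState, len]
    omega
  let g : ℕ → ℤ := fun i => if i = 1 then x else 0
  have ha : Agree g s₂.mem s₂ := by
    refine ⟨fun i h1 h2 => ?_, rfl⟩
    by_cases hi : i = 1
    · subst hi; simp [hs₂, g]
    · simp [hs₂, hs₁, hs₀, initState, g, hi, show i ≠ 17 by omega, show i ≠ 0 by omega]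
  have hb : RegBound R g := by
    intro i h1 h2
    by_cases hi : i = 1
    · subst hi; simpa [g] using hB.hx
    · simp [g, hi]; omega
  obtain ⟨g₃, st, hg₃, h14⟩ := steps_init hB hm (g := g) (by simp [g]) (by simp [g])
  obtain ⟨T₃, s₃, e₃, t₃, a₃, b₃⟩ := exec_block hR st hb ha
  obtain ⟨T₄, s₄, e₄, t₄, i₄⟩ := exec_rounds hq hB hr hfin hgo (s := s₃)
    ⟨g₃, s₂.mem, a₃, b₃, hm, hg₃, by simpa using h14, fun h => by omega⟩
  obtain ⟨T₅, s₅, e₅, t₅, h0, h1, h2⟩ := exec_out hq hB hr i₄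
  have hM : 0 < gridM q x := by unfold gridM gridD; positivity
  refine ⟨_, ⟨s₅, Exec.seq e₁ (Exec.ite_neg ?_ (Exec.seq e₂ (Exec.seq e₃ (Exec.seq e₄ e₅)))), ?_,
    ?_, ?_⟩, ?_⟩
  · simpa [Expr.eval, hs₁] using hK
  · rw [h2]; exact_mod_cast hM
  · rw [h0, h2]; simp
  · rw [h1, h2]; simp
  · have hcost : (Expr.reg 17).cost s₁ = len (O 2 (List.ofFn fun _ : Fin d => 0)) := by
      simp [Expr.cost, hs₁]
    rw [hcost]
    set X := blockE q (initBlock q d) + roundE d q + outE d q +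
      2 * (powExpr (.reg 0) (d - 1)).sz + d + 30 with hX
    have hans : len (O 2 (List.ofFn fun _ : Fin d => 0)) ≤ R ^ X :=
      le_pow_of_le (m := 1) hR (by rw [pow_one]; exact hB.inK _) (by omega)
    have k1 : d ≤ R ^ X := le_pow_of_le hR (self_le_pow hR d) (by omega)
    have k2 : _ ≤ R ^ X := le_pow_of_le hR hc (by omega)
    have k3 : _ ≤ R ^ X := le_pow_of_le hR t₃ (by omega)
    have k4 : _ ≤ R ^ X := le_pow_of_le hR t₄ (by omega)
    have k5 : _ ≤ R ^ X := le_pow_of_le hR t₅ (by omega)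
    have k6 := one_le_pow' hR X
    have := add_le_pow hR (add_le_pow hR (add_le_pow hR hans hans) (add_le_pow hR k1 k2))
      (add_le_pow hR (add_le_pow hR k3 k4) (add_le_pow hR k5 k6))
    have := add_le_pow hR this (le_pow_of_le hR k6 (show X ≤ X + 1 + 1 + 1 by omega))
    refine le_trans ?_ (le_pow_of_le hR this (m' := mainE d q) (by simp only [mainE]; omega))
    omega

/-- An origin in `K` has to be treated separately, since the prescription at the origin takes
precedence over the one on `K` in `forced`; the entropy is 0 then. -/
theorem mainP_outputs_zero (hK : 0 < O 2 (List.ofFn fun _ : Fin d => 0)) :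
    ∃ t, Outputs (mainP q d) O n 0 0 t ∧
      t ≤ d + 2 * len (O 2 (List.ofFn fun _ : Fin d => 0)) + 9 := by
  set s₀ := initState n with hs₀
  set s₁ : State := ⟨Function.update s₀.reg 17 (O 2 (List.ofFn fun _ : Fin d => 0)), s₀.mem⟩ with hs₁
  have e₁ : Exec O (.query 17 2 (List.replicate d (.const 0))) s₀
      (d + len (O 2 (List.ofFn fun _ : Fin d => 0)) + 1) s₁ := by
    have := Exec.query (O := O) 17 2 (List.replicate d (.const 0)) s₀
    simpa [Expr.cost, Expr.eval, len, hs₁, List.ofFn_const] using this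
  have e₂ := Exec.seq (Exec.assign (O := O) 0 (.const 0) s₁)
    (Exec.seq (Exec.assign 1 (.const 0) _) (Exec.assign 2 (.const 1) _))
  have e₃ := Exec.seq e₁ (Exec.ite_pos (p₂ := (.seq (.assign 1 (powExpr (.reg 0) (d - 1)))
    (.seq (blockP q (initBlock q d)) (.seq (.loop (.reg 14) (roundP q d)) (outP q d)))))
    (x := .reg 17) (by simpa [Expr.eval, hs₁] using hK) e₂)
  refine ⟨_, ⟨_, e₃, by simp [Expr.eval], by simp [Expr.eval], by simp [Expr.eval]⟩, ?_⟩
  simp [Expr.cost, hs₁, len, Nat.size_one]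
  omega

end


/-! ## The transfer matrix recursion computes partition functions -/

section Row

variable {d q r : ℕ} {O : Oracle} {ξ y x : ℕ}

lemma mod_pow_digit (q : ℕ) {m n k : ℕ} (hq : 0 < q) (hk : k < n) :
    m % q ^ n / q ^ k % q = m / q ^ k % q := by
  obtain ⟨l, rfl⟩ := Nat.exists_eq_add_of_lt hk
  have h : m / q ^ k = m % q ^ (k + l + 1) / q ^ k + q * (q ^ l * (m / q ^ (k + l + 1))) := by
    conv_lhs => rw [← Nat.mod_add_div m (q ^ (k + l + 1))]
    rw [show q ^ (k + l + 1) * (m / q ^ (k + l + 1)) =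
      q ^ k * (q * (q ^ l * (m / q ^ (k + l + 1)))) by ring,
      Nat.add_mul_div_left _ _ (by positivity)]
  rw [h, Nat.add_mul_mod_self_left]

/-- The contribution of the site with index `t` to the weight. -/
def locF (d q r : ℕ) (O : Oracle) (ξ y x : ℕ) (f : ℕ → ℕ) (t : ℕ) : ℤ :=
  (if forced d q r O ξ y x t (f t) = f t then 1 else 0) * O 0 [(f t : ℤ), (r : ℤ)] *
    ∏ i : Fin d, if coord r t i + 1 < sideL r then
      O 1 [((i : ℕ) : ℤ), (f t : ℤ), (f (t + sideL r ^ (i : ℕ)) : ℤ), (r : ℤ)] else 1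

/-- The function `f` with the first values replaced by those of `w`. -/
def overwrite {t : ℕ} (w : Fin t → Fin q) (f : ℕ → ℕ) : ℕ → ℕ :=
  fun s => if h : s < t then w ⟨s, h⟩ else f s

lemma overwrite_snoc {t : ℕ} (w : Fin t → Fin q) (a : Fin q) (f : ℕ → ℕ) :
    overwrite (Fin.snoc (α := fun _ => Fin q) w a) f = overwrite w (Function.update f t a) := by
  funext s
  rcases lt_trichotomy s t with h | rfl | h
  · simp [overwrite, h, Nat.lt_succ_of_lt h, Fin.snoc]
  · simp [overwrite, Fin.snoc]
  · simp [overwrite, show ¬ s < t + 1 by omega, show ¬ s < t by omega, show s ≠ t by omega]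

lemma sideL_pos : 0 < sideL r := by unfold sideL; omega

lemma winLen_le : winLen d r ≤ nSites d r :=
  Nat.pow_le_pow_right sideL_pos (Nat.sub_le _ _)

/-- `row` at height t sums over all choices of symbols at the sites below t, the symbols from t on
being those of `f`. Only the window of `f` matters, because the forward neighbours of a site s are s
+ L^i with L^i at most the length of the window. The induction splits off the symbol at the highest
free site. -/
lemma row_eq (hq : 0 < q) (t : ℕ) : ∀ (f : ℕ → ℕ) (c : ℕ), (∀ s, f s < q) →
    (∀ k < winLen d r, c / q ^ k % q = f (t + k)) →
    row d q r O ξ y x t c =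
      ∑ w : Fin t → Fin q, ∏ s ∈ Finset.range t, locF d q r O ξ y x (overwrite w f) s := by
  induction t with
  | zero => intro f c _ _; simp [row]
  | succ t ih =>
    intro f c hf hc
    rw [row, ← (Fin.snocEquiv fun _ : Fin (t + 1) => Fin q).sum_comp, Fintype.sum_prod_type,
      Finset.sum_range]
    refine Finset.sum_congr rfl fun a _ => ?_
    -- The new window represents `f` with the chosen symbol at t.
    have hrep : ∀ k < winLen d r, (a + q * c) % winQ d q r / q ^ k % q =
        Function.update f t a (t + k) := by
      intro k hk
      rw [winQ, mod_pow_digit q hq hk]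
      rcases k with _ | k
      · simp [Nat.mod_eq_of_lt a.2]
      · rw [pow_succ', ← Nat.div_div_eq_div_mul, Nat.add_mul_div_left _ _ hq,
          Nat.div_eq_of_lt a.2, zero_add, hc k (by omega), Function.update_of_ne (by omega)]
        congr 1; ring
    rw [ih (Function.update f t a) _ (fun s => by
      by_cases h : s = t
      · subst h; simp
      · rw [Function.update_of_ne h]; exact hf s) hrep, Finset.mul_sum]
    refine Finset.sum_congr rfl fun w _ => ?_
    rw [Finset.prod_range_succ, mul_comm]
    have hs : (Fin.snocEquiv fun _ : Fin (t + 1) => Fin q) (a, w) =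
      Fin.snoc (α := fun _ => Fin q) w a := rfl
    rw [hs, overwrite_snoc]
    congr 1
    have h0 : overwrite w (Function.update f t a) t = a := by simp [overwrite]
    have hi : ∀ i : Fin d, overwrite w (Function.update f t a) (t + sideL r ^ (i : ℕ)) =
        digit q (nSites d r) c (sideL r ^ (i : ℕ) - 1) := by
      intro i
      have h1 : 1 ≤ sideL r ^ (i : ℕ) := Nat.one_le_pow _ _ sideL_pos
      have h2 : sideL r ^ (i : ℕ) ≤ winLen d r :=
        Nat.pow_le_pow_right sideL_pos (by have := i.2; omega)
      have h3 := winLen_le (d := d) (r := r)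
      rw [digit, min_eq_left (by omega), hc _ (by omega)]
      simp only [overwrite, show ¬ t + sideL r ^ (i : ℕ) < t by omega, dif_neg, not_false_eq_true]
      rw [Function.update_of_ne (by omega)]
      congr 1; omega
    simp only [locF, h0, hi]

end Row

/-! ## The encoding of configurations -/

section Enc

variable {q : ℕ} (P : ℕ → Prop) [DecidablePred P] {f : ℕ → ℕ}

/-- The number with the digits `f t`, where `t` runs through the numbers with the property `P`. -/
def enc (q : ℕ) (f : ℕ → ℕ) : ℕ → ℕ
  | 0 => 0
  | t + 1 => enc q f t + if P t then f t * q ^ Nat.count P t else 0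

lemma enc_lt (hf : ∀ s, f s < q) (t : ℕ) : enc P q f t < q ^ Nat.count P t := by
  induction t with
  | zero => simp [enc]
  | succ t ih =>
    rw [enc, Nat.count_succ]
    split_ifs with h
    · have := Nat.mul_le_mul_right (q ^ Nat.count P t) (hf t)
      rw [Nat.succ_mul] at this
      rw [pow_succ, mul_comm _ q]
      omega
    · simpa using ih

lemma enc_digit (hf : ∀ s, f s < q) {s t : ℕ} (hs : s < t) (hP : P s) :
    enc P q f t / q ^ Nat.count P s % q = f s := by
  have hq : 0 < q := (Nat.zero_le _).trans_lt (hf 0)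
  induction t with
  | zero => omega
  | succ t ih =>
    rw [enc]
    rcases (Nat.lt_succ_iff_lt_or_eq.mp hs) with h | rfl
    · split_ifs with ht
      · have hlt : Nat.count P s < Nat.count P t := Nat.count_strict_mono hP h
        rw [← mod_pow_digit q hq hlt, Nat.add_mul_mod_self_right, mod_pow_digit q hq hlt]
        exact ih h
      · simpa using ih h
    · rw [if_pos hP, Nat.add_mul_div_right _ _ (by positivity), Nat.div_eq_of_lt (enc_lt P hf s),
        zero_add, Nat.mod_eq_of_lt (hf s)]

lemma eq_enc {c : ℕ} (hf : ∀ s, f s < q) {t : ℕ} (hc : c < q ^ Nat.count P t)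
    (h : ∀ s < t, P s → c / q ^ Nat.count P s % q = f s) : c = enc P q f t := by
  have hq : 0 < q := (Nat.zero_le _).trans_lt (hf 0)
  induction t generalizing c with
  | zero => simpa [enc] using hc
  | succ t ih =>
    rw [enc]
    rw [Nat.count_succ] at hc
    by_cases ht : P t
    · rw [if_pos ht] at hc ⊢
      have h1 : c % q ^ Nat.count P t = enc P q f t := ih (Nat.mod_lt _ (by positivity))
        fun s hs hP => by
          rw [mod_pow_digit q hq (Nat.count_strict_mono hP hs)]
          exact h s (by omega) hP
      have h2 : c / q ^ Nat.count P t < q := by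
        rw [Nat.div_lt_iff_lt_mul (by positivity)]
        rwa [pow_succ, mul_comm] at hc
      have h3 := h t (by omega) ht
      rw [Nat.mod_eq_of_lt h2] at h3
      rw [← h1, ← h3, mul_comm]
      exact (Nat.mod_add_div _ _).symm
    · rw [if_neg ht] at hc ⊢
      exact ih hc fun s hs => h s (by omega)

lemma enc_eq_iff {g : ℕ → ℕ} (hf : ∀ s, f s < q) (hg : ∀ s, g s < q) {t : ℕ} :
    enc P q f t = enc P q g t ↔ ∀ s < t, P s → f s = g s := by
  constructor
  · intro h s hs hP
    rw [← enc_digit P hf hs hP, h, enc_digit P hg hs hP]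
  · intro h
    refine eq_enc P hg (enc_lt P hf t) fun s hs hP => ?_
    rw [enc_digit P hf hs hP, h s hs hP]

end Enc

/-! ## The sites of a cube -/

section Sites

variable {d r : ℕ}

/-- The site with index `t`. -/
def siteOf (d r t : ℕ) : Site d := fun i => (coord r t i : ℤ) - (r + 1)

lemma siteZ_eq (t : ℕ) : siteZ d r (sideL r) t = siteOf d r t := by
  funext i
  simp [siteZ, siteOf, coord]

lemma coord_lt (t i : ℕ) : coord r t i < sideL r := Nat.mod_lt _ sideL_pos

lemma mem_box {n : ℕ} {v : Site d} : v ∈ box d n ↔ ∀ i, -(n : ℤ) ≤ v i ∧ v i ≤ n := by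
  simp [box]

lemma siteOf_mem (t : ℕ) : siteOf d r t ∈ box d (r + 1) := by
  rw [mem_box]
  intro i
  have := coord_lt (r := r) t i
  simp only [siteOf, sideL] at *
  push_cast
  omega

/-- The index of a site. -/
def idx (d r : ℕ) (v : Site d) : ℕ := ∑ i, (v i + (r + 1)).toNat * sideL r ^ (i : ℕ)

/-- The coordinates of a site of the cube, shifted to be non-negative. -/
def shiftCoord {v : Site d} (hv : v ∈ box d (r + 1)) : Fin d → Fin (sideL r) :=
  fun i => ⟨(v i + (r + 1)).toNat, by
    have := mem_box.mp hv i
    push_cast at this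
    unfold sideL
    omega⟩

lemma idx_eq {v : Site d} (hv : v ∈ box d (r + 1)) :
    idx d r v = (finFunctionFinEquiv (shiftCoord hv) : ℕ) := by
  rw [finFunctionFinEquiv_apply]
  rfl

lemma idx_lt {v : Site d} (hv : v ∈ box d (r + 1)) : idx d r v < nSites d r := by
  rw [idx_eq hv]
  exact Fin.is_lt _

lemma siteOf_idx {v : Site d} (hv : v ∈ box d (r + 1)) : siteOf d r (idx d r v) = v := by
  funext i
  have h : coord r (idx d r v) i = (finFunctionFinEquiv.symm (finFunctionFinEquiv (shiftCoord hv)) i : ℕ) := by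
    rw [idx_eq hv]
    rfl
  rw [Equiv.symm_apply_apply] at h
  have := mem_box.mp hv i
  push_cast at this
  simp only [siteOf, h, shiftCoord]
  omega

lemma idx_siteOf {t : ℕ} (ht : t < nSites d r) : idx d r (siteOf d r t) = t := by
  have h : shiftCoord (siteOf_mem (d := d) (r := r) t) =
      finFunctionFinEquiv.symm (⟨t, ht⟩ : Fin (sideL r ^ d)) := by
    funext i
    apply Fin.ext
    have h1 : ((finFunctionFinEquiv.symm (⟨t, ht⟩ : Fin (sideL r ^ d)) i : Fin _) : ℕ) =
      coord r t i := rfl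
    rw [h1]
    simp [shiftCoord, siteOf]
  rw [idx_eq (siteOf_mem t), h, Equiv.apply_symm_apply]

/-- The enumeration of the sites of the cube. -/
def siteEquiv (d r : ℕ) : Fin (nSites d r) ≃ box d (r + 1) where
  toFun t := ⟨siteOf d r t, siteOf_mem _⟩
  invFun v := ⟨idx d r v, idx_lt v.2⟩
  left_inv t := Fin.ext (idx_siteOf t.2)
  right_inv v := Subtype.ext (siteOf_idx v.2)

/-- All shifted coordinates of the origin are r + 1, and L - 1 = 2 (r + 1). The geometric sum (L^d -
1) / (L - 1), multiplied by r + 1, is the middle index. -/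
lemma idx_zero : idx d r 0 = (nSites d r - 1) / 2 := by
  have h : ∑ i : Fin d, (sideL r) ^ (i : ℕ) = ∑ i ∈ Finset.range d, (sideL r) ^ i :=
    (Finset.sum_range fun i => sideL r ^ i).symm
  have h2 := Nat.geomSum_eq (m := sideL r) (by unfold sideL; omega) d
  have h3 : (sideL r - 1) ∣ (sideL r ^ d - 1) := by
    simpa using Nat.sub_dvd_pow_sub_pow (sideL r) 1 d
  have h4 : idx d r 0 = (r + 1) * ∑ i ∈ Finset.range d, (sideL r) ^ i := by
    rw [← h, idx, Finset.mul_sum]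
    refine Finset.sum_congr rfl fun i _ => ?_
    congr 1
    simp
  rw [h4, h2, nSites]
  obtain ⟨k, hk⟩ := h3
  have h5 : sideL r - 1 = 2 * (r + 1) := by unfold sideL; omega
  rw [hk, h5, Nat.mul_div_cancel_left _ (by omega), mul_assoc, Nat.mul_div_cancel_left _ (by omega)]

lemma siteOf_eq_zero {t : ℕ} (ht : t < nSites d r) :
    siteOf d r t = 0 ↔ t = (nSites d r - 1) / 2 := by
  rw [← idx_zero]
  constructor
  · intro h; rw [← h, idx_siteOf ht]
  · rintro rfl; exact siteOf_idx (mem_box.mpr (by intro i; simp; omega))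

lemma inner_iff {t : ℕ} : Inner d r t ↔ siteOf d r t ∈ box d r := by
  rw [mem_box]
  refine forall_congr' fun i => ?_
  simp only [siteOf, sideL]
  omega

lemma succ_mem_iff {t : ℕ} (i : Fin d) :
    siteOf d r t + e i ∈ box d (r + 1) ↔ coord r t i + 1 < sideL r := by
  have ht := mem_box.mp (siteOf_mem (d := d) (r := r) t)
  rw [mem_box]
  constructor
  · intro h
    have := h i
    simp [e, siteOf] at this
    unfold sideL
    omega
  · intro h j
    have h1 := ht j
    by_cases hij : j = i
    · subst hij
      simp only [e, Pi.add_apply, Pi.single_eq_same, siteOf, sideL] at *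
      push_cast at *
      omega
    · simpa [e, hij] using h1

lemma idx_add {t : ℕ} (ht : t < nSites d r) (i : Fin d) :
    idx d r (siteOf d r t + e i) = t + sideL r ^ (i : ℕ) := by
  conv_rhs => rw [← idx_siteOf ht]
  have h : ∀ j : Fin d, ((siteOf d r t + e i) j + (r + 1)).toNat * sideL r ^ (j : ℕ) =
      (siteOf d r t j + (r + 1)).toNat * sideL r ^ (j : ℕ) +
        if j = i then sideL r ^ (j : ℕ) else 0 := by
    intro j
    by_cases hij : j = i
    · subst hij
      simp only [e, Pi.add_apply, Pi.single_eq_same, siteOf, if_true]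
      rw [show (coord r t j : ℤ) - (r + 1) + 1 + (r + 1) = ((coord r t j + 1 : ℕ) : ℤ) by
        push_cast; ring, show (coord r t j : ℤ) - (r + 1) + (r + 1) = ((coord r t j : ℕ) : ℤ) by ring,
        Int.toNat_natCast, Int.toNat_natCast]
      ring
    · simp [e, hij]
  rw [idx, Finset.sum_congr rfl fun j _ => h j, Finset.sum_add_distrib]
  simp [idx]

lemma siteOf_add {t : ℕ} (ht : t < nSites d r) {i : Fin d} (hi : coord r t i + 1 < sideL r) :
    t + sideL r ^ (i : ℕ) < nSites d r ∧
      siteOf d r (t + sideL r ^ (i : ℕ)) = siteOf d r t + e i := by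
  have h := (succ_mem_iff i).mpr hi
  rw [← idx_add ht i]
  exact ⟨idx_lt h, siteOf_idx h⟩

end Sites


/-! ### Integer weights and the partition functions of the cube -/

/-- The weight of a configuration, for interactions in a commutative semiring. -/
def genWeight {S : Type*} [CommSemiring S] {d q : ℕ} (g : Fin q → S)
    (b : Fin d → Fin q → Fin q → S) {W : Finset (Site d)} (w : Config d q W) : S :=
  (∏ v : W, g (w v)) *
    ∏ i : Fin d, ∏ v : W, if h : v.1 + e i ∈ W then b i (w v) (w ⟨v.1 + e i, h⟩) else 1

lemma zero_mem_box {d n : ℕ} : (0 : Site d) ∈ box d n := mem_box.mpr (by intro i; simp)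

section PartA

variable {d q r : ℕ} {O : Oracle}

/-- The integer weight of a configuration on the cube. -/
def intWeight (r : ℕ) (O : Oracle) (w : Config d q (box d (r + 1))) : ℤ :=
  genWeight (fun a => O 0 [((a : ℕ) : ℤ), (r : ℤ)])
    (fun i a b => O 1 [((i : ℕ) : ℤ), ((a : ℕ) : ℤ), ((b : ℕ) : ℤ), (r : ℤ)]) w

/-- The symbol at the site with index `t`. -/
def valAt (w : Config d q (box d (r + 1))) (t : ℕ) : ℕ := w ⟨siteOf d r t, siteOf_mem t⟩

lemma valAt_lt (w : Config d q (box d (r + 1))) (t : ℕ) : valAt w t < q := Fin.is_lt _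

/-- The code of the configuration on the boundary of the cube. -/
def ringCode (w : Config d q (box d (r + 1))) : ℕ := enc (Outer d r) q (valAt w) (nSites d r)

/-- The code of the configuration on the part of the given set inside the cube. -/
def keyCode (O : Oracle) (w : Config d q (box d (r + 1))) : ℕ :=
  enc (Key d r O) q (valAt w) (nSites d r)

lemma ringCode_lt (w : Config d q (box d (r + 1))) : ringCode w < ringQ d q r :=
  enc_lt _ (valAt_lt w) _

lemma keyCode_lt (w : Config d q (box d (r + 1))) : keyCode O w < keyQ d q r O :=
  enc_lt _ (valAt_lt w) _

lemma forall_site_iff {p : ℕ → Prop} {w w' : Config d q (box d (r + 1))} {S : Set (Site d)}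
    (hp : ∀ t < nSites d r, p t ↔ siteOf d r t ∈ S) :
    (∀ t < nSites d r, p t → valAt w t = valAt w' t) ↔ ∀ v, v.1 ∈ S → w v = w' v := by
  constructor
  · intro h v hv
    have h1 := siteOf_idx v.2
    have h2 := h _ (idx_lt v.2) ((hp _ (idx_lt v.2)).mpr (by rwa [h1]))
    have h3 : (⟨siteOf d r (idx d r v.1), siteOf_mem _⟩ : box d (r + 1)) = v := Subtype.ext h1
    simpa [valAt, h3, Fin.ext_iff] using h2
  · intro h t ht hpt
    simpa [valAt, Fin.ext_iff] using h ⟨siteOf d r t, siteOf_mem t⟩ ((hp t ht).mp hpt)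

lemma ringCode_eq_iff {w w' : Config d q (box d (r + 1))} :
    ringCode w = ringCode w' ↔ ∀ v, v.1 ∉ box d r → w v = w' v := by
  rw [ringCode, ringCode, enc_eq_iff _ (valAt_lt w) (valAt_lt w')]
  exact forall_site_iff (S := {v | v ∉ box d r}) fun t _ => not_congr inner_iff

lemma keyCode_eq_iff {K : Finset (Site d)} (hO : ∀ v : Site d, O 2 (List.ofFn v) = if v ∈ K then 1 else 0)
    {w w' : Config d q (box d (r + 1))} :
    keyCode O w = keyCode O w' ↔ ∀ v, v.1 ∈ box d r ∩ K → w v = w' v := by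
  rw [keyCode, keyCode, enc_eq_iff _ (valAt_lt w) (valAt_lt w')]
  refine (forall_site_iff (S := {v | v ∈ box d r ∩ K}) fun t _ => ?_)
  rw [Key, siteZ_eq, hO, inner_iff]
  simp
  intro _
  split_ifs <;> simp_all

lemma mid_lt : (nSites d r - 1) / 2 < nSites d r := by
  have : 0 < nSites d r := Nat.pow_pos sideL_pos
  omega

/-- The local constraints at all sites together say that the codes and the symbol at the origin are
the prescribed ones; at a free site `forced` returns its last argument, so nothing is required
there. If the origin were a key site, its digit of y would never be compared. -/
lemma forced_iff (h0 : ¬ Key d r O ((nSites d r - 1) / 2)) {ξ y : ℕ} (x : Fin q)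
    (hξ : ξ < ringQ d q r) (hy : y < keyQ d q r O) (w : Config d q (box d (r + 1))) :
    (∀ t < nSites d r, forced d q r O ξ y x t (valAt w t) = valAt w t) ↔
      ringCode w = ξ ∧ keyCode O w = y ∧ w ⟨0, zero_mem_box⟩ = x := by
  have hmid : valAt w ((nSites d r - 1) / 2) = w ⟨0, zero_mem_box⟩ := by
    have : siteOf d r ((nSites d r - 1) / 2) = 0 := (siteOf_eq_zero mid_lt).mpr rfl
    simp only [valAt, this]
  have hin : Inner d r ((nSites d r - 1) / 2) := by
    rw [inner_iff, (siteOf_eq_zero mid_lt).mpr rfl]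
    exact zero_mem_box
  have hd : ∀ (P : ℕ → Prop) [DecidablePred P] (c t : ℕ), t < nSites d r →
      digit q (nSites d r) c (Nat.count P (min t (nSites d r))) = c / q ^ Nat.count P t % q := by
    intro P _ c t ht
    rw [digit, min_eq_left ht.le, min_eq_left ((Nat.count_le P).trans ht.le)]
  constructor
  · intro h
    refine ⟨?_, ?_, ?_⟩
    · refine (eq_enc _ (valAt_lt w) hξ fun t ht hP => ?_).symm
      rw [← hd _ _ _ ht]
      simpa [forced, if_neg (show ¬ Inner d r t from hP)] using h t ht
    · refine (eq_enc _ (valAt_lt w) hy fun t ht hP => ?_).symm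
      rw [← hd _ _ _ ht]
      have hne : t ≠ (nSites d r - 1) / 2 := by rintro rfl; exact h0 hP
      simpa [forced, if_pos hP.1, hne, hP] using h t ht
    · have := h _ mid_lt
      rw [forced, if_pos hin, if_pos rfl, hmid] at this
      exact (Fin.ext this).symm
  · rintro ⟨rfl, rfl, hx⟩ t ht
    rw [forced]
    split_ifs with h1 h2 h3
    · rw [h2, hmid, hx]
    · rw [hd _ _ _ ht]
      exact enc_digit _ (valAt_lt w) ht h3
    · rfl
    · rw [hd _ _ _ ht]
      exact enc_digit _ (valAt_lt w) ht h1

lemma intWeight_eq (w : Config d q (box d (r + 1))) :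
    intWeight r O w = ∏ t ∈ Finset.range (nSites d r), O 0 [(valAt w t : ℤ), (r : ℤ)] *
      ∏ i : Fin d, if coord r t i + 1 < sideL r then
        O 1 [((i : ℕ) : ℤ), (valAt w t : ℤ), (valAt w (t + sideL r ^ (i : ℕ)) : ℤ), (r : ℤ)]
        else 1 := by
  rw [intWeight, genWeight, Finset.prod_comm, ← Finset.prod_mul_distrib,
    ← (siteEquiv d r).prod_comp, Finset.prod_range]
  refine Finset.prod_congr rfl fun t _ => ?_
  congr 1
  refine Finset.prod_congr rfl fun i _ => ?_
  have h : ((siteEquiv d r t).1 + e i ∈ box d (r + 1)) ↔ coord r t i + 1 < sideL r :=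
    succ_mem_iff (d := d) (r := r) (t := t) i
  by_cases hc : coord r t i + 1 < sideL r
  · rw [if_pos hc, dif_pos (h.mpr hc)]
    have h2 := (siteOf_add t.2 hc).2
    have h3 : (⟨siteOf d r (t + sideL r ^ (i : ℕ)), siteOf_mem _⟩ : box d (r + 1)) =
      ⟨(siteEquiv d r t).1 + e i, h.mpr hc⟩ := Subtype.ext h2
    simp only [valAt, h3]
    rfl
  · rw [if_neg hc, dif_neg (fun h' => hc (h.mp h'))]

/-- The transfer matrix recursion computes the partition function of the cube. -/
theorem partA_eq (hq : 0 < q) (h0 : ¬ Key d r O ((nSites d r - 1) / 2)) {ξ y : ℕ} (x : Fin q)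
    (hξ : ξ < ringQ d q r) (hy : y < keyQ d q r O) :
    partA d q r O ξ y x = ∑ w : Config d q (box d (r + 1)),
      if ringCode w = ξ ∧ keyCode O w = y ∧ w ⟨0, zero_mem_box⟩ = x then intWeight r O w
      else 0 := by
  -- At full height the window lies beyond the last site, so any continuation of the configuration
  -- will do; the window 0 represents the constant 0.
  rw [partA, row_eq hq (nSites d r) (fun _ => 0) 0 (fun _ => hq) (by simp),
    ← ((siteEquiv d r).arrowCongr (Equiv.refl (Fin q))).symm.sum_comp]
  refine Finset.sum_congr rfl fun w => fun _ => ?_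
  set f := overwrite (((siteEquiv d r).arrowCongr (Equiv.refl (Fin q))).symm w) (fun _ => 0) with hf
  have hfw : ∀ t < nSites d r, f t = valAt w t := by
    intro t ht
    simp only [hf, overwrite, dif_pos ht]
    rfl
  have hF : ∀ t ∈ Finset.range (nSites d r), locF d q r O ξ y x f t =
      (if forced d q r O ξ y x t (valAt w t) = valAt w t then 1 else 0) *
      (O 0 [(valAt w t : ℤ), (r : ℤ)] *
      ∏ i : Fin d, if coord r t i + 1 < sideL r then
        O 1 [((i : ℕ) : ℤ), (valAt w t : ℤ), (valAt w (t + sideL r ^ (i : ℕ)) : ℤ), (r : ℤ)]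
        else 1) := by
    intro t ht
    rw [Finset.mem_range] at ht
    rw [locF, hfw t ht, mul_assoc]
    congr 2
    refine Finset.prod_congr rfl fun i _ => ?_
    split_ifs with hc
    · rw [hfw _ (siteOf_add ht hc).1]
    · rfl
  rw [Finset.prod_congr rfl hF, Finset.prod_mul_distrib, ← intWeight_eq, Finset.prod_boole]
  simp only [Finset.mem_range, forced_iff h0 x hξ hy, ite_mul, one_mul, zero_mul]

end PartA


/-! ## Partition functions and strong spatial mixing -/

section Weights

variable {d q : ℕ} (Φ : Interaction d q)

/-- The restriction of a configuration on the lattice to a finite set. -/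
def rst (W : Finset (Site d)) (X : Site d → Fin q) : Config d q W := fun v => X v

/-- The configuration `X` with its values on `V` replaced by those of `w`. -/
def glue {V : Finset (Site d)} (w : Config d q V) (X : Site d → Fin q) : Site d → Fin q :=
  fun v => if h : v ∈ V then w ⟨v, h⟩ else X v

/-- The edges in direction `i` inside a set. -/
def edges (W : Finset (Site d)) (i : Fin d) : Finset (Site d) := W.filter fun v => v + e i ∈ W

lemma weight_rst (W : Finset (Site d)) (X : Site d → Fin q) :
    Φ.weight (rst W X) =
      (∏ v ∈ W, Φ.γ (X v)) * ∏ i, ∏ v ∈ edges W i, Φ.β i (X v) (X (v + e i)) := by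
  rw [Interaction.weight]
  congr 1
  · exact Finset.prod_coe_sort W (fun v => Φ.γ (X v))
  · refine Finset.prod_congr rfl fun i _ => ?_
    rw [edges, Finset.prod_filter, ← Finset.prod_coe_sort W]
    refine Finset.prod_congr rfl fun v _ => ?_
    split_ifs <;> rfl

lemma weight_nonneg {W : Finset (Site d)} (w : Config d q W) : 0 ≤ Φ.weight w := by
  refine mul_nonneg (Finset.prod_nonneg fun v _ => (Φ.γ_pos _).le)
    (Finset.prod_nonneg fun i _ => Finset.prod_nonneg fun v _ => ?_)
  split_ifs
  · exact Φ.β_nonneg _ _ _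
  · norm_num

lemma add_mem_of_bdry {V : Finset (Site d)} {v : Site d} (hv : v ∈ V) (i : Fin d) :
    v + e i ∈ V ∪ bdry V := by
  by_cases h : v + e i ∈ V
  · exact Finset.mem_union_left _ h
  · refine Finset.mem_union_right _ (Finset.mem_sdiff.mpr ⟨?_, h⟩)
    simp only [Finset.mem_biUnion, Finset.mem_univ, true_and]
    exact ⟨v, hv, i, by simp⟩

lemma mem_of_add_bdry {V : Finset (Site d)} {v : Site d} {i : Fin d} (hv : v + e i ∈ V) :
    v ∈ V ∪ bdry V := by
  by_cases h : v ∈ V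
  · exact Finset.mem_union_left _ h
  · refine Finset.mem_union_right _ (Finset.mem_sdiff.mpr ⟨?_, h⟩)
    simp only [Finset.mem_biUnion, Finset.mem_univ, true_and]
    exact ⟨v + e i, hv, i, by simp⟩

/-- The weight of the sites and edges in `W` that do not touch `V`. -/
def outerWeight (W V : Finset (Site d)) (X : Site d → Fin q) : ℝ :=
  (∏ v ∈ W \ (V ∪ bdry V), Φ.γ (X v)) *
    ∏ i, ∏ v ∈ edges W i \ edges (V ∪ bdry V) i, Φ.β i (X v) (X (v + e i))

/-- An edge that meets V lies in V ∪ ∂V, so the second factor does not see the values on V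
(`outerWeight_congr`) and cancels in all conditional probabilities. This permits weights on the full
cube of radius r + 1, which is larger than V ∪ ∂V because of its corners and lower-dimensional
faces. -/
lemma weight_eq_mul_outerWeight {W V : Finset (Site d)} (hW : V ∪ bdry V ⊆ W)
    (X : Site d → Fin q) :
    Φ.weight (rst W X) = Φ.weight (rst (V ∪ bdry V) X) * outerWeight Φ W V X := by
  have h1 : ∀ i, edges (V ∪ bdry V) i ⊆ edges W i := fun i v hv => by
    rw [edges, Finset.mem_filter] at hv ⊢
    exact ⟨hW hv.1, hW hv.2⟩
  rw [weight_rst, weight_rst, outerWeight, mul_mul_mul_comm, ← Finset.prod_mul_distrib,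
    ← Finset.prod_sdiff hW, mul_comm (∏ v ∈ W \ (V ∪ bdry V), Φ.γ (X v))]
  congr 1
  refine Finset.prod_congr rfl fun i _ => ?_
  rw [← Finset.prod_sdiff (h1 i), mul_comm]

lemma outerWeight_congr {W V : Finset (Site d)} {X X' : Site d → Fin q}
    (h : ∀ v, v ∉ V → X v = X' v) : outerWeight Φ W V X = outerWeight Φ W V X' := by
  rw [outerWeight, outerWeight]
  congr 1
  · refine Finset.prod_congr rfl fun v hv => ?_
    rw [Finset.mem_sdiff, Finset.mem_union, not_or] at hv
    rw [h v hv.2.1]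
  · refine Finset.prod_congr rfl fun i _ => Finset.prod_congr rfl fun v hv => ?_
    rw [Finset.mem_sdiff, edges, edges, Finset.mem_filter, Finset.mem_filter] at hv
    rw [h v fun hV => hv.2 ⟨Finset.mem_union_left _ hV, add_mem_of_bdry hV i⟩,
      h (v + e i) fun hV => hv.2 ⟨mem_of_add_bdry hV, Finset.mem_union_left _ hV⟩]

lemma glue_apply_of_mem {V : Finset (Site d)} (w : Config d q V) (X : Site d → Fin q) {v : Site d}
    (h : v ∈ V) : glue w X v = w ⟨v, h⟩ := dif_pos h

lemma glue_apply_of_not_mem {V : Finset (Site d)} (w : Config d q V) (X : Site d → Fin q)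
    {v : Site d} (h : v ∉ V) : glue w X v = X v := dif_neg h

lemma concat_rst {V T : Finset (Site d)} (w : Config d q V) (X : Site d → Fin q) :
    concat w (rst T X) = rst (V ∪ T) (glue w X) := rfl

open Classical in
/-- The partition function on `V` with boundary configuration `X`, restricted to an event. The
weights are those of the configurations on a larger set `W`. -/
def pf (W V : Finset (Site d)) (X : Site d → Fin q) (E : Set (Config d q V)) : ℝ :=
  ∑ w : Config d q V, if w ∈ E then Φ.weight (rst W (glue w X)) else 0

/-- The configurations on `V` that agree with `X` on `S`. -/
def agree (V S : Finset (Site d)) (X : Site d → Fin q) : Set (Config d q V) :=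
  {w | ∀ v : V, v.1 ∈ S → w v = X v}

variable {Φ}

lemma pf_nonneg (W V : Finset (Site d)) (X : Site d → Fin q) (E : Set (Config d q V)) :
    0 ≤ pf Φ W V X E := by
  refine Finset.sum_nonneg fun w _ => ?_
  split_ifs
  · exact weight_nonneg Φ _
  · exact le_rfl

lemma pf_mono {W V : Finset (Site d)} {X : Site d → Fin q} {E E' : Set (Config d q V)}
    (h : E ⊆ E') : pf Φ W V X E ≤ pf Φ W V X E' := by
  refine Finset.sum_le_sum fun w _ => ?_
  by_cases hw : w ∈ E
  · rw [if_pos hw, if_pos (h hw)]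
  · rw [if_neg hw]
    split_ifs
    · exact weight_nonneg Φ _
    · exact le_rfl

lemma pf_eq_mul {W V : Finset (Site d)} (hW : V ∪ bdry V ⊆ W) (X : Site d → Fin q)
    (E : Set (Config d q V)) :
    pf Φ W V X E = pf Φ (V ∪ bdry V) V X E * outerWeight Φ W V X := by
  rw [pf, pf, Finset.sum_mul]
  refine Finset.sum_congr rfl fun w _ => ?_
  split_ifs
  · rw [weight_eq_mul_outerWeight Φ hW]
    congr 1
    exact outerWeight_congr Φ fun v hv => glue_apply_of_not_mem w X hv
  · rw [zero_mul]

lemma outerWeight_nonneg (W V : Finset (Site d)) (X : Site d → Fin q) :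
    0 ≤ outerWeight Φ W V X :=
  mul_nonneg (Finset.prod_nonneg fun _ _ => (Φ.γ_pos _).le)
    (Finset.prod_nonneg fun _ _ => Finset.prod_nonneg fun _ _ => Φ.β_nonneg _ _ _)

lemma specProb_eq (V : Finset (Site d)) (X : Site d → Fin q)
    (E : Set (Config d q (V ∪ bdry V))) :
    Φ.specProb V (rst (bdry V) X) E =
      pf Φ (V ∪ bdry V) V X {w | rst (V ∪ bdry V) (glue w X) ∈ E} /
        pf Φ (V ∪ bdry V) V X Set.univ := by
  rw [Interaction.specProb, pf, Finset.sum_div]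
  refine Finset.sum_congr rfl fun w _ => ?_
  have hs : Φ.spec V (rst (bdry V) X) w = Φ.weight (rst (V ∪ bdry V) (glue w X)) /
      pf Φ (V ∪ bdry V) V X Set.univ := by
    simp [Interaction.spec, concat_rst, pf]
  rw [concat_rst, hs]
  by_cases h : rst (V ∪ bdry V) (glue w X) ∈ E
  · rw [if_pos h, if_pos (show w ∈ {w | rst (V ∪ bdry V) (glue w X) ∈ E} from h)]
  · rw [if_neg h, if_neg (show w ∉ {w | rst (V ∪ bdry V) (glue w X) ∈ E} from h), zero_div]

/-- Strong spatial mixing, for partition functions. -/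
lemma ssm_pf {C α : ℝ} (hC : 0 < C)
    (hS : ∀ (V : Finset (Site d)) (u : Site d) (hu : u ∈ V) (T : Finset (Site d))
      (h₁ : bdry V ⊆ T) (h₂ : T ⊆ V ∪ bdry V) (x : Fin q) (y z : Config d q T),
      Φ.Admissible V (res h₁ y) → Φ.Admissible V (res h₁ z) →
      0 < Φ.specProb V (res h₁ y) (cylIn h₂ y) →
      0 < Φ.specProb V (res h₁ z) (cylIn h₂ z) →
      |Φ.specProb V (res h₁ y)
            ({c | c ⟨u, Finset.mem_union_left _ hu⟩ = x} ∩ cylIn h₂ y) /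
          Φ.specProb V (res h₁ y) (cylIn h₂ y) -
        Φ.specProb V (res h₁ z)
            ({c | c ⟨u, Finset.mem_union_left _ hu⟩ = x} ∩ cylIn h₂ z) /
          Φ.specProb V (res h₁ z) (cylIn h₂ z)| ≤
        C * Real.exp (-α * (distTo u (diffSet y z) : ℝ)))
    (hα : 0 < α) {W V S : Finset (Site d)} (hW : V ∪ bdry V ⊆ W) (hSV : S ⊆ V) {u : Site d}
    (hu : u ∈ V) (x : Fin q) {X X' : Site d → Fin q} {n : ℕ}
    (hn : ∀ v ∈ S ∪ bdry V, X v ≠ X' v → n ≤ l1 u v)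
    (hX : 0 < pf Φ W V X (agree V S X)) (hX' : 0 < pf Φ W V X' (agree V S X')) :
    |pf Φ W V X ({w | w ⟨u, hu⟩ = x} ∩ agree V S X) / pf Φ W V X (agree V S X) -
      pf Φ W V X' ({w | w ⟨u, hu⟩ = x} ∩ agree V S X') / pf Φ W V X' (agree V S X')| ≤
      C * Real.exp (-α * n) := by
  set T := S ∪ bdry V with hT
  have h₁ : bdry V ⊆ T := Finset.subset_union_right
  have h₂ : T ⊆ V ∪ bdry V := Finset.union_subset_union_left hSV
  have key : ∀ Y : Site d → Fin q, 0 < pf Φ W V Y (agree V S Y) →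
      Φ.Admissible V (res h₁ (rst T Y)) ∧ 0 < Φ.specProb V (res h₁ (rst T Y)) (cylIn h₂ (rst T Y)) ∧
      Φ.specProb V (res h₁ (rst T Y)) ({c | c ⟨u, Finset.mem_union_left _ hu⟩ = x} ∩
        cylIn h₂ (rst T Y)) / Φ.specProb V (res h₁ (rst T Y)) (cylIn h₂ (rst T Y)) =
      pf Φ W V Y ({w | w ⟨u, hu⟩ = x} ∩ agree V S Y) / pf Φ W V Y (agree V S Y) := by
    intro Y hY
    have hr : res h₁ (rst T Y) = rst (bdry V) Y := rfl
    have e1 : {w | rst (V ∪ bdry V) (glue w Y) ∈ cylIn h₂ (rst T Y)} = agree V S Y := by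
      ext w
      constructor
      · intro h v hv
        have := congrFun h ⟨v, Finset.mem_union_left _ hv⟩
        simpa [res, rst, glue_apply_of_mem w Y v.2] using this
      · intro h
        funext v
        change glue w Y v = Y v
        by_cases hv : v.1 ∈ V
        · rw [glue_apply_of_mem w Y hv]
          refine h ⟨v, hv⟩ ?_
          rcases Finset.mem_union.mp v.2 with h' | h'
          · exact h'
          · exact absurd hv (Finset.mem_sdiff.mp h').2
        · exact glue_apply_of_not_mem w Y hv
    have e2 : {w | rst (V ∪ bdry V) (glue w Y) ∈ {c : Config d q (V ∪ bdry V) |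
        c ⟨u, Finset.mem_union_left _ hu⟩ = x} ∩ cylIn h₂ (rst T Y)} =
        {w | w ⟨u, hu⟩ = x} ∩ agree V S Y := by
      rw [← e1]
      ext w
      simp [rst, glue_apply_of_mem w Y hu]
    rw [pf_eq_mul hW] at hY
    have ho : 0 < outerWeight Φ W V Y := by
      rcases (outerWeight_nonneg (Φ := Φ) W V Y).lt_or_eq with h | h
      · exact h
      · rw [← h, mul_zero] at hY; exact absurd hY (lt_irrefl _)
    have hp : 0 < pf Φ (V ∪ bdry V) V Y (agree V S Y) := pos_of_mul_pos_left hY ho.le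
    have hu' : 0 < pf Φ (V ∪ bdry V) V Y Set.univ := hp.trans_le (pf_mono (Set.subset_univ _))
    refine ⟨?_, ?_, ?_⟩
    · rw [hr]
      obtain ⟨w, -, hw⟩ := Finset.exists_ne_zero_of_sum_ne_zero hu'.ne'
      refine ⟨w, lt_of_le_of_ne (weight_nonneg Φ _) (Ne.symm ?_)⟩
      simpa [concat_rst] using hw
    · rw [hr, specProb_eq, e1]; positivity
    · rw [hr, specProb_eq, specProb_eq, e1, e2, pf_eq_mul hW, pf_eq_mul hW]
      field_simp
  obtain ⟨a1, b1, c1⟩ := key X hX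
  obtain ⟨a2, b2, c2⟩ := key X' hX'
  have hpos : 0 ≤ C * Real.exp (-α * n) := by positivity
  -- The distance to the empty set is 0 by convention, for which SSM gives only the bound C; in that
  -- case the two sides agree.
  by_cases hd : (diffSet (rst T X) (rst T X')).Nonempty
  · have := hS V u hu T h₁ h₂ x _ _ a1 a2 b1 b2
    rw [c1, c2] at this
    refine this.trans ?_
    have hle : n ≤ distTo u (diffSet (rst T X) (rst T X')) := by
      refine le_csInf (hd.image _) ?_
      rintro _ ⟨v, ⟨hv, hne⟩, rfl⟩
      exact hn v hv hne
    have hle' : (n : ℝ) ≤ distTo u (diffSet (rst T X) (rst T X')) := by exact_mod_cast hle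
    gcongr C * Real.exp ?_
    nlinarith
  · have heq : rst T X = rst T X' := by
      funext v
      by_contra hne
      exact hd ⟨v.1, v.2, hne⟩
    rw [← c1, ← c2, heq, sub_self, abs_zero]
    exact hpos

end Weights


/-! ### Mixing for partition functions and the chain rule -/

section Mixing

variable {d q : ℕ} {Φ : Interaction d q} {C α : ℝ}

/-- Strong spatial mixing with given constants, for partition functions. -/
def Mixing (Φ : Interaction d q) (C α : ℝ) : Prop :=
  ∀ (W V S : Finset (Site d)), V ∪ bdry V ⊆ W → S ⊆ V → ∀ (u : Site d) (hu : u ∈ V) (x : Fin q)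
    (X X' : Site d → Fin q) (n : ℕ), (∀ v ∈ S ∪ bdry V, X v ≠ X' v → n ≤ l1 u v) →
    0 < pf Φ W V X (agree V S X) → 0 < pf Φ W V X' (agree V S X') →
    |pf Φ W V X ({w | w ⟨u, hu⟩ = x} ∩ agree V S X) / pf Φ W V X (agree V S X) -
      pf Φ W V X' ({w | w ⟨u, hu⟩ = x} ∩ agree V S X') / pf Φ W V X' (agree V S X')| ≤
      C * Real.exp (-α * n)

lemma _root_.GibbsEntropy.Interaction.SSM.mixing (h : Φ.SSM) :
    ∃ C α : ℝ, 0 < C ∧ 0 < α ∧ Mixing Φ C α := by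
  obtain ⟨C, α, hC, hα, hS⟩ := h
  exact ⟨C, α, hC, hα, fun W V S hW hSV u hu x X X' n hn hX hX' =>
    ssm_pf hC hS hα hW hSV hu x hn hX hX'⟩

lemma agree_empty (V : Finset (Site d)) (X : Site d → Fin q) : agree V ∅ X = Set.univ := by
  ext w; simp [agree]

lemma agree_insert {V S : Finset (Site d)} {u : Site d} (hu : u ∈ V) (X : Site d → Fin q) :
    agree V (insert u S) X = {w | w ⟨u, hu⟩ = X u} ∩ agree V S X := by
  ext w
  constructor
  · exact fun h => ⟨h ⟨u, hu⟩ (Finset.mem_insert_self _ _),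
      fun v hv => h v (Finset.mem_insert_of_mem hv)⟩
  · rintro ⟨h1, h2⟩ v hv
    rcases Finset.mem_insert.mp hv with h | h
    · have : v = ⟨u, hu⟩ := Subtype.ext h
      subst this
      exact h1
    · exact h2 v h

/-- The influence of the boundary on the probability of a configuration on a set. -/
lemma Mixing.chain (h : Mixing Φ C α) (hC : 0 < C) {W V S : Finset (Site d)}
    (hW : V ∪ bdry V ⊆ W) (hSV : S ⊆ V) {X X' : Site d → Fin q} (hXX : ∀ v ∈ S, X v = X' v) {n : ℕ}
    (hn : ∀ u ∈ S, ∀ v ∈ bdry V, n ≤ l1 u v) (hX : 0 < pf Φ W V X Set.univ)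
    (hX' : 0 < pf Φ W V X' Set.univ) :
    |pf Φ W V X (agree V S X) / pf Φ W V X Set.univ -
      pf Φ W V X' (agree V S X') / pf Φ W V X' Set.univ| ≤ S.card * (C * Real.exp (-α * n)) := by
  classical
  set ε := C * Real.exp (-α * n) with hε
  have hε0 : 0 ≤ ε := by positivity
  induction S using Finset.induction_on with
  | empty => simp [agree_empty, div_self hX.ne', div_self hX'.ne']
  | @insert u S hu ih =>
    have huV : u ∈ V := hSV (Finset.mem_insert_self _ _)
    have hS' : S ⊆ V := fun v hv => hSV (Finset.mem_insert_of_mem hv)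
    have ih' := ih hS' (fun v hv => hXX v (Finset.mem_insert_of_mem hv))
      (fun v hv => hn v (Finset.mem_insert_of_mem hv))
    rw [agree_insert huV, agree_insert huV, Finset.card_insert_of_notMem hu]
    push_cast
    set a := pf Φ W V X (agree V S X)
    set a' := pf Φ W V X' (agree V S X')
    set b := pf Φ W V X ({w | w ⟨u, huV⟩ = X u} ∩ agree V S X)
    set b' := pf Φ W V X' ({w | w ⟨u, huV⟩ = X' u} ∩ agree V S X')
    set z := pf Φ W V X Set.univ
    set z' := pf Φ W V X' Set.univ
    have hb : 0 ≤ b := pf_nonneg _ _ _ _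
    have hb' : 0 ≤ b' := pf_nonneg _ _ _ _
    have ha0 : 0 ≤ a := pf_nonneg _ _ _ _
    have ha0' : 0 ≤ a' := pf_nonneg _ _ _ _
    have hba : b ≤ a := pf_mono Set.inter_subset_right
    have hba' : b' ≤ a' := pf_mono Set.inter_subset_right
    have haz' : a' ≤ z' := pf_mono (Set.subset_univ _)
    have haz : a ≤ z := pf_mono (Set.subset_univ _)
    -- SSM says nothing if the sites revealed so far already have probability zero under one of the
    -- boundaries. Then the probability under the other one is bounded by the induction hypothesis,
    -- and revealing one more site only decreases it.
    rcases (hb.trans hba).eq_or_lt with ha | ha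
    · have hb0 : b = 0 := le_antisymm (ha ▸ hba) hb
      rw [← ha, zero_div, zero_sub, abs_neg, abs_of_nonneg (by positivity)] at ih'
      rw [hb0, zero_div, zero_sub, abs_neg, abs_of_nonneg (by positivity)]
      calc b' / z' ≤ a' / z' := by gcongr
        _ ≤ _ := by nlinarith
    · rcases (hb'.trans hba').eq_or_lt with ha' | ha'
      · have hb0 : b' = 0 := le_antisymm (ha' ▸ hba') hb'
        rw [← ha', zero_div, sub_zero, abs_of_nonneg (by positivity)] at ih'
        rw [hb0, zero_div, sub_zero, abs_of_nonneg (by positivity)]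
        calc b / z ≤ a / z := by gcongr
          _ ≤ _ := by nlinarith
      -- The two backgrounds agree on the revealed sites, so they differ only on the boundary, at
      -- distance at least `n`.
      · have hm := h W V S hW hS' u huV (X u) X X' n (fun v hv hne => by
          rcases Finset.mem_union.mp hv with h1 | h1
          · exact absurd (hXX v (Finset.mem_insert_of_mem h1)) hne
          · exact hn u (Finset.mem_insert_self _ _) v h1) ha ha'
        have hxu : X' u = X u := (hXX u (Finset.mem_insert_self _ _)).symm
        have e1 : b / z = a / z * (b / a) := by field_simp
        have e2 : b' / z' = a' / z' * (b' / a') := by field_simp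
        have hm' : |b / a - b' / a'| ≤ ε := by
          simpa only [b', hxu] using hm
        have h1 : b / a ≤ 1 := (div_le_one ha).mpr hba
        have h2 : a' / z' ≤ 1 := (div_le_one hX').mpr haz'
        have h3 : 0 ≤ b / a := by positivity
        have h4 : 0 ≤ a' / z' := by positivity
        rw [e1, e2, show a / z * (b / a) - a' / z' * (b' / a') =
          (a / z - a' / z') * (b / a) + a' / z' * (b / a - b' / a') by ring]
        refine (abs_add_le _ _).trans ?_
        rw [abs_mul, abs_mul, abs_of_nonneg h3, abs_of_nonneg h4, add_mul, one_mul]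
        refine add_le_add ?_ ?_
        · exact (mul_le_of_le_one_right (abs_nonneg _) h1).trans ih'
        · exact (mul_le_of_le_one_left (abs_nonneg _) h2).trans hm'

end Mixing

/-! ## Gibbs measures -/

section Gibbs

variable {d q : ℕ} {Φ : Interaction d q} {μ : Measure (Site d → Fin q)}

lemma measurableSet_cyl {S : Finset (Site d)} (w : Config d q S) : MeasurableSet (cyl w) := by
  have : cyl w = ⋂ v : S, (fun x : Site d → Fin q => x v.1) ⁻¹' {w v} := by
    ext x; simp [cyl]
  rw [this]
  exact MeasurableSet.iInter fun v => measurable_pi_apply v.1 (measurableSet_singleton _)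

lemma cyl_rst_subset {S T : Finset (Site d)} (h : S ⊆ T) (X : Site d → Fin q) :
    cyl (rst T X) ⊆ cyl (rst S X) := fun _ hx v => hx ⟨v.1, h v.2⟩

lemma cond_real {Ω : Type*} [MeasurableSpace Ω] {ν : Measure Ω} {A : Set Ω}
    (hA : MeasurableSet A) (B : Set Ω) : (ν[|A]).real B = ν.real (A ∩ B) / ν.real A := by
  rw [measureReal_def, cond_apply hA, ENNReal.toReal_mul, ENNReal.toReal_inv, mul_comm]
  rfl

lemma real_eq_sum_cyl [IsFiniteMeasure μ] (T : Finset (Site d)) {E : Set (Site d → Fin q)}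
    (hE : MeasurableSet E) : μ.real E = ∑ ζ : Config d q T, μ.real (E ∩ cyl ζ) := by
  rw [← measureReal_iUnion_fintype]
  · congr 1
    ext x
    simp only [Set.mem_iUnion, Set.mem_inter_iff, exists_and_left, iff_self_and]
    exact fun _ => ⟨rst T x, fun v => rfl⟩
  · intro ζ ζ' hne
    refine Set.disjoint_left.mpr fun x hx hx' => hne ?_
    funext v
    rw [← hx.2 v, ← hx'.2 v]
  · exact fun ζ => hE.inter (measurableSet_cyl ζ)

lemma spec_eq (V : Finset (Site d)) (X : Site d → Fin q) (v : Config d q V) :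
    Φ.spec V (rst (bdry V) X) v =
      Φ.weight (rst (V ∪ bdry V) (glue v X)) / pf Φ (V ∪ bdry V) V X Set.univ := by
  simp [Interaction.spec, concat_rst, pf]

lemma glue_rst (V : Finset (Site d)) (X : Site d → Fin q) : glue (rst V X) X = X := by
  funext v
  by_cases h : v ∈ V
  · rw [glue_apply_of_mem _ _ h]; rfl
  · rw [glue_apply_of_not_mem _ _ h]

lemma cyl_rst_eq {S : Finset (Site d)} {X : Site d → Fin q} {w : Config d q S}
    (h : ∀ v : S, X v = w v) : rst S X = w := funext h

/-- Configurations of positive measure have positive weight. -/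
lemma IsGibbs.weight_pos (hμ : IsGibbs Φ μ) {W : Finset (Site d)} {X : Site d → Fin q}
    (hX : 0 < μ.real (cyl (rst W X))) : 0 < Φ.weight (rst W X) := by
  have := hμ.isProbabilityMeasure
  -- Some extension to the boundary of W also has positive measure. There the specification forces a
  -- positive weight on W ∪ ∂W, and the factors of the weight on W are among its factors.
  rw [real_eq_sum_cyl (bdry W) (measurableSet_cyl _)] at hX
  obtain ⟨δ, -, hδ⟩ := Finset.exists_ne_zero_of_sum_ne_zero hX.ne'
  have hpos : 0 < μ.real (cyl (rst W X) ∩ cyl δ) := lt_of_le_of_ne measureReal_nonneg hδ.symm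
  have hne : (cyl (rst W X) ∩ cyl δ).Nonempty := by
    by_contra h
    rw [Set.not_nonempty_iff_eq_empty] at h
    simp [h] at hpos
  obtain ⟨Y, hY, hY'⟩ := hne
  have e1 : rst W X = rst W Y := (cyl_rst_eq hY).symm
  have e2 : δ = rst (bdry W) Y := (cyl_rst_eq hY').symm
  rw [e1, e2] at hpos
  rw [e1]
  have h1 : 0 < μ.real (cyl (rst (bdry W) Y)) :=
    hpos.trans_le (measureReal_mono Set.inter_subset_right)
  have h2 := (hμ.gibbs W _ h1).2 (rst W Y)
  rw [cond_real (measurableSet_cyl _), spec_eq, glue_rst, Set.inter_comm] at h2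
  have h3 : Φ.weight (rst (W ∪ bdry W) Y) ≠ 0 := by
    intro h
    rw [h, zero_div] at h2
    exact (div_pos hpos h1).ne' h2
  refine lt_of_le_of_ne (weight_nonneg Φ _) (Ne.symm ?_)
  intro h
  rw [weight_rst] at h h3
  rcases mul_eq_zero.mp h with h | h
  · obtain ⟨v, hv, h⟩ := Finset.prod_eq_zero_iff.mp h
    exact (Φ.γ_pos _).ne' h
  · obtain ⟨i, hi, h⟩ := Finset.prod_eq_zero_iff.mp h
    obtain ⟨v, hv, h⟩ := Finset.prod_eq_zero_iff.mp h
    refine h3 (mul_eq_zero_of_right _ (Finset.prod_eq_zero hi (Finset.prod_eq_zero (i := v) ?_ h)))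
    rw [edges, Finset.mem_filter] at hv ⊢
    exact ⟨Finset.mem_union_left _ hv.1, Finset.mem_union_left _ hv.2⟩

/-- The Gibbs equation, conditioned on any T containing ∂V by the Markov property, and with weights
on W, since the surplus factor cancels. That T contains W \ V determines the configuration on W,
which gives the positivity of the partition function. -/
lemma IsGibbs.real_cyl_inter (hμ : IsGibbs Φ μ) {V T W : Finset (Site d)} (hT : bdry V ⊆ T)
    (hTV : Disjoint T V) (hW : V ∪ bdry V ⊆ W) (hWT : W \ V ⊆ T) (X : Site d → Fin q)
    (hX : 0 < μ.real (cyl (rst T X))) :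
    0 < pf Φ W V X Set.univ ∧ ∀ v : Config d q V, μ.real (cyl v ∩ cyl (rst T X)) =
      μ.real (cyl (rst T X)) * (Φ.weight (rst W (glue v X)) / pf Φ W V X Set.univ) := by
  have := hμ.isProbabilityMeasure
  have h1 : 0 < μ.real (cyl (rst (bdry V) X)) :=
    hX.trans_le (measureReal_mono (cyl_rst_subset hT X))
  have hr : res hT (rst T X) = rst (bdry V) X := rfl
  have hpos : 0 < pf Φ W V X Set.univ := by
    have hX' := hX
    rw [real_eq_sum_cyl V (measurableSet_cyl _)] at hX'
    obtain ⟨v, -, hv⟩ := Finset.exists_ne_zero_of_sum_ne_zero hX'.ne'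
    have hsub : cyl (rst T X) ∩ cyl v ⊆ cyl (rst W (glue v X)) := by
      rintro Y ⟨hY, hY'⟩ u
      change Y u = glue v X u
      by_cases hu : u.1 ∈ V
      · rw [glue_apply_of_mem _ _ hu]; exact hY' ⟨u, hu⟩
      · rw [glue_apply_of_not_mem _ _ hu]
        exact hY ⟨u, hWT (Finset.mem_sdiff.mpr ⟨u.2, hu⟩)⟩
    have h2 := hμ.weight_pos ((lt_of_le_of_ne measureReal_nonneg hv.symm).trans_le
      (measureReal_mono hsub))
    refine h2.trans_le ?_
    rw [pf]
    simp only [Set.mem_univ, if_true]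
    exact Finset.single_le_sum (f := fun v => Φ.weight (rst W (glue v X)))
      (fun v _ => weight_nonneg Φ _) (Finset.mem_univ v)
  refine ⟨hpos, fun v => ?_⟩
  have hm := hμ.isMRF V v T hT hTV (rst T X) hX
  rw [hr, (hμ.gibbs V _ h1).2 v, cond_real (measurableSet_cyl _), spec_eq] at hm
  rw [Set.inter_comm, ← mul_div_cancel₀ (μ.real (cyl (rst T X) ∩ cyl v)) hX.ne', ← hm]
  congr 1
  rw [pf_eq_mul hW] at hpos ⊢
  have ho : outerWeight Φ W V X ≠ 0 := right_ne_zero_of_mul hpos.ne'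
  rw [weight_eq_mul_outerWeight Φ hW, outerWeight_congr Φ (X := glue v X) (X' := X)
    fun u hu => glue_apply_of_not_mem v X hu, mul_div_mul_right _ _ ho]

end Gibbs


/-! ## The conditional entropy in terms of partition functions of a cube -/

section Formula

variable {d q : ℕ} {Φ : Interaction d q} {μ : Measure (Site d → Fin q)}

/-- The event that `x` occurs at the origin, together with a cylinder. -/
def originCyl {K : Finset (Site d)} (u : Config d q K) (x : Fin q) : Set (Site d → Fin q) :=
  cyl u ∩ {X | X 0 = x}

lemma measurableSet_originCyl {K : Finset (Site d)} (u : Config d q K) (x : Fin q) :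
    MeasurableSet (originCyl u x) := by
  have h : {X : Site d → Fin q | X 0 = x} = (fun X => X 0) ⁻¹' {x} := by ext; simp
  refine (measurableSet_cyl u).inter ?_
  rw [h]
  exact measurable_pi_apply 0 (measurableSet_singleton x)

lemma zero_mem_union {K : Finset (Site d)} : (0 : Site d) ∈ ({0} ∪ K : Finset (Site d)) :=
  Finset.mem_union_left _ (Finset.mem_singleton_self 0)

/-- Configurations on a set with an additional site. -/
def configInsertEquiv {K : Finset (Site d)} (h0 : (0 : Site d) ∉ K) :
    Config d q ({0} ∪ K) ≃ Config d q K × Fin q where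
  toFun w := (res Finset.subset_union_right w, w ⟨0, zero_mem_union⟩)
  invFun p v := if h : v.1 ∈ K then p.1 ⟨v, h⟩ else p.2
  left_inv w := by
    funext v
    by_cases h : v.1 ∈ K
    · change (if h : v.1 ∈ K then _ else _) = _
      rw [dif_pos h]
      rfl
    · have hv : v = ⟨0, zero_mem_union⟩ := Subtype.ext (by
        rcases Finset.mem_union.mp v.2 with h' | h'
        · simpa using h'
        · exact absurd h' h)
      change (if h : v.1 ∈ K then _ else _) = _
      rw [dif_neg h, hv]
  right_inv p := by
    ext v
    · simp [res]
    · simp [h0]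

lemma condEntropy_eq [IsProbabilityMeasure μ] {K : Finset (Site d)} (h0 : (0 : Site d) ∉ K) :
    condEntropy μ {0} K = ∑ u : Config d q K, μ.real (cyl u) *
      ∑ x, Real.negMulLog (μ.real (originCyl u x) / μ.real (cyl u)) := by
  rw [condEntropy, ← (configInsertEquiv h0).symm.sum_comp, Fintype.sum_prod_type]
  refine Finset.sum_congr rfl fun u _ => ?_
  rw [Finset.mul_sum]
  refine Finset.sum_congr rfl fun x _ => ?_
  have h1 : res (T := K) Finset.subset_union_right ((configInsertEquiv h0).symm (u, x)) = u :=
    congrArg Prod.fst ((configInsertEquiv h0).apply_symm_apply (u, x))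
  have h2 : (configInsertEquiv h0).symm (u, x) ⟨0, zero_mem_union⟩ = x :=
    congrArg Prod.snd ((configInsertEquiv h0).apply_symm_apply (u, x))
  have h3 : cyl ((configInsertEquiv h0).symm (u, x)) = originCyl u x := by
    ext X
    constructor
    · intro hX
      refine ⟨fun v => ?_, (hX ⟨0, zero_mem_union⟩).trans h2⟩
      rw [← congrFun h1 v]
      exact hX ⟨v.1, Finset.mem_union_right _ v.2⟩
    · rintro ⟨hX, hX0⟩ v
      by_cases hv : v.1 ∈ K
      · rw [hX ⟨v, hv⟩, ← congrFun h1 ⟨v, hv⟩]; rfl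
      · have hv' : v = ⟨0, zero_mem_union⟩ := Subtype.ext (by
          rcases Finset.mem_union.mp v.2 with h' | h'
          · simpa using h'
          · exact absurd h' hv)
        subst hv'
        rw [h2]
        exact hX0
  rw [h1, h3, Real.negMulLog]
  have hle : μ.real (originCyl u x) ≤ μ.real (cyl u) := measureReal_mono Set.inter_subset_left
  rcases (measureReal_nonneg (μ := μ) (s := cyl u)).eq_or_lt with h | h
  · have : μ.real (originCyl u x) = 0 := le_antisymm (h ▸ hle) measureReal_nonneg
    rw [this, ← h]; simp
  · field_simp

lemma condEntropy_eq_zero [IsProbabilityMeasure μ] {K : Finset (Site d)} (h0 : (0 : Site d) ∈ K) :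
    condEntropy μ {0} K = 0 := by
  rw [condEntropy]
  refine Finset.sum_eq_zero fun w _ => ?_
  have : cyl (res (T := K) Finset.subset_union_right w) = cyl w := by
    ext X
    constructor
    · intro hX v
      have hv : v.1 ∈ K := by
        rcases Finset.mem_union.mp v.2 with h | h
        · rw [Finset.mem_singleton] at h; rwa [h]
        · exact h
      exact hX ⟨v, hv⟩
    · exact fun hX v => hX ⟨v.1, Finset.mem_union_right _ v.2⟩
  rw [this]
  rcases eq_or_ne (μ.real (cyl w)) 0 with h | h
  · rw [h, zero_mul, neg_zero]
  · rw [div_self h, Real.log_one, mul_zero, neg_zero]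

variable {r : ℕ} {K : Finset (Site d)} {O : Oracle}

lemma box_union_bdry_subset : box d r ∪ bdry (box d r) ⊆ box d (r + 1) := by
  intro v hv
  rw [mem_box]
  intro j
  rcases Finset.mem_union.mp hv with h | h
  · have := mem_box.mp h j
    push_cast
    omega
  · have h := (Finset.mem_sdiff.mp h).1
    simp only [Finset.mem_biUnion, Finset.mem_univ, true_and, Finset.mem_insert,
      Finset.mem_singleton] at h
    obtain ⟨u, hu, i, h | h⟩ := h
    all_goals
      have := mem_box.mp hu j
      subst h
      by_cases hij : j = i
      · subst hij
        simp only [e, Pi.add_apply, Pi.sub_apply, Pi.single_eq_same]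
        push_cast
        omega
      · simp only [e, Pi.add_apply, Pi.sub_apply, Pi.single_eq_of_ne hij]
        push_cast
        omega

/-- The sum over the configurations on the inner cube, in terms of codes. -/
lemma sum_glue (X : Site d → Fin q) (G : Config d q (box d (r + 1)) → ℝ) :
    ∑ v : Config d q (box d r), G (rst (box d (r + 1)) (glue v X)) =
      ∑ w : Config d q (box d (r + 1)),
        if ringCode w = ringCode (rst (box d (r + 1)) X) then G w else 0 := by
  have hsub : box d r ⊆ box d (r + 1) := Finset.subset_union_left.trans box_union_bdry_subset
  rw [← Finset.sum_filter]
  refine Finset.sum_bij' (fun v _ => rst (box d (r + 1)) (glue v X)) (fun w _ => res hsub w)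
    ?_ ?_ ?_ ?_ ?_
  · intro v _
    rw [Finset.mem_filter, ringCode_eq_iff]
    exact ⟨Finset.mem_univ _, fun u hu => glue_apply_of_not_mem _ _ hu⟩
  · intro w _
    exact Finset.mem_univ _
  · intro v _
    funext u
    exact glue_apply_of_mem v X u.2
  · intro w hw
    rw [Finset.mem_filter, ringCode_eq_iff] at hw
    funext u
    by_cases hu : u.1 ∈ box d r
    · exact glue_apply_of_mem _ _ hu
    · exact (glue_apply_of_not_mem _ _ hu).trans (hw.2 u hu).symm
  · intro v _
    rfl

/-- The partition function with a prescribed boundary configuration. -/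
def ringPf (Φ : Interaction d q) (r ξ : ℕ) : ℝ :=
  ∑ w : Config d q (box d (r + 1)), if ringCode w = ξ then Φ.weight w else 0

lemma pf_univ_eq (X : Site d → Fin q) :
    pf Φ (box d (r + 1)) (box d r) X Set.univ =
      ringPf Φ r (ringCode (rst (box d (r + 1)) X)) := by
  rw [ringPf, ← sum_glue]
  simp [pf]

/-- The outside of the cube that is relevant for the entropy. -/
def outside (K : Finset (Site d)) (r : ℕ) : Finset (Site d) := (box d (r + 1) ∪ K) \ box d r

/-- The extension of a configuration on the outside to the lattice. -/
def extend (a₀ : Fin q) (ζ : Config d q (outside K r)) : Site d → Fin q := glue ζ fun _ => a₀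

/-- The conditional probability of a configuration on the cube. -/
def condWeight (Φ : Interaction d q) (r ξ : ℕ) (w : Config d q (box d (r + 1))) : ℝ :=
  (if ringCode w = ξ then Φ.weight w else 0) / ringPf Φ r ξ

/-- The code of the boundary configuration of a configuration on the outside. -/
def outRing (a₀ : Fin q) (ζ : Config d q (outside K r)) : ℕ :=
  ringCode (rst (box d (r + 1)) (extend a₀ ζ))

/-- The part of a configuration on the outside that is in the given set. -/
def outKey (a₀ : Fin q) (ζ : Config d q (outside K r)) : Config d q (K \ box d r) :=
  rst (K \ box d r) (extend a₀ ζ)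

lemma rst_extend (a₀ : Fin q) (ζ : Config d q (outside K r)) :
    rst (outside K r) (extend a₀ ζ) = ζ := by
  funext v
  change extend a₀ ζ v.1 = ζ v
  exact dif_pos v.2

/-- The configuration on the given set. -/
def onKey (a₀ : Fin q) (ζ : Config d q (outside K r)) (w : Config d q (box d (r + 1))) :
    Config d q K :=
  fun k => glue w (extend a₀ ζ) k

lemma IsGibbs.ringPf_pos (hμ : IsGibbs Φ μ) (a₀ : Fin q) (ζ : Config d q (outside K r))
    (hζ : 0 < μ.real (cyl ζ)) : 0 < ringPf Φ r (outRing a₀ ζ) ∧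
    ∀ v : Config d q (box d r), μ.real (cyl v ∩ cyl ζ) = μ.real (cyl ζ) *
      (Φ.weight (rst (box d (r + 1)) (glue v (extend a₀ ζ))) / ringPf Φ r (outRing a₀ ζ)) := by
  have h := hμ.real_cyl_inter (V := box d r) (T := outside K r) (W := box d (r + 1))
    (fun v hv => Finset.mem_sdiff.mpr ⟨Finset.mem_union_left _ (box_union_bdry_subset
      (Finset.mem_union_right _ hv)), (Finset.mem_sdiff.mp hv).2⟩)
    Finset.sdiff_disjoint box_union_bdry_subset
    (Finset.sdiff_subset_sdiff Finset.subset_union_left subset_rfl) (extend a₀ ζ)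
    (by rwa [rst_extend])
  rwa [rst_extend, pf_univ_eq] at h

/-- Probabilities as sums over configurations on the outside and on the cube. -/
lemma IsGibbs.real_eq_sum (hμ : IsGibbs Φ μ) (a₀ : Fin q) {E : Set (Site d → Fin q)}
    (hE : MeasurableSet E) (p : Config d q (outside K r) → Config d q (box d (r + 1)) → Prop)
    [∀ ζ w, Decidable (p ζ w)]
    (hp : ∀ X : Site d → Fin q, X ∈ E ↔ p (rst _ X) (rst _ X)) :
    μ.real E = ∑ ζ : Config d q (outside K r), ∑ w : Config d q (box d (r + 1)),
      if p ζ w then μ.real (cyl ζ) * condWeight Φ r (outRing a₀ ζ) w else 0 := by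
  have := hμ.isProbabilityMeasure
  rw [real_eq_sum_cyl (outside K r) hE]
  refine Finset.sum_congr rfl fun ζ _ => ?_
  rw [real_eq_sum_cyl (box d r) (hE.inter (measurableSet_cyl ζ))]
  have h1 : ∀ v : Config d q (box d r), μ.real (E ∩ cyl ζ ∩ cyl v) =
      if p ζ (rst _ (glue v (extend a₀ ζ))) then μ.real (cyl ζ) *
        (Φ.weight (rst (box d (r + 1)) (glue v (extend a₀ ζ))) / ringPf Φ r (outRing a₀ ζ))
      else 0 := by
    intro v
    have hX : ∀ X ∈ cyl ζ ∩ cyl v, rst (outside K r) X = ζ ∧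
        rst (box d (r + 1)) X = rst _ (glue v (extend a₀ ζ)) := by
      rintro X ⟨h, h'⟩
      refine ⟨funext h, ?_⟩
      funext u
      by_cases hu : u.1 ∈ box d r
      · exact (h' ⟨u, hu⟩).trans (glue_apply_of_mem v _ hu).symm
      · refine Eq.trans ?_ (glue_apply_of_not_mem v _ hu).symm
        have hu' : u.1 ∈ outside K r :=
          Finset.mem_sdiff.mpr ⟨Finset.mem_union_left _ u.2, hu⟩
        exact (h ⟨u, hu'⟩).trans (glue_apply_of_mem ζ _ hu').symm
    split_ifs with hpz
    · have : E ∩ cyl ζ ∩ cyl v = cyl v ∩ cyl ζ := by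
        rw [Set.inter_assoc, Set.inter_comm (cyl v)]
        refine Set.inter_eq_right.mpr fun X hX' => (hp X).mpr ?_
        rwa [(hX X hX').1, (hX X hX').2]
      rw [this]
      -- For ζ of measure zero the partition function may vanish and the Gibbs equation is not
      -- available, but both sides are zero.
      rcases (measureReal_nonneg (μ := μ) (s := cyl ζ)).eq_or_lt with h | h
      · rw [← h, zero_mul]
        exact le_antisymm (h ▸ measureReal_mono Set.inter_subset_right) measureReal_nonneg
      · exact (hμ.ringPf_pos a₀ ζ h).2 v
    · have : E ∩ cyl ζ ∩ cyl v = ∅ := by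
        rw [Set.inter_assoc, Set.eq_empty_iff_forall_notMem]
        rintro X ⟨hXE, hX'⟩
        have := (hp X).mp hXE
        rw [(hX X hX').1, (hX X hX').2] at this
        exact hpz this
      rw [this, measureReal_empty]
  rw [Finset.sum_congr rfl fun v _ => h1 v,
    sum_glue (extend a₀ ζ) fun w => if p ζ w then μ.real (cyl ζ) *
        (Φ.weight w / ringPf Φ r (outRing a₀ ζ)) else 0]
  refine Finset.sum_congr rfl fun w _ => ?_
  rw [condWeight, ← outRing]
  split_ifs <;> simp

end Formula


section Formula

variable {d q : ℕ} {Φ : Interaction d q} {μ : Measure (Site d → Fin q)} {r : ℕ}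
  {K : Finset (Site d)} {O : Oracle}

/-- The hypothesis makes w and ζ agree on the outer layer, so the part of `K` in this layer can be
read off from ζ, leaving only the inner cube to w. -/
lemma onKey_apply {a₀ : Fin q} {ζ : Config d q (outside K r)} {w : Config d q (box d (r + 1))}
    (h : ringCode w = outRing a₀ ζ) (k : K) : onKey a₀ ζ w k =
      if hk : k.1 ∈ box d r then w ⟨k, box_union_bdry_subset (Finset.mem_union_left _ hk)⟩
      else extend a₀ ζ k := by
  rw [onKey]
  split_ifs with hk
  · exact glue_apply_of_mem w _ _
  · by_cases hk' : k.1 ∈ box d (r + 1)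
    · rw [glue_apply_of_mem w _ hk']
      exact ringCode_eq_iff.mp h ⟨k, hk'⟩ hk
    · exact glue_apply_of_not_mem w _ hk'

/-- The configuration on `K` consists of a part outside the inner cube, carried by ζ, and a part
inside, recorded by `keyCode`. -/
lemma onKey_eq_iff (hO : ∀ v : Site d, O 2 (List.ofFn v) = if v ∈ K then 1 else 0) {a₀ : Fin q}
    {ζ ζ' : Config d q (outside K r)} {w w' : Config d q (box d (r + 1))}
    (h : ringCode w = outRing a₀ ζ) (h' : ringCode w' = outRing a₀ ζ') :
    onKey a₀ ζ' w' = onKey a₀ ζ w ↔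
      outKey a₀ ζ' = outKey a₀ ζ ∧ keyCode O w' = keyCode O w := by
  rw [keyCode_eq_iff hO]
  constructor
  · intro he
    have he' : ∀ k : K, _ := fun k =>
      (onKey_apply h' k).symm.trans ((congrFun he k).trans (onKey_apply h k))
    constructor
    · funext k
      have hk := Finset.mem_sdiff.mp k.2
      have := he' ⟨k, hk.1⟩
      rwa [dif_neg hk.2, dif_neg hk.2] at this
    · intro v hv
      have hk := Finset.mem_inter.mp hv
      have := he' ⟨v, hk.2⟩
      rwa [dif_pos hk.1, dif_pos hk.1] at this
  · rintro ⟨h1, h2⟩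
    funext k
    rw [onKey_apply h, onKey_apply h']
    split_ifs with hk
    · exact h2 ⟨k, _⟩ (Finset.mem_inter.mpr ⟨hk, k.2⟩)
    · exact congrFun h1 ⟨k, Finset.mem_sdiff.mpr ⟨k.2, hk⟩⟩

lemma onKey_rst (a₀ : Fin q) (X : Site d → Fin q) :
    onKey a₀ (rst (outside K r) X) (rst (box d (r + 1)) X) = rst K X := by
  funext k
  rw [onKey]
  by_cases hk : k.1 ∈ box d (r + 1)
  · exact glue_apply_of_mem _ _ hk
  · rw [glue_apply_of_not_mem _ _ hk]
    have : k.1 ∈ outside K r := Finset.mem_sdiff.mpr ⟨Finset.mem_union_right _ k.2, fun h =>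
      hk (box_union_bdry_subset (Finset.mem_union_left _ h))⟩
    exact dif_pos this

lemma mem_cyl_iff {S : Finset (Site d)} {u : Config d q S} {X : Site d → Fin q} :
    X ∈ cyl u ↔ rst S X = u := ⟨fun h => funext h, fun h v => congrFun h v⟩

lemma sum_fiber {A B U : Type*} [Fintype A] [Fintype B] [Fintype U] [DecidableEq U]
    (J : A → B → ℝ) (k : A → B → U) (G : U → ℝ) :
    ∑ u, (∑ a, ∑ b, if k a b = u then J a b else 0) * G u = ∑ a, ∑ b, J a b * G (k a b) := by
  simp only [Finset.sum_mul]
  rw [Finset.sum_comm]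
  refine Finset.sum_congr rfl fun a _ => ?_
  rw [Finset.sum_comm]
  refine Finset.sum_congr rfl fun b _ => ?_
  simp

/-- Each configuration on `K` is replaced by the pairs (ζ, w) that induce it, and the sum over it by
the sum over the pairs (`sum_fiber`). Pairs that disagree on the outer layer have weight zero, which
is why the splitting of `K` in `onKey_eq_iff` may be used throughout. -/
lemma IsGibbs.condEntropy_formula (hμ : IsGibbs Φ μ) (h0 : (0 : Site d) ∉ K)
    (hO : ∀ v : Site d, O 2 (List.ofFn v) = if v ∈ K then 1 else 0) (a₀ : Fin q)
    (J : Config d q (outside K r) → Config d q (box d (r + 1)) → ℝ)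
    (hJ : ∀ ζ w, J ζ w = μ.real (cyl ζ) * condWeight Φ r (outRing a₀ ζ) w) :
    condEntropy μ {0} K = ∑ ζ, ∑ w, J ζ w * ∑ x, Real.negMulLog
      ((∑ ζ', ∑ w', if outKey a₀ ζ' = outKey a₀ ζ ∧ keyCode O w' = keyCode O w ∧
          w' ⟨0, zero_mem_box⟩ = x then J ζ' w' else 0) /
        ∑ ζ', ∑ w', if outKey a₀ ζ' = outKey a₀ ζ ∧ keyCode O w' = keyCode O w then
          J ζ' w' else 0) := by
  have := hμ.isProbabilityMeasure
  have hring : ∀ ζ w, J ζ w ≠ 0 → ringCode w = outRing a₀ ζ := by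
    intro ζ w h
    by_contra hne
    rw [hJ, condWeight, if_neg hne] at h
    simp at h
  have h1 : ∀ u : Config d q K, μ.real (cyl u) =
      ∑ ζ, ∑ w, if onKey a₀ ζ w = u then J ζ w else 0 := by
    intro u
    simp only [hJ]
    exact hμ.real_eq_sum a₀ (measurableSet_cyl u) (fun ζ w => onKey a₀ ζ w = u)
      fun X => by rw [onKey_rst, mem_cyl_iff]
  have h2 : ∀ (u : Config d q K) (x : Fin q), μ.real (originCyl u x) =
      ∑ ζ, ∑ w, if onKey a₀ ζ w = u ∧ w ⟨0, zero_mem_box⟩ = x then J ζ w else 0 := by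
    intro u x
    simp only [hJ]
    exact hμ.real_eq_sum a₀ (measurableSet_originCyl u x)
      (fun ζ w => onKey a₀ ζ w = u ∧ w ⟨0, zero_mem_box⟩ = x)
      fun X => by rw [onKey_rst, originCyl, Set.mem_inter_iff, mem_cyl_iff]; rfl
  have h3 : ∀ (ζ : Config d q (outside K r)) (w : Config d q (box d (r + 1))), J ζ w ≠ 0 →
      ∑ x, Real.negMulLog (μ.real (originCyl (onKey a₀ ζ w) x) / μ.real (cyl (onKey a₀ ζ w))) =
      ∑ x, Real.negMulLog
      ((∑ ζ', ∑ w', if outKey a₀ ζ' = outKey a₀ ζ ∧ keyCode O w' = keyCode O w ∧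
          w' ⟨0, zero_mem_box⟩ = x then J ζ' w' else 0) /
        ∑ ζ', ∑ w', if outKey a₀ ζ' = outKey a₀ ζ ∧ keyCode O w' = keyCode O w then
          J ζ' w' else 0) := by
    intro ζ w h
    refine Finset.sum_congr rfl fun x _ => congrArg Real.negMulLog (congrArg₂ (· / ·) ?_ ?_)
    · rw [h2]
      refine Finset.sum_congr rfl fun ζ' _ => Finset.sum_congr rfl fun w' _ => ?_
      rcases eq_or_ne (J ζ' w') 0 with h' | h'
      · rw [h', ite_self, ite_self]
      · simp only [onKey_eq_iff hO (hring ζ w h) (hring ζ' w' h'), and_assoc]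
    · rw [h1]
      refine Finset.sum_congr rfl fun ζ' _ => Finset.sum_congr rfl fun w' _ => ?_
      rcases eq_or_ne (J ζ' w') 0 with h' | h'
      · rw [h', ite_self, ite_self]
      · simp only [onKey_eq_iff hO (hring ζ w h) (hring ζ' w' h')]
  rw [condEntropy_eq h0]
  refine Eq.trans (Finset.sum_congr rfl fun u _ => congrArg₂ (· * ·) (h1 u) rfl)
    ((sum_fiber J (onKey a₀) fun u => ∑ x, Real.negMulLog
      (μ.real (originCyl u x) / μ.real (cyl u))).trans ?_)
  refine Finset.sum_congr rfl fun ζ _ => Finset.sum_congr rfl fun w _ => ?_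
  rcases eq_or_ne (J ζ w) 0 with h | h
  · rw [h, zero_mul, zero_mul]
  · rw [h3 ζ w h]

lemma sum_real_cyl [IsProbabilityMeasure μ] (T : Finset (Site d)) :
    ∑ ζ : Config d q T, μ.real (cyl ζ) = 1 := by
  have := real_eq_sum_cyl (μ := μ) T MeasurableSet.univ
  simpa using this.symm

end Formula


/-! ## The function `-p log p` and its approximation -/

section NegMulLog

open Real

/-- With v = t^(1/4) one has -t log t = 4 v⁴ log(1/v) ≤ 4 (v³ - v⁴) ≤ v², the last step being v² (2v
- 1)² ≥ 0. -/
lemma negMulLog_le_sqrt {t : ℝ} (ht : 0 ≤ t) : negMulLog t ≤ √t := by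
  rcases ht.eq_or_lt with rfl | ht
  · simp
  set v := √(√t) with hv
  have hu : 0 < √t := sqrt_pos.mpr ht
  have hv0 : 0 < v := sqrt_pos.mpr hu
  have hvu : v ^ 2 = √t := sq_sqrt hu.le
  have hvt : v ^ 4 = t := by rw [show v ^ 4 = (v ^ 2) ^ 2 by ring, hvu, sq_sqrt ht.le]
  have h := log_le_sub_one_of_pos (inv_pos.mpr hv0)
  rw [log_inv] at h
  rw [negMulLog, ← hvt, log_pow, hvt, ← hvu, ← hvt]
  push_cast
  have h2 : v ^ 4 * (-log v) ≤ v ^ 4 * (v⁻¹ - 1) := mul_le_mul_of_nonneg_left h (by positivity)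
  have h3 : v ^ 4 * (v⁻¹ - 1) = v ^ 3 - v ^ 4 := by field_simp
  nlinarith [sq_nonneg (2 * v - 1), sq_nonneg v, mul_nonneg (sq_nonneg v) (sq_nonneg (2 * v - 1))]

lemma negMulLog_add_le {a t : ℝ} (ha : 0 ≤ a) (ht : 0 ≤ t) :
    negMulLog (a + t) ≤ negMulLog a + negMulLog t := by
  rcases ha.eq_or_lt with rfl | ha
  · simp
  rcases ht.eq_or_lt with rfl | ht
  · simp
  have h1 : log a ≤ log (a + t) := log_le_log ha (by linarith)
  have h2 : log t ≤ log (a + t) := log_le_log ht (by linarith)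
  simp only [negMulLog]
  nlinarith

/-- The derivative -log p - 1 is at least -1 on (0, 1]. -/
lemma negMulLog_sub_le {a b : ℝ} (ha : 0 ≤ a) (hab : a ≤ b) (hb : b ≤ 1) :
    negMulLog a - negMulLog b ≤ b - a := by
  rcases ha.eq_or_lt with rfl | ha
  · have := mul_nonpos_of_nonneg_of_nonpos hab (log_nonpos hab hb)
    simp only [negMulLog]
    linarith
  have hb0 : 0 < b := ha.trans_le hab
  have h1 := log_le_sub_one_of_pos (div_pos hb0 ha)
  rw [log_div hb0.ne' ha.ne'] at h1
  have h2 : a * (log b - log a) ≤ a * (b / a - 1) := mul_le_mul_of_nonneg_left h1 ha.le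
  have h3 : a * (b / a - 1) = b - a := by field_simp
  have h4 := mul_nonpos_of_nonneg_of_nonpos (sub_nonneg.mpr hab) (log_nonpos hb0.le hb)
  simp only [negMulLog]
  linarith

/-- The modulus of continuity of `-p log p`. -/
lemma abs_negMulLog_sub_le {a b : ℝ} (ha : 0 ≤ a) (ha' : a ≤ 1) (hb : 0 ≤ b) (hb' : b ≤ 1) :
    |negMulLog a - negMulLog b| ≤ √|a - b| := by
  wlog hab : a ≤ b generalizing a b
  · rw [abs_sub_comm, abs_sub_comm a]
    exact this hb hb' ha ha' (le_of_not_ge hab)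
  rw [abs_sub_comm a, abs_of_nonneg (sub_nonneg.mpr hab)]
  -- An increase of -p log p is controlled by subadditivity and the square root bound, a decrease by
  -- the slope -1.
  refine abs_le.mpr ⟨?_, ?_⟩
  · have h1 := negMulLog_add_le ha (sub_nonneg.mpr hab)
    have h2 := negMulLog_le_sqrt (sub_nonneg.mpr hab)
    rw [add_sub_cancel] at h1
    linarith
  · refine (negMulLog_sub_le ha hab hb').trans (le_sqrt_of_sq_le ?_)
    nlinarith

/-- The logarithm of N / j is approximated by the sum of 1/i over j < i ≤ N, which needs rational
arithmetic only. The error is at most 1/j, so after multiplication by j it is at most 1, uniformly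
in j. -/
lemma harmonic_bounds {j N : ℕ} (hj : 1 ≤ j) (hN : j ≤ N) :
    (∑ i ∈ Finset.range N, if j < i + 1 then 1 / ((i : ℝ) + 1) else 0) ≤ log N - log j ∧
    log N - log j + 1 / N ≤
      (∑ i ∈ Finset.range N, if j < i + 1 then 1 / ((i : ℝ) + 1) else 0) + 1 / j := by
  induction N, hN using Nat.le_induction with
  | base =>
    have : (∑ i ∈ Finset.range j, if j < i + 1 then 1 / ((i : ℝ) + 1) else 0) = 0 :=
      Finset.sum_eq_zero fun i hi => by
        rw [Finset.mem_range] at hi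
        rw [if_neg (by omega)]
    rw [this]
    simp
  | succ N hN ih =>
    have hN0 : (0 : ℝ) < N := by exact_mod_cast (show 0 < N by omega)
    rw [Finset.sum_range_succ, if_pos (by omega)]
    have h1 := log_le_sub_one_of_pos (show (0 : ℝ) < (N + 1) / N by positivity)
    have h2 := log_le_sub_one_of_pos (show (0 : ℝ) < N / (N + 1) by positivity)
    rw [log_div (by positivity) (by positivity)] at h1 h2
    have h3 : ((N : ℝ) + 1) / N - 1 = 1 / N := by field_simp; ring
    have h4 : (N : ℝ) / (N + 1) - 1 = -(1 / (N + 1)) := by field_simp; ring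
    rw [h3] at h1
    rw [h4] at h2
    push_cast
    constructor
    · linarith [ih.1]
    · linarith [ih.2]

lemma ediv_bounds (a : ℤ) {b : ℤ} (hb : 0 < b) :
    ((a / b : ℤ) : ℝ) ≤ (a : ℝ) / b ∧ (a : ℝ) / b < ((a / b : ℤ) : ℝ) + 1 := by
  have hb' : (0 : ℝ) < b := by exact_mod_cast hb
  rw [le_div_iff₀ hb', div_lt_iff₀ hb']
  constructor
  · exact_mod_cast Int.ediv_mul_le a hb.ne'
  · exact_mod_cast Int.lt_ediv_add_one_mul_self a hb

/-- The 3 consists of 1 from the harmonic sum, 1 from rounding its M terms before the division by M,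
and 1 from rounding that division. -/
lemma phi_bounds {M : ℕ} (hM : 0 < M) {j : ℕ} (hj : j ≤ M) :
    (phi M j : ℝ) ≤ M * negMulLog (j / M) ∧ M * negMulLog (j / M) ≤ phi M j + 3 := by
  have hM' : (0 : ℝ) < M := by exact_mod_cast hM
  rcases Nat.eq_zero_or_pos j with rfl | hj0
  · simp [phi]
  have hj' : (0 : ℝ) < j := by exact_mod_cast hj0
  have hf : (M : ℝ) * negMulLog (j / M) = j * (log M - log j) := by
    rw [negMulLog, log_div hj'.ne' hM'.ne']
    field_simp
    ring
  set s : ℤ := ∑ i ∈ Finset.range M, if 0 < ((i + 1 : ℕ) : ℤ) - (j : ℤ) then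
    (j : ℤ) * M / ((i + 1 : ℕ) : ℤ) else 0 with hs
  set h : ℝ := ∑ i ∈ Finset.range M, if j < i + 1 then 1 / ((i : ℝ) + 1) else 0 with hh
  have h1 : (s : ℝ) ≤ j * M * h ∧ (j : ℝ) * M * h ≤ s + M := by
    have hterm : ∀ i ∈ Finset.range M,
        (((if 0 < ((i + 1 : ℕ) : ℤ) - (j : ℤ) then
          (j : ℤ) * M / ((i + 1 : ℕ) : ℤ) else 0 : ℤ)) : ℝ) ≤
          j * M * (if j < i + 1 then 1 / ((i : ℝ) + 1) else 0) ∧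
        (j : ℝ) * M * (if j < i + 1 then 1 / ((i : ℝ) + 1) else 0) ≤
        (((if 0 < ((i + 1 : ℕ) : ℤ) - (j : ℤ) then
          (j : ℤ) * M / ((i + 1 : ℕ) : ℤ) else 0 : ℤ)) : ℝ) + 1 := by
      intro i _
      by_cases hi : j < i + 1
      · rw [if_pos hi, if_pos (by omega)]
        have := ediv_bounds ((j : ℤ) * M) (b := ((i + 1 : ℕ) : ℤ)) (by positivity)
        push_cast at this ⊢
        rw [mul_one_div]
        exact ⟨this.1, this.2.le⟩
      · rw [if_neg hi, if_neg (by omega)]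
        simp
    constructor
    · rw [hs, hh, Finset.mul_sum]
      push_cast
      refine Finset.sum_le_sum fun i hi => ?_
      have := (hterm i hi).1
      push_cast at this
      exact this
    · have := Finset.sum_le_sum fun i hi => (hterm i hi).2
      rw [← Finset.mul_sum, Finset.sum_add_distrib] at this
      rw [hs, Int.cast_sum, hh]
      refine this.trans (le_of_eq ?_)
      rw [Finset.sum_const, Finset.card_range, nsmul_eq_mul, mul_one]
  have h2 := ediv_bounds s (b := (M : ℤ)) (by exact_mod_cast hM)
  have h3 := harmonic_bounds hj0 hj
  rw [← hh] at h3
  have h4 : phi M j = s / (M : ℤ) := rfl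
  rw [hf, h4]
  push_cast at h2
  have h5 : (s : ℝ) / M ≤ j * h := by
    rw [div_le_iff₀ hM']; linarith [h1.1]
  have h6 : (j : ℝ) * h ≤ s / M + 1 := by
    rw [← sub_le_iff_le_add, le_div_iff₀ hM']; linarith [h1.2]
  have h7 : (j : ℝ) * h ≤ j * (log M - log j) := mul_le_mul_of_nonneg_left h3.1 hj'.le
  have h8 : (j : ℝ) * (log M - log j) ≤ j * (h + 1 / j) :=
    mul_le_mul_of_nonneg_left (by have : 0 ≤ 1 / (M : ℝ) := by positivity
                                  linarith [h3.2]) hj'.le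
  have h9 : (j : ℝ) * (h + 1 / j) = j * h + 1 := by field_simp
  constructor
  · linarith [h2.1]
  · linarith [h2.2]

lemma phi_nonneg (M : ℕ) (j : ℕ) : 0 ≤ phi M j := by
  refine Int.ediv_nonneg (Finset.sum_nonneg fun i _ => ?_) (by positivity)
  split_ifs
  · positivity
  · exact le_rfl

lemma phi_le {M : ℕ} (hM : 0 < M) {j : ℕ} (hj : j ≤ M) : (phi M j : ℝ) ≤ M := by
  have hM' : (0 : ℝ) < M := by exact_mod_cast hM
  refine (phi_bounds hM hj).1.trans (mul_le_of_le_one_right hM'.le ?_)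
  refine (negMulLog_le_sqrt (by positivity)).trans ?_
  refine sqrt_le_iff.mpr ⟨zero_le_one, ?_⟩
  rw [one_pow]
  exact (div_le_one hM').mpr (by exact_mod_cast hj)

/-- The approximation of `-p log p` at points close to the grid. -/
lemma phi_approx {D : ℕ} (hD : 0 < D) {j : ℕ} (hj : j ≤ D ^ 2) {p c : ℝ} (hp : 0 ≤ p)
    (hp1 : p ≤ 1) (hc : |p * (D ^ 2 : ℕ) - j| ≤ c ^ 2) (hc0 : 0 ≤ c) :
    |(D ^ 2 : ℕ) * negMulLog p - phi (D ^ 2) j| ≤ c * D + 3 := by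
  have hM : 0 < D ^ 2 := by positivity
  have hD' : (0 : ℝ) < D := by exact_mod_cast hD
  have hM' : (0 : ℝ) < (D ^ 2 : ℕ) := by exact_mod_cast hM
  have hj1 : (j : ℝ) / (D ^ 2 : ℕ) ≤ 1 := (div_le_one hM').mpr (by exact_mod_cast hj)
  have h1 := abs_negMulLog_sub_le hp hp1 (show 0 ≤ (j : ℝ) / (D ^ 2 : ℕ) by positivity) hj1
  -- The modulus of continuity is a square root, so c² steps of the grid of mesh 1/D² become an
  -- error c/D.
  have h2 : √|p - (j : ℝ) / (D ^ 2 : ℕ)| ≤ c / D := by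
    rw [sqrt_le_left (by positivity)]
    have : p - (j : ℝ) / (D ^ 2 : ℕ) = (p * (D ^ 2 : ℕ) - j) / (D ^ 2 : ℕ) := by field_simp
    rw [this, abs_div, abs_of_pos hM', div_pow, Nat.cast_pow]
    gcongr
    exact_mod_cast hc
  have h3 := phi_bounds hM hj
  have h4 : (D ^ 2 : ℕ) * |negMulLog p - negMulLog (j / (D ^ 2 : ℕ))| ≤ c * D := by
    refine (mul_le_mul_of_nonneg_left (h1.trans h2) hM'.le).trans (le_of_eq ?_)
    push_cast
    field_simp
  have h5 : |(D ^ 2 : ℕ) * negMulLog p - (D ^ 2 : ℕ) * negMulLog (j / (D ^ 2 : ℕ))| ≤ c * D := by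
    rw [← mul_sub, abs_mul, abs_of_pos hM']
    exact h4
  rw [abs_le] at h5 ⊢
  constructor <;> linarith [h3.1, h3.2, h5.1, h5.2]

end NegMulLog


/-! ## Averages with respect to weights that are close to each other -/

section Avg

variable {Ω : Type*} [Fintype Ω]

/-- The total weight of the points with a property. -/
def wsum (I : Ω → ℝ) (Q : Ω → Prop) [DecidablePred Q] : ℝ := ∑ w, if Q w then I w else 0

/-- The average of a function over the points with a property. -/
def avg (I : Ω → ℝ) (Q : Ω → Prop) [DecidablePred Q] (g : Ω → ℝ) : ℝ :=
  wsum (fun w => I w * g w) Q / wsum I Q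

variable {I J : Ω → ℝ} {Q : Ω → Prop} [DecidablePred Q]

lemma wsum_nonneg (h : ∀ w, 0 ≤ I w) : 0 ≤ wsum I Q := by
  refine Finset.sum_nonneg fun w _ => ?_
  split_ifs
  · exact h w
  · exact le_rfl

lemma wsum_le_mul {c : ℝ} (h : ∀ w, I w ≤ c * J w) : wsum I Q ≤ c * wsum J Q := by
  rw [wsum, wsum, Finset.mul_sum]
  refine Finset.sum_le_sum fun w _ => ?_
  split_ifs
  · exact h w
  · simp

lemma wsum_pos_of (h : ∀ w, 0 ≤ I w) {w : Ω} (hw : Q w) (hI : 0 < I w) : 0 < wsum I Q :=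
  hI.trans_le (by
    have := Finset.single_le_sum (f := fun w => if Q w then I w else 0) (fun w _ => by
      split_ifs
      · exact h w
      · exact le_rfl) (Finset.mem_univ w)
    rw [if_pos hw] at this
    exact this)

lemma exists_of_wsum_pos (h : 0 < wsum I Q) : ∃ w, Q w ∧ I w ≠ 0 := by
  obtain ⟨w, -, hw⟩ := Finset.exists_ne_zero_of_sum_ne_zero h.ne'
  by_cases hQ : Q w
  · exact ⟨w, hQ, by simpa [hQ] using hw⟩
  · simp [hQ] at hw

lemma avg_le (h : ∀ w, 0 ≤ I w) {g : Ω → ℝ} {B : ℝ} (hB : 0 ≤ B) (hg : ∀ w, g w ≤ B) :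
    avg I Q g ≤ B := by
  refine div_le_of_le_mul₀ (wsum_nonneg h) hB ?_
  refine wsum_le_mul fun w => ?_
  rw [mul_comm B]
  exact mul_le_mul_of_nonneg_left (hg w) (h w)

/-- Numerator and denominator each contribute a factor exp τ, and exp (2τ) - 1 ≤ 4τ as 2τ ≤ 1. -/
lemma ratio_le {N N' D D' s τ B : ℝ} (hN' : 0 ≤ N') (hD : 0 < D) (hD' : 0 < D')
    (h1 : N ≤ Real.exp τ * (s * N')) (h2 : s * D' ≤ Real.exp τ * D)
    (hτ : 0 ≤ τ) (hτ1 : τ ≤ 1 / 2) (hB : N' / D' ≤ B) : N / D - N' / D' ≤ 4 * τ * B := by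
  have h3 : N * D' ≤ Real.exp (2 * τ) * N' * D := by
    have e2 : Real.exp (2 * τ) = Real.exp τ * Real.exp τ := by rw [← Real.exp_add]; ring_nf
    calc N * D' ≤ Real.exp τ * (s * N') * D' := by gcongr
      _ = Real.exp τ * N' * (s * D') := by ring
      _ ≤ Real.exp τ * N' * (Real.exp τ * D) := by gcongr
      _ = Real.exp (2 * τ) * N' * D := by rw [e2]; ring
  have h4 : N / D ≤ Real.exp (2 * τ) * (N' / D') := by
    rw [div_le_iff₀ hD, mul_div_assoc', div_mul_eq_mul_div, le_div_iff₀ hD']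
    linarith
  have h5 := Real.abs_exp_sub_one_le (x := 2 * τ) (by rw [abs_of_nonneg (by linarith)]; linarith)
  rw [abs_of_nonneg (show 0 ≤ 2 * τ by linarith)] at h5
  have h6 := (abs_le.mp h5).2
  have h7 : 0 ≤ N' / D' := by positivity
  calc N / D - N' / D' ≤ (Real.exp (2 * τ) - 1) * (N' / D') := by linarith
    _ ≤ 4 * τ * (N' / D') := by
      refine mul_le_mul_of_nonneg_right ?_ h7
      linarith
    _ ≤ 4 * τ * B := by gcongr

/-- The unknown scale `s` cancels in the quotient; exchanging the roles of the two weights turns it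
into its inverse. -/
lemma avg_close {s τ B : ℝ} (hI : ∀ w, 0 ≤ I w) (hs : 0 < s) (hτ : 0 ≤ τ) (hτ1 : τ ≤ 1 / 2)
    (h1 : ∀ w, J w ≤ Real.exp τ * (s * I w)) (h2 : ∀ w, s * I w ≤ Real.exp τ * J w)
    {g : Ω → ℝ} (hg : ∀ w, 0 ≤ g w) (hB : ∀ w, g w ≤ B) (hB0 : 0 ≤ B) :
    |avg J Q g - avg I Q g| ≤ 4 * τ * B := by
  have hJ : ∀ w, 0 ≤ J w := fun w => by
    have := (mul_nonneg hs.le (hI w)).trans (h2 w)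
    exact nonneg_of_mul_nonneg_right this (Real.exp_pos _)
  have hDle : wsum J Q ≤ Real.exp τ * (s * wsum I Q) := by
    rw [← mul_assoc]
    exact wsum_le_mul fun w => by rw [mul_assoc]; exact h1 w
  have hDle' : s * wsum I Q ≤ Real.exp τ * wsum J Q := by
    have : wsum I Q ≤ Real.exp τ / s * wsum J Q := wsum_le_mul fun w => by
      rw [div_mul_eq_mul_div, le_div_iff₀ hs, mul_comm]; exact h2 w
    rwa [div_mul_eq_mul_div, le_div_iff₀ hs, mul_comm] at this
  have hNle : wsum (fun w => J w * g w) Q ≤ Real.exp τ * (s * wsum (fun w => I w * g w) Q) := by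
    rw [← mul_assoc]
    exact wsum_le_mul fun w => by
      have := mul_le_mul_of_nonneg_right (h1 w) (hg w)
      linarith
  have hNle' : s * wsum (fun w => I w * g w) Q ≤ Real.exp τ * wsum (fun w => J w * g w) Q := by
    have : wsum (fun w => I w * g w) Q ≤ Real.exp τ / s * wsum (fun w => J w * g w) Q :=
      wsum_le_mul fun w => by
        rw [div_mul_eq_mul_div, le_div_iff₀ hs]
        have := mul_le_mul_of_nonneg_right (h2 w) (hg w)
        linarith
    rwa [div_mul_eq_mul_div, le_div_iff₀ hs, mul_comm] at this
  have e0 : 0 ≤ 4 * τ * B := by positivity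
  -- The total weights vanish simultaneously, and then both averages are 0 by the convention for
  -- division by zero.
  rcases (wsum_nonneg (Q := Q) hI).eq_or_lt with h | h
  · have : wsum J Q = 0 := le_antisymm (by rw [← h] at hDle; simpa using hDle) (wsum_nonneg hJ)
    rw [avg, avg, this, ← h]
    simpa using e0
  · have hJ0 : 0 < wsum J Q := by
      have : 0 < Real.exp τ * wsum J Q := lt_of_lt_of_le (by positivity) hDle'
      exact pos_of_mul_pos_right this (Real.exp_pos _).le
    have hN0 := wsum_nonneg (Q := Q) fun w => mul_nonneg (hI w) (hg w)
    have hN0' := wsum_nonneg (Q := Q) fun w => mul_nonneg (hJ w) (hg w)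
    rw [abs_le]
    constructor
    · have := ratio_le (s := s⁻¹) hN0' h hJ0
        (by rw [mul_left_comm, ← div_eq_inv_mul, le_div_iff₀ hs, mul_comm]; exact hNle')
        (by rw [← div_eq_inv_mul, div_le_iff₀ hs]; linarith [hDle]) hτ hτ1
        (avg_le (Q := Q) hJ hB0 hB)
      have e : avg I Q g - avg J Q g ≤ 4 * τ * B := this
      linarith
    · exact ratio_le hN0 hJ0 h hNle hDle' hτ hτ1 (avg_le (Q := Q) hI hB0 hB)

lemma wsum_mul_avg (h : ∀ w, 0 ≤ I w) (g : Ω → ℝ) :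
    wsum I Q * avg I Q g = wsum (fun w => I w * g w) Q := by
  rcases (wsum_nonneg (Q := Q) h).eq_or_lt with h0 | h0
  · have hz : ∀ w, (if Q w then I w else 0) = 0 := fun w =>
      (Finset.sum_eq_zero_iff_of_nonneg (fun w _ => by
        split_ifs
        · exact h w
        · exact le_rfl)).mp h0.symm w (Finset.mem_univ w)
    rw [← h0, zero_mul, wsum]
    refine (Finset.sum_eq_zero fun w _ => ?_).symm
    have := hz w
    split_ifs with hQ
    · rw [if_pos hQ] at this; rw [this, zero_mul]
    · rfl
  · rw [avg]; field_simp

end Avg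

/-! ## The quantities computed by the algorithm -/

section Rounded

variable {Ω : Type*} [Fintype Ω] {q : ℕ}

/-- Real weights and integer weights that approximate them up to a scale. -/
structure Rounded (I : Ω → ℝ) (J : Ω → ℤ) (ρ κ : Ω → ℕ) (o : Ω → Fin q) (A : ℕ → ℕ → ℕ → ℤ)
    (Qx Qy D : ℕ) (τ s : ℝ) : Prop where
  I_nonneg : ∀ w, 0 ≤ I w
  s_pos : 0 < s
  τ_nonneg : 0 ≤ τ
  -- Passing between the two weights changes a conditional probability by at most 4τ, so this keeps
  -- the change below a quarter of a grid step.
  τ_le : 16 * τ * (D ^ 2 : ℕ) ≤ 1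
  q_pos : 0 < q
  le_D : 50 * q ≤ D
  le₁ : ∀ w, (J w : ℝ) ≤ Real.exp τ * (s * I w)
  le₂ : ∀ w, s * I w ≤ Real.exp τ * J w
  ρ_lt : ∀ w, ρ w < Qx
  κ_lt : ∀ w, κ w < Qy
  A_eq : ∀ ξ < Qx, ∀ y < Qy, ∀ x : Fin q,
    A ξ y x = ∑ w, if ρ w = ξ ∧ κ w = y ∧ o w = x then J w else 0

variable {I : Ω → ℝ} {J : Ω → ℤ} {ρ κ : Ω → ℕ} {o : Ω → Fin q} {A : ℕ → ℕ → ℕ → ℤ}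
  {Qx Qy D : ℕ} {τ s : ℝ}

namespace Rounded

variable (h : Rounded I J ρ κ o A Qx Qy D τ s)
include h

lemma J_nonneg (w : Ω) : 0 ≤ J w := by
  have := (mul_nonneg h.s_pos.le (h.I_nonneg w)).trans (h.le₂ w)
  exact_mod_cast nonneg_of_mul_nonneg_right this (Real.exp_pos _)

lemma D_pos : 0 < D := by have := h.q_pos; have := h.le_D; omega

lemma τ_le_half : τ ≤ 1 / 2 := by
  have h1 : (1 : ℝ) ≤ (D ^ 2 : ℕ) := by exact_mod_cast Nat.one_le_pow _ _ h.D_pos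
  nlinarith [h.τ_le, h.τ_nonneg]

lemma close {Q : Ω → Prop} [DecidablePred Q] {g : Ω → ℝ} {B : ℝ} (hg : ∀ w, 0 ≤ g w)
    (hB : ∀ w, g w ≤ B) (hB0 : 0 ≤ B) :
    |avg (fun w => (J w : ℝ)) Q g - avg I Q g| ≤ 4 * τ * B :=
  avg_close h.I_nonneg h.s_pos h.τ_nonneg h.τ_le_half h.le₁ h.le₂ hg hB hB0

/-- The mutual bounds give both weights the same zeros. So what the algorithm recognises as possible
is exactly what is possible. -/
lemma wsum_pos_iff {Q : Ω → Prop} [DecidablePred Q] :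
    0 < wsum (fun w => (J w : ℝ)) Q ↔ 0 < wsum I Q := by
  constructor
  · intro h1
    obtain ⟨w, hw, hJ⟩ := exists_of_wsum_pos h1
    refine wsum_pos_of h.I_nonneg hw (lt_of_le_of_ne (h.I_nonneg w) fun h0 => hJ ?_)
    have := h.le₁ w
    rw [← h0, mul_zero, mul_zero] at this
    exact le_antisymm this (by exact_mod_cast h.J_nonneg w)
  · intro h1
    obtain ⟨w, hw, hI⟩ := exists_of_wsum_pos h1
    refine wsum_pos_of (fun w => by exact_mod_cast h.J_nonneg w) hw
      (lt_of_le_of_ne (by exact_mod_cast h.J_nonneg w) fun h0 => hI ?_)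
    have := h.le₂ w
    rw [← h0, mul_zero] at this
    exact le_antisymm (by nlinarith [h.s_pos]) (h.I_nonneg w)

lemma sumX_eq {ξ y : ℕ} (hξ : ξ < Qx) (hy : y < Qy) :
    sumX A q ξ y = ∑ w, if ρ w = ξ ∧ κ w = y then J w else 0 := by
  rw [sumX, Finset.sum_range, Finset.sum_congr rfl fun x _ => h.A_eq ξ hξ y hy x, Finset.sum_comm]
  refine Finset.sum_congr rfl fun w _ => ?_
  by_cases hw : ρ w = ξ ∧ κ w = y
  · simp [hw.1, hw.2]
  · rw [if_neg hw]
    exact Finset.sum_eq_zero fun x _ => if_neg fun h' => hw ⟨h'.1, h'.2.1⟩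

lemma sumX_cast {ξ y : ℕ} (hξ : ξ < Qx) (hy : y < Qy) :
    (sumX A q ξ y : ℝ) = wsum (fun w => (J w : ℝ)) (fun w => ρ w = ξ ∧ κ w = y) := by
  rw [h.sumX_eq hξ hy, wsum]; push_cast; rfl

lemma A_cast {ξ y : ℕ} (hξ : ξ < Qx) (hy : y < Qy) (x : Fin q) :
    (A ξ y x : ℝ) = wsum (fun w => (J w : ℝ) * if o w = x then 1 else 0)
      (fun w => ρ w = ξ ∧ κ w = y) := by
  rw [h.A_eq ξ hξ y hy x, wsum]
  push_cast
  refine Finset.sum_congr rfl fun w _ => ?_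
  by_cases h1 : ρ w = ξ <;> by_cases h2 : κ w = y <;> by_cases h3 : o w = x <;> simp [h1, h2, h3]

lemma sumX_mul {ξ : ℕ} (hξ : ξ < Qx) (S : ℕ → ℤ) :
    ∑ y ∈ Finset.range Qy, sumX A q ξ y * S y = ∑ w, if ρ w = ξ then J w * S (κ w) else 0 := by
  have : ∀ y ∈ Finset.range Qy, sumX A q ξ y * S y =
      ∑ w, if ρ w = ξ ∧ κ w = y then J w * S y else 0 := fun y hy => by
    rw [h.sumX_eq hξ (Finset.mem_range.mp hy), Finset.sum_mul]
    simp only [ite_mul, zero_mul]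
  rw [Finset.sum_congr rfl this, Finset.sum_comm]
  refine Finset.sum_congr rfl fun w _ => ?_
  by_cases hw : ρ w = ξ
  · simp [hw, h.κ_lt w]
  · simp [hw]

lemma sumYX_cast {ξ : ℕ} (hξ : ξ < Qx) :
    (sumYX A q Qy ξ : ℝ) = wsum (fun w => (J w : ℝ)) (fun w => ρ w = ξ) := by
  have := h.sumX_mul hξ fun _ => 1
  simp only [mul_one] at this
  rw [sumYX, this, wsum]; push_cast; rfl

lemma sumYX_pos_iff {ξ : ℕ} (hξ : ξ < Qx) :
    0 < sumYX A q Qy ξ ↔ 0 < wsum I (fun w => ρ w = ξ) := by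
  rw [← h.wsum_pos_iff, ← h.sumYX_cast hξ, Int.cast_pos]

lemma sumX_pos_iff {ξ y : ℕ} (hξ : ξ < Qx) (hy : y < Qy) :
    0 < sumX A q ξ y ↔ 0 < wsum I (fun w => ρ w = ξ ∧ κ w = y) := by
  rw [← h.wsum_pos_iff, ← h.sumX_cast hξ hy, Int.cast_pos]

/-- The conditional probabilities on the grid. -/
lemma condJ_bounds {ξ y : ℕ} (hξ : ξ < Qx) (hy : y < Qy) (x : Fin q) :
    ∃ j : ℕ, condJ A q (D ^ 2) ξ y x = j ∧ j ≤ D ^ 2 ∧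
      (0 < sumX A q ξ y →
        (j : ℝ) ≤ (D ^ 2 : ℕ) * avg I (fun w => ρ w = ξ ∧ κ w = y)
          (fun w => if o w = x then 1 else 0) + 1 / 4 ∧
        (D ^ 2 : ℕ) * avg I (fun w => ρ w = ξ ∧ κ w = y)
          (fun w => if o w = x then 1 else 0) ≤ j + 5 / 4) := by
  have hle : A ξ y x ≤ sumX A q ξ y := by
    rw [h.A_eq ξ hξ y hy, h.sumX_eq hξ hy]
    refine Finset.sum_le_sum fun w _ => ?_
    have := h.J_nonneg w
    by_cases h1 : ρ w = ξ <;> by_cases h2 : κ w = y <;> by_cases h3 : o w = x <;>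
      simp [h1, h2, h3, this]
  have h0 : 0 ≤ A ξ y x := by
    rw [h.A_eq ξ hξ y hy]
    refine Finset.sum_nonneg fun w _ => ?_
    split_ifs
    · exact h.J_nonneg w
    · exact le_rfl
  have hM : 0 < D ^ 2 := Nat.pow_pos h.D_pos
  -- With total weight zero, integer division by zero yields the grid point 0.
  rcases (h0.trans hle).eq_or_lt with hs | hs
  · refine ⟨0, ?_, by omega, fun h' => absurd hs h'.ne⟩
    rw [condJ, ← hs, Int.ediv_zero]; rfl
  have hj0 : 0 ≤ condJ A q (D ^ 2) ξ y x := Int.ediv_nonneg (mul_nonneg (by positivity) h0) hs.le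
  obtain ⟨j, hj⟩ := Int.eq_ofNat_of_zero_le hj0
  have hb := ediv_bounds (((D ^ 2 : ℕ) : ℤ) * A ξ y x) hs
  have hj' : ((D ^ 2 : ℕ) : ℤ) * A ξ y x / sumX A q ξ y = j := hj
  refine ⟨j, hj, ?_, fun _ => ?_⟩
  · have : ((j : ℕ) : ℤ) ≤ (D ^ 2 : ℕ) := by
      rw [← hj']
      refine Int.ediv_le_of_le_mul hs ?_
      exact mul_le_mul_of_nonneg_left hle (by positivity)
    exact_mod_cast this
  · rw [hj'] at hb
    have hc := h.close (Q := fun w => ρ w = ξ ∧ κ w = y) (g := fun w => if o w = x then 1 else 0)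
      (B := 1) (fun w => by split_ifs <;> norm_num) (fun w => by split_ifs <;> norm_num) (by norm_num)
    have he : avg (fun w => (J w : ℝ)) (fun w => ρ w = ξ ∧ κ w = y)
        (fun w => if o w = x then 1 else 0) = (A ξ y x : ℝ) / sumX A q ξ y := by
      rw [avg, h.sumX_cast hξ hy, h.A_cast hξ hy]
    rw [he] at hc
    push_cast at hb hc ⊢
    rw [mul_div_assoc] at hb
    have hM' : (0 : ℝ) < (D : ℝ) ^ 2 := by exact_mod_cast hM
    have ht := h.τ_le
    push_cast at ht
    obtain ⟨c1, c2⟩ := abs_le.mp hc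
    have c3 := mul_le_mul_of_nonneg_left c1 hM'.le
    have c4 := mul_le_mul_of_nonneg_left c2 hM'.le
    constructor
    · linarith [hb.1]
    · linarith [hb.2]

/-- The approximate entropy for given boundary configuration and given configuration on the set. -/
lemma sum_phi_bounds {ξ y : ℕ} (hξ : ξ < Qx) (hy : y < Qy) :
    0 ≤ ∑ x ∈ Finset.range q, phi (D ^ 2) (condJ A q (D ^ 2) ξ y x) ∧
    ((∑ x ∈ Finset.range q, phi (D ^ 2) (condJ A q (D ^ 2) ξ y x) : ℤ) : ℝ) ≤ q * (D ^ 2 : ℕ) := by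
  have hM : 0 < D ^ 2 := Nat.pow_pos h.D_pos
  rw [Finset.sum_range]
  constructor
  · refine Finset.sum_nonneg fun x _ => ?_
    obtain ⟨j, hj, -⟩ := h.condJ_bounds hξ hy x
    rw [hj]
    exact phi_nonneg _ _
  · push_cast
    have := Finset.sum_le_card_nsmul Finset.univ
      (fun x : Fin q => (phi (D ^ 2) (condJ A q (D ^ 2) ξ y x) : ℝ)) (D ^ 2 : ℕ) (fun x _ => by
        obtain ⟨j, hj, hjM, -⟩ := h.condJ_bounds hξ hy x
        rw [hj]
        exact phi_le hM hjM)
    simpa using this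

/-- The approximate entropy for a given boundary configuration. -/
lemma entH_bounds {ξ : ℕ} (hξ : ξ < Qx) (hpos : 0 < sumYX A q Qy ξ) :
    |(entH A q Qy (D ^ 2) ξ : ℝ) - avg I (fun w => ρ w = ξ) (fun w =>
      ((∑ x ∈ Finset.range q, phi (D ^ 2) (condJ A q (D ^ 2) ξ (κ w) x) : ℤ) : ℝ))| ≤
      q / 4 + 1 := by
  set S : ℕ → ℤ := fun y => ∑ x ∈ Finset.range q, phi (D ^ 2) (condJ A q (D ^ 2) ξ y x) with hS
  have hb := ediv_bounds (∑ y ∈ Finset.range Qy, sumX A q ξ y * S y) hpos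
  have he : avg (fun w => (J w : ℝ)) (fun w => ρ w = ξ) (fun w => (S (κ w) : ℝ)) =
      ((∑ y ∈ Finset.range Qy, sumX A q ξ y * S y : ℤ) : ℝ) / sumYX A q Qy ξ := by
    rw [avg, h.sumYX_cast hξ, h.sumX_mul hξ, wsum]
    push_cast
    rfl
  have hent : entH A q Qy (D ^ 2) ξ =
      (∑ y ∈ Finset.range Qy, sumX A q ξ y * S y) / sumYX A q Qy ξ := rfl
  have hc := h.close (Q := fun w => ρ w = ξ) (g := fun w => (S (κ w) : ℝ))
    (B := q * (D ^ 2 : ℕ)) (fun w => by exact_mod_cast (h.sum_phi_bounds hξ (h.κ_lt w)).1)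
    (fun w => (h.sum_phi_bounds hξ (h.κ_lt w)).2) (by positivity)
  -- The averaged function is at most q M, so replacing the weights costs 4τ q M ≤ q/4; the
  -- remaining 1 is the rounding of the quotient.
  have ht : 4 * τ * (q * (D ^ 2 : ℕ)) ≤ q / 4 := by
    have := mul_le_mul_of_nonneg_left h.τ_le (Nat.cast_nonneg (α := ℝ) q)
    linarith
  rw [← he] at hb
  rw [hent]
  obtain ⟨c1, c2⟩ := abs_le.mp hc
  rw [abs_le]
  constructor <;> linarith [hb.1, hb.2]

end Rounded

end Rounded


/-! ## Soundness of the stopping condition -/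

section Violations

variable {A : ℕ → ℕ → ℕ → ℤ} {q Qy Qx M : ℕ}

lemma viol₁_nonneg (d q r : ℕ) (O : Oracle) (M : ℕ) : 0 ≤ viol₁ d q r O M := by
  refine add_nonneg (Finset.sum_nonneg fun _ _ => ?_) (Finset.sum_nonneg fun _ _ =>
    Finset.sum_nonneg fun _ _ => Finset.sum_nonneg fun _ _ => ?_) <;> split_ifs <;> norm_num

lemma viol₂_nonneg : 0 ≤ viol₂ A q Qy Qx M := by
  refine Finset.sum_nonneg fun _ _ => Finset.sum_nonneg fun _ _ => Finset.sum_nonneg fun _ _ =>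
    Finset.sum_nonneg fun _ _ => ?_
  split_ifs <;> norm_num

lemma viol₃_nonneg {e : ℕ} : 0 ≤ viol₃ A q Qy Qx M e := by
  refine Finset.sum_nonneg fun _ _ => Finset.sum_nonneg fun _ _ => ?_
  split_ifs <;> norm_num

lemma term_le_of_sum_le {ι : Type*} {s : Finset ι} {f : ι → ℤ} (hf : ∀ i ∈ s, 0 ≤ f i)
    (h : ∑ i ∈ s, f i ≤ 0) {i : ι} (hi : i ∈ s) : f i ≤ 0 :=
  (Finset.single_le_sum hf hi).trans h

lemma viol₁_nonpos_iff {d q r : ℕ} {O : Oracle} {M : ℕ} : viol₁ d q r O M ≤ 0 ↔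
    (∀ a < q, (thresh d r M : ℤ) ≤ O 0 [(a : ℤ), (r : ℤ)]) ∧
    ∀ i : Fin d, ∀ a < q, ∀ b < q, O 1 [((i : ℕ) : ℤ), (a : ℤ), (b : ℤ), (r : ℤ)] = 0 ∨
      (thresh d r M : ℤ) ≤ O 1 [((i : ℕ) : ℤ), (a : ℤ), (b : ℤ), (r : ℤ)] := by
  constructor
  · intro h
    have h1 : 0 ≤ ∑ a ∈ Finset.range q,
        if 0 < (thresh d r M : ℤ) - O 0 [(a : ℤ), (r : ℤ)] then (1 : ℤ) else 0 :=
      Finset.sum_nonneg fun _ _ => by split_ifs <;> norm_num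
    have h2 : 0 ≤ ∑ i : Fin d, ∑ a ∈ Finset.range q, ∑ b ∈ Finset.range q,
        if 0 < (thresh d r M : ℤ) - O 1 [((i : ℕ) : ℤ), (a : ℤ), (b : ℤ), (r : ℤ)] then
        if 0 < O 1 [((i : ℕ) : ℤ), (a : ℤ), (b : ℤ), (r : ℤ)] *
          O 1 [((i : ℕ) : ℤ), (a : ℤ), (b : ℤ), (r : ℤ)] then (1 : ℤ) else 0 else 0 :=
      Finset.sum_nonneg fun _ _ => Finset.sum_nonneg fun _ _ => Finset.sum_nonneg fun _ _ => by
        split_ifs <;> norm_num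
    rw [viol₁] at h
    have s1 := (le_add_of_nonneg_right h2).trans h
    have s2 := (le_add_of_nonneg_left h1).trans h
    constructor
    · intro a ha
      have := term_le_of_sum_le (fun _ _ => by split_ifs <;> norm_num) s1
        (Finset.mem_range.mpr ha)
      by_contra hc
      rw [if_pos (by omega)] at this
      omega
    · intro i a ha b hb
      have k1 := term_le_of_sum_le (fun _ _ => Finset.sum_nonneg fun _ _ =>
        Finset.sum_nonneg fun _ _ => by split_ifs <;> norm_num)
        s2 (Finset.mem_univ i)
      have k2 := term_le_of_sum_le (fun _ _ =>
        Finset.sum_nonneg fun _ _ => by split_ifs <;> norm_num) k1 (Finset.mem_range.mpr ha)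
      have k3 := term_le_of_sum_le (fun _ _ => by split_ifs <;> norm_num) k2
        (Finset.mem_range.mpr hb)
      by_contra! hc
      rw [if_pos (by omega), if_pos (mul_self_pos.mpr hc.1)] at k3
      omega
  · rintro ⟨h1, h2⟩
    rw [viol₁, Finset.sum_eq_zero, Finset.sum_eq_zero]
    · norm_num
    · intro i _
      refine Finset.sum_eq_zero fun a ha => Finset.sum_eq_zero fun b hb => ?_
      rcases h2 i a (Finset.mem_range.mp ha) b (Finset.mem_range.mp hb) with h | h
      · simp [h]
      · rw [if_neg (by omega)]
    · intro a ha
      rw [if_neg (by have := h1 a (Finset.mem_range.mp ha); omega)]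

lemma viol₂_nonpos_iff : viol₂ A q Qy Qx M ≤ 0 ↔
    ∀ ξ < Qx, ∀ η < Qx, ∀ y < Qy, ∀ x < q, 0 < sumX A q ξ y → 0 < sumX A q η y →
      condJ A q M ξ y x - condJ A q M η y x ≤ 1 := by
  constructor
  · intro h ξ hξ η hη y hy x hx h1 h2
    have k1 := term_le_of_sum_le (fun _ _ => Finset.sum_nonneg fun _ _ => Finset.sum_nonneg
      fun _ _ => Finset.sum_nonneg fun _ _ => by split_ifs <;> norm_num) h (Finset.mem_range.mpr hξ)
    have k2 := term_le_of_sum_le (fun _ _ => Finset.sum_nonneg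
      fun _ _ => Finset.sum_nonneg fun _ _ => by split_ifs <;> norm_num) k1 (Finset.mem_range.mpr hη)
    have k3 := term_le_of_sum_le (fun _ _ => Finset.sum_nonneg fun _ _ => by
      split_ifs <;> norm_num) k2 (Finset.mem_range.mpr hy)
    have k4 := term_le_of_sum_le (fun _ _ => by split_ifs <;> norm_num) k3 (Finset.mem_range.mpr hx)
    by_contra hc
    rw [if_pos h1, if_pos h2, if_pos (by omega)] at k4
    omega
  · intro h
    refine (Finset.sum_eq_zero fun ξ hξ => Finset.sum_eq_zero fun η hη => Finset.sum_eq_zero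
      fun y hy => Finset.sum_eq_zero fun x hx => ?_).le
    rw [Finset.mem_range] at hξ hη hy hx
    beta_reduce
    split_ifs with h1 h2 h3
    · have := h ξ hξ η hη y hy x hx h1 h2
      omega
    all_goals rfl

lemma viol₃_nonpos_iff {e : ℕ} : viol₃ A q Qy Qx M e ≤ 0 ↔
    ∀ ξ < Qx, ∀ η < Qx, 0 < sumYX A q Qy ξ → 0 < sumYX A q Qy η →
      entH A q Qy M ξ - entH A q Qy M η ≤ e := by
  constructor
  · intro h ξ hξ η hη h1 h2
    have k1 := term_le_of_sum_le (fun _ _ => Finset.sum_nonneg fun _ _ => by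
      split_ifs <;> norm_num) h (Finset.mem_range.mpr hξ)
    have k2 := term_le_of_sum_le (fun _ _ => by split_ifs <;> norm_num) k1 (Finset.mem_range.mpr hη)
    by_contra hc
    rw [if_pos h1, if_pos h2, if_pos (by omega)] at k2
    omega
  · intro h
    refine (Finset.sum_eq_zero fun ξ hξ => Finset.sum_eq_zero fun η hη => ?_).le
    rw [Finset.mem_range] at hξ hη
    beta_reduce
    split_ifs with h1 h2 h3
    · have := h ξ hξ η hη h1 h2
      omega
    all_goals rfl

/-- All entropies in the average are integers within `e` of the given one. The bounds being
integers, they also hold for the mean rounded down. -/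
lemma abs_meanH_sub_le {e : ℕ} (h : viol₃ A q Qy Qx M e ≤ 0) {ξ : ℕ} (hξ : ξ < Qx)
    (hpos : 0 < sumYX A q Qy ξ) : |entH A q Qy M ξ - meanH A q Qy Qx M| ≤ e := by
  rw [viol₃_nonpos_iff] at h
  have hn : 0 < ∑ η ∈ Finset.range Qx, if 0 < sumYX A q Qy η then (1 : ℤ) else 0 := by
    have := Finset.single_le_sum (f := fun η => if 0 < sumYX A q Qy η then (1 : ℤ) else 0)
      (fun η _ => by split_ifs <;> norm_num) (Finset.mem_range.mpr hξ)
    simp only [if_pos hpos] at this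
    omega
  have key : ∀ c : ℤ, c * ∑ η ∈ Finset.range Qx, (if 0 < sumYX A q Qy η then (1 : ℤ) else 0) =
      ∑ η ∈ Finset.range Qx, if 0 < sumYX A q Qy η then c else 0 := by
    intro c
    rw [Finset.mul_sum]
    simp
  rw [abs_le, meanH]
  constructor
  · have : (∑ η ∈ Finset.range Qx, if 0 < sumYX A q Qy η then entH A q Qy M η else 0) /
        ∑ η ∈ Finset.range Qx, (if 0 < sumYX A q Qy η then (1 : ℤ) else 0) ≤
        entH A q Qy M ξ + e := by
      refine Int.ediv_le_of_le_mul hn ?_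
      rw [key]
      refine Finset.sum_le_sum fun η hη => ?_
      split_ifs with h1
      · have := h η (Finset.mem_range.mp hη) ξ hξ h1 hpos
        omega
      · rfl
    omega
  · have : entH A q Qy M ξ - e ≤
        (∑ η ∈ Finset.range Qx, if 0 < sumYX A q Qy η then entH A q Qy M η else 0) /
        ∑ η ∈ Finset.range Qx, (if 0 < sumYX A q Qy η then (1 : ℤ) else 0) := by
      rw [Int.le_ediv_iff_mul_le hn, key]
      refine Finset.sum_le_sum fun η hη => ?_
      split_ifs with h1
      · have := h ξ hξ η (Finset.mem_range.mp hη) hpos h1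
        omega
      · rfl
    omega

end Violations

/-! ### Correctness of the output, from the tests alone -/

section Sound

variable {Ω : Type*} [Fintype Ω] {q : ℕ} {I : Ω → ℝ} {J : Ω → ℤ} {ρ κ : Ω → ℕ} {o : Ω → Fin q}
  {A : ℕ → ℕ → ℕ → ℤ} {Qx Qy D : ℕ} {τ s : ℝ}

namespace Rounded

variable (h : Rounded I J ρ κ o A Qx Qy D τ s)
include h

/-- The grid value computed for ξ is within one step of the one for η, and that is within 5/4 of the
true value for η. The bound 4 is chosen as 2², for `phi_approx`. The inequality is multiplied by the
total weight so that it can be summed over the boundary conditions, impossible ones included. -/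
lemma condJ_compare (hv : viol₂ A q Qy Qx (D ^ 2) ≤ 0) {ξ η y : ℕ} (hξ : ξ < Qx) (hη : η < Qx)
    (hy : y < Qy) (h1 : 0 < sumX A q ξ y) (x : Fin q) {j : ℕ}
    (hj : condJ A q (D ^ 2) ξ y x = j) :
    |wsum (fun w => I w * if o w = x then 1 else 0) (fun w => ρ w = η ∧ κ w = y) * (D ^ 2 : ℕ) -
      j * wsum I (fun w => ρ w = η ∧ κ w = y)| ≤
      4 * wsum I (fun w => ρ w = η ∧ κ w = y) := by
  rw [← wsum_mul_avg h.I_nonneg]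
  set Z := wsum I (fun w => ρ w = η ∧ κ w = y) with hZ
  rcases (show 0 ≤ Z from wsum_nonneg h.I_nonneg).eq_or_lt with h0 | h0
  · rw [← h0]; simp
  have h2 := (h.sumX_pos_iff hη hy).mpr h0
  obtain ⟨j', hj', -, hb⟩ := h.condJ_bounds hη hy x
  obtain ⟨b1, b2⟩ := hb h2
  have hv' := viol₂_nonpos_iff.mp hv
  have c1 := hv' ξ hξ η hη y hy x x.2 h1 h2
  have c2 := hv' η hη ξ hξ y hy x x.2 h2 h1
  rw [hj, hj'] at c1 c2
  have c1' : (j : ℝ) - j' ≤ 1 := by exact_mod_cast c1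
  have c2' : (j' : ℝ) - j ≤ 1 := by exact_mod_cast c2
  set p := avg I (fun w => ρ w = η ∧ κ w = y) (fun w => if o w = x then 1 else 0)
  rw [show Z * p * (D ^ 2 : ℕ) - j * Z = ((D ^ 2 : ℕ) * p - j) * Z by ring, abs_mul, abs_of_pos h0]
  refine mul_le_mul_of_nonneg_right (abs_le.mpr ⟨?_, ?_⟩) h0.le <;> linarith

/-- If there are no violations, then the output is correct. -/
theorem sound (hv₂ : viol₂ A q Qy Qx (D ^ 2) ≤ 0) (hv₃ : viol₃ A q Qy Qx (D ^ 2) (20 * q * D) ≤ 0)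
    {T α : Type*} [Fintype T] [DecidableEq α] (m : T → ℝ) (hm : ∀ ζ, 0 ≤ m ζ) (hm1 : ∑ ζ, m ζ = 1)
    (ξ : T → ℕ) (hξ : ∀ ζ, ξ ζ < Qx) (hpos : ∀ ζ, 0 < m ζ → 0 < wsum I (fun w => ρ w = ξ ζ))
    (k : T → α) (P : T → Ω → ℝ)
    (hP : ∀ ζ w, P ζ w = m ζ * ((if ρ w = ξ ζ then I w else 0) / wsum I (fun w => ρ w = ξ ζ))) :
    |(D ^ 2 : ℕ) * (∑ ζ, ∑ w, P ζ w * ∑ x, Real.negMulLog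
      ((∑ ζ', ∑ w', if k ζ' = k ζ ∧ κ w' = κ w ∧ o w' = x then P ζ' w' else 0) /
        ∑ ζ', ∑ w', if k ζ' = k ζ ∧ κ w' = κ w then P ζ' w' else 0)) -
      meanH A q Qy Qx (D ^ 2)| ≤ 25 * q * D := by
  have hD0 := h.D_pos
  have hM : 0 < D ^ 2 := Nat.pow_pos hD0
  have hM' : (0 : ℝ) < (D ^ 2 : ℕ) := by exact_mod_cast hM
  have hP0 : ∀ ζ w, 0 ≤ P ζ w := fun ζ w => by
    rw [hP]
    refine mul_nonneg (hm ζ) (div_nonneg ?_ (wsum_nonneg h.I_nonneg))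
    split_ifs
    · exact h.I_nonneg w
    · exact le_rfl
  have hPsum : ∀ (ζ : T) (g : Ω → ℝ), ∑ w, P ζ w * g w = m ζ * avg I (fun w => ρ w = ξ ζ) g := by
    intro ζ g
    rw [avg, wsum, Finset.sum_div, Finset.mul_sum]
    refine Finset.sum_congr rfl fun w _ => ?_
    rw [hP]
    split_ifs <;> ring
  have hPsum1 : ∀ ζ, ∑ w, P ζ w = m ζ := by
    intro ζ
    have := hPsum ζ fun _ => 1
    simp only [mul_one] at this
    rw [this, avg]
    simp only [mul_one]
    rcases (hm ζ).eq_or_lt with h0 | h0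
    · rw [← h0, zero_mul]
    · rw [div_self (hpos ζ h0).ne', mul_one]
  have hPin : ∀ (ζ : T) (y : ℕ) (g : Ω → ℝ), (∑ w', if κ w' = y then P ζ w' * g w' else 0) =
      m ζ / wsum I (fun w => ρ w = ξ ζ) *
        wsum (fun w => I w * g w) (fun w => ρ w = ξ ζ ∧ κ w = y) := by
    intro ζ y g
    set Z := wsum I (fun w => ρ w = ξ ζ) with hZ
    rw [wsum, Finset.mul_sum]
    refine Finset.sum_congr rfl fun w _ => ?_
    rw [hP, ← hZ]
    by_cases h1 : κ w = y <;> by_cases h2 : ρ w = ξ ζ <;> simp [h1, h2]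
    ring
  set F : T → Ω → ℝ := fun ζ w => ∑ x, Real.negMulLog
      ((∑ ζ', ∑ w', if k ζ' = k ζ ∧ κ w' = κ w ∧ o w' = x then P ζ' w' else 0) /
        ∑ ζ', ∑ w', if k ζ' = k ζ ∧ κ w' = κ w then P ζ' w' else 0) with hF
  set S : ℕ → ℕ → ℤ := fun ξ y =>
    ∑ x ∈ Finset.range q, phi (D ^ 2) (condJ A q (D ^ 2) ξ y x) with hS
  -- The entropy term for a given configuration on `K` is close to the one computed for the boundary
  -- condition of the single ζ.
  have hlocal : ∀ ζ w, P ζ w ≠ 0 → |(D ^ 2 : ℕ) * F ζ w - S (ξ ζ) (κ w)| ≤ 3 * q * D := by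
    intro ζ w hPw
    have hPw' : 0 < P ζ w := lt_of_le_of_ne (hP0 ζ w) hPw.symm
    have hρ : ρ w = ξ ζ := by
      by_contra hne
      rw [hP, if_neg hne] at hPw
      simp at hPw
    have hI : 0 < I w := by
      refine lt_of_le_of_ne (h.I_nonneg w) fun h0 => hPw ?_
      rw [hP, ← h0]; simp
    have hy := h.κ_lt w
    have hs : 0 < sumX A q (ξ ζ) (κ w) :=
      (h.sumX_pos_iff (hξ ζ) hy).mpr (wsum_pos_of h.I_nonneg ⟨hρ, rfl⟩ hI)
    set Den := ∑ ζ', ∑ w', if k ζ' = k ζ ∧ κ w' = κ w then P ζ' w' else 0 with hDen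
    have hDenpos : 0 < Den := by
      refine Finset.sum_pos' (fun ζ' _ => Finset.sum_nonneg fun w' _ => ?_) ⟨ζ, Finset.mem_univ _,
        Finset.sum_pos' (fun w' _ => ?_) ⟨w, Finset.mem_univ _, by simpa using hPw'⟩⟩
      · split_ifs
        · exact hP0 _ _
        · exact le_rfl
      · split_ifs
        · exact hP0 _ _
        · exact le_rfl
    have hterm : ∀ x : Fin q, |(D ^ 2 : ℕ) * Real.negMulLog
        ((∑ ζ', ∑ w', if k ζ' = k ζ ∧ κ w' = κ w ∧ o w' = x then P ζ' w' else 0) / Den) -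
        phi (D ^ 2) (condJ A q (D ^ 2) (ξ ζ) (κ w) x)| ≤ 2 * D + 3 := by
      intro x
      set Num := ∑ ζ', ∑ w', if k ζ' = k ζ ∧ κ w' = κ w ∧ o w' = x then P ζ' w' else 0 with hNum
      obtain ⟨j, hj, hjM, -⟩ := h.condJ_bounds (hξ ζ) hy x
      have hNum0 : 0 ≤ Num := Finset.sum_nonneg fun ζ' _ => Finset.sum_nonneg fun w' _ => by
        split_ifs
        · exact hP0 _ _
        · exact le_rfl
      have hNumle : Num ≤ Den := Finset.sum_le_sum fun ζ' _ => Finset.sum_le_sum fun w' _ => by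
        have := hP0 ζ' w'
        by_cases h1 : k ζ' = k ζ <;> by_cases h2 : κ w' = κ w <;> by_cases h3 : o w' = x <;>
          simp [h1, h2, h3, this]
      -- The conditional probability given `K` is a mixture over the ζ' with the same part of `K`
      -- outside the cube. Each of them is compared with the grid value j of the fixed ζ, and the
      -- inequalities are added up.
      have hcmp : |Num * (D ^ 2 : ℕ) - j * Den| ≤ 4 * Den := by
        rw [hNum, hDen, Finset.sum_mul, Finset.mul_sum, Finset.mul_sum, ← Finset.sum_sub_distrib]
        refine (Finset.abs_sum_le_sum_abs _ _).trans (Finset.sum_le_sum fun ζ' _ => ?_)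
        by_cases hk : k ζ' = k ζ
        · have e1 : (∑ w', if k ζ' = k ζ ∧ κ w' = κ w ∧ o w' = x then P ζ' w' else 0) =
              m ζ' / wsum I (fun w => ρ w = ξ ζ') *
              wsum (fun w => I w * if o w = x then 1 else 0)
                (fun w' => ρ w' = ξ ζ' ∧ κ w' = κ w) := by
            rw [← hPin]
            refine Finset.sum_congr rfl fun w' _ => ?_
            by_cases h2 : κ w' = κ w <;> by_cases h3 : o w' = x <;> simp [hk, h2, h3]
          have e2 : (∑ w', if k ζ' = k ζ ∧ κ w' = κ w then P ζ' w' else 0) =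
              m ζ' / wsum I (fun w => ρ w = ξ ζ') *
              wsum I (fun w' => ρ w' = ξ ζ' ∧ κ w' = κ w) := by
            have := hPin ζ' (κ w) fun _ => 1
            simp only [mul_one] at this
            rw [← this]
            refine Finset.sum_congr rfl fun w' _ => ?_
            simp [hk]
          rw [e1, e2]
          set c := m ζ' / wsum I (fun w => ρ w = ξ ζ') with hc
          have hc0 : 0 ≤ c := div_nonneg (hm ζ') (wsum_nonneg h.I_nonneg)
          have := mul_le_mul_of_nonneg_left
            (h.condJ_compare hv₂ (hξ ζ) (hξ ζ') hy hs x hj) hc0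
          rw [mul_assoc, mul_left_comm (j : ℝ), ← mul_sub, abs_mul, abs_of_nonneg hc0]
          linarith
        · simp [hk]
      rw [hj]
      have := phi_approx hD0 hjM (p := Num / Den) (c := 2) (by positivity)
        ((div_le_one hDenpos).mpr hNumle) (by
          rw [show Num / Den * (D ^ 2 : ℕ) - j = (Num * (D ^ 2 : ℕ) - j * Den) / Den by
            field_simp, abs_div, abs_of_pos hDenpos, div_le_iff₀ hDenpos]
          linarith) (by norm_num)
      exact this
    have hFS : (D ^ 2 : ℕ) * F ζ w - S (ξ ζ) (κ w) = ∑ x : Fin q, ((D ^ 2 : ℕ) * Real.negMulLog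
        ((∑ ζ', ∑ w', if k ζ' = k ζ ∧ κ w' = κ w ∧ o w' = x then P ζ' w' else 0) / Den) -
        phi (D ^ 2) (condJ A q (D ^ 2) (ξ ζ) (κ w) x)) := by
      simp only [hF, hS]
      rw [Finset.sum_sub_distrib, Finset.mul_sum, Finset.sum_range]
      push_cast
      rfl
    rw [hFS]
    refine (Finset.abs_sum_le_sum_abs _ _).trans
      ((Finset.sum_le_card_nsmul _ _ _ fun x _ => hterm x).trans ?_)
    have hD50 : (50 : ℝ) * q ≤ D := by exact_mod_cast h.le_D
    have hq1 : (1 : ℝ) ≤ q := by exact_mod_cast h.q_pos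
    rw [Finset.card_univ, Fintype.card_fin, nsmul_eq_mul]
    nlinarith
  have hq1 : (1 : ℝ) ≤ q := by exact_mod_cast h.q_pos
  have hD50 : (50 : ℝ) * q ≤ D := by exact_mod_cast h.le_D
  -- The constant is 25 = 3 + 2 + 20: the local error, the error of `entH`, and the spread of the
  -- entropies permitted by the third test.
  have hζ : ∀ ζ, |(D ^ 2 : ℕ) * (∑ w, P ζ w * F ζ w) - m ζ * meanH A q Qy Qx (D ^ 2)| ≤
      m ζ * (25 * q * D) := by
    intro ζ
    rcases (hm ζ).eq_or_lt with h0 | h0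
    · have : ∀ w, P ζ w = 0 := fun w => by rw [hP, ← h0, zero_mul]
      simp [this, ← h0]
    have hp := (h.sumYX_pos_iff (hξ ζ)).mpr (hpos ζ h0)
    have a1 : |(D ^ 2 : ℕ) * (∑ w, P ζ w * F ζ w) -
        m ζ * avg I (fun w => ρ w = ξ ζ) (fun w => (S (ξ ζ) (κ w) : ℝ))| ≤ m ζ * (3 * q * D) := by
      rw [← hPsum, Finset.mul_sum, ← Finset.sum_sub_distrib, ← hPsum1, Finset.sum_mul]
      refine (Finset.abs_sum_le_sum_abs _ _).trans (Finset.sum_le_sum fun w _ => ?_)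
      rw [mul_left_comm, ← mul_sub, abs_mul, abs_of_nonneg (hP0 ζ w)]
      rcases eq_or_ne (P ζ w) 0 with hz | hz
      · rw [hz, zero_mul, zero_mul]
      · exact mul_le_mul_of_nonneg_left (hlocal ζ w hz) (hP0 ζ w)
    have a2 := h.entH_bounds (hξ ζ) hp
    have a3 : |(entH A q Qy (D ^ 2) (ξ ζ) : ℝ) - meanH A q Qy Qx (D ^ 2)| ≤ 20 * q * D := by
      exact_mod_cast abs_meanH_sub_le hv₃ (hξ ζ) hp
    obtain ⟨b1, b2⟩ := abs_le.mp a1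
    obtain ⟨c1, c2⟩ := abs_le.mp a2
    obtain ⟨d1, d2⟩ := abs_le.mp a3
    have c1' := mul_le_mul_of_nonneg_left c1 h0.le
    have c2' := mul_le_mul_of_nonneg_left c2 h0.le
    have d1' := mul_le_mul_of_nonneg_left d1 h0.le
    have d2' := mul_le_mul_of_nonneg_left d2 h0.le
    have e1 : m ζ * ((q : ℝ) / 4 + 1) ≤ m ζ * (2 * q * D) :=
      mul_le_mul_of_nonneg_left (by nlinarith) h0.le
    rw [abs_le]
    constructor <;> linarith
  calc |(D ^ 2 : ℕ) * (∑ ζ, ∑ w, P ζ w * F ζ w) - meanH A q Qy Qx (D ^ 2)|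
      = |∑ ζ, ((D ^ 2 : ℕ) * (∑ w, P ζ w * F ζ w) - m ζ * meanH A q Qy Qx (D ^ 2))| := by
        rw [Finset.sum_sub_distrib, ← Finset.mul_sum, ← Finset.sum_mul, hm1, one_mul]
    _ ≤ ∑ ζ, m ζ * (25 * q * D) :=
        (Finset.abs_sum_le_sum_abs _ _).trans (Finset.sum_le_sum fun ζ _ => hζ ζ)
    _ = 25 * q * D := by rw [← Finset.sum_mul, hm1, one_mul]

end Rounded

end Sound


/-! ## Sufficient conditions for the stopping condition -/

section Complete

variable {Ω : Type*} [Fintype Ω] {q : ℕ} {I : Ω → ℝ} {J : Ω → ℤ} {ρ κ : Ω → ℕ} {o : Ω → Fin q}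
  {A : ℕ → ℕ → ℕ → ℤ} {Qx Qy D : ℕ} {τ s : ℝ}

lemma abs_avg_sub_le {Q : Ω → Prop} [DecidablePred Q] (hI : ∀ w, 0 ≤ I w) {g g' : Ω → ℝ} {ε : ℝ}
    (hε : 0 ≤ ε) (h : ∀ w, Q w → 0 < I w → |g w - g' w| ≤ ε) :
    |avg I Q g - avg I Q g'| ≤ ε := by
  rw [avg, avg, ← sub_div, abs_div, abs_of_nonneg (wsum_nonneg hI)]
  refine div_le_of_le_mul₀ (wsum_nonneg hI) hε ?_
  rw [wsum, wsum, wsum, ← Finset.sum_sub_distrib, Finset.mul_sum]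
  refine (Finset.abs_sum_le_sum_abs _ _).trans (Finset.sum_le_sum fun w _ => ?_)
  split_ifs with hQ
  · rw [← mul_sub, abs_mul, abs_of_nonneg (hI w), mul_comm]
    rcases (hI w).eq_or_lt with h0 | h0
    · rw [← h0, mul_zero, mul_zero]
    · exact mul_le_mul_of_nonneg_right (h w hQ h0) h0.le
  · simp

lemma avg_comp {β : Type*} [Fintype β] [DecidableEq β] {Q : Ω → Prop} [DecidablePred Q]
    (π : Ω → β) (t : β → ℝ) : avg I Q (fun w => t (π w)) =
      ∑ c, avg I Q (fun w => if π w = c then 1 else 0) * t c := by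
  simp only [avg, div_mul_eq_mul_div]
  rw [← Finset.sum_div]
  congr 1
  simp only [wsum, Finset.sum_mul]
  rw [Finset.sum_comm]
  refine Finset.sum_congr rfl fun w _ => ?_
  split_ifs <;> simp

namespace Rounded

variable (h : Rounded I J ρ κ o A Qx Qy D τ s)
include h

/-- Grid values j and j' satisfy j ≤ Mp + 1/4 ≤ Mp' + 1/2 ≤ j' + 7/4 < j' + 2, hence j - j' ≤ 1 for
integers. -/
lemma condJ_sub_le {ξ η y z : ℕ} (hξ : ξ < Qx) (hη : η < Qx) (hy : y < Qy) (hz : z < Qy)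
    (h1 : 0 < sumX A q ξ y) (h2 : 0 < sumX A q η z) {x : Fin q}
    (hc : (D ^ 2 : ℕ) * |avg I (fun w => ρ w = ξ ∧ κ w = y) (fun w => if o w = x then 1 else 0) -
      avg I (fun w => ρ w = η ∧ κ w = z) (fun w => if o w = x then 1 else 0)| ≤ 1 / 4) :
    condJ A q (D ^ 2) ξ y x - condJ A q (D ^ 2) η z x ≤ 1 := by
  obtain ⟨j, hj, -, hb⟩ := h.condJ_bounds hξ hy x
  obtain ⟨j', hj', -, hb'⟩ := h.condJ_bounds hη hz x
  obtain ⟨b1, b2⟩ := hb h1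
  obtain ⟨c1, c2⟩ := hb' h2
  have hM : (0 : ℝ) ≤ (D ^ 2 : ℕ) := Nat.cast_nonneg _
  have := mul_le_mul_of_nonneg_left (le_abs_self (avg I (fun w => ρ w = ξ ∧ κ w = y)
    (fun w => if o w = x then 1 else 0) - avg I (fun w => ρ w = η ∧ κ w = z)
    (fun w => if o w = x then 1 else 0))) hM
  have hlt : (j : ℝ) < j' + 2 := by linarith
  have : j < j' + 2 := by exact_mod_cast hlt
  rw [hj, hj']
  omega

lemma sum_phi_sub_le {ξ η y z : ℕ} (hξ : ξ < Qx) (hη : η < Qx) (hy : y < Qy) (hz : z < Qy)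
    (h1 : 0 < sumX A q ξ y) (h2 : 0 < sumX A q η z)
    (hc : ∀ x, (D ^ 2 : ℕ) * |avg I (fun w => ρ w = ξ ∧ κ w = y)
      (fun w => if o w = x then 1 else 0) -
      avg I (fun w => ρ w = η ∧ κ w = z) (fun w => if o w = x then 1 else 0)| ≤ 1 / 4) :
    |((∑ x ∈ Finset.range q, phi (D ^ 2) (condJ A q (D ^ 2) ξ y x) : ℤ) : ℝ) -
      ((∑ x ∈ Finset.range q, phi (D ^ 2) (condJ A q (D ^ 2) η z x) : ℤ) : ℝ)| ≤ 2 * q * D := by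
  have hM : 0 < D ^ 2 := Nat.pow_pos h.D_pos
  have hM' : (0 : ℝ) < (D ^ 2 : ℕ) := by exact_mod_cast hM
  have hterm : ∀ x : Fin q, |(phi (D ^ 2) (condJ A q (D ^ 2) ξ y x) : ℝ) -
      phi (D ^ 2) (condJ A q (D ^ 2) η z x)| ≤ D + 6 := by
    intro x
    have e1 := h.condJ_sub_le hξ hη hy hz h1 h2 (hc x)
    have e2 := h.condJ_sub_le hη hξ hz hy h2 h1 (x := x) (by rw [abs_sub_comm]; exact hc x)
    obtain ⟨j, hj, hjM, -⟩ := h.condJ_bounds hξ hy x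
    obtain ⟨j', hj', hjM', -⟩ := h.condJ_bounds hη hz x
    rw [hj, hj'] at e1 e2
    rw [hj, hj']
    -- Both values of `phi` are compared with M times -p log p at the grid point p = j'/M, with
    -- errors D + 3 and 3.
    have a1 := phi_approx h.D_pos hjM (p := j' / (D ^ 2 : ℕ)) (c := 1) (by positivity)
      ((div_le_one hM').mpr (by exact_mod_cast hjM')) (by
        rw [div_mul_cancel₀ _ hM'.ne', one_pow, abs_le]
        have e1' : (j : ℝ) - j' ≤ 1 := by exact_mod_cast e1
        have e2' : (j' : ℝ) - j ≤ 1 := by exact_mod_cast e2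
        constructor <;> linarith) (by norm_num)
    have a2 := phi_bounds hM hjM'
    rw [abs_le] at a1 ⊢
    constructor <;> linarith [a1.1, a1.2, a2.1, a2.2]
  rw [Finset.sum_range, Finset.sum_range]
  push_cast
  rw [← Finset.sum_sub_distrib]
  refine (Finset.abs_sum_le_sum_abs _ _).trans
    ((Finset.sum_le_card_nsmul _ _ _ fun x _ => hterm x).trans ?_)
  have hD50 : (50 : ℝ) * q ≤ D := by exact_mod_cast h.le_D
  have hq1 : (1 : ℝ) ≤ q := by exact_mod_cast h.q_pos
  rw [Finset.card_univ, Fintype.card_fin, nsmul_eq_mul]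
  nlinarith

/-- There are no violations if the conditional probabilities depend little on the boundary. -/
theorem complete {β : Type*} [Fintype β] [DecidableEq β] (π : Ω → β)
    (hπ : ∀ w w', κ w = κ w' → π w = π w')
    (ha : ∀ w w', 0 < I w → 0 < I w' → π w = π w' → ∀ x, (D ^ 2 : ℕ) *
      |avg I (fun v => ρ v = ρ w ∧ κ v = κ w) (fun v => if o v = x then 1 else 0) -
      avg I (fun v => ρ v = ρ w' ∧ κ v = κ w') (fun v => if o v = x then 1 else 0)| ≤ 1 / 4)
    (hb : ∀ w w', 0 < I w → 0 < I w' →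
      D * ∑ c, |avg I (fun v => ρ v = ρ w) (fun v => if π v = c then 1 else 0) -
        avg I (fun v => ρ v = ρ w') (fun v => if π v = c then 1 else 0)| ≤ 1) :
    viol₂ A q Qy Qx (D ^ 2) ≤ 0 ∧ viol₃ A q Qy Qx (D ^ 2) (20 * q * D) ≤ 0 := by
  have hex : ∀ {Q : Ω → Prop} [DecidablePred Q], 0 < wsum I Q → ∃ w, Q w ∧ 0 < I w :=
    fun hQ => by
      obtain ⟨w, hw, hI⟩ := exists_of_wsum_pos hQ
      exact ⟨w, hw, lt_of_le_of_ne (h.I_nonneg w) hI.symm⟩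
  have hD1 : (1 : ℝ) ≤ D := by exact_mod_cast h.D_pos
  have hq1 : (1 : ℝ) ≤ q := by exact_mod_cast h.q_pos
  have hD50 : (50 : ℝ) * q ≤ D := by exact_mod_cast h.le_D
  constructor
  · rw [viol₂_nonpos_iff]
    intro ξ hξ η hη y hy x hx h1 h2
    obtain ⟨w, ⟨rfl, rfl⟩, hw⟩ := hex ((h.sumX_pos_iff hξ hy).mp h1)
    obtain ⟨w', ⟨rfl, hκ⟩, hw'⟩ := hex ((h.sumX_pos_iff hη hy).mp h2)
    have := ha w w' hw hw' (hπ w w' hκ.symm) ⟨x, hx⟩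
    rw [hκ] at this
    exact h.condJ_sub_le hξ hη hy hy h1 h2 (x := ⟨x, hx⟩) this
  · rw [viol₃_nonpos_iff]
    intro ξ hξ η hη h1 h2
    set S : ℕ → ℕ → ℤ := fun ξ y =>
      ∑ x ∈ Finset.range q, phi (D ^ 2) (condJ A q (D ^ 2) ξ y x) with hS
    have hSd : ∀ w w', 0 < I w → 0 < I w' → π w = π w' →
        |(S (ρ w) (κ w) : ℝ) - S (ρ w') (κ w')| ≤ 2 * q * D := fun w w' hw hw' hww =>
      h.sum_phi_sub_le (h.ρ_lt w) (h.ρ_lt w') (h.κ_lt w) (h.κ_lt w')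
        ((h.sumX_pos_iff (h.ρ_lt w) (h.κ_lt w)).mpr (wsum_pos_of h.I_nonneg ⟨rfl, rfl⟩ hw))
        ((h.sumX_pos_iff (h.ρ_lt w') (h.κ_lt w')).mpr (wsum_pos_of h.I_nonneg ⟨rfl, rfl⟩ hw'))
        (ha w w' hw hw' hww)
    -- Up to 2 q D the local entropy depends on `π w` only; `t` takes the value at one possible
    -- representative of each class. It remains to compare the laws of `π` under the two boundaries.
    have ht : ∃ t : β → ℝ, (∀ c, 0 ≤ t c ∧ t c ≤ q * (D ^ 2 : ℕ)) ∧
        ∀ w, 0 < I w → |(S (ρ w) (κ w) : ℝ) - t (π w)| ≤ 2 * q * D := by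
      classical
      refine ⟨fun c => if hc : ∃ w, 0 < I w ∧ π w = c then
        (S (ρ hc.choose) (κ hc.choose) : ℝ) else 0, fun c => ?_, fun w hw => ?_⟩
      · beta_reduce
        split_ifs with hc
        · have := h.sum_phi_bounds (h.ρ_lt hc.choose) (h.κ_lt hc.choose)
          exact ⟨by exact_mod_cast this.1, this.2⟩
        · exact ⟨le_rfl, by positivity⟩
      · have hc : ∃ w', 0 < I w' ∧ π w' = π w := ⟨w, hw, rfl⟩
        beta_reduce
        rw [dif_pos hc]
        exact hSd _ _ hw hc.choose_spec.1 hc.choose_spec.2.symm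
    obtain ⟨t, ht0, ht⟩ := ht
    have hε : (0 : ℝ) ≤ 2 * q * D := by positivity
    have happ : ∀ ξ, |avg I (fun w => ρ w = ξ) (fun w => (S ξ (κ w) : ℝ)) -
        avg I (fun w => ρ w = ξ) (fun w => t (π w))| ≤ 2 * q * D := fun ξ =>
      abs_avg_sub_le h.I_nonneg hε fun w hw hI => by rw [← hw]; exact ht w hI
    obtain ⟨w, rfl, hw⟩ := hex ((h.sumYX_pos_iff hξ).mp h1)
    obtain ⟨w', rfl, hw'⟩ := hex ((h.sumYX_pos_iff hη).mp h2)
    have hdiff : |avg I (fun v => ρ v = ρ w) (fun v => t (π v)) -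
        avg I (fun v => ρ v = ρ w') (fun v => t (π v))| ≤ q * D := by
      rw [avg_comp π t, avg_comp π t, ← Finset.sum_sub_distrib]
      simp only [← sub_mul]
      calc _ ≤ ∑ c, |avg I (fun v => ρ v = ρ w) (fun v => if π v = c then 1 else 0) -
            avg I (fun v => ρ v = ρ w') (fun v => if π v = c then 1 else 0)| *
              (q * (D ^ 2 : ℕ)) := by
            refine (Finset.abs_sum_le_sum_abs _ _).trans (Finset.sum_le_sum fun c _ => ?_)
            rw [abs_mul, abs_of_nonneg (ht0 c).1]
            exact mul_le_mul_of_nonneg_left (ht0 c).2 (abs_nonneg _)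
        _ = (D * ∑ c, |avg I (fun v => ρ v = ρ w) (fun v => if π v = c then 1 else 0) -
            avg I (fun v => ρ v = ρ w') (fun v => if π v = c then 1 else 0)|) * (q * D) := by
            rw [← Finset.sum_mul]; push_cast; ring
        _ ≤ 1 * (q * D) := mul_le_mul_of_nonneg_right (hb w w' hw hw') (by positivity)
        _ = q * D := one_mul _
    have b1 := h.entH_bounds hξ h1
    have b2 := h.entH_bounds hη h2
    have b3 := happ (ρ w)
    have b4 := happ (ρ w')
    rw [abs_le] at b1 b2 b3 b4 hdiff
    -- The errors add up to 9 q D: twice 2 for `entH`, twice 2 for replacing the local entropy by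
    -- `t`, and 1 for the laws of `π`.
    have : (entH A q Qy (D ^ 2) (ρ w) : ℝ) - entH A q Qy (D ^ 2) (ρ w') ≤ 20 * q * D := by
      have : (q : ℝ) / 4 + 1 ≤ 2 * q * D := by nlinarith
      have : (0 : ℝ) ≤ q * D := by positivity
      linarith [b1.1, b1.2, b2.1, b2.2, b3.1, b3.2, b4.1, b4.2, hdiff.2]
    exact_mod_cast this

end Rounded

end Complete


/-! ## The integer weights approximate the real weights -/

section Close

/-- Two numbers agree up to a factor `exp t`. -/
def Close (t a b : ℝ) : Prop := 0 ≤ a ∧ 0 ≤ b ∧ a ≤ Real.exp t * b ∧ b ≤ Real.exp t * a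

lemma Close.one {t : ℝ} (ht : 0 ≤ t) : Close t 1 1 := by
  have := Real.one_le_exp ht
  exact ⟨zero_le_one, zero_le_one, by linarith, by linarith⟩

lemma Close.mul {t t' a b a' b' : ℝ} (h : Close t a b) (h' : Close t' a' b') :
    Close (t + t') (a * a') (b * b') := by
  obtain ⟨h1, h2, h3, h4⟩ := h
  obtain ⟨h1', h2', h3', h4'⟩ := h'
  refine ⟨mul_nonneg h1 h1', mul_nonneg h2 h2', ?_, ?_⟩
  · calc a * a' ≤ (Real.exp t * b) * (Real.exp t' * b') :=
        mul_le_mul h3 h3' h1' (by positivity)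
      _ = _ := by rw [Real.exp_add]; ring
  · calc b * b' ≤ (Real.exp t * a) * (Real.exp t' * a') :=
        mul_le_mul h4 h4' h2' (by positivity)
      _ = _ := by rw [Real.exp_add]; ring

lemma Close.prod {ι : Type*} (s : Finset ι) {t : ℝ} {a b : ι → ℝ}
    (h : ∀ i ∈ s, Close t (a i) (b i)) : Close (s.card * t) (∏ i ∈ s, a i) (∏ i ∈ s, b i) := by
  classical
  induction s using Finset.induction_on with
  | empty => simpa using Close.one le_rfl
  | @insert i s hi ih =>
    rw [Finset.prod_insert hi, Finset.prod_insert hi, Finset.card_insert_of_notMem hi]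
    have := (h i (Finset.mem_insert_self _ _)).mul
      (ih fun j hj => h j (Finset.mem_insert_of_mem hj))
    convert this using 1
    push_cast; ring

/-- For c ≥ Θ one has c + 1 ≤ (1 + 1/Θ) c ≤ exp (1/Θ) c. The extra 1 in the hypothesis ensures b ≥ Θ
as well. -/
lemma Close.of_abs_le {Θ a b : ℝ} (hΘ : 0 < Θ) (ha : Θ + 1 ≤ a) (h : |a - b| ≤ 1) :
    Close (1 / Θ) a b := by
  obtain ⟨h1, h2⟩ := abs_le.mp h
  have he : 1 + 1 / Θ ≤ Real.exp (1 / Θ) := by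
    have := Real.add_one_le_exp (1 / Θ); linarith
  have key : ∀ c, Θ ≤ c → c + 1 ≤ Real.exp (1 / Θ) * c := fun c hc => by
    have : 1 ≤ 1 / Θ * c := by rw [one_div_mul_eq_div, le_div_iff₀ hΘ]; linarith
    nlinarith
  refine ⟨by linarith, by linarith, ?_, ?_⟩
  · linarith [key b (by linarith)]
  · linarith [key a (by linarith)]

end Close

/-! ### Precision of the integer weights obtained from the oracles -/

section Approx

variable {d q r x : ℕ} {O : Oracle} {Φ : Interaction d q} {K : Finset (Site d)}

lemma card_cube : Fintype.card (box d (r + 1)) = nSites d r := by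
  rw [← Fintype.card_congr (siteEquiv d r), Fintype.card_fin]

lemma not_key_mid (hO : ∀ v : Site d, O 2 (List.ofFn v) = if v ∈ K then 1 else 0)
    (h0 : (0 : Site d) ∉ K) : ¬ Key d r O ((nSites d r - 1) / 2) := by
  rintro ⟨-, h⟩
  rw [siteZ_eq, hO, (siteOf_eq_zero mid_lt).mpr rfl, if_neg h0] at h
  exact lt_irrefl _ h

/-- The scale of the integer weights. -/
def scale (d r : ℕ) : ℝ :=
  (∏ _v : box d (r + 1), (2 : ℝ) ^ r) *
    ∏ i : Fin d, ∏ v : box d (r + 1), if v.1 + e i ∈ box d (r + 1) then (2 : ℝ) ^ r else 1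

lemma scale_pos : 0 < scale d r := by
  refine mul_pos (Finset.prod_pos fun _ _ => by positivity)
    (Finset.prod_pos fun _ _ => Finset.prod_pos fun _ _ => ?_)
  split_ifs <;> positivity

lemma scale_mul_weight (w : Config d q (box d (r + 1))) : scale d r * Φ.weight w =
    (∏ v : box d (r + 1), 2 ^ r * Φ.γ (w v)) * ∏ i : Fin d, ∏ v : box d (r + 1),
      if h : v.1 + e i ∈ box d (r + 1) then 2 ^ r * Φ.β i (w v) (w ⟨v.1 + e i, h⟩) else 1 := by
  rw [scale, Interaction.weight, mul_mul_mul_comm, ← Finset.prod_mul_distrib,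
    ← Finset.prod_mul_distrib]
  congr 1
  refine Finset.prod_congr rfl fun i _ => ?_
  rw [← Finset.prod_mul_distrib]
  refine Finset.prod_congr rfl fun v _ => ?_
  split_ifs <;> simp

lemma abs_sub_le_one {m b : ℝ} (h : |m / 2 ^ r - b| ≤ 1 / 2 ^ r) : |m - 2 ^ r * b| ≤ 1 := by
  have h2 : (0 : ℝ) < 2 ^ r := by positivity
  have : m - 2 ^ r * b = 2 ^ r * (m / 2 ^ r - b) := by field_simp
  rw [this, abs_mul, abs_of_pos h2]
  calc _ ≤ 2 ^ r * (1 / 2 ^ r : ℝ) := mul_le_mul_of_nonneg_left h h2.le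
    _ = 1 := by field_simp

/-- A weight has at most (d + 1) N factors, N being the number of sites. Each is an exact zero, or
1, or by the first test accurate up to exp (1/Θ) with Θ = 16 (d + 1) N M; so the total error is exp
(1/(16 M)). This explains `thresh`, which is Θ + 1. -/
lemma close_intWeight (hO : Represents Φ K O) {M : ℕ} (hM : 0 < M) (hv : viol₁ d q r O M ≤ 0)
    (w : Config d q (box d (r + 1))) :
    Close (1 / (16 * M)) (intWeight r O w) (scale d r * Φ.weight w) := by
  obtain ⟨h1, h2⟩ := viol₁_nonpos_iff.mp hv
  have hN : 0 < nSites d r := Nat.pow_pos sideL_pos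
  set Θ : ℝ := 16 * (d + 1) * nSites d r * M with hΘ
  have hΘ0 : 0 < Θ := by
    have : (0 : ℝ) < nSites d r := by exact_mod_cast hN
    have : (0 : ℝ) < M := by exact_mod_cast hM
    positivity
  have hth : ((thresh d r M : ℤ) : ℝ) = Θ + 1 := by simp [thresh, hΘ]
  have hθ : (0 : ℝ) ≤ 1 / Θ := by positivity
  have hg : ∀ v ∈ (Finset.univ : Finset (box d (r + 1))), Close (1 / Θ)
      ((O 0 [((w v : ℕ) : ℤ), (r : ℤ)] : ℤ) : ℝ) (2 ^ r * Φ.γ (w v)) := fun v _ => by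
    refine Close.of_abs_le hΘ0 ?_ (abs_sub_le_one (hO.gamma (w v) r))
    rw [← hth]
    exact_mod_cast h1 _ (w v).2
  have hb : ∀ i ∈ (Finset.univ : Finset (Fin d)), Close (nSites d r * (1 / Θ))
      (∏ v : box d (r + 1), if h : v.1 + e i ∈ box d (r + 1) then
        ((O 1 [((i : ℕ) : ℤ), ((w v : ℕ) : ℤ), ((w ⟨v.1 + e i, h⟩ : ℕ) : ℤ), (r : ℤ)] : ℤ) : ℝ)
        else 1)
      (∏ v : box d (r + 1), if h : v.1 + e i ∈ box d (r + 1) then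
        2 ^ r * Φ.β i (w v) (w ⟨v.1 + e i, h⟩) else 1) := fun i _ => by
    rw [← card_cube (d := d), ← Finset.card_univ]
    refine Close.prod _ fun v _ => ?_
    split_ifs with h
    · rcases h2 i _ (w v).2 _ (w ⟨v.1 + e i, h⟩).2 with h0 | h0
      · rw [h0, (hO.beta_zero i _ _ r).mp h0]
        simp [Close]
      · refine Close.of_abs_le hΘ0 ?_ (abs_sub_le_one (hO.beta i _ _ r))
        rw [← hth]
        exact_mod_cast h0
    · exact Close.one hθ
  have := (Close.prod _ hg).mul (Close.prod _ hb)
  rw [scale_mul_weight, intWeight, genWeight]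
  push_cast [apply_dite]
  convert this using 1
  rw [Finset.card_univ, Finset.card_univ, card_cube, Fintype.card_fin]
  have : (0 : ℝ) < nSites d r := by exact_mod_cast hN
  have : (0 : ℝ) < M := by exact_mod_cast hM
  rw [hΘ]
  field_simp
  ring

lemma gridD_pos (hq : 0 < q) : 0 < gridD q x := by unfold gridD; positivity

lemma rounded (hq : 0 < q) (hO : Represents Φ K O) (h0 : (0 : Site d) ∉ K)
    (hv : viol₁ d q r O (gridM q x) ≤ 0) :
    Rounded (Φ.weight (W := box d (r + 1))) (intWeight r O) ringCode (keyCode O)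
      (fun w => w ⟨0, zero_mem_box⟩) (partA d q r O) (ringQ d q r) (keyQ d q r O) (gridD q x)
      (1 / (16 * gridM q x)) (scale d r) where
  I_nonneg := weight_nonneg Φ
  s_pos := scale_pos
  τ_nonneg := by positivity
  τ_le := by
    have : (0 : ℝ) < (gridD q x ^ 2 : ℕ) := by exact_mod_cast Nat.pow_pos (gridD_pos hq)
    rw [gridM]
    field_simp
    exact le_rfl
  q_pos := hq
  le_D := Nat.le_mul_of_pos_right _ (by positivity)
  le₁ := fun w => (close_intWeight hO (Nat.pow_pos (gridD_pos hq)) hv w).2.2.1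
  le₂ := fun w => (close_intWeight hO (Nat.pow_pos (gridD_pos hq)) hv w).2.2.2
  ρ_lt := ringCode_lt
  κ_lt := keyCode_lt
  A_eq := fun _ hξ _ hy x => partA_eq hq (not_key_mid hO.mem h0) x hξ hy

/-- If there are no violations, then the output is correct. -/
theorem abs_condEntropy_sub_le {μ : Measure (Site d → Fin q)} (hq : 0 < q) (hμ : IsGibbs Φ μ)
    (hO : Represents Φ K O) (h0 : (0 : Site d) ∉ K) (hv : viol d q r x O ≤ 0) :
    |gridM q x * condEntropy μ {0} K -
      meanH (partA d q r O) q (keyQ d q r O) (ringQ d q r) (gridM q x)| ≤ 25 * q * gridD q x := by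
  have := hμ.isProbabilityMeasure
  have v1 := viol₁_nonneg d q r O (gridM q x)
  have v2 := viol₂_nonneg (A := partA d q r O) (q := q) (Qy := keyQ d q r O) (Qx := ringQ d q r)
    (M := gridM q x)
  have v3 := viol₃_nonneg (A := partA d q r O) (q := q) (Qy := keyQ d q r O) (Qx := ringQ d q r)
    (M := gridM q x) (e := 20 * q * gridD q x)
  have hv' : viol₁ d q r O (gridM q x) +
    viol₂ (partA d q r O) q (keyQ d q r O) (ringQ d q r) (gridM q x) +
    viol₃ (partA d q r O) q (keyQ d q r O) (ringQ d q r) (gridM q x) (20 * q * gridD q x : ℕ) ≤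
      0 := by exact_mod_cast hv
  have h := rounded (x := x) hq hO h0 (show viol₁ d q r O (gridM q x) ≤ 0 by linarith)
  have h₂ : viol₂ (partA d q r O) q (keyQ d q r O) (ringQ d q r) (gridM q x) ≤ 0 := by linarith
  have h₃ : viol₃ (partA d q r O) q (keyQ d q r O) (ringQ d q r) (gridM q x)
    (20 * q * gridD q x) ≤ 0 := by linarith
  set a₀ : Fin q := ⟨0, hq⟩
  rw [hμ.condEntropy_formula (r := r) h0 hO.mem a₀ (fun ζ w => μ.real (cyl ζ) *
    condWeight Φ r (outRing a₀ ζ) w) fun _ _ => rfl]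
  exact h.sound h₂ h₃ (fun ζ => μ.real (cyl ζ))
    (fun _ => measureReal_nonneg) (sum_real_cyl _) (outRing a₀) (fun ζ => ringCode_lt _)
    (fun ζ hζ => (hμ.ringPf_pos a₀ ζ hζ).1) (outKey a₀) _ fun _ _ => rfl

end Approx


/-! ## Strong spatial mixing implies the stopping condition -/

section

variable {d q r x : ℕ} {O : Oracle} {Φ : Interaction d q} {K : Finset (Site d)}

/-- The bridge from the sums over codes, in which the tests are phrased, to the partition functions,
in which mixing is phrased. -/
lemma wsum_eq_pf (X : Site d → Fin q) (E : Set (Config d q (box d r)))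
    (E' : Config d q (box d (r + 1)) → Prop) [DecidablePred E']
    (hE : ∀ v, E' (rst (box d (r + 1)) (glue v X)) ↔ v ∈ E) :
    wsum Φ.weight (fun w => ringCode w = ringCode (rst (box d (r + 1)) X) ∧ E' w) =
      pf Φ (box d (r + 1)) (box d r) X E := by
  have := sum_glue X fun w => if E' w then Φ.weight w else 0
  rw [wsum, pf]
  simp only [ite_and]
  rw [← this]
  refine Finset.sum_congr rfl fun v _ => ?_
  by_cases hv : v ∈ E
  · rw [if_pos hv, if_pos ((hE v).mpr hv)]
  · rw [if_neg hv, if_neg fun h => hv ((hE v).mp h)]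

lemma wsum_mul_ite {Ω : Type*} [Fintype Ω] (I : Ω → ℝ) (Q P : Ω → Prop) [DecidablePred Q]
    [DecidablePred P] :
    wsum (fun w => I w * if P w then 1 else 0) Q = wsum I (fun w => Q w ∧ P w) := by
  refine Finset.sum_congr rfl fun w _ => ?_
  by_cases h1 : Q w <;> by_cases h2 : P w <;> simp [h1, h2]

lemma lt_l1_of_not_mem_box {n : ℕ} {v : Site d} (hv : v ∉ box d n) {m : ℕ} {u : Site d}
    (hu : u ∈ box d m) : n - m ≤ l1 u v := by
  rw [mem_box] at hv hu
  push Not at hv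
  obtain ⟨i, hi⟩ := hv
  have h1 : (u i - v i).natAbs ≤ l1 u v :=
    Finset.single_le_sum (f := fun i => (u i - v i).natAbs) (fun _ _ => Nat.zero_le _)
      (Finset.mem_univ i)
  have h2 := hu i
  by_cases h3 : -(n : ℤ) ≤ v i
  · have := hi h3; omega
  · omega

lemma ringCode_rst {X : Site d → Fin q} {w : Config d q (box d (r + 1))}
    (h : ∀ v : box d (r + 1), v.1 ∉ box d r → X v = w v) :
    ringCode (rst (box d (r + 1)) X) = ringCode w := ringCode_eq_iff.mpr h

lemma avg_key_eq (hO : ∀ v : Site d, O 2 (List.ofFn v) = if v ∈ K then 1 else 0)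
    {X : Site d → Fin q} {w : Config d q (box d (r + 1))} (hX : rst (box d (r + 1)) X = w)
    (y : Fin q) :
    wsum Φ.weight (fun v : Config d q (box d (r + 1)) => ringCode v = ringCode w ∧ keyCode O v = keyCode O w) =
      pf Φ (box d (r + 1)) (box d r) X (agree (box d r) (box d r ∩ K) X) ∧
    avg Φ.weight (fun v : Config d q (box d (r + 1)) => ringCode v = ringCode w ∧ keyCode O v = keyCode O w)
      (fun v : Config d q (box d (r + 1)) => if v ⟨0, zero_mem_box⟩ = y then 1 else 0) =
      pf Φ (box d (r + 1)) (box d r) X ({v | v ⟨0, zero_mem_box⟩ = y} ∩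
        agree (box d r) (box d r ∩ K) X) /
      pf Φ (box d (r + 1)) (box d r) X (agree (box d r) (box d r ∩ K) X) := by
  subst hX
  have hE : ∀ v, keyCode O (rst (box d (r + 1)) (glue v X)) = keyCode O (rst (box d (r + 1)) X) ↔
      v ∈ agree (box d r) (box d r ∩ K) X := by
    intro v
    rw [keyCode_eq_iff hO]
    constructor
    · intro h u hu
      have := h ⟨u, box_union_bdry_subset (Finset.mem_union_left _ u.2)⟩ hu
      rwa [rst, glue_apply_of_mem v X u.2] at this
    · intro h u hu
      have hu' := (Finset.mem_inter.mp hu).1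
      rw [rst, glue_apply_of_mem v X hu']
      exact h ⟨u, hu'⟩ hu
  have h1 := wsum_eq_pf (Φ := Φ) X _ (fun v => keyCode O v = keyCode O (rst (box d (r + 1)) X)) hE
  refine ⟨h1, ?_⟩
  rw [avg, h1, wsum_mul_ite]
  congr 1
  rw [← wsum_eq_pf X _ (fun v => keyCode O v = keyCode O (rst (box d (r + 1)) X) ∧
    v ⟨0, zero_mem_box⟩ = y)]
  · simp only [and_assoc]
  · intro v
    rw [hE, and_comm, rst, glue_apply_of_mem v X zero_mem_box]
    rfl

/-- The part of the set `K` that is far from the boundary of the cube. -/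
def core (K : Finset (Site d)) (r : ℕ) : Finset (Site d) := box d (r / 2) ∩ K

lemma box_mono {m n : ℕ} (h : m ≤ n) : box d m ⊆ box d n := by
  intro v hv
  rw [mem_box] at hv ⊢
  intro i
  have := hv i
  omega

lemma core_subset : core K r ⊆ box d r :=
  Finset.inter_subset_left.trans (box_mono (Nat.div_le_self _ _))

lemma core_subset_succ : core K r ⊆ box d (r + 1) := core_subset.trans (box_mono (Nat.le_succ _))

/-- Gluing c into the background turns the event that the core carries c into agreement with the
background, the form required by `Mixing.chain`. It does not affect the boundary code, as the core
lies in the inner cube. -/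
lemma avg_core_eq {X : Site d → Fin q} {w : Config d q (box d (r + 1))}
    (hX : rst (box d (r + 1)) X = w) (c : Config d q (core K r)) :
    wsum Φ.weight (fun v : Config d q (box d (r + 1)) => ringCode v = ringCode w) =
      pf Φ (box d (r + 1)) (box d r) (glue c X) Set.univ ∧
    avg Φ.weight (fun v : Config d q (box d (r + 1)) => ringCode v = ringCode w)
      (fun v : Config d q (box d (r + 1)) => if res core_subset_succ v = c then 1 else 0) =
      pf Φ (box d (r + 1)) (box d r) (glue c X) (agree (box d r) (core K r) (glue c X)) /
      pf Φ (box d (r + 1)) (box d r) (glue c X) Set.univ := by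
  subst hX
  have hr : ringCode (rst (box d (r + 1)) (glue c X)) = ringCode (rst (box d (r + 1)) X) :=
    ringCode_rst fun v hv => glue_apply_of_not_mem c X fun h => hv (core_subset h)
  have h1 := wsum_eq_pf (Φ := Φ) (r := r) (glue c X) Set.univ (fun _ => True) fun v => by simp
  simp only [and_true, hr] at h1
  refine ⟨h1, ?_⟩
  rw [avg, h1, wsum_mul_ite]
  congr 1
  rw [← wsum_eq_pf (glue c X) _ (fun v => res core_subset_succ v = c), hr]
  intro v
  have hv : ∀ u (hu : u ∈ core K r), rst (box d (r + 1)) (glue v (glue c X))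
      ⟨u, core_subset_succ hu⟩ = v ⟨u, core_subset hu⟩ :=
    fun u hu => glue_apply_of_mem v _ (core_subset hu)
  constructor
  · intro h u hu
    rw [glue_apply_of_mem c X hu, ← h]
    exact (hv u hu).symm
  · intro h
    funext u
    refine (hv u u.2).trans ((h ⟨u, core_subset u.2⟩ u.2).trans ?_)
    exact glue_apply_of_mem c X u.2

/-- Strong spatial mixing implies that there are no violations if the cube is large enough. -/
theorem viol_nonpos {C α : ℝ} (hC : 0 < C) (hmix : Mixing Φ C α) (hq : 0 < q)
    (hO : Represents Φ K O) (h0 : (0 : Site d) ∉ K) (hv : viol₁ d q r O (gridM q x) ≤ 0)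
    (h₁ : gridM q x * (C * Real.exp (-α * (r / 2 : ℕ))) ≤ 1 / 4)
    (h₂ : gridD q x * (q ^ K.card * (K.card * (C * Real.exp (-α * (r / 2 : ℕ))))) ≤ 1) :
    viol d q r x O ≤ 0 := by
  set ε := C * Real.exp (-α * (r / 2 : ℕ)) with hε
  have hε0 : 0 ≤ ε := by positivity
  have h := rounded (x := x) hq hO h0 hv
  set a₀ : Fin q := ⟨0, hq⟩
  set ex : Config d q (box d (r + 1)) → Site d → Fin q := fun w => glue w fun _ => a₀ with hex
  have hrst : ∀ w, rst (box d (r + 1)) (ex w) = w := fun w => by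
    funext v
    exact dif_pos v.2
  have hπ : ∀ w w' : Config d q (box d (r + 1)), keyCode O w = keyCode O w' →
      res (core_subset_succ (K := K)) w = res core_subset_succ w' := by
    intro w w' hκ
    rw [keyCode_eq_iff hO.mem] at hκ
    funext u
    exact hκ ⟨u, _⟩ (Finset.mem_inter.mpr ⟨core_subset u.2, (Finset.mem_inter.mp u.2).2⟩)
  obtain ⟨v₂, v₃⟩ := h.complete (res (core_subset_succ (K := K))) hπ
    (by
      intro w w' hw hw' hc y
      obtain ⟨e1, e2⟩ := avg_key_eq (Φ := Φ) hO.mem (hrst w) y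
      obtain ⟨e1', e2'⟩ := avg_key_eq (Φ := Φ) hO.mem (hrst w') y
      rw [e2, e2']
      refine le_trans (mul_le_mul_of_nonneg_left ?_ (Nat.cast_nonneg _)) h₁
      -- The two backgrounds agree on the core, so among the conditioned sites they differ only
      -- outside the cube of radius r/2, at distance at least r/2 from the origin.
      refine hmix _ _ _ box_union_bdry_subset Finset.inter_subset_left 0 zero_mem_box y _ _ _ ?_ ?_ ?_
      · intro v hv hne
        have hv' : v ∉ core K r := by
          intro hvc
          refine hne ?_
          have := congrFun hc ⟨v, hvc⟩
          simp only [hex]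
          rw [glue_apply_of_mem w _ (core_subset_succ hvc),
            glue_apply_of_mem w' _ (core_subset_succ hvc)]
          exact this
        have hvb : v ∉ box d (r / 2) := by
          intro hvb
          rcases Finset.mem_union.mp hv with h1 | h1
          · exact hv' (Finset.mem_inter.mpr ⟨hvb, (Finset.mem_inter.mp h1).2⟩)
          · exact (Finset.mem_sdiff.mp h1).2 (box_mono (Nat.div_le_self _ _) hvb)
        have := lt_l1_of_not_mem_box hvb (zero_mem_box (n := 0))
        simpa using this
      · rw [← e1]
        exact wsum_pos_of (weight_nonneg Φ) ⟨rfl, rfl⟩ hw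
      · rw [← e1']
        exact wsum_pos_of (weight_nonneg Φ) ⟨rfl, rfl⟩ hw')
    (by
      intro w w' hw hw'
      refine le_trans (mul_le_mul_of_nonneg_left ?_ (Nat.cast_nonneg _)) h₂
      have hcard : (core K r).card ≤ K.card := Finset.card_le_card Finset.inter_subset_right
      -- For each of the at most q^|K| core configurations, the chain rule bounds the influence of
      -- the boundary, whose distance from the core is at least r - r/2 ≥ r/2.
      refine (Finset.sum_le_card_nsmul _ _ (K.card * ε) fun c _ => ?_).trans ?_
      · obtain ⟨e1, e2⟩ := avg_core_eq (Φ := Φ) (hrst w) c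
        obtain ⟨e1', e2'⟩ := avg_core_eq (Φ := Φ) (hrst w') c
        rw [e2, e2']
        refine (hmix.chain hC box_union_bdry_subset core_subset (n := r / 2) ?_ ?_ ?_ ?_).trans ?_
        · intro v hv
          rw [glue_apply_of_mem c _ hv, glue_apply_of_mem c _ hv]
        · intro u hu v hv
          have := lt_l1_of_not_mem_box (Finset.mem_sdiff.mp hv).2 (Finset.mem_inter.mp hu).1
          omega
        · rw [← e1]
          exact wsum_pos_of (weight_nonneg Φ) rfl hw
        · rw [← e1']
          exact wsum_pos_of (weight_nonneg Φ) rfl hw'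
        · have : ((core K r).card : ℝ) ≤ K.card := by exact_mod_cast hcard
          gcongr
      · rw [Finset.card_univ, nsmul_eq_mul, Fintype.card_fun, Fintype.card_fin, Fintype.card_coe]
        have hq1 : (1 : ℝ) ≤ q := by exact_mod_cast hq
        push_cast
        gcongr)
  have hviol : viol d q r x O = viol₁ d q r O (gridM q x) +
    viol₂ (partA d q r O) q (keyQ d q r O) (ringQ d q r) (gridM q x) +
    viol₃ (partA d q r O) q (keyQ d q r O) (ringQ d q r) (gridM q x) (20 * q * gridD q x : ℕ) := by
    simp [viol]
  have v₂' : viol₂ (partA d q r O) q (keyQ d q r O) (ringQ d q r) (gridM q x) ≤ 0 := v₂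
  have v₃' : viol₃ (partA d q r O) q (keyQ d q r O) (ringQ d q r) (gridM q x)
    (20 * q * gridD q x) ≤ 0 := v₃
  rw [hviol]
  linarith

end


/-! ## The radius at which there are no violations -/

/-- Exponential decay in a large multiple of `x + 1` beats polynomials and fixed exponentials. -/
lemma eventually_poly_mul_exp_le (A B lam : ℝ) (hB : 0 ≤ B) (hlam : 0 < lam) (k : ℕ) :
    ∀ᶠ c : ℕ in atTop, ∀ x : ℕ, A * (2 * (c * (x + 1) : ℕ) + 3) ^ k * B ^ (x + 1) *
      Real.exp (-lam * (c * (x + 1) : ℕ)) ≤ 1 := by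
  have h1 : Tendsto (fun r : ℕ => |A| * (2 * (r : ℝ) + 3) ^ k * Real.exp (-(lam / 2) * r)) atTop
      (nhds 0) := by
    -- With y = (λ/2) r + 3λ/4 as the argument of the exponential, 2 r + 3 = (4/λ) y is a monomial
    -- in y.
    have h := (Polynomial.tendsto_div_exp_atTop
      (Polynomial.C (|A| * Real.exp (3 * lam / 4)) * (Polynomial.C (4 / lam)* Polynomial.X) ^ k)).comp
      ((tendsto_natCast_atTop_atTop (R := ℝ)).const_mul_atTop (show 0 < lam / 2 by positivity)
        |>.atTop_add (tendsto_const_nhds (x := 3 * lam / 4)))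
    refine h.congr fun r => ?_
    simp only [Function.comp_apply, Polynomial.eval_mul, Polynomial.eval_C, Polynomial.eval_pow,
      Polynomial.eval_X, Real.exp_add, neg_mul, Real.exp_neg]
    have e : 4 / lam * (lam / 2 * (r : ℝ) + 3 * lam / 4) = 2 * r + 3 := by field_simp; ring
    rw [e]
    field_simp
  have h2 : Tendsto (fun c : ℕ => B * Real.exp (-(lam / 2) * c)) atTop (nhds 0) := by
    have : Tendsto (fun c : ℕ => Real.exp (-(lam / 2) * c)) atTop (nhds 0) :=
      Real.tendsto_exp_atBot.comp ((tendsto_natCast_atTop_atTop (R := ℝ)).const_mul_atTop_of_neg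
        (by linarith))
    simpa using this.const_mul B
  obtain ⟨r₀, hr₀⟩ := eventually_atTop.mp (h1.eventually_le_const one_pos)
  filter_upwards [h2.eventually_le_const one_pos, eventually_ge_atTop r₀] with c hc hc' x
  have hr := hr₀ (c * (x + 1)) (hc'.trans (Nat.le_mul_of_pos_right _ x.succ_pos))
  have hp : B ^ (x + 1) * Real.exp (-(lam / 2) * (c * (x + 1) : ℕ)) ≤ 1 := by
    have : B ^ (x + 1) * Real.exp (-(lam / 2) * (c * (x + 1) : ℕ)) =
        (B * Real.exp (-(lam / 2) * c)) ^ (x + 1) := by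
      rw [mul_pow, ← Real.exp_nat_mul]
      congr 2
      push_cast
      ring
    rw [this]
    exact pow_le_one₀ (by positivity) hc
  -- One half of the decay beats the polynomial and the other half beats B^(x+1). Both estimates are
  -- uniform in x because c (x + 1) ≥ c.
  have he : Real.exp (-lam * (c * (x + 1) : ℕ)) = Real.exp (-(lam / 2) * (c * (x + 1) : ℕ)) *
      Real.exp (-(lam / 2) * (c * (x + 1) : ℕ)) := by
    rw [← Real.exp_add]
    congr 1
    ring
  calc A * (2 * (c * (x + 1) : ℕ) + 3) ^ k * B ^ (x + 1) * Real.exp (-lam * (c * (x + 1) : ℕ))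
      = (A * (2 * (c * (x + 1) : ℕ) + 3) ^ k * Real.exp (-(lam / 2) * (c * (x + 1) : ℕ))) *
        (B ^ (x + 1) * Real.exp (-(lam / 2) * (c * (x + 1) : ℕ))) := by rw [he]; ring
    _ ≤ 1 * 1 := by
        refine mul_le_mul (le_trans ?_ hr) hp (by positivity) zero_le_one
        gcongr
        exact le_abs_self A
    _ = 1 := one_mul 1

section

variable {d q : ℕ}

/-- The threshold grows like a polynomial in r times 9^x, as M is of order (3^x)²; the precision
gains a factor 2 with each unit of r = c (x + 1). -/
lemma eventually_thresh_le (hq : 0 < q) {g : ℝ} (hg : 0 < g) :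
    ∀ᶠ c : ℕ in atTop, ∀ x : ℕ,
      (thresh d (c * (x + 1)) (gridM q x) : ℝ) + 1 ≤ 2 ^ (c * (x + 1)) * g := by
  filter_upwards [eventually_poly_mul_exp_le (18 * (d + 1) * 2500 * q ^ 2 / g) 9 (Real.log 2)
    (by norm_num) (Real.log_pos one_lt_two) d] with c hc x
  set r := c * (x + 1) with hr
  have h := hc x
  rw [← hr, neg_mul, Real.exp_neg, mul_comm (Real.log 2), Real.exp_nat_mul, Real.exp_log two_pos,
    ← div_eq_mul_inv, div_le_one (by positivity)] at h
  have hNM : 1 ≤ nSites d r * gridM q x := Nat.mul_pos (pow_pos sideL_pos _) (pow_pos (gridD_pos hq) _)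
  have hNM' : (1 : ℝ) ≤ nSites d r * gridM q x := by exact_mod_cast hNM
  have hd : (0 : ℝ) ≤ d := Nat.cast_nonneg d
  have hM : (gridM q x : ℝ) ≤ 2500 * q ^ 2 * 9 ^ (x + 1) := by
    have : (9 : ℝ) ^ x = (3 ^ x) ^ 2 := by rw [← pow_mul, mul_comm, pow_mul]; norm_num
    simp only [gridM, gridD]
    push_cast
    rw [pow_succ 9, this]
    nlinarith [show (0 : ℝ) ≤ q ^ 2 * (3 ^ x) ^ 2 by positivity]
  have hN : (nSites d r : ℝ) = (2 * r + 3) ^ d := by simp [nSites, sideL]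
  calc (thresh d r (gridM q x) : ℝ) + 1 = 16 * (d + 1) * (nSites d r * gridM q x) + 2 := by
        simp only [thresh]; push_cast; ring
    _ ≤ 18 * (d + 1) * (nSites d r * gridM q x) := by nlinarith
    _ ≤ 18 * (d + 1) * ((2 * r + 3) ^ d * (2500 * q ^ 2 * 9 ^ (x + 1))) := by
        rw [hN]; gcongr
    _ = (18 * (d + 1) * 2500 * q ^ 2 / g * (2 * r + 3) ^ d * 9 ^ (x + 1)) * g := by
        field_simp
    _ ≤ 2 ^ r * g := by gcongr

/-- There are finitely many non-zero interactions, so one c serves them all. It is uniform in the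
oracles, as only the guaranteed precision of the answers is used. -/
lemma eventually_viol₁_nonpos (Φ : Interaction d q) (hq : 0 < q) :
    ∀ᶠ c : ℕ in atTop, ∀ (x : ℕ) (K : Finset (Site d)) (O : Oracle), Represents Φ K O →
      viol₁ d q (c * (x + 1)) O (gridM q x) ≤ 0 := by
  have hγ : ∀ᶠ c : ℕ in atTop, ∀ (a : Fin q) (x : ℕ),
      (thresh d (c * (x + 1)) (gridM q x) : ℝ) + 1 ≤ 2 ^ (c * (x + 1)) * Φ.γ a :=
    eventually_all.mpr fun a => eventually_thresh_le hq (Φ.γ_pos a)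
  have hβ : ∀ᶠ c : ℕ in atTop, ∀ (i : Fin d) (a b : Fin q), Φ.β i a b ≠ 0 → ∀ x : ℕ,
      (thresh d (c * (x + 1)) (gridM q x) : ℝ) + 1 ≤ 2 ^ (c * (x + 1)) * Φ.β i a b := by
    refine eventually_all.mpr fun i => eventually_all.mpr fun a => eventually_all.mpr fun b => ?_
    by_cases h : Φ.β i a b = 0
    · simp [h]
    · filter_upwards [eventually_thresh_le hq ((Φ.β_nonneg i a b).lt_of_ne' h)] with c hc _
      exact hc
  filter_upwards [hγ, hβ] with c h1 h2 x K O hO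
  rw [viol₁_nonpos_iff]
  have key : ∀ (m : ℤ) (b : ℝ) (r : ℕ), |(m : ℝ) / 2 ^ r - b| ≤ 1 / 2 ^ r →
      (thresh d r (gridM q x) : ℝ) + 1 ≤ 2 ^ r * b → (thresh d r (gridM q x) : ℤ) ≤ m := by
    intro m b r h h'
    have := (abs_le.mp (abs_sub_le_one h)).1
    have h3 : ((thresh d r (gridM q x) : ℤ) : ℝ) ≤ m := by push_cast; linarith
    exact_mod_cast h3
  refine ⟨fun a ha => key _ _ _ (hO.gamma ⟨a, ha⟩ _) (h1 ⟨a, ha⟩ x), fun i a ha b hb => ?_⟩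
  by_cases h : Φ.β i ⟨a, ha⟩ ⟨b, hb⟩ = 0
  · exact Or.inl ((hO.beta_zero i ⟨a, ha⟩ ⟨b, hb⟩ _).mpr h)
  · exact Or.inr (key _ _ _ (hO.beta i ⟨a, ha⟩ ⟨b, hb⟩ _) (h2 i ⟨a, ha⟩ ⟨b, hb⟩ h x))

/-- A radius proportional to `x + 1` suffices, uniformly in the oracles. -/
theorem exists_radius {Φ : Interaction d q} (hΦ : Φ.SSM) (hq : 0 < q) (k : ℕ) :
    ∃ c : ℕ, 1 ≤ c ∧ ∀ (x : ℕ) (K : Finset (Site d)) (O : Oracle), Represents Φ K O →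
      (0 : Site d) ∉ K → K.card ≤ k * (x + 1) → viol d q (c * (x + 1)) x O ≤ 0 := by
  obtain ⟨C, α, hC, hα, hmix⟩ := hΦ.mixing
  have hq1 : (1 : ℝ) ≤ q := by exact_mod_cast hq
  -- The base 9 comes from M and the base 3 (2q)^k from D q^|K| |K| with |K| ≤ k (x + 1). The factor
  -- exp (α/2) pays for rounding down r/2.
  obtain ⟨c, h1, h2, h3, h4⟩ := ((eventually_viol₁_nonpos Φ hq).and
    ((eventually_poly_mul_exp_le (4 * 2500 * q ^ 2 * C * Real.exp (α / 2)) 9 (α / 2) (by norm_num)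
      (by positivity) 0).and
    ((eventually_poly_mul_exp_le (50 * q * C * Real.exp (α / 2)) (3 * (2 * q) ^ k) (α / 2)
      (by positivity) (by positivity) 0).and (eventually_ge_atTop 1)))).exists
  refine ⟨c, h4, fun x K O hO h0 hK => viol_nonpos hC hmix hq hO h0 (h1 x K O hO) ?_ ?_⟩ <;>
    set r := c * (x + 1) with hr
  all_goals
    have hexp : Real.exp (-α * (r / 2 : ℕ)) ≤ Real.exp (α / 2) * Real.exp (-(α / 2) * r) := by
      rw [← Real.exp_add]
      have : (r : ℝ) ≤ 2 * (r / 2 : ℕ) + 1 := by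
        have : r ≤ 2 * (r / 2) + 1 := by omega
        exact_mod_cast this
      exact Real.exp_le_exp.mpr (by nlinarith)
  · have h := h2 x
    rw [← hr, pow_zero, mul_one] at h
    have e : (gridM q x : ℝ) ≤ 2500 * q ^ 2 * 9 ^ (x + 1) := by
      have : (9 : ℝ) ^ x = (3 ^ x) ^ 2 := by rw [← pow_mul, mul_comm, pow_mul]; norm_num
      simp only [gridM, gridD]
      push_cast
      rw [pow_succ 9, this]
      nlinarith [show (0 : ℝ) ≤ q ^ 2 * (3 ^ x) ^ 2 by positivity]
    calc (gridM q x : ℝ) * (C * Real.exp (-α * (r / 2 : ℕ)))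
        ≤ (2500 * q ^ 2 * 9 ^ (x + 1)) * (C * (Real.exp (α / 2) * Real.exp (-(α / 2) * r))) := by
          gcongr
      _ = 1 / 4 * (4 * 2500 * q ^ 2 * C * Real.exp (α / 2) * 9 ^ (x + 1) *
          Real.exp (-(α / 2) * r)) := by ring
      _ ≤ 1 / 4 := by linarith
  · have h := h3 x
    rw [← hr, pow_zero, mul_one] at h
    have e1 : (q : ℝ) ^ K.card * K.card ≤ ((2 * q) ^ k) ^ (x + 1) := by
      have : (K.card : ℝ) ≤ 2 ^ K.card := by exact_mod_cast Nat.lt_two_pow_self.le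
      calc (q : ℝ) ^ K.card * K.card ≤ q ^ K.card * 2 ^ K.card := by gcongr
        _ = (2 * q) ^ K.card := by rw [mul_comm, mul_pow]
        _ ≤ (2 * q) ^ (k * (x + 1)) := pow_le_pow_right₀ (by linarith) hK
        _ = _ := pow_mul _ _ _
    calc (gridD q x : ℝ) * (q ^ K.card * (K.card * (C * Real.exp (-α * (r / 2 : ℕ)))))
        = gridD q x * (q ^ K.card * K.card) * (C * Real.exp (-α * (r / 2 : ℕ))) := by ring
      _ ≤ (50 * q * 3 ^ (x + 1)) * ((2 * q) ^ k) ^ (x + 1) *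
          (C * (Real.exp (α / 2) * Real.exp (-(α / 2) * r))) := by
          gcongr
          simp only [gridD]
          push_cast
          gcongr
          · norm_num
          · omega
      _ = 50 * q * C * Real.exp (α / 2) * (3 * (2 * q) ^ k) ^ (x + 1) * Real.exp (-(α / 2) * r) := by
          rw [mul_pow 3]; ring
      _ ≤ 1 := h

end


/-! ## Bounds for the running time -/

section

variable {d q r : ℕ} {O : Oracle}

/-- A discrete mean value estimate. It shows that the outer layer, the difference of two cubes, has
only O(r^(d-1)) sites. -/
lemma add_two_pow_le (a d : ℕ) : (a + 2) ^ d ≤ a ^ d + 2 * d * (a + 2) ^ (d - 1) := by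
  induction d with
  | zero => simp
  | succ d ih =>
    have h : d * (a * (a + 2) ^ (d - 1)) ≤ d * (a + 2) ^ d := by
      rcases d with _ | d
      · simp
      · rw [Nat.add_sub_cancel, pow_succ (a + 2) d, mul_comm a]
        gcongr
        omega
    calc (a + 2) ^ (d + 1) = a * (a + 2) ^ d + 2 * (a + 2) ^ d := by ring
      _ ≤ a * (a ^ d + 2 * d * (a + 2) ^ (d - 1)) + 2 * (a + 2) ^ d := by gcongr
      _ = a ^ (d + 1) + 2 * (d * (a * (a + 2) ^ (d - 1))) + 2 * (a + 2) ^ d := by ring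
      _ ≤ a ^ (d + 1) + 2 * (d * (a + 2) ^ d) + 2 * (a + 2) ^ d := by gcongr
      _ = a ^ (d + 1) + 2 * (d + 1) * (a + 2) ^ (d + 1 - 1) := by
        rw [Nat.add_sub_cancel]; ring

lemma card_box (d n : ℕ) : (box d n).card = (2 * n + 1) ^ d := by
  rw [box, Fintype.card_piFinset_const, Int.card_Icc]
  congr 1
  omega

lemma count_outer_le : Nat.count (Outer d r) (nSites d r) ≤ 2 * d * winLen d r := by
  have h1 : Nat.count (Outer d r) (nSites d r) + Nat.count (Inner d r) (nSites d r) =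
      nSites d r := by
    rw [Nat.count_eq_card_filter_range, Nat.count_eq_card_filter_range, add_comm]
    have := Finset.card_filter_add_card_filter_not (s := Finset.range (nSites d r)) (Inner d r)
    rwa [Finset.card_range] at this
  have h2 : (2 * r + 1) ^ d ≤ Nat.count (Inner d r) (nSites d r) := by
    rw [← card_box, Nat.count_eq_card_filter_range]
    refine Finset.card_le_card_of_injOn (idx d r) (fun v hv => ?_) fun v hv u hu h => ?_
    · have hv' := box_mono (Nat.le_succ r) hv
      rw [Finset.mem_coe, Finset.mem_filter, Finset.mem_range, inner_iff, siteOf_idx hv']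
      exact ⟨idx_lt hv', hv⟩
    · rw [← siteOf_idx (box_mono (Nat.le_succ r) hv), h, siteOf_idx (box_mono (Nat.le_succ r) hu)]
  have h3 := add_two_pow_le (2 * r + 1) d
  have h4 : nSites d r = (2 * r + 1 + 2) ^ d := rfl
  have h5 : winLen d r = (2 * r + 1 + 2) ^ (d - 1) := rfl
  rw [h5]
  omega

lemma count_key_le {K : Finset (Site d)}
    (hO : ∀ v : Site d, O 2 (List.ofFn v) = if v ∈ K then 1 else 0) :
    Nat.count (Key d r O) (nSites d r) ≤ K.card := by
  rw [Nat.count_eq_card_filter_range]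
  refine Finset.card_le_card_of_injOn (siteOf d r) (fun t ht => ?_) fun t ht s hs h => ?_
  · rw [Finset.mem_coe, Finset.mem_filter] at ht
    have h := ht.2.2
    rw [siteZ_eq, hO] at h
    by_contra hc
    simp [show siteOf d r t ∉ K from hc] at h
  · rw [Finset.mem_coe, Finset.mem_filter, Finset.mem_range] at ht hs
    rw [← idx_siteOf ht.1, h, idx_siteOf hs.1]

lemma natAbs_sum_le {ι : Type*} (s : Finset ι) (f : ι → ℤ) {B : ℕ} (h : ∀ i ∈ s, (f i).natAbs ≤ B) :
    (∑ i ∈ s, f i).natAbs ≤ s.card * B := by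
  refine (Int.natAbs_sum_le s f).trans ?_
  simpa using Finset.sum_le_card_nsmul s (fun i => (f i).natAbs) B h

/-- Each step chooses among q symbols and multiplies by one vertex weight and at most d edge
weights. Thus the entries have only polynomially many bits in r. -/
lemma natAbs_row_le (ξ y x : ℕ) {G : ℕ} (hG : 1 ≤ G)
    (h₀ : ∀ a < q, (O 0 [(a : ℤ), (r : ℤ)]).natAbs ≤ G)
    (h₁ : ∀ (i : Fin d), ∀ a < q, ∀ b < q,
      (O 1 [((i : ℕ) : ℤ), (a : ℤ), (b : ℤ), (r : ℤ)]).natAbs ≤ G) (t c : ℕ) :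
    (row d q r O ξ y x t c).natAbs ≤ (q * G ^ (d + 1)) ^ t := by
  induction t generalizing c with
  | zero => simp [row]
  | succ t ih =>
    rw [row, pow_succ']
    refine (natAbs_sum_le _ _ (B := G ^ (d + 1) * (q * G ^ (d + 1)) ^ t) fun a ha => ?_).trans
      (by rw [Finset.card_range, mul_assoc])
    have ha' := Finset.mem_range.mp ha
    rw [Int.natAbs_mul]
    refine Nat.mul_le_mul ?_ (ih _)
    rw [Int.natAbs_mul, Int.natAbs_mul, pow_succ']
    refine Nat.mul_le_mul ?_ ?_
    · calc _ ≤ 1 * G := Nat.mul_le_mul (by split_ifs <;> simp) (h₀ a ha')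
        _ = G := one_mul G
    · rw [show ∀ f : Fin d → ℤ, (∏ i, f i).natAbs = ∏ i, (f i).natAbs from
        fun f => map_prod Int.natAbsHom f _]
      refine (Finset.prod_le_pow_card _ _ G fun i _ => ?_).trans (by simp)
      split_ifs
      · exact h₁ i a ha' _ (Nat.mod_lt _ (by omega))
      · simpa using hG

lemma natAbs_answer_le {m : ℤ} {g : ℝ} {k Γ : ℕ} (h : |(m : ℝ) / 2 ^ k - g| ≤ 1 / 2 ^ k)
    (hg : 0 ≤ g) (hΓ : g ≤ Γ) : m.natAbs ≤ 2 ^ (k + Γ) := by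
  have h1 := abs_sub_le_one h
  have h2 : |(m : ℝ)| ≤ 2 ^ k * g + 1 := by
    have := abs_sub_abs_le_abs_sub (m : ℝ) (2 ^ k * g)
    rw [abs_of_nonneg (show 0 ≤ 2 ^ k * g by positivity)] at this
    linarith
  have h3 : ((m.natAbs : ℕ) : ℝ) ≤ 2 ^ (k + Γ) := by
    rw [Nat.cast_natAbs, Int.cast_abs]
    have h4 : (Γ : ℝ) + 1 ≤ 2 ^ Γ := by exact_mod_cast Nat.lt_two_pow_self
    have h5 : (1 : ℝ) ≤ 2 ^ k := one_le_pow₀ (by norm_num)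
    rw [pow_add]
    nlinarith
  exact_mod_cast h3

lemma exists_interaction_le (Φ : Interaction d q) :
    ∃ Γ : ℕ, (∀ a, Φ.γ a ≤ Γ) ∧ ∀ i a b, Φ.β i a b ≤ Γ := by
  obtain ⟨Γ, hΓ⟩ := exists_nat_ge ((∑ a, Φ.γ a) + ∑ i, ∑ a, ∑ b, Φ.β i a b)
  have hβ : 0 ≤ ∑ i, ∑ a, ∑ b, Φ.β i a b :=
    Finset.sum_nonneg fun i _ => Finset.sum_nonneg fun a _ => Finset.sum_nonneg fun b _ =>
      Φ.β_nonneg i a b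
  have hγ : 0 ≤ ∑ a, Φ.γ a := Finset.sum_nonneg fun a _ => (Φ.γ_pos a).le
  refine ⟨Γ, fun a => ?_, fun i a b => ?_⟩
  · have := Finset.single_le_sum (f := Φ.γ) (fun a _ => (Φ.γ_pos a).le) (Finset.mem_univ a)
    linarith
  · have h1 := Finset.single_le_sum (f := fun b => Φ.β i a b) (fun b _ => Φ.β_nonneg i a b)
      (Finset.mem_univ b)
    have h2 := Finset.single_le_sum (f := fun a => ∑ b, Φ.β i a b)
      (fun a _ => Finset.sum_nonneg fun b _ => Φ.β_nonneg i a b) (Finset.mem_univ a)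
    have h3 := Finset.single_le_sum (f := fun i => ∑ a, ∑ b, Φ.β i a b)
      (fun i _ => Finset.sum_nonneg fun a _ => Finset.sum_nonneg fun b _ => Φ.β_nonneg i a b)
      (Finset.mem_univ i)
    linarith

lemma le_two_pow_mul {m a Y : ℕ} (h : m ≤ a * Y) : m ≤ 2 ^ (a * Y) :=
  h.trans Nat.lt_two_pow_self.le

lemma pow_le_two_pow_mul {m a Y : ℕ} (h : m ≤ a * Y) : q ^ m ≤ 2 ^ (q * a * Y) :=
  calc q ^ m ≤ (2 ^ q) ^ m := Nat.pow_le_pow_left Nat.lt_two_pow_self.le m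
    _ = 2 ^ (q * m) := (pow_mul _ _ _).symm
    _ ≤ 2 ^ (q * a * Y) := Nat.pow_le_pow_right two_pos (by rw [mul_assoc]; gcongr)

lemma mul_le_two_pow_mul {m n a b Y : ℕ} (h : m ≤ 2 ^ (a * Y)) (h' : n ≤ 2 ^ (b * Y)) :
    m * n ≤ 2 ^ ((a + b) * Y) := by
  rw [add_mul, pow_add]
  exact Nat.mul_le_mul h h'

lemma succ_le_two_pow_mul {m a b Y : ℕ} (hY : 1 ≤ Y) (h : m ≤ 2 ^ (a * Y)) (hb : a + 1 ≤ b) :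
    m + 1 ≤ 2 ^ (b * Y) :=
  calc m + 1 ≤ 2 ^ (a * Y) * 2 ^ Y := by
        have h1 : 1 ≤ 2 ^ (a * Y) := Nat.one_le_two_pow
        have h2 : 2 ≤ 2 ^ Y := Nat.le_self_pow (by omega) 2
        nlinarith
    _ = 2 ^ ((a + 1) * Y) := by rw [← pow_add]; congr 1; ring
    _ ≤ 2 ^ (b * Y) := Nat.pow_le_pow_right two_pos (Nat.mul_le_mul_right Y hb)

/-- All quantities that the algorithm handles are at most exponential in `(x + 1) ^ (d - 1)`. -/
theorem exists_bounds (Φ : Interaction d q) (hd : 1 ≤ d) (hq : 0 < q) (k c : ℕ) :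
    ∃ E : ℕ, ∀ (n x r : ℕ) (K : Finset (Site d)) (O : Oracle), Represents Φ K O →
      x = n ^ (d - 1) → K.card ≤ k * (x + 1) → r ≤ c * (x + 1) →
      Bounds d q n r x O (2 ^ (E * (x + 1) ^ (d - 1))) := by
  obtain ⟨Γ, hγ, hβ⟩ := exists_interaction_le Φ
  -- The constants are the exponents, in units of Y, for the number of sites, the window, the outer
  -- layer, the key configurations, the grid, the length of the entries and the size of the table;
  -- `eW` bounds the length of the window itself.
  set l := 2 * c + 3 with hl
  set eN := d * (2 * l) with heN
  set eW := l ^ (d - 1) with heW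
  set eR := q * (2 * d * eW) with heR
  set eK := q * (2 * k) with heK
  set eD := 50 * q + 6 with heD
  set eT := (q + (2 * c + Γ) * (d + 1)) + eN with heT
  set eU := eR + eK + q + (eN + 1) + q * eW with heU
  set E := 2 * l + eN + eW + eR + eK + 2 * eD + eT + eU + q * eW + 2 * c + Γ + q + 10 with hE
  refine ⟨E, fun n x r K O hO hxn hK hr => ?_⟩
  set Y := (x + 1) ^ (d - 1) with hY
  have hY1 : 1 ≤ Y := Nat.one_le_pow _ _ x.succ_pos
  -- For d = 1 one has Y = 1 and x = n^0 = 1, which is why the factor 2 is needed.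
  have hXY : x + 1 ≤ 2 * Y := by
    rcases (show d = 1 ∨ 2 ≤ d by omega) with rfl | h2
    · simp [hxn, hY]
    · have : x + 1 ≤ Y := Nat.le_self_pow (by omega) _
      omega
  have hi : ∀ i ≤ r, i ≤ 2 * c * Y := fun i hi =>
    calc i ≤ c * (x + 1) := hi.trans hr
      _ ≤ c * (2 * Y) := Nat.mul_le_mul_left c hXY
      _ = 2 * c * Y := by ring
  have hL' : ∀ i ≤ r, sideL i ≤ l * (x + 1) := fun i hi => by
    have := hi.trans hr
    calc 2 * i + 3 ≤ 2 * (c * (x + 1)) + 3 * (x + 1) := by omega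
      _ = l * (x + 1) := by rw [hl]; ring
  have hL : ∀ i ≤ r, sideL i ≤ 2 * l * Y := fun i hi =>
    calc sideL i ≤ l * (x + 1) := hL' i hi
      _ ≤ l * (2 * Y) := Nat.mul_le_mul_left l hXY
      _ = 2 * l * Y := by ring
  have hN : ∀ i ≤ r, nSites d i ≤ 2 ^ (eN * Y) := fun i hi =>
    calc sideL i ^ d ≤ (2 ^ (2 * l * Y)) ^ d := Nat.pow_le_pow_left (le_two_pow_mul (hL i hi)) d
      _ = 2 ^ (eN * Y) := by rw [← pow_mul, heN]; congr 1; ring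
  have hW : ∀ i ≤ r, winLen d i ≤ eW * Y := fun i hi =>
    (Nat.pow_le_pow_left (hL' i hi) (d - 1)).trans (mul_pow _ _ _).le
  have hQ : ∀ i ≤ r, winQ d q i ≤ 2 ^ (q * eW * Y) := fun i hi => pow_le_two_pow_mul (hW i hi)
  have hring : ∀ i ≤ r, ringQ d q i ≤ 2 ^ (eR * Y) := fun i hi => by
    refine pow_le_two_pow_mul (count_outer_le.trans ?_)
    rw [mul_assoc (2 * d)]
    exact Nat.mul_le_mul_left _ (hW i hi)
  have hkX : k * (x + 1) ≤ 2 * k * Y :=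
    (Nat.mul_le_mul_left k hXY).trans (by rw [mul_left_comm, mul_assoc])
  have hkey : ∀ i ≤ r, keyQ d q i O ≤ 2 ^ (eK * Y) := fun i hi =>
    pow_le_two_pow_mul ((count_key_le hO.mem).trans (hK.trans hkX))
  have hqY : q ≤ q * Y := Nat.le_mul_of_pos_right q hY1
  have hU : ∀ i ≤ r, tabSize d q i O ≤ 2 ^ (eU * Y) := fun i hi =>
    mul_le_two_pow_mul (mul_le_two_pow_mul (mul_le_two_pow_mul (mul_le_two_pow_mul (hring i hi)
      (hkey i hi)) (le_two_pow_mul hqY)) (succ_le_two_pow_mul hY1 (hN i hi) le_rfl)) (hQ i hi)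
  have hD : gridD q x ≤ 2 ^ (eD * Y) := by
    refine mul_le_two_pow_mul (le_two_pow_mul (Nat.le_mul_of_pos_right _ hY1)) ?_
    calc 3 ^ x ≤ 2 ^ (3 * (2 * Y)) := by
          calc 3 ^ x ≤ (2 ^ 3) ^ x := Nat.pow_le_pow_left (by norm_num) x
            _ = 2 ^ (3 * x) := (pow_mul _ _ _).symm
            _ ≤ _ := Nat.pow_le_pow_right two_pos (by omega)
      _ = 2 ^ (6 * Y) := by congr 1; ring
  have hM : gridM q x ≤ 2 ^ (2 * eD * Y) := by
    calc gridM q x ≤ (2 ^ (eD * Y)) ^ 2 := Nat.pow_le_pow_left hD 2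
      _ = _ := by rw [← pow_mul]; congr 1; ring
  clear_value E eU eT eD eK eR eW eN l Y
  have hT : (q + (2 * c + Γ) * (d + 1)) + eN + 1 + 1 ≤ E := by rw [← heT]; omega
  clear heT heU heD heK heR heW heN hl hY
  have h₀ : ∀ i ≤ r, ∀ a < q, (O 0 [(a : ℤ), (i : ℤ)]).natAbs ≤ 2 ^ (i + Γ) := fun i _ a ha =>
    natAbs_answer_le (hO.gamma ⟨a, ha⟩ i) (Φ.γ_pos _).le (hγ _)
  have h₁ : ∀ i ≤ r, ∀ (j : Fin d), ∀ a < q, ∀ b < q,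
      (O 1 [((j : ℕ) : ℤ), (a : ℤ), (b : ℤ), (i : ℤ)]).natAbs ≤ 2 ^ (i + Γ) :=
    fun i _ j a ha b hb => natAbs_answer_le (hO.beta j ⟨a, ha⟩ ⟨b, hb⟩ i) (Φ.β_nonneg _ _ _)
      (hβ _ _ _)
  have hlen : ∀ i ≤ r, ∀ z : ℤ, z.natAbs ≤ 2 ^ (i + Γ) → len z ≤ 2 ^ (E * Y) := by
    intro i hi' z hz
    have h1 : len z ≤ i + Γ + 2 := len_le_iff.mpr (hz.trans_lt (Nat.pow_lt_pow_right one_lt_two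
      (Nat.lt_succ_self _)))
    have h2 : i + Γ + 2 ≤ (2 * c + Γ + 2) * Y := by
      have := hi i hi'
      rw [add_mul, add_mul]
      have h3 : Γ ≤ Γ * Y := Nat.le_mul_of_pos_right Γ hY1
      omega
    exact h1.trans ((le_two_pow_mul h2).trans (Nat.pow_le_pow_right two_pos
      (Nat.mul_le_mul_right Y (by omega))))
  have hmod : ∀ a : ℤ, ∃ b : ℕ, b < q ∧ a % (q : ℤ) = b := fun a => by
    have h1 := Int.emod_nonneg a (show (q : ℤ) ≠ 0 by omega)
    have h2 := Int.emod_lt_of_pos a (show (0 : ℤ) < q by omega)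
    exact ⟨(a % (q : ℤ)).toNat, by omega, by omega⟩
  refine ⟨?_, fun h2 => ?_, ?_, ?_, ?_, ?_, ?_, fun i hi => ?_, fun i hi => ?_, fun i hi => ?_,
    fun i hi => ?_, fun i hi => ?_, fun i hi => ?_, fun i hi => ?_, fun i hi' u hu => ?_,
    fun i hi a => ?_, fun i hi j a b => ?_, fun v => ?_⟩
  · exact Nat.le_self_pow (Nat.mul_pos (by omega) hY1).ne' 2
  · have h3 : n ≤ x := hxn ▸ Nat.le_self_pow (by omega) n
    exact succ_le_two_pow_mul hY1 (le_two_pow_mul (show n ≤ 2 * Y by omega)) (by omega)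
  · exact succ_le_two_pow_mul hY1 (le_two_pow_mul (show x ≤ 2 * Y by omega)) (by omega)
  · exact succ_le_two_pow_mul hY1 (le_two_pow_mul hqY) (by omega)
  · refine succ_le_two_pow_mul (a := 2 * c + 1) hY1 (le_two_pow_mul ?_) (by omega)
    have := hi r le_rfl
    rw [add_mul]
    omega
  · exact succ_le_two_pow_mul hY1 hD (by omega)
  · exact succ_le_two_pow_mul hY1 hM (by omega)
  · exact succ_le_two_pow_mul hY1 (le_two_pow_mul (hL i hi)) (by omega)
  · exact succ_le_two_pow_mul hY1 (hN i hi) (by omega)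
  · exact succ_le_two_pow_mul hY1 (le_two_pow_mul (hW i hi)) (by omega)
  · exact succ_le_two_pow_mul hY1 (hQ i hi) (by omega)
  · exact succ_le_two_pow_mul hY1 (hring i hi) (by omega)
  · exact succ_le_two_pow_mul hY1 (hkey i hi) (by omega)
  · exact succ_le_two_pow_mul hY1 (hU i hi) (by omega)
  · set t := u / winQ d q i % (nSites d i + 1) with ht
    have ht' : t ≤ nSites d i := Nat.lt_succ_iff.mp (Nat.mod_lt _ (Nat.succ_pos _))
    have h1 : (tab d q i O u).natAbs ≤ 2 ^ ((q + (i + Γ) * (d + 1)) * nSites d i) :=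
      calc (tab d q i O u).natAbs ≤ (q * (2 ^ (i + Γ)) ^ (d + 1)) ^ t :=
            natAbs_row_le _ _ _ Nat.one_le_two_pow (h₀ i hi') (h₁ i hi') _ _
        _ ≤ (2 ^ q * (2 ^ (i + Γ)) ^ (d + 1)) ^ t := by
            gcongr
            exact Nat.lt_two_pow_self.le
        _ = 2 ^ ((q + (i + Γ) * (d + 1)) * t) := by rw [← pow_mul, ← pow_add, ← pow_mul]
        _ ≤ _ := Nat.pow_le_pow_right two_pos (Nat.mul_le_mul_left _ ht')
    have h2 : len (tab d q i O u) ≤ (q + (i + Γ) * (d + 1)) * nSites d i + 1 + 1 :=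
      len_le_iff.mpr (h1.trans_lt (Nat.pow_lt_pow_right one_lt_two (Nat.lt_succ_self _)))
    refine h2.trans ?_
    have h3 : q + (i + Γ) * (d + 1) ≤ (q + (2 * c + Γ) * (d + 1)) * Y := by
      have h4 : i + Γ ≤ (2 * c + Γ) * Y := by
        rw [add_mul]
        exact Nat.add_le_add (hi i hi') (Nat.le_mul_of_pos_right Γ hY1)
      rw [add_mul q, mul_right_comm]
      exact Nat.add_le_add hqY (Nat.mul_le_mul_right (d + 1) h4)
    have h6 := mul_le_two_pow_mul (le_two_pow_mul h3) (hN i hi')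
    exact succ_le_two_pow_mul hY1 (succ_le_two_pow_mul hY1 h6 le_rfl) hT
  · obtain ⟨b, hb, e⟩ := hmod a
    rw [e]
    exact hlen i hi _ (h₀ i hi b hb)
  · obtain ⟨a', ha, e⟩ := hmod a
    obtain ⟨b', hb, e'⟩ := hmod b
    rw [e, e']
    exact hlen i hi _ (h₁ i hi j a' ha b' hb)
  · rw [hO.mem]
    have h1 : ∀ z : ℤ, z.natAbs ≤ 1 → len z ≤ 2 * Y := fun z hz =>
      (len_le_natAbs z).trans (by omega)
    refine ((h1 _ ?_).trans Nat.lt_two_pow_self.le).trans (Nat.pow_le_pow_right two_pos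
      (Nat.mul_le_mul_right Y (by omega)))
    split_ifs <;> simp

end


section

variable {d q : ℕ}

/-- The output must be correct for every n, so the bound is needed for small n as well; finitely
many cardinalities are absorbed into the constant. -/
lemma exists_card_le {K : ℕ → Finset (Site d)} {m : ℕ}
    (hK : (fun n : ℕ => ((K n).card : ℝ)) =O[atTop] (fun n : ℕ => (n : ℝ) ^ m)) :
    ∃ k : ℕ, ∀ n, (K n).card ≤ k * (n ^ m + 1) := by
  obtain ⟨C, hC⟩ := hK.bound
  obtain ⟨N, hN⟩ := eventually_atTop.mp hC
  obtain ⟨k, hk⟩ := exists_nat_ge C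
  refine ⟨k + ∑ i ∈ Finset.range N, (K i).card, fun n => ?_⟩
  rcases lt_or_ge n N with h | h
  · have h1 := Finset.single_le_sum (f := fun i => (K i).card) (fun i _ => Nat.zero_le _)
      (Finset.mem_range.mpr h)
    calc (K n).card ≤ ∑ i ∈ Finset.range N, (K i).card := h1
      _ ≤ k + ∑ i ∈ Finset.range N, (K i).card := Nat.le_add_left _ _
      _ ≤ _ := Nat.le_mul_of_pos_right _ (Nat.succ_pos _)
  · have h1 := hN n h
    rw [Real.norm_of_nonneg (Nat.cast_nonneg _), Real.norm_of_nonneg (by positivity)] at h1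
    have h2 : ((K n).card : ℝ) ≤ k * n ^ m := h1.trans (by gcongr)
    have h3 : (K n).card ≤ k * n ^ m := by exact_mod_cast h2
    exact h3.trans (Nat.mul_le_mul (Nat.le_add_right _ _) (Nat.le_succ _))

/-- With k = d - 1 this is the origin of the exponent (d-1)²: the radius is of order n^k, and the
time is exponential in its k-th power. -/
lemma succ_pow_le {n : ℕ} (hn : 1 ≤ n) (k : ℕ) : (n ^ k + 1) ^ k ≤ 2 ^ k * n ^ k ^ 2 := by
  have h : n ^ k + 1 ≤ 2 * n ^ k := by have := Nat.one_le_pow k n hn; omega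
  calc (n ^ k + 1) ^ k ≤ (2 * n ^ k) ^ k := Nat.pow_le_pow_left h k
    _ = 2 ^ k * n ^ k ^ 2 := by rw [mul_pow, ← pow_mul, sq]

lemma two_pow_mul_le_exp {n : ℕ} (hn : 1 ≤ n) (E k e : ℕ) :
    (((2 ^ (E * (n ^ k + 1) ^ k)) ^ e : ℕ) : ℝ) ≤
      Real.exp ((E * e * 2 ^ k : ℕ) * (n : ℝ) ^ (k ^ 2)) := by
  have h1 : (2 : ℝ) ≤ Real.exp 1 := by have := Real.add_one_le_exp (1 : ℝ); linarith
  have h2 : E * (n ^ k + 1) ^ k * e ≤ E * e * 2 ^ k * n ^ k ^ 2 := by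
    have := Nat.mul_le_mul_left (E * e) (succ_pow_le hn k)
    linarith
  calc (((2 ^ (E * (n ^ k + 1) ^ k)) ^ e : ℕ) : ℝ) = 2 ^ (E * (n ^ k + 1) ^ k * e) := by
        push_cast
        rw [← pow_mul]
    _ ≤ Real.exp 1 ^ (E * (n ^ k + 1) ^ k * e) := by gcongr
    _ ≤ Real.exp 1 ^ (E * e * 2 ^ k * n ^ k ^ 2) :=
        pow_le_pow_right₀ (by linarith) h2
    _ = _ := by
        rw [← Real.exp_nat_mul, mul_one]
        push_cast
        rfl

/-- The output is correct at every radius without violations. -/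
lemma output_correct {Φ : Interaction d q} {μ : Measure (Site d → Fin q)} {K : Finset (Site d)}
    {O : Oracle} {r x : ℕ} (hq : 0 < q) (hμ : IsGibbs Φ μ) (hO : Represents Φ K O)
    (h0 : (0 : Site d) ∉ K) (hv : viol d q r x O ≤ 0) :
    ((outLo d q r x O / gridM q x : ℚ) : ℝ) ≤ condEntropy μ {0} K ∧
      condEntropy μ {0} K ≤ ((outHi d q r x O / gridM q x : ℚ) : ℝ) ∧
      ((outHi d q r x O / gridM q x : ℚ) : ℝ) - ((outLo d q r x O / gridM q x : ℚ) : ℝ) ≤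
        Real.exp (-(x : ℝ)) := by
  have h := abs_le.mp (abs_condEntropy_sub_le hq hμ hO h0 hv)
  have hD : (0 : ℝ) < gridD q x := by exact_mod_cast gridD_pos hq
  have hM' : (gridM q x : ℝ) = gridD q x ^ 2 := by simp [gridM]
  have hM : (0 : ℝ) < gridM q x := by rw [hM']; positivity
  have e1 : ((outLo d q r x O : ℤ) : ℝ) =
      meanH (partA d q r O) q (keyQ d q r O) (ringQ d q r) (gridM q x) - 25 * q * gridD q x := by
    simp [outLo]
  have e2 : ((outHi d q r x O : ℤ) : ℝ) =
      meanH (partA d q r O) q (keyQ d q r O) (ringQ d q r) (gridM q x) + 25 * q * gridD q x := by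
    simp [outHi]
  push_cast
  rw [e1, e2]
  refine ⟨?_, ?_, ?_⟩
  · rw [div_le_iff₀ hM]; linarith
  · rw [le_div_iff₀ hM]; linarith
  · have hq' : (0 : ℝ) < q := by exact_mod_cast hq
    -- The interval has length 50 q D / D² = 50 q / D, and D = 50 q 3^x makes this 3^(-x) ≤ e^(-x).
    have e3 : (gridD q x : ℝ) = 50 * q * 3 ^ x := by simp [gridD]
    rw [← sub_div, div_le_iff₀ hM, hM']
    have h3 : Real.exp x ≤ 3 ^ x := by
      rw [← Real.exp_one_pow]
      gcongr
      exact Real.exp_one_lt_three.le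
    have h4 : Real.exp (-(x : ℝ)) * Real.exp x = 1 := by rw [← Real.exp_add]; simp
    have h5 : 1 ≤ Real.exp (-(x : ℝ)) * 3 ^ x := by
      rw [← h4]; gcongr
    have h6 : 50 * q * gridD q x * 1 ≤ 50 * q * gridD q x * (Real.exp (-(x : ℝ)) * 3 ^ x) := by
      gcongr
    calc _ = 50 * q * (gridD q x : ℝ) * 1 := by ring
      _ ≤ _ := h6
      _ = Real.exp (-(x : ℝ)) * (gridD q x * (50 * q * 3 ^ x)) := by ring
      _ = _ := by rw [← e3, sq]

end

end GibbsEntropy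

end

theorem theorem4p1 (d q : ℕ) (hd : 1 ≤ d) (hq : 2 ≤ q) :
    ∃ p : Prog, ∀ (Φ : Interaction d q), Φ.SSM →
      ∀ (μ : Measure (Site d → Fin q)), IsGibbs Φ μ →
      ∀ (K : ℕ → Finset (Site d)), (∀ n, K n ⊆ box d n) →
        (fun n : ℕ => ((K n).card : ℝ)) =O[atTop] (fun n : ℕ => (n : ℝ) ^ (d - 1)) →
      ∃ (c : ℝ) (N : ℕ), ∀ (n : ℕ) (O : Oracle), Represents Φ (K n) O →
        ∃ (lo hi : ℚ) (t : ℕ), Outputs p O n lo hi t ∧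
          (lo : ℝ) ≤ condEntropy μ {0} (K n) ∧ condEntropy μ {0} (K n) ≤ (hi : ℝ) ∧
          (hi : ℝ) - (lo : ℝ) ≤ Real.exp (-((n : ℝ) ^ (d - 1))) ∧
          (N ≤ n → (t : ℝ) ≤ Real.exp (c * (n : ℝ) ^ ((d - 1) ^ 2))) := by
  refine ⟨mainP q d, fun Φ hΦ μ hμ K _ hK => ?_⟩
  have := hμ.isProbabilityMeasure
  have hq0 : 0 < q := by omega
  obtain ⟨k, hk⟩ := exists_card_le hK
  obtain ⟨c, hc, hrad⟩ := exists_radius hΦ hq0 k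
  obtain ⟨E, hE⟩ := exists_bounds Φ hd hq0 k c
  -- The first summand is for an origin outside `K`, the second for an origin in `K`, where the time
  -- is at most d + 13. The input n = 0 is excluded because the time bound degenerates there.
  refine ⟨(E * mainE d q * 2 ^ (d - 1) : ℕ) + (d + 13 : ℕ), 1, fun n O hO => ?_⟩
  by_cases h0 : (0 : Site d) ∈ K n
  · have hO0 : O 2 (List.ofFn fun _ : Fin d => 0) = 1 := (hO.mem 0).trans (if_pos h0)
    obtain ⟨t, ht, htime⟩ := mainP_outputs_zero (q := q) (n := n)
      (show 0 < O 2 (List.ofFn fun _ : Fin d => 0) by rw [hO0]; exact one_pos)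
    refine ⟨0, 0, t, ht, ?_, ?_, ?_, fun hn => ?_⟩
    · simp [condEntropy_eq_zero h0]
    · simp [condEntropy_eq_zero h0]
    · simpa using (Real.exp_pos _).le
    · have h1 : (t : ℝ) ≤ (d + 13 : ℕ) := by
        have h2 := len_le_natAbs 1
        rw [hO0] at htime
        have h3 : t ≤ d + 13 := by simp at h2; omega
        exact_mod_cast h3
      have h4 : (1 : ℝ) ≤ (n : ℝ) ^ ((d - 1) ^ 2) := one_le_pow₀ (by exact_mod_cast hn)
      calc (t : ℝ) ≤ (d + 13 : ℕ) := h1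
        _ ≤ Real.exp (d + 13 : ℕ) := by have := Real.add_one_le_exp ((d + 13 : ℕ) : ℝ); linarith
        _ ≤ _ := Real.exp_le_exp.mpr ((le_add_of_nonneg_left (Nat.cast_nonneg _)).trans
          (le_mul_of_one_le_right (by positivity) h4))
  · have hO0 : ¬ 0 < O 2 (List.ofFn fun _ : Fin d => 0) :=
      ((hO.mem 0).trans (if_neg h0)).le.not_gt
    have hviol := hrad (n ^ (d - 1)) (K n) O hO h0 (hk n)
    classical
    -- The algorithm stops at the first radius that passes the tests. It depends on the oracles but
    -- is at most c (x + 1), and c does not.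
    have hex : ∃ r, 1 ≤ r ∧ viol d q r (n ^ (d - 1)) O ≤ 0 :=
      ⟨_, Nat.mul_pos hc (Nat.succ_pos _), hviol⟩
    obtain ⟨hr1, hr⟩ := Nat.find_spec hex
    have hB := hE n (n ^ (d - 1)) (Nat.find hex) (K n) O hO rfl (hk n)
      (Nat.find_min' hex ⟨Nat.mul_pos hc (Nat.succ_pos _), hviol⟩)
    obtain ⟨t, ht, htime⟩ := mainP_outputs hd hq0 rfl hB hr1 hO0 hr
      fun i hi hir => not_le.mp fun h => Nat.find_min hex hir ⟨hi, h⟩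
    obtain ⟨hlo, hhi, hgap⟩ := output_correct hq0 hμ hO h0 hr
    refine ⟨_, _, t, ht, hlo, hhi, by simpa using hgap, fun hn => ?_⟩
    calc (t : ℝ) ≤ (((2 ^ (E * (n ^ (d - 1) + 1) ^ (d - 1))) ^ mainE d q : ℕ) : ℝ) := by
          exact_mod_cast htime
      _ ≤ Real.exp ((E * mainE d q * 2 ^ (d - 1) : ℕ) * (n : ℝ) ^ ((d - 1) ^ 2)) :=
          two_pow_mul_le_exp hn _ _ _
      _ ≤ _ := by
          gcongr
          exact le_add_of_nonneg_right (Nat.cast_nonneg _)
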